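/- **Setting.** A Cartan datum is a set $I$ with a symmetric bilinear form $i\cdot j$ on $\mathbb{Z}I$ such that $i\cdot i\in\{2,4,6,\dots\}$ for all $i\in I$ and $2\,\frac{i\cdot j}{i\cdot i}\in\{0,-1,-2,\dots\}$ for all distinct $i,j\in I$; put $d_i=\frac{i\cdot i}{2}$ and $c_{ij}=\frac{i\cdot j}{d_i}$. Let $a$ be an automorphism of $(I,\cdot)$ of finite order $n$ such that $i\cdot j=0$ whenever $i\neq j$ lie in the same $a$-orbit. Let $J$ be the set of $a$-orbits, and identify $\mathbb{N}J$ with the set of $a$-fixed elements of $\mathbb{N}I$ by $j\mapsto\sum_{i\in j}i$. Let $k$ be an algebraically closed field whose characteristic does not divide $n$, and let $Q_{ij}(u,v)\in k[u,v]$ ($i,j\in I$) be polynomials with $Q_{ii}=0$, $Q_{ij}(u,v)=Q_{ji}(v,u)$, $Q_{a(i)a(j)}=Q_{ij}$, and, for $i\ne j$, homogeneous of degree $-d_ic_{ij}$ when $u$ has degree $d_i$ and $v$ has degree $d_j$, with nonzero coefficients of $u^{-c_{ij}}$ and $v^{-c_{ji}}$. For $\nu\in\mathbb{N}J$ let $R(\nu)$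 be the KLR algebra: the $k$-algebra with generators $e_{\mathbf i}$ (for sequences $\mathbf i=(\mathbf i_1,\dots,\mathbf i_{|\nu|})$ in $I$ with $\sum_p\mathbf i_p=\nu$), $y_p$ ($1\le p\le|\nu|$), $\tau_p$ ($1\le p<|\nu|$), and relations $e_{\mathbf i}e_{\mathbf j}=\delta_{\mathbf i\mathbf j}e_{\mathbf i}$; $\sum_{\mathbf i}e_{\mathbf i}=1$; $y_py_q=y_qy_p$; $y_pe_{\mathbf i}=e_{\mathbf i}y_p$; $\tau_pe_{\mathbf i}=e_{s_p\mathbf i}\tau_p$; $\tau_p\tau_q=\tau_q\tau_p$ if $|p-q|>1$; $\tau_p^2e_{\mathbf i}=Q_{\mathbf i_p\mathbf i_{p+1}}(y_p,y_{p+1})e_{\mathbf i}$; $(\tau_py_l-y_{s_p(l)}\tau_p)e_{\mathbf i}$ equals $-e_{\mathbf i}$ if $l=p$ and $\mathbf i_p=\mathbf i_{p+1}$, equals $e_{\mathbf i}$ if $l=p+1$ and $\mathbf i_p=\mathbf i_{p+1}$, and is $0$ otherwise; $(\tau_{p+1}\tau_p\tau_{p+1}-\tau_p\tau_{p+1}\tau_p)e_{\mathbf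 i}$ equals $\frac{Q_{\mathbf i_p\mathbf i_{p+1}}(y_p,y_{p+1})-Q_{\mathbf i_p\mathbf i_{p+1}}(y_{p+2},y_{p+1})}{y_p-y_{p+2}}e_{\mathbf i}$ if $\mathbf i_p=\mathbf i_{p+2}$ and $0$ otherwise. It is $\mathbb{Z}$-graded by $\deg e_{\mathbf i}=0$, $\deg y_pe_{\mathbf i}=\mathbf i_p\cdot\mathbf i_p$, $\deg\tau_pe_{\mathbf i}=-\mathbf i_p\cdot\mathbf i_{p+1}$, and $a$ acts on it by $e_{\mathbf i}\mapsto e_{a\mathbf i}$, $y_p\mapsto y_p$, $\tau_p\mapsto\tau_p$. On tensor products of such algebras $a$ acts factorwise. For a graded algebra $A$ with such an action, consider the category of pairs $(M,\sigma)$, where $M$ is a graded left $A$-module and $\sigma:a^*M\to M$ is an isomorphism of graded modules with $\sigma\circ a^*\sigma\circ\cdots\circ(a^*)^{n-1}\sigma=\mathrm{id}$; here $a^*M$ is $M$ with $r$ acting as $a(r)$, and morphisms are the degree-zero module maps that commute with the $\sigma$'s. For $A=\bigotimes_iR(\lambda_i)$ it is denoted $\mathcal{C}_{\lambda_1\sqcup\cdots\sqcup\lambda_r}$.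 A pair $(M,\sigma)$ is *traceless* if for some $t\ge2$ dividing $n$ the module is a direct sum of graded submodules $M\cong N\oplus a^*N\oplus\cdots\oplus(a^*)^{t-1}N$ with $(a^*)^tN\cong N$, whose summands $\sigma$ permutes cyclically. A functor is traceless if all objects in its image are; it is exact if it preserves short exact sequences. For $\lambda=\lambda_1+\cdots+\lambda_r$ in $\mathbb{N}J$ there is a homomorphism $\bigotimes_iR(\lambda_i)\to R(\lambda)$ placing the generators side by side (in general it does not preserve the unit); let $e_{\lambda_1\cdots\lambda_r}$ be the image of $1$. Induction is $\operatorname{Ind}_{\lambda_1,\dots,\lambda_r}(M)=R(\lambda)\otimes_{\bigotimes_iR(\lambda_i)}M$ and restriction is $\operatorname{Res}_{\lambda_1,\dots,\lambda_r}(M)=e_{\lambda_1\cdots\lambda_r}M$, with the induced isomorphisms $\sigma$. **Theorem.** Let $\lambda_1,\dots,\lambda_r,\mu_1,\dots,\mu_s\in\mathbb{N}J$ with $\sum_i\lambda_i=\sum_j\mu_j$. Then the functor $$\operatorname{Res}_{\mu_1,\dots,\mu_s}\circ\operatorname{Ind}_{\lambda_1,\dots,\lambda_r}:\ \mathcal{C}_{\lambda_1\sqcup\cdots\sqcup\lambda_r}\to\mathcal{C}_{\mu_1\sqcup\cdots\sqcup\mu_s}$$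 has a finite filtration by exact subfunctors $0=F_0\subset F_1\subset\cdots\subset F_m=\operatorname{Res}_{\mu_1,\dots,\mu_s}\circ\operatorname{Ind}_{\lambda_1,\dots,\lambda_r}$ with exact subquotient functors $S_p=F_p/F_{p-1}$, such that the indices $p$ for which $S_p$ is not traceless are in bijection with the tuples $(\nu_{ij})_{1\le i\le r,\,1\le j\le s}$ of elements of $\mathbb{N}J$ (that is, of $a$-fixed elements of $\mathbb{N}I$) satisfying $\sum_j\nu_{ij}=\lambda_i$ for all $i$ and $\sum_i\nu_{ij}=\mu_j$ for all $j$, and the subquotient that corresponds to $\nu$ is isomorphic, up to a grading shift, to $$\operatorname{Ind}_\nu^\mu\circ\tau\circ\operatorname{Res}_\nu^\lambda.$$ Here $\operatorname{Res}_\nu^\lambda$, from $\bigotimes_iR(\lambda_i)$ to $\bigotimes_i\bigotimes_jR(\nu_{ij})$, is the tensor product over $i$ of the functors $\operatorname{Res}_{\nu_{i1},\dots,\nu_{is}}$; $\tau$, from $\bigotimes_i\bigotimes_jR(\nu_{ij})$ to $\bigotimes_j\bigotimes_iR(\nu_{ij})$, permutes the tensor factors; and $\operatorname{Ind}_\nu^\mu$,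 from $\bigotimes_j\bigotimes_iR(\nu_{ij})$ to $\bigotimes_jR(\mu_j)$, is the tensor product over $j$ of the functors $\operatorname{Ind}_{\nu_{1j},\dots,\nu_{rj}}$ (all taken between the categories of pairs $(M,\sigma)$). -/

import Mathlib

open CategoryTheory TensorProduct

universe u

namespace FoldedKLR

noncomputable section

/-! ### Gradings -/

section Gradings

variable {k : Type u} [Field k] {V : Type u} [AddCommGroup V] [Module k V]

theorem exists_unit_injOn [Infinite k] (s : Finset ℤ) :
    ∃ z : kˣ, Set.InjOn (fun d : ℤ => ((z ^ d : kˣ) : k)) (s : Set ℤ) := by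
  classical
  set P : Polynomial k :=
    Polynomial.X * ∏ p ∈ s.offDiag, (Polynomial.X ^ (p.1 - p.2).natAbs - Polynomial.C 1) with hP
  have hP0 : P ≠ 0 := by
    refine mul_ne_zero Polynomial.X_ne_zero (Finset.prod_ne_zero_iff.2 fun p hp => ?_)
    have hne := (Finset.mem_offDiag.1 hp).2.2
    exact Polynomial.X_pow_sub_C_ne_zero (by omega) 1
  obtain ⟨z, hz⟩ : ∃ z : k, P.eval z ≠ 0 := by
    by_contra! h
    exact hP0 (Polynomial.funext fun z => by simpa using h z)
  rw [hP, Polynomial.eval_mul, Polynomial.eval_X, Polynomial.eval_prod] at hz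
  have hz0 : z ≠ 0 := left_ne_zero_of_mul hz
  have hz1 := Finset.prod_ne_zero_iff.1 (right_ne_zero_of_mul hz)
  refine ⟨Units.mk0 z hz0, fun c hc d hd hcd => ?_⟩
  by_contra hne
  refine hz1 (c, d) (Finset.mem_offDiag.2 ⟨hc, hd, hne⟩) ?_
  have h1 : (Units.mk0 z hz0) ^ (c - d) = 1 := by
    rw [zpow_sub, Units.ext hcd, mul_inv_cancel]
  have h2 : (Units.mk0 z hz0) ^ (c - d).natAbs = 1 := by
    rcases Int.natAbs_eq (c - d) with h | h
    · rw [h] at h1; simpa using h1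
    · rw [h] at h1; simpa using h1
  have h3 : z ^ (c - d).natAbs = 1 := by simpa using congrArg Units.val h2
  simp [h3]

/-- A family of subspaces on whose `d`-th member some operator acts as `z ^ d`, for every unit `z`,
is independent when the field is infinite. -/
theorem isInternal_of_scaling [Infinite k] (gr : ℤ → Submodule k V) (htop : ⨆ d, gr d = ⊤)
    (f : kˣ → V →ₗ[k] V) (hf : ∀ z d, ∀ x ∈ gr d, f z x = ((z ^ d : kˣ) : k) • x) :
    DirectSum.IsInternal gr := by
  classical
  refine DirectSum.isInternal_submodule_of_iSupIndep_of_iSup_eq_top ?_ htop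
  rw [iSupIndep_iff_finsetSum_eq_zero_imp_eq_zero]
  intro s v hv hsum d hd
  obtain ⟨z, hz⟩ := exists_unit_injOn (k := k) s
  have hinj : Function.Injective (fun d : s => ((z ^ (d : ℤ) : kˣ) : k)) :=
    fun c d h => Subtype.ext (hz c.2 d.2 h)
  have hind := (Module.End.eigenspaces_iSupIndep (f z)).comp hinj
  rw [iSupIndep_iff_finsetSum_eq_zero_imp_eq_zero] at hind
  refine hind Finset.univ (fun d => v d) (fun c _ => ?_) ?_ ⟨d, hd⟩ (Finset.mem_univ _)
  · exact Module.End.mem_eigenspace_iff.2 (hf z c _ (hv c c.2))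
  · rw [Finset.sum_coe_sort s v, hsum]

/-- The operator acting on the `d`-th component of a graded space as `z ^ d`. -/
def scaling (gr : ℤ → Submodule k V) (h : DirectSum.IsInternal gr) (z : kˣ) : V →ₗ[k] V :=
  (DirectSum.toModule k ℤ V fun d => ((z ^ d : kˣ) : k) • (gr d).subtype) ∘ₗ
    (LinearEquiv.ofBijective (DirectSum.coeLinearMap gr) h).symm.toLinearMap

theorem scaling_apply (gr : ℤ → Submodule k V) (h : DirectSum.IsInternal gr) (z : kˣ) {d : ℤ}
    {x : V} (hx : x ∈ gr d) : scaling gr h z x = ((z ^ d : kˣ) : k) • x := by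
  have : (LinearEquiv.ofBijective (DirectSum.coeLinearMap gr) h).symm x =
      DirectSum.lof k ℤ (fun d => gr d) d ⟨x, hx⟩ :=
    (LinearEquiv.symm_apply_eq _).2 (DirectSum.coeLinearMap_lof gr d ⟨x, hx⟩).symm
  rw [scaling, LinearMap.comp_apply, LinearEquiv.coe_coe, this, DirectSum.toModule_lof]
  rfl

end Gradings

/-! ### Graded algebras with automorphism, and their equivariant graded modules -/

/-- A `ℤ`-graded `k`-algebra with a grading-preserving automorphism `a` such that `a ^ n = 1`. -/
structure FoldedAlg (k : Type u) [Field k] (n : ℕ) where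
  carrier : Type u
  [ring : Ring carrier]
  [algebra : Algebra k carrier]
  gr : ℤ → Submodule k carrier
  internal : DirectSum.IsInternal gr
  one_mem : (1 : carrier) ∈ gr 0
  mul_mem : ∀ {c d : ℤ} {x y : carrier}, x ∈ gr c → y ∈ gr d → x * y ∈ gr (c + d)
  aut : carrier ≃ₐ[k] carrier
  aut_mem : ∀ {d : ℤ} {x : carrier}, x ∈ gr d → aut x ∈ gr d
  aut_pow : aut ^ n = 1

attribute [instance] FoldedAlg.ring FoldedAlg.algebra

/-- An object `(M, σ)`: a graded left module `M` over the algebra, and an isomorphism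
`σ : a^* M → M` of graded modules with `σ ∘ a^* σ ∘ ⋯ ∘ (a^*) ^ (n-1) σ = id`. Here `a^* M` is the
space `M` on which `r` acts as `a r`, so that `σ` is a linear map `M → M` with
`σ (a r • m) = r • σ m`, and the last condition says that its `n`-th iterate is the identity (for
`n ≥ 1`, this makes `σ` bijective). -/
structure FMod {k : Type u} [Field k] {n : ℕ} (A : FoldedAlg k n) where
  carrier : Type u
  [addCommGroup : AddCommGroup carrier]
  [moduleField : Module k carrier]
  [module : Module A.carrier carrier]
  [tower : IsScalarTower k A.carrier carrier]
  gr : ℤ → Submodule k carrier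
  internal : DirectSum.IsInternal gr
  smul_mem : ∀ {c d : ℤ} {r : A.carrier} {m : carrier}, r ∈ A.gr c → m ∈ gr d →
    r • m ∈ gr (c + d)
  σ : carrier →ₗ[k] carrier
  σ_mem : ∀ {d : ℤ} {m : carrier}, m ∈ gr d → σ m ∈ gr d
  σ_smul : ∀ (r : A.carrier) (m : carrier), σ (A.aut r • m) = r • σ m
  σ_pow : σ ^ n = 1

attribute [instance] FMod.addCommGroup FMod.moduleField FMod.module FMod.tower

namespace FMod

variable {k : Type u} [Field k] {n : ℕ} {A : FoldedAlg k n}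

/-- A morphism `(M, σ) → (M', σ')`: a module map of degree zero that commutes with `σ`, `σ'`. -/
@[ext]
structure Hom (M N : FMod A) where
  toLin : M.carrier →ₗ[A.carrier] N.carrier
  map_mem : ∀ {d : ℤ} {m : M.carrier}, m ∈ M.gr d → toLin m ∈ N.gr d
  comm : ∀ m : M.carrier, toLin (M.σ m) = N.σ (toLin m)

instance : Category (FMod A) where
  Hom := Hom
  id M := ⟨LinearMap.id, fun h => h, fun _ => rfl⟩
  comp f g := ⟨g.toLin ∘ₗ f.toLin, fun h => g.map_mem (f.map_mem h), fun m => by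
    simp [f.comm, g.comm]⟩

@[ext]
theorem hom_ext {M N : FMod A} {f g : M ⟶ N} (h : Hom.toLin f = Hom.toLin g) : f = g :=
  Hom.ext h

@[simp] theorem id_toLin (M : FMod A) : Hom.toLin (𝟙 M) = LinearMap.id := rfl

@[simp] theorem comp_toLin {M N P : FMod A} (f : M ⟶ N) (g : N ⟶ P) :
    Hom.toLin (f ≫ g) = Hom.toLin g ∘ₗ Hom.toLin f := rfl

/-- `0 → M → N → P → 0` is a short exact sequence. -/
structure IsShortExact {M N P : FMod A} (f : M ⟶ N) (g : N ⟶ P) : Prop where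
  injective : Function.Injective (Hom.toLin f)
  exact : Function.Exact (Hom.toLin f) (Hom.toLin g)
  surjective : Function.Surjective (Hom.toLin g)

/-- The object `(M, σ)` is traceless: for some `t ≥ 2` dividing `n`, the graded module `M` is the
direct sum of graded submodules `N 0, …, N (t - 1)`, and `σ` carries `N s` onto `N (s + 1)`, the
indices being taken modulo `t`. (As `σ` is an isomorphism `a^* M → M`, it restricts to
isomorphisms `a^* (N s) → N (s + 1)`. So this says that `M` is isomorphic to
`N 0 ⊕ a^* (N 0) ⊕ ⋯ ⊕ (a^*) ^ (t - 1) (N 0)` with `(a^*) ^ t (N 0) ≅ N 0`, and that `σ`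
permutes the summands cyclically.) -/
def IsTraceless (M : FMod A) : Prop :=
  ∃ t : ℕ, 2 ≤ t ∧ t ∣ n ∧ ∃ N : ZMod t → Submodule A.carrier M.carrier,
    (∀ s, ((N s).restrictScalars k) = ⨆ d : ℤ, ((N s).restrictScalars k) ⊓ M.gr d) ∧
    DirectSum.IsInternal N ∧
    ∀ s, ((N s).restrictScalars k).map M.σ = (N (s + 1)).restrictScalars k

theorem smul_mem_zero (M : FMod A) {d : ℤ} {r : A.carrier} {m : M.carrier} (hr : r ∈ A.gr 0)
    (hm : m ∈ M.gr d) : r • m ∈ M.gr d := by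
  simpa using M.smul_mem hr hm

/-- The grading shift `q ^ c`: the component of degree `d` of `q ^ c M` is the component of degree
`d - c` of `M`. -/
abbrev shiftObj (c : ℤ) (M : FMod A) : FMod A where
  carrier := M.carrier
  gr d := M.gr (d - c)
  internal := by
    refine DirectSum.isInternal_submodule_of_iSupIndep_of_iSup_eq_top ?_ ?_
    · exact M.internal.submodule_iSupIndep.comp (sub_left_injective (b := c))
    · rw [← M.internal.submodule_iSup_eq_top]
      exact (Equiv.subRight c).iSup_comp (g := M.gr)
  smul_mem {b d r m} hr hm := by
    rw [add_sub_assoc]; exact M.smul_mem hr hm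
  σ := M.σ
  σ_mem h := M.σ_mem h
  σ_smul := M.σ_smul
  σ_pow := M.σ_pow

/-- The grading shift functor. -/
def shift (A : FoldedAlg k n) (c : ℤ) : FMod A ⥤ FMod A where
  obj M := shiftObj c M
  map f := ⟨f.toLin, fun h => f.map_mem h, f.comm⟩

end FMod

/-- A functor is exact if it takes short exact sequences to short exact sequences. -/
def IsExactFunctor {k : Type u} [Field k] {n : ℕ} {A B : FoldedAlg k n} (F : FMod A ⥤ FMod B) :
    Prop :=
  ∀ ⦃M N P : FMod A⦄ (f : M ⟶ N) (g : N ⟶ P), FMod.IsShortExact f g →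
    FMod.IsShortExact (F.map f) (F.map g)

/-- A functor is traceless if all the objects in its image are. -/
def IsTracelessFunctor {k : Type u} [Field k] {n : ℕ} {A B : FoldedAlg k n}
    (F : FMod A ⥤ FMod B) : Prop :=
  ∀ M : FMod A, (F.obj M).IsTraceless

/-! ### Restriction and induction along a homomorphism that need not preserve the unit -/

/-- A homomorphism of graded algebras, not necessarily preserving the unit, which commutes with
the automorphisms. -/
structure FoldedHom {k : Type u} [Field k] {n : ℕ} (S R : FoldedAlg k n) where
  toLin : S.carrier →ₗ[k] R.carrier
  map_mul : ∀ x y, toLin (x * y) = toLin x * toLin y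
  map_mem : ∀ {d : ℤ} {x : S.carrier}, x ∈ S.gr d → toLin x ∈ R.gr d
  comm : ∀ x, toLin (S.aut x) = R.aut (toLin x)

namespace FoldedHom

variable {k : Type u} [Field k] {n : ℕ} {S R : FoldedAlg k n} (φ : FoldedHom S R)

/-- The image of the unit, an idempotent. -/
def e : R.carrier := φ.toLin 1

theorem e_mul_map (x : S.carrier) : φ.e * φ.toLin x = φ.toLin x := by
  rw [e, ← φ.map_mul, one_mul]

theorem map_mul_e (x : S.carrier) : φ.toLin x * φ.e = φ.toLin x := by
  rw [e, ← φ.map_mul, mul_one]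

theorem aut_e : R.aut φ.e = φ.e := by
  rw [e, ← φ.comm, map_one]

theorem e_mem : φ.e ∈ R.gr 0 := φ.map_mem S.one_mem

/-- The subspace `e M`. -/
def resSpace (M : FMod R) : Submodule k M.carrier where
  carrier := {m | φ.e • m = m}
  add_mem' {x y} hx hy := by
    change φ.e • (x + y) = x + y
    rw [smul_add, show φ.e • x = x from hx, show φ.e • y = y from hy]
  zero_mem' := smul_zero _
  smul_mem' c x hx := by
    change φ.e • (c • x) = c • x
    rw [smul_comm, show φ.e • x = x from hx]

theorem mem_resSpace {M : FMod R} {m : M.carrier} : m ∈ φ.resSpace M ↔ φ.e • m = m := Iff.rfl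

theorem e_smul_mem {M : FMod R} (m : M.carrier) : φ.e • m ∈ φ.resSpace M := by
  rw [mem_resSpace, smul_smul, e, ← φ.map_mul, one_mul]

instance resModule (M : FMod R) : Module S.carrier (φ.resSpace M) where
  smul s m := ⟨φ.toLin s • (m : M.carrier), by
    rw [mem_resSpace, smul_smul, e_mul_map]⟩
  one_smul m := Subtype.ext m.2
  mul_smul s t m := Subtype.ext (by
    change φ.toLin (s * t) • (m : M.carrier) = φ.toLin s • φ.toLin t • (m : M.carrier)
    rw [φ.map_mul, mul_smul])
  smul_zero s := Subtype.ext (smul_zero _)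
  smul_add s x y := Subtype.ext (smul_add _ _ _)
  add_smul s t m := Subtype.ext (by
    change φ.toLin (s + t) • (m : M.carrier) = φ.toLin s • (m : M.carrier) +
      φ.toLin t • (m : M.carrier)
    rw [map_add, add_smul])
  zero_smul m := Subtype.ext (by
    change φ.toLin 0 • (m : M.carrier) = 0
    rw [map_zero, zero_smul])

@[simp] theorem coe_res_smul (M : FMod R) (s : S.carrier) (m : φ.resSpace M) :
    ((s • m : φ.resSpace M) : M.carrier) = φ.toLin s • (m : M.carrier) := rfl

/-- The restriction of a module: the space `e M`, where `e` is the image of the unit. -/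
abbrev resObj (M : FMod R) : FMod S where
  carrier := φ.resSpace M
  module := φ.resModule M
  tower := ⟨fun c s m => Subtype.ext (by simp)⟩
  gr d := (M.gr d).comap (φ.resSpace M).subtype
  internal := by
    refine DirectSum.isInternal_submodule_of_iSupIndep_of_iSup_eq_top ?_ ?_
    · have h := M.internal.submodule_iSupIndep
      rw [iSupIndep_iff_finsetSum_eq_zero_imp_eq_zero] at h ⊢
      intro s v hv hsum d hd
      refine Subtype.ext (h s (fun d => (v d : M.carrier)) (fun i hi => hv i hi) ?_ d hd)
      simpa using congrArg Subtype.val hsum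
    · rw [eq_top_iff]
      rintro ⟨m, hm⟩ -
      have hm' : m ∈ ⨆ d, M.gr d := by rw [M.internal.submodule_iSup_eq_top]; trivial
      have key : ∀ x ∈ ⨆ d, M.gr d, (⟨φ.e • x, φ.e_smul_mem x⟩ : φ.resSpace M) ∈
          ⨆ d, (M.gr d).comap (φ.resSpace M).subtype := by
        intro x hx
        induction hx using Submodule.iSup_induction' with
        | mem d x hx =>
          refine Submodule.mem_iSup_of_mem d ?_
          exact M.smul_mem_zero φ.e_mem hx
        | zero => 
          convert Submodule.zero_mem _
          simp
        | add x y _ _ hx hy =>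
          convert Submodule.add_mem _ hx hy
          simp
      convert key m hm'
      exact hm.symm
  smul_mem {c d r m} hr hm := M.smul_mem (φ.map_mem hr) hm
  σ := M.σ.restrict (p := φ.resSpace M) (q := φ.resSpace M) fun m hm => by
    rw [mem_resSpace, ← M.σ_smul, φ.aut_e, φ.mem_resSpace.1 hm]
  σ_mem h := M.σ_mem h
  σ_smul r m := Subtype.ext (by
    simp [φ.comm, M.σ_smul])
  σ_pow := by
    ext m
    rw [Module.End.pow_restrict]
    simp [M.σ_pow]

/-- Restriction of modules along `φ`. -/
def res : FMod R ⥤ FMod S where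
  obj M := φ.resObj M
  map {M N} f :=
    { toLin :=
        { toFun := fun m => ⟨f.toLin m.1, by
            have hm : φ.e • m.1 = m.1 := m.2
            rw [mem_resSpace, ← f.toLin.map_smul, hm]⟩
          map_add' := fun x y => Subtype.ext (f.toLin.map_add _ _)
          map_smul' := fun s x => Subtype.ext (f.toLin.map_smul _ _) }
      map_mem := fun h => f.map_mem h
      comm := fun m => Subtype.ext (f.comm m.1) }

/-- The relations of the tensor product over `S`. -/
def indRel (N : FMod S) : Submodule R.carrier (R.carrier ⊗[k] N.carrier) :=
  Submodule.span R.carrier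
    {v | ∃ (r : R.carrier) (s : S.carrier) (m : N.carrier),
      v = (r * φ.toLin s) ⊗ₜ[k] m - r ⊗ₜ[k] (s • m)}

/-- The module `R ⊗_S N`. (Taking `s = 1` in the relations, `r ⊗ m = r e ⊗ m`.) -/
abbrev IndSpace (N : FMod S) : Type u := (R.carrier ⊗[k] N.carrier) ⧸ φ.indRel N

/-- The class of `r ⊗ m`. -/
def indMk (N : FMod S) (r : R.carrier) (m : N.carrier) : φ.IndSpace N :=
  (φ.indRel N).mkQ (r ⊗ₜ[k] m)

theorem smul_indMk (N : FMod S) (r r' : R.carrier) (m : N.carrier) :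
    r • φ.indMk N r' m = φ.indMk N (r * r') m := by
  rw [indMk, ← map_smul]; rfl

theorem indMk_map (N : FMod S) (r : R.carrier) (s : S.carrier) (m : N.carrier) :
    φ.indMk N (r * φ.toLin s) m = φ.indMk N r (s • m) := by
  rw [indMk, indMk, ← sub_eq_zero, ← map_sub, Submodule.mkQ_apply,
    Submodule.Quotient.mk_eq_zero]
  exact Submodule.subset_span ⟨r, s, m, rfl⟩

@[elab_as_elim]
theorem ind_induction {N : FMod S} {p : φ.IndSpace N → Prop}
    (hmk : ∀ r m, p (φ.indMk N r m)) (h0 : p 0) (hadd : ∀ x y, p x → p y → p (x + y))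
    (x : φ.IndSpace N) : p x := by
  obtain ⟨x, rfl⟩ := (φ.indRel N).mkQ_surjective x
  induction x with
  | zero => simpa using h0
  | tmul r m => exact hmk r m
  | add x y hx hy => rw [map_add]; exact hadd _ _ hx hy

/-- A linear map on `R ⊗_k N` that respects the relations descends to `R ⊗_S N`. -/
def indLift {V : Type u} [AddCommGroup V] [Module k V] (N : FMod S)
    (f : R.carrier ⊗[k] N.carrier →ₗ[k] V)
    (hf : ∀ r s m, f ((r * φ.toLin s) ⊗ₜ m) = f (r ⊗ₜ (s • m))) : φ.IndSpace N →ₗ[k] V :=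
  ((φ.indRel N).restrictScalars k).liftQ f (by
    have key : ∀ x ∈ φ.indRel N, ∀ r : R.carrier, f (r • x) = 0 := by
      intro x hx
      induction hx using Submodule.span_induction with
      | mem x hx =>
        obtain ⟨r, s, m, rfl⟩ := hx
        intro r'
        rw [smul_sub, TensorProduct.smul_tmul', TensorProduct.smul_tmul', map_sub, smul_eq_mul,
          smul_eq_mul, ← mul_assoc, hf, sub_self]
      | zero => simp
      | add x y _ _ hx hy => intro r; rw [smul_add, map_add, hx, hy, add_zero]
      | smul a x _ hx => intro r; rw [smul_smul]; exact hx _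
    intro x hx
    simpa using key x hx 1) ∘ₗ
  (Submodule.Quotient.restrictScalarsEquiv k (φ.indRel N)).symm.toLinearMap

theorem indLift_indMk {V : Type u} [AddCommGroup V] [Module k V] (N : FMod S)
    (f : R.carrier ⊗[k] N.carrier →ₗ[k] V)
    (hf : ∀ r s m, f ((r * φ.toLin s) ⊗ₜ m) = f (r ⊗ₜ (s • m))) (r : R.carrier) (m : N.carrier) :
    φ.indLift N f hf (φ.indMk N r m) = f (r ⊗ₜ m) := rfl

@[elab_as_elim]
theorem hom_induction {V : Type u} [AddCommGroup V] [Module k V] {gr : ℤ → Submodule k V}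
    (h : DirectSum.IsInternal gr) {p : V → Prop} (hmem : ∀ d, ∀ x ∈ gr d, p x) (h0 : p 0)
    (hadd : ∀ x y, p x → p y → p (x + y)) (x : V) : p x := by
  have hx : x ∈ ⨆ d, gr d := by rw [h.submodule_iSup_eq_top]; trivial
  exact Submodule.iSup_induction gr (motive := p) hx hmem h0 hadd

theorem scaling_mul (A : FoldedAlg k n) (z : kˣ) (x y : A.carrier) :
    scaling A.gr A.internal z (x * y) =
      scaling A.gr A.internal z x * scaling A.gr A.internal z y := by
  induction x using hom_induction A.internal with
  | h0 => simp
  | hadd x x' hx hx' => rw [add_mul, map_add, hx, hx', map_add, add_mul]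
  | hmem c x hx =>
    induction y using hom_induction A.internal with
    | h0 => simp
    | hadd y y' hy hy' => rw [mul_add, map_add, hy, hy', map_add, mul_add]
    | hmem d y hy =>
      rw [scaling_apply _ _ _ hx, scaling_apply _ _ _ hy, scaling_apply _ _ _ (A.mul_mem hx hy),
        smul_mul_smul_comm, zpow_add, Units.val_mul]

theorem scaling_smul (N : FMod S) (z : kˣ) (x : S.carrier) (y : N.carrier) :
    scaling N.gr N.internal z (x • y) =
      scaling S.gr S.internal z x • scaling N.gr N.internal z y := by
  induction x using hom_induction S.internal with
  | h0 => simp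
  | hadd x x' hx hx' => rw [add_smul, map_add, hx, hx', map_add, add_smul]
  | hmem c x hx =>
    induction y using hom_induction N.internal with
    | h0 => simp
    | hadd y y' hy hy' => rw [smul_add, map_add, hy, hy', map_add, smul_add]
    | hmem d y hy =>
      rw [scaling_apply _ _ _ hx, scaling_apply _ _ _ hy, scaling_apply _ _ _ (N.smul_mem hx hy),
        smul_assoc, smul_comm x, smul_smul, zpow_add, Units.val_mul]

theorem scaling_map (z : kˣ) (x : S.carrier) :
    scaling R.gr R.internal z (φ.toLin x) = φ.toLin (scaling S.gr S.internal z x) := by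
  induction x using hom_induction S.internal with
  | h0 => simp
  | hadd x x' hx hx' => rw [map_add, map_add, hx, hx', map_add, map_add]
  | hmem c x hx => rw [scaling_apply _ _ _ hx, scaling_apply _ _ _ (φ.map_mem hx), map_smul]

/-- The part of degree `d` of `R ⊗_S N`. -/
def indGr (N : FMod S) (d : ℤ) : Submodule k (φ.IndSpace N) :=
  Submodule.span k {v | ∃ (b c : ℤ) (r : R.carrier) (m : N.carrier),
    r ∈ R.gr b ∧ m ∈ N.gr c ∧ b + c = d ∧ v = φ.indMk N r m}

theorem indMk_mem (N : FMod S) {b c : ℤ} {r : R.carrier} {m : N.carrier} (hr : r ∈ R.gr b)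
    (hm : m ∈ N.gr c) : φ.indMk N r m ∈ φ.indGr N (b + c) :=
  Submodule.subset_span ⟨b, c, r, m, hr, hm, rfl, rfl⟩

theorem indMk_add_left (N : FMod S) (r r' : R.carrier) (m : N.carrier) :
    φ.indMk N (r + r') m = φ.indMk N r m + φ.indMk N r' m := by
  rw [indMk, add_tmul, map_add]; rfl

theorem indMk_add_right (N : FMod S) (r : R.carrier) (m m' : N.carrier) :
    φ.indMk N r (m + m') = φ.indMk N r m + φ.indMk N r m' := by
  rw [indMk, tmul_add, map_add]; rfl

theorem indMk_zero_left (N : FMod S) (m : N.carrier) : φ.indMk N 0 m = 0 := by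
  rw [indMk, zero_tmul, map_zero]

theorem indMk_zero_right (N : FMod S) (r : R.carrier) : φ.indMk N r 0 = 0 := by
  rw [indMk, tmul_zero, map_zero]

theorem indMk_smul (N : FMod S) (c c' : k) (r : R.carrier) (m : N.carrier) :
    φ.indMk N (c • r) (c' • m) = (c * c') • φ.indMk N r m := by
  rw [indMk, smul_tmul_smul, Submodule.mkQ_apply, Submodule.Quotient.mk_smul]; rfl

theorem indGr_iSup (N : FMod S) : ⨆ d, φ.indGr N d = ⊤ := by
  rw [eq_top_iff]
  rintro x -
  induction x using φ.ind_induction with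
  | h0 => exact zero_mem _
  | hadd x y hx hy => exact add_mem hx hy
  | hmk r m =>
    induction r using hom_induction R.internal with
    | h0 => rw [indMk_zero_left]; exact zero_mem _
    | hadd x y hx hy => rw [indMk_add_left]; exact add_mem hx hy
    | hmem b r hr =>
      induction m using hom_induction N.internal with
      | h0 => rw [indMk_zero_right]; exact zero_mem _
      | hadd x y hx hy => rw [indMk_add_right]; exact add_mem hx hy
      | hmem c m hm => exact Submodule.mem_iSup_of_mem _ (φ.indMk_mem N hr hm)

/-- The quotient map, as a linear map over the field. -/
def indMkQ (N : FMod S) : R.carrier ⊗[k] N.carrier →ₗ[k] φ.IndSpace N :=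
  (φ.indRel N).mkQ.restrictScalars k

theorem indMkQ_tmul (N : FMod S) (r : R.carrier) (m : N.carrier) :
    φ.indMkQ N (r ⊗ₜ m) = φ.indMk N r m := rfl

theorem indGr_internal [Infinite k] (N : FMod S) : DirectSum.IsInternal (φ.indGr N) := by
  refine isInternal_of_scaling (φ.indGr N) (φ.indGr_iSup N)
    (fun z => φ.indLift N (φ.indMkQ N ∘ₗ
      TensorProduct.map (scaling R.gr R.internal z) (scaling N.gr N.internal z)) ?_) ?_
  · intro r s m
    simp only [LinearMap.comp_apply, map_tmul, indMkQ_tmul, scaling_mul, scaling_smul,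
      scaling_map, indMk_map]
  · intro z d x hx
    induction hx using Submodule.span_induction with
    | mem x hx =>
      obtain ⟨b, c, r, m, hr, hm, rfl, rfl⟩ := hx
      rw [indLift_indMk, LinearMap.comp_apply, map_tmul, indMkQ_tmul, scaling_apply _ _ _ hr,
        scaling_apply _ _ _ hm, indMk_smul, zpow_add, Units.val_mul]
    | zero => simp
    | add x y _ _ hx hy => rw [map_add, hx, hy, smul_add]
    | smul a x _ hx => rw [map_smul, hx, smul_comm]

theorem comm_symm (x : S.carrier) : φ.toLin (S.aut.symm x) = R.aut.symm (φ.toLin x) := by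
  rw [AlgEquiv.eq_symm_apply, ← φ.comm, AlgEquiv.apply_symm_apply]

theorem aut_symm_pow (A : FoldedAlg k n) : A.aut.symm ^ n = 1 := by
  change A.aut⁻¹ ^ n = 1
  rw [inv_pow, A.aut_pow, inv_one]

theorem mem_of_aut_mem (A : FoldedAlg k n) {d : ℤ} {y : A.carrier} (hy : A.aut y ∈ A.gr d) :
    y ∈ A.gr d := by
  classical
  have h := A.internal.submodule_iSupIndep
  rw [iSupIndep_iff_finsetSum_eq_zero_imp_eq_zero] at h
  have hy' : y ∈ ⨆ d, A.gr d := by rw [A.internal.submodule_iSup_eq_top]; trivial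
  obtain ⟨f, hf, hsum⟩ := (Submodule.mem_iSup_iff_exists_finsupp _ _).1 hy'
  have hsum' : ∑ c ∈ insert d f.support, f c = y := by
    rw [← hsum, Finsupp.sum]
    symm
    refine Finset.sum_subset (Finset.subset_insert _ _) fun c _ hc => ?_
    simpa using hc
  have key : ∀ c ∈ insert d f.support, A.aut (f c) - (if c = d then A.aut y else 0) = 0 := by
    refine h _ (fun c => A.aut (f c) - (if c = d then A.aut y else 0)) (fun c _ => ?_) ?_
    · refine sub_mem (A.aut_mem (hf c)) ?_
      split_ifs with hcd
      · rw [hcd]; exact hy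
      · exact zero_mem _
    · rw [Finset.sum_sub_distrib, ← map_sum, hsum']
      simp
  have hfd := key d (Finset.mem_insert_self _ _)
  rw [if_pos rfl, sub_eq_zero] at hfd
  rw [← A.aut.injective hfd]
  exact hf d

theorem aut_symm_mem (A : FoldedAlg k n) {d : ℤ} {x : A.carrier} (hx : x ∈ A.gr d) :
    A.aut.symm x ∈ A.gr d :=
  mem_of_aut_mem A (by simpa using hx)

/-- The map `r ⊗ m ↦ a⁻¹ r ⊗ σ m` on `R ⊗_S N`. Viewed as a map from `a^* (R ⊗_S N)`, it is
the composite of the isomorphism `a^* (R ⊗_S N) → R ⊗_S a^* N`, `r ⊗ m ↦ a⁻¹ r ⊗ m`, with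
`id ⊗ σ`. -/
def indσ (N : FMod S) : φ.IndSpace N →ₗ[k] φ.IndSpace N :=
  φ.indLift N (φ.indMkQ N ∘ₗ TensorProduct.map R.aut.symm.toLinearMap N.σ) (by
    intro r s m
    have h : N.σ (s • m) = S.aut.symm s • N.σ m := by
      rw [← N.σ_smul, AlgEquiv.apply_symm_apply]
    simp only [LinearMap.comp_apply, map_tmul, indMkQ_tmul, AlgEquiv.toLinearMap_apply,
      _root_.map_mul, ← comm_symm, indMk_map, h])

theorem indσ_indMk (N : FMod S) (r : R.carrier) (m : N.carrier) :
    φ.indσ N (φ.indMk N r m) = φ.indMk N (R.aut.symm r) (N.σ m) := rfl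

theorem indσ_pow (N : FMod S) (t : ℕ) (r : R.carrier) (m : N.carrier) :
    (φ.indσ N ^ t) (φ.indMk N r m) = φ.indMk N ((R.aut.symm ^ t) r) ((N.σ ^ t) m) := by
  induction t with
  | zero => rfl
  | succ t ih =>
    rw [pow_succ', Module.End.mul_apply, ih, indσ_indMk, pow_succ', pow_succ']
    rfl

/-- The induced module `R ⊗_S N`. -/
abbrev indObj [Infinite k] (N : FMod S) : FMod R where
  carrier := φ.IndSpace N
  gr := φ.indGr N
  internal := φ.indGr_internal N
  smul_mem {c d r x} hr hx := by
    induction hx using Submodule.span_induction with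
    | mem x hx =>
      obtain ⟨a, b, r', m, hr', hm, rfl, rfl⟩ := hx
      rw [smul_indMk, ← add_assoc]
      exact φ.indMk_mem N (R.mul_mem hr hr') hm
    | zero => rw [smul_zero]; exact zero_mem _
    | add x y _ _ hx hy => rw [smul_add]; exact add_mem hx hy
    | smul a x _ hx => rw [smul_comm]; exact Submodule.smul_mem _ _ hx
  σ := φ.indσ N
  σ_mem {d x} hx := by
    induction hx using Submodule.span_induction with
    | mem x hx =>
      obtain ⟨a, b, r', m, hr', hm, rfl, rfl⟩ := hx
      exact φ.indMk_mem N (aut_symm_mem R hr') (N.σ_mem hm)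
    | zero => rw [map_zero]; exact zero_mem _
    | add x y _ _ hx hy => rw [map_add]; exact add_mem hx hy
    | smul a x _ hx => rw [map_smul]; exact Submodule.smul_mem _ _ hx
  σ_smul r x := by
    induction x using φ.ind_induction with
    | h0 => simp
    | hadd x y hx hy => rw [smul_add, map_add, map_add, hx, hy, smul_add]
    | hmk r' m =>
      rw [smul_indMk, indσ_indMk, indσ_indMk, smul_indMk, _root_.map_mul,
        AlgEquiv.symm_apply_apply]
  σ_pow := by
    refine LinearMap.ext fun x => ?_
    induction x using φ.ind_induction with
    | h0 => simp
    | hadd x y hx hy => rw [map_add, map_add, hx, hy]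
    | hmk r' m => rw [indσ_pow, aut_symm_pow, N.σ_pow]; rfl

/-- The map `r ⊗ m ↦ r ⊗ f m`. -/
def indMap {M N : FMod S} (f : M ⟶ N) : φ.IndSpace M →ₗ[R.carrier] φ.IndSpace N where
  toFun := φ.indLift M (φ.indMkQ N ∘ₗ
    TensorProduct.map LinearMap.id ((FMod.Hom.toLin f).restrictScalars k)) (by
      intro r s m
      simp [indMkQ_tmul, indMk_map])
  map_add' := map_add _
  map_smul' r x := by
    induction x using φ.ind_induction with
    | h0 => simp
    | hadd x y hx hy => rw [smul_add, map_add, hx, hy, map_add, smul_add]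
    | hmk r' m =>
      rw [smul_indMk, indLift_indMk]
      exact (φ.smul_indMk N r r' _).symm

theorem indMap_indMk {M N : FMod S} (f : M ⟶ N) (r : R.carrier) (m : M.carrier) :
    φ.indMap f (φ.indMk M r m) = φ.indMk N r (FMod.Hom.toLin f m) := rfl

theorem indMap_mem {M N : FMod S} (f : M ⟶ N) {d : ℤ} {x : φ.IndSpace M}
    (hx : x ∈ φ.indGr M d) : φ.indMap f x ∈ φ.indGr N d := by
  induction hx using Submodule.span_induction with
  | mem x hx =>
    obtain ⟨a, b, r', m, hr', hm, rfl, rfl⟩ := hx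
    exact φ.indMk_mem N hr' (FMod.Hom.map_mem f hm)
  | zero => rw [map_zero]; exact zero_mem _
  | add x y _ _ hx hy => rw [map_add]; exact add_mem hx hy
  | smul a x _ hx => rw [LinearMap.map_smul_of_tower]; exact Submodule.smul_mem _ _ hx

theorem indMap_comm {M N : FMod S} (f : M ⟶ N) (x : φ.IndSpace M) :
    φ.indMap f (φ.indσ M x) = φ.indσ N (φ.indMap f x) := by
  induction x using φ.ind_induction with
  | h0 => simp
  | hadd x y hx hy => rw [map_add, map_add, hx, hy, map_add, map_add]
  | hmk r m => rw [indσ_indMk, indMap_indMk, indMap_indMk, indσ_indMk, FMod.Hom.comm f]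

theorem indMap_id (M : FMod S) : φ.indMap (𝟙 M) = LinearMap.id := by
  refine LinearMap.ext fun x => ?_
  induction x using φ.ind_induction with
  | h0 => rw [map_zero, map_zero]
  | hadd x y hx hy => rw [map_add, map_add, hx, hy]
  | hmk r m => rfl

theorem indMap_comp {M N P : FMod S} (f : M ⟶ N) (g : N ⟶ P) :
    φ.indMap (f ≫ g) = φ.indMap g ∘ₗ φ.indMap f := by
  refine LinearMap.ext fun x => ?_
  induction x using φ.ind_induction with
  | h0 => rw [map_zero, map_zero]
  | hadd x y hx hy => rw [map_add, map_add, hx, hy]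
  | hmk r m => rfl

/-- Induction of modules along `φ`. -/
def ind [Infinite k] : FMod S ⥤ FMod R where
  obj N := φ.indObj N
  map f := ⟨φ.indMap f, φ.indMap_mem f, φ.indMap_comm f⟩
  map_id M := FMod.hom_ext (φ.indMap_id M)
  map_comp f g := FMod.hom_ext (φ.indMap_comp f g)

end FoldedHom

/-! ### Tensor products of graded algebras with automorphism -/

section Tensor

open PiTensorProduct

variable {k : Type u} [Field k] {n : ℕ} {ι : Type}

theorem zpow_finset_sum {G : Type*} [CommGroup G] (z : G) (s : Finset ι) (p : ι → ℤ) :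
    z ^ (∑ i ∈ s, p i) = ∏ i ∈ s, z ^ p i := by
  classical
  induction s using Finset.induction_on with
  | empty => simp
  | insert j s hj ih => rw [Finset.sum_insert hj, Finset.prod_insert hj, zpow_add, ih]

/-- The part of degree `d` of a tensor product of graded algebras. -/
def piGr [Fintype ι] (B : ι → FoldedAlg k n) (d : ℤ) : Submodule k (⨂[k] i, (B i).carrier) :=
  Submodule.span k {v | ∃ (p : ι → ℤ) (x : ∀ i, (B i).carrier),
    (∀ i, x i ∈ (B i).gr (p i)) ∧ ∑ i, p i = d ∧ v = tprod k x}

theorem tprod_mem_piGr [Fintype ι] (B : ι → FoldedAlg k n) {p : ι → ℤ} {x : ∀ i, (B i).carrier}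
    (h : ∀ i, x i ∈ (B i).gr (p i)) : tprod k x ∈ piGr B (∑ i, p i) :=
  Submodule.subset_span ⟨p, x, h, rfl, rfl⟩

theorem piGr_iSup [Fintype ι] (B : ι → FoldedAlg k n) : ⨆ d, piGr B d = ⊤ := by
  classical
  have key : ∀ (s : Finset ι) (x : ∀ i, (B i).carrier),
      (∀ i ∉ s, ∃ d, x i ∈ (B i).gr d) → tprod k x ∈ ⨆ d, piGr B d := by
    intro s
    induction s using Finset.induction_on with
    | empty =>
      intro x hx
      choose p hp using fun i => hx i (Finset.notMem_empty i)
      exact Submodule.mem_iSup_of_mem _ (tprod_mem_piGr B hp)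
    | insert j s hj ih =>
      intro x hx
      have h : ∀ y, tprod k (Function.update x j y) ∈ ⨆ d, piGr B d := by
        intro y
        induction y using FoldedHom.hom_induction (B j).internal with
        | h0 => rw [MultilinearMap.map_update_zero]; exact zero_mem _
        | hadd y z hy hz => rw [MultilinearMap.map_update_add]; exact add_mem hy hz
        | hmem d y hy =>
          refine ih _ fun i hi => ?_
          by_cases hij : i = j
          · subst hij
            exact ⟨d, by simpa using hy⟩
          · rw [Function.update_of_ne hij]
            exact hx i (by simp [hij, hi])
      simpa using h (x j)
  rw [eq_top_iff, ← span_tprod_eq_top, Submodule.span_le]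
  rintro _ ⟨x, rfl⟩
  exact key Finset.univ x (by simp)

theorem piGr_internal [Fintype ι] [Infinite k] (B : ι → FoldedAlg k n) :
    DirectSum.IsInternal (piGr B) := by
  refine isInternal_of_scaling (piGr B) (piGr_iSup B)
    (fun z => PiTensorProduct.map fun i => scaling (B i).gr (B i).internal z) ?_
  intro z d x hx
  induction hx using Submodule.span_induction with
  | mem x hx =>
    obtain ⟨p, x, hx, rfl, rfl⟩ := hx
    rw [map_tprod]
    have : (fun i => scaling (B i).gr (B i).internal z (x i)) =
        fun i => ((z ^ p i : kˣ) : k) • x i := funext fun i => scaling_apply _ _ _ (hx i)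
    rw [this, MultilinearMap.map_smul_univ, ← Units.coe_prod, ← zpow_finset_sum]
  | zero => simp
  | add x y _ _ hx hy => rw [map_add, hx, hy, smul_add]
  | smul a x _ hx => rw [map_smul, hx, smul_comm]

theorem pi_map_mul {V : Type u} [Ring V] [Algebra k V] {B : ι → FoldedAlg k n}
    (f : (⨂[k] i, (B i).carrier) →ₗ[k] V)
    (h : ∀ x y : ∀ i, (B i).carrier,
      f (tprod k fun i => x i * y i) = f (tprod k x) * f (tprod k y))
    (x y : ⨂[k] i, (B i).carrier) : f (x * y) = f x * f y := by
  induction x using PiTensorProduct.induction_on with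
  | add x x' hx hx' => rw [add_mul, map_add, hx, hx', map_add, add_mul]
  | smul_tprod r x =>
    induction y using PiTensorProduct.induction_on with
    | add y y' hy hy' => rw [mul_add, map_add, hy, hy', map_add, mul_add]
    | smul_tprod s y =>
      rw [smul_mul_smul_comm, tprod_mul_tprod, map_smul, map_smul, map_smul,
        smul_mul_smul_comm, ← h]
      rfl

/-- The automorphism `x_1 ⊗ x_2 ⊗ ⋯ ↦ a x_1 ⊗ a x_2 ⊗ ⋯` of a tensor product. -/
def piAut (B : ι → FoldedAlg k n) :
    (⨂[k] i, (B i).carrier) ≃ₐ[k] ⨂[k] i, (B i).carrier :=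
  AlgEquiv.ofLinearEquiv (PiTensorProduct.congr fun i => (B i).aut.toLinearEquiv)
    (by
      rw [PiTensorProduct.one_def, congr_tprod]
      congr 1
      funext i
      exact map_one (B i).aut)
    (pi_map_mul (PiTensorProduct.congr fun i => (B i).aut.toLinearEquiv).toLinearMap
      fun x y => by
        simp only [LinearEquiv.coe_coe, congr_tprod, tprod_mul_tprod]
        congr 1
        funext i
        exact map_mul (B i).aut _ _)

theorem piAut_tprod (B : ι → FoldedAlg k n) (x : ∀ i, (B i).carrier) :
    piAut B (tprod k x) = tprod k fun i => (B i).aut (x i) :=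
  congr_tprod _ _

theorem piAut_pow_tprod (B : ι → FoldedAlg k n) (t : ℕ) (x : ∀ i, (B i).carrier) :
    (piAut B ^ t) (tprod k x) = tprod k fun i => ((B i).aut ^ t) (x i) := by
  induction t with
  | zero => rfl
  | succ t ih =>
    rw [pow_succ', AlgEquiv.mul_apply, ih, piAut_tprod]
    simp only [pow_succ', AlgEquiv.mul_apply]

theorem pi_ext {V : Type u} [AddCommGroup V] [Module k V] {B : ι → FoldedAlg k n}
    {f g : (⨂[k] i, (B i).carrier) →ₗ[k] V} (h : ∀ x, f (tprod k x) = g (tprod k x))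
    (x : ⨂[k] i, (B i).carrier) : f x = g x := by
  have : f = g := PiTensorProduct.ext (MultilinearMap.ext h)
  rw [this]

/-- The tensor product of a family of graded algebras with automorphism. -/
abbrev FoldedAlg.pi [Fintype ι] [Infinite k] (B : ι → FoldedAlg k n) : FoldedAlg k n where
  carrier := ⨂[k] i, (B i).carrier
  gr := piGr B
  internal := piGr_internal B
  one_mem := by
    have := tprod_mem_piGr B (p := 0) (x := 1) fun i => (B i).one_mem
    rw [show ∑ i : ι, (0 : ι → ℤ) i = 0 by simp] at this
    exact this
  mul_mem {c d x y} hx hy := by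
    induction hx using Submodule.span_induction with
    | mem x hx =>
      obtain ⟨p, x, hx, rfl, rfl⟩ := hx
      induction hy using Submodule.span_induction with
      | mem y hy =>
        obtain ⟨q, y, hy, rfl, rfl⟩ := hy
        rw [tprod_mul_tprod, ← Finset.sum_add_distrib]
        exact tprod_mem_piGr B fun i => (B i).mul_mem (hx i) (hy i)
      | zero => rw [mul_zero]; exact zero_mem _
      | add x y _ _ hx hy => rw [mul_add]; exact add_mem hx hy
      | smul a x _ hx => rw [mul_smul_comm]; exact Submodule.smul_mem _ _ hx
    | zero => rw [zero_mul]; exact zero_mem _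
    | add x y _ _ hx hy => rw [add_mul]; exact add_mem hx hy
    | smul a x _ hx => rw [smul_mul_assoc]; exact Submodule.smul_mem _ _ hx
  aut := piAut B
  aut_mem {d x} hx := by
    induction hx using Submodule.span_induction with
    | mem x hx =>
      obtain ⟨p, x, hx, rfl, rfl⟩ := hx
      rw [piAut_tprod]
      exact tprod_mem_piGr B fun i => (B i).aut_mem (hx i)
    | zero => rw [map_zero]; exact zero_mem _
    | add x y _ _ hx hy => rw [map_add]; exact add_mem hx hy
    | smul a x _ hx => rw [map_smul]; exact Submodule.smul_mem _ _ hx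
  aut_pow := by
    refine AlgEquiv.ext fun x => ?_
    refine pi_ext (f := (piAut B ^ n).toLinearMap) (g := LinearMap.id) (fun x => ?_) x
    rw [AlgEquiv.toLinearMap_apply, piAut_pow_tprod]
    simp only [FoldedAlg.aut_pow]
    rfl

theorem piMap_mem [Fintype ι] [Infinite k] {S R : ι → FoldedAlg k n}
    (φ : ∀ i, FoldedHom (S i) (R i)) {d : ℤ} {x : ⨂[k] i, (S i).carrier} (hx : x ∈ piGr S d) :
    PiTensorProduct.map (fun i => (φ i).toLin) x ∈ piGr R d := by
  induction hx using Submodule.span_induction with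
  | mem x hx =>
    obtain ⟨p, x, hx, rfl, rfl⟩ := hx
    rw [map_tprod]
    exact tprod_mem_piGr R fun i => (φ i).map_mem (hx i)
  | zero => rw [map_zero]; exact zero_mem _
  | add x y _ _ hx hy => rw [map_add]; exact add_mem hx hy
  | smul a x _ hx => rw [map_smul]; exact Submodule.smul_mem _ _ hx

/-- The tensor product of a family of homomorphisms. -/
def FoldedHom.pi [Fintype ι] [Infinite k] {S R : ι → FoldedAlg k n}
    (φ : ∀ i, FoldedHom (S i) (R i)) : FoldedHom (FoldedAlg.pi S) (FoldedAlg.pi R) where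
  toLin := PiTensorProduct.map fun i => (φ i).toLin
  map_mul := pi_map_mul _ fun x y => by
    simp only [map_tprod, FoldedHom.map_mul]
    exact (tprod_mul_tprod _ _).symm
  map_mem := piMap_mem φ
  comm x := by
    refine pi_ext (f := PiTensorProduct.map (fun i => (φ i).toLin) ∘ₗ (piAut S).toLinearMap)
      (g := (piAut R).toLinearMap ∘ₗ PiTensorProduct.map (fun i => (φ i).toLin)) (fun x => ?_) x
    simp [piAut_tprod, FoldedHom.comm]


theorem list_prod_ofFn_mem (A : FoldedAlg k n) {l : ℕ} (f : Fin l → A.carrier) (p : Fin l → ℤ)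
    (h : ∀ j, f j ∈ A.gr (p j)) : (List.ofFn f).prod ∈ A.gr (∑ j, p j) := by
  induction l with
  | zero => simpa using A.one_mem
  | succ l ih =>
    rw [List.ofFn_succ, List.prod_cons, Fin.sum_univ_succ]
    exact A.mul_mem (h 0) (ih _ _ fun j => h j.succ)

theorem list_prod_ofFn_mul {M : Type u} [Monoid M] {l : ℕ} (f g : Fin l → M)
    (h : ∀ i j, i ≠ j → Commute (g i) (f j)) :
    (List.ofFn fun j => f j * g j).prod = (List.ofFn f).prod * (List.ofFn g).prod := by
  induction l with
  | zero => simp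
  | succ l ih =>
    simp only [List.ofFn_succ, List.prod_cons]
    rw [ih _ _ fun i j hij => h _ _ fun h => hij (Fin.succ_injective _ h)]
    have hc : Commute (g 0) (List.ofFn fun j : Fin l => f j.succ).prod := by
      refine Commute.list_prod_right _ _ fun x hx => ?_
      obtain ⟨j, rfl⟩ := (List.mem_ofFn' _ _).1 hx
      exact h _ _ (Fin.succ_ne_zero j).symm
    rw [mul_assoc, mul_assoc, ← mul_assoc (g 0), hc.eq, mul_assoc]

/-- Homomorphisms `s j` into `R` whose images commute with each other and that all take the unit
to the same element `e` combine to the homomorphism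
`x_1 ⊗ x_2 ⊗ ⋯ ↦ e * s_1 x_1 * s_2 x_2 * ⋯` on the tensor product. -/
def FoldedHom.ofCommuting [Infinite k] {l : ℕ} {B : Fin l → FoldedAlg k n} {R : FoldedAlg k n}
    (s : ∀ j, FoldedHom (B j) R) (e : R.carrier) (he : e * e = e) (hmem : e ∈ R.gr 0)
    (haut : R.aut e = e) (h1 : ∀ j, (s j).e = e)
    (hc : ∀ i j, i ≠ j → ∀ x y, Commute ((s i).toLin x) ((s j).toLin y)) :
    FoldedHom (FoldedAlg.pi B) R where
  toLin := LinearMap.mulLeft k e ∘ₗ PiTensorProduct.lift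
    ((MultilinearMap.mkPiAlgebraFin k l R.carrier).compLinearMap fun j => (s j).toLin)
  map_mul := pi_map_mul _ fun x y => by
    simp only [LinearMap.comp_apply, lift.tprod, MultilinearMap.compLinearMap_apply,
      MultilinearMap.mkPiAlgebraFin_apply, LinearMap.mulLeft_apply, FoldedHom.map_mul]
    rw [list_prod_ofFn_mul _ _ fun i j hij => hc i j hij _ _]
    have hcomm : Commute e (List.ofFn fun j => (s j).toLin (x j)).prod := by
      refine Commute.list_prod_right _ _ fun z hz => ?_
      obtain ⟨j, rfl⟩ := (List.mem_ofFn' _ _).1 hz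
      change e * _ = _ * e
      rw [← h1 j, e_mul_map, map_mul_e]
    rw [mul_assoc e, ← mul_assoc _ e, ← hcomm.eq, ← mul_assoc, ← mul_assoc, ← mul_assoc, he]
  map_mem {d x} hx := by
    induction hx using Submodule.span_induction with
    | mem x hx =>
      obtain ⟨p, x, hx, rfl, rfl⟩ := hx
      simp only [LinearMap.comp_apply, lift.tprod, MultilinearMap.compLinearMap_apply,
        MultilinearMap.mkPiAlgebraFin_apply, LinearMap.mulLeft_apply]
      rw [← zero_add (∑ i, p i)]
      exact R.mul_mem hmem (list_prod_ofFn_mem R _ _ fun j => (s j).map_mem (hx j))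
    | zero => rw [map_zero]; exact zero_mem _
    | add x y _ _ hx hy => rw [map_add]; exact add_mem hx hy
    | smul a x _ hx => rw [map_smul]; exact Submodule.smul_mem _ _ hx
  comm x := by
    refine pi_ext (f := (LinearMap.mulLeft k e ∘ₗ PiTensorProduct.lift
      ((MultilinearMap.mkPiAlgebraFin k l R.carrier).compLinearMap fun j => (s j).toLin)) ∘ₗ
        (piAut B).toLinearMap)
      (g := R.aut.toLinearMap ∘ₗ (LinearMap.mulLeft k e ∘ₗ PiTensorProduct.lift
      ((MultilinearMap.mkPiAlgebraFin k l R.carrier).compLinearMap fun j => (s j).toLin)))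
      (fun x => ?_) x
    simp only [LinearMap.comp_apply, lift.tprod, MultilinearMap.compLinearMap_apply,
      MultilinearMap.mkPiAlgebraFin_apply, LinearMap.mulLeft_apply, AlgEquiv.toLinearMap_apply,
      piAut_tprod, _root_.map_mul, haut, map_list_prod, List.map_ofFn, Function.comp_def,
      FoldedHom.comm]

theorem FoldedHom.ofCommuting_tprod [Infinite k] {l : ℕ} {B : Fin l → FoldedAlg k n}
    {R : FoldedAlg k n} (s : ∀ j, FoldedHom (B j) R) (e : R.carrier) (he : e * e = e)
    (hmem : e ∈ R.gr 0) (haut : R.aut e = e) (h1 : ∀ j, (s j).e = e)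
    (hc : ∀ i j, i ≠ j → ∀ x y, Commute ((s i).toLin x) ((s j).toLin y))
    (x : ∀ j, (B j).carrier) :
    (FoldedHom.ofCommuting s e he hmem haut h1 hc).toLin (tprod k x) =
      e * (List.ofFn fun j => (s j).toLin (x j)).prod := by
  change (LinearMap.mulLeft k e ∘ₗ PiTensorProduct.lift
      ((MultilinearMap.mkPiAlgebraFin k l R.carrier).compLinearMap fun j => (s j).toLin))
      (tprod k x) = _
  simp

/-- The inclusion of a tensor factor. -/
def FoldedHom.single [Fintype ι] [DecidableEq ι] [Infinite k] (B : ι → FoldedAlg k n) (j : ι) :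
    FoldedHom (B j) (FoldedAlg.pi B) where
  toLin := (singleAlgHom (R := k) (A := fun i => (B i).carrier) j).toLinearMap
  map_mul x y := _root_.map_mul (singleAlgHom (R := k) (A := fun i => (B i).carrier) j) x y
  map_mem {d x} hx := by
    have h := tprod_mem_piGr B (p := Pi.single j d) (x := Pi.mulSingle j x) fun i => by
      by_cases hij : i = j
      · subst hij; simpa using hx
      · simpa [hij] using (B i).one_mem
    rw [Finset.sum_pi_single'] at h
    simpa using h
  comm x := by
    change PiTensorProduct.tprod k _ = piAut B (PiTensorProduct.tprod k _)
    rw [piAut_tprod]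
    congr 1
    funext i
    by_cases hij : i = j
    · subst hij; simp
    · simp [hij]

theorem FoldedHom.single_apply [Fintype ι] [DecidableEq ι] [Infinite k] (B : ι → FoldedAlg k n)
    (j : ι) (x : (B j).carrier) : (FoldedHom.single B j).toLin x = PiTensorProduct.tprod k (Pi.mulSingle j x) :=
  rfl

theorem FoldedHom.pi_tprod [Fintype ι] [Infinite k] {S R : ι → FoldedAlg k n}
    (φ : ∀ i, FoldedHom (S i) (R i)) (x : ∀ i, (S i).carrier) :
    (FoldedHom.pi φ).toLin (tprod k x) = tprod k fun i => (φ i).toLin (x i) :=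
  map_tprod _ _

theorem FoldedHom.single_commute [Fintype ι] [DecidableEq ι] [Infinite k]
    (B : ι → FoldedAlg k n) {j j' : ι} (h : j ≠ j') (x : (B j).carrier) (y : (B j').carrier) :
    Commute ((FoldedHom.single B j).toLin x) ((FoldedHom.single B j').toLin y) :=
  (Pi.mulSingle_commute (f := fun i => (B i).carrier) h x y).tprod

theorem list_prod_ofFn_eq {M : Type u} [Monoid M] {l : ℕ} (f : Fin l → M) (i : Fin l)
    (h : ∀ j, j ≠ i → f j = 1) : (List.ofFn f).prod = f i := by
  induction l with
  | zero => exact i.elim0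
  | succ l ih =>
    rw [List.ofFn_succ, List.prod_cons]
    induction i using Fin.cases with
    | zero =>
      have : (fun j : Fin l => f j.succ) = fun _ => 1 := funext fun j => h _ (Fin.succ_ne_zero j)
      rw [this]
      simp
    | succ i =>
      rw [ih (fun j => f j.succ) i fun j hj => h _ fun h => hj (Fin.succ_injective _ h),
        h 0 (Fin.succ_ne_zero i).symm, one_mul]

theorem list_prod_single [Infinite k] {l : ℕ} (B : Fin l → FoldedAlg k n)
    (x : ∀ j, (B j).carrier) :
    (List.ofFn fun j => (FoldedHom.single B j).toLin (x j)).prod = tprod k x := by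
  have h : (List.ofFn fun j => (Pi.mulSingle j (x j) : ∀ j, (B j).carrier)).prod = x := by
    funext i
    rw [Pi.list_prod_apply, List.map_ofFn, list_prod_ofFn_eq _ i]
    · simp
    · intro j hj
      simp [Pi.mulSingle_eq_of_ne hj.symm]
  calc _ = (List.map (tprodMonoidHom k)
        (List.ofFn fun j => (Pi.mulSingle j (x j) : ∀ j, (B j).carrier))).prod := by
        rw [List.map_ofFn]; rfl
    _ = _ := by rw [← map_list_prod, h]; rfl

theorem pi_commute {V : Type u} [Ring V] [Algebra k V] {B : ι → FoldedAlg k n} {v : V}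
    (f : (⨂[k] i, (B i).carrier) →ₗ[k] V) (h : ∀ x, Commute (f (tprod k x)) v)
    (x : ⨂[k] i, (B i).carrier) : Commute (f x) v :=
  pi_ext (f := LinearMap.mulRight k v ∘ₗ f) (g := LinearMap.mulLeft k v ∘ₗ f) h x

/-- The permutation of tensor factors `⨂_j (⨂_i B i j) → ⨂_i (⨂_j B i j)`. -/
def FoldedHom.swap [Infinite k] {r l : ℕ} (B : Fin r → Fin l → FoldedAlg k n) :
    FoldedHom (FoldedAlg.pi fun j => FoldedAlg.pi fun i => B i j)
      (FoldedAlg.pi fun i => FoldedAlg.pi fun j => B i j) :=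
  FoldedHom.ofCommuting (fun j => FoldedHom.pi fun i => FoldedHom.single (B i) j) 1
    (mul_one 1) (FoldedAlg.one_mem _) (map_one _)
    (fun j => by
      rw [FoldedHom.e, PiTensorProduct.one_def, FoldedHom.pi_tprod, PiTensorProduct.one_def]
      congr 1
      funext i
      rw [Pi.one_apply, FoldedHom.single_apply, Pi.mulSingle_one]
      rfl)
    (fun j j' hj x y => by
      refine pi_commute (FoldedHom.pi fun i => FoldedHom.single (B i) j).toLin (fun x => ?_) x
      refine Commute.symm ?_
      refine pi_commute (FoldedHom.pi fun i => FoldedHom.single (B i) j').toLin (fun y => ?_) y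
      rw [FoldedHom.pi_tprod, FoldedHom.pi_tprod]
      refine Commute.tprod ?_
      exact funext fun i => FoldedHom.single_commute (B i) hj.symm (y i) (x i))

theorem FoldedHom.swap_tprod [Infinite k] {r l : ℕ} (B : Fin r → Fin l → FoldedAlg k n)
    (x : ∀ i j, (B i j).carrier) :
    (FoldedHom.swap B).toLin (PiTensorProduct.tprod k fun j =>
        (PiTensorProduct.tprod k fun i => x i j : (FoldedAlg.pi fun i => B i j).carrier)) =
      PiTensorProduct.tprod k fun i =>
        (PiTensorProduct.tprod k fun j => x i j : (FoldedAlg.pi fun j => B i j).carrier) := by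
  rw [FoldedHom.swap, FoldedHom.ofCommuting_tprod, one_mul]
  have h : ∀ j, (FoldedHom.pi fun i => FoldedHom.single (B i) j).toLin
      (PiTensorProduct.tprod k fun i => x i j) =
      PiTensorProduct.tprod k fun i => (FoldedHom.single (B i) j).toLin (x i j) :=
    fun j => FoldedHom.pi_tprod _ _
  calc _ = (List.ofFn fun j => (PiTensorProduct.tprod k fun i =>
        (FoldedHom.single (B i) j).toLin (x i j) :
          (FoldedAlg.pi fun i => FoldedAlg.pi fun j => B i j).carrier)).prod :=
        congrArg (fun f => (List.ofFn f).prod) (funext h)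
    _ = (List.map (tprodMonoidHom k) (List.ofFn fun j => fun i =>
        (FoldedHom.single (B i) j).toLin (x i j))).prod := by
        rw [List.map_ofFn]; rfl
    _ = _ := by
      rw [← map_list_prod]
      change PiTensorProduct.tprod k _ = PiTensorProduct.tprod k _
      congr 1
      funext i
      rw [Pi.list_prod_apply, List.map_ofFn, ← list_prod_single]
      rfl

end Tensor

/-! ### Cartan data with automorphism -/

/-- A Cartan datum; the symmetric bilinear form on the free abelian group on `I` is given by its
values on the basis. -/
structure CartanDatum (I : Type u) where
  form : I → I → ℤ
  symm : ∀ i j, form i j = form j i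
  pos : ∀ i, 0 < form i i
  even : ∀ i, Even (form i i)
  off_diag : ∀ i j, i ≠ j → ∃ c : ℕ, 2 * form i j = -(c * form i i)

namespace CartanDatum

variable {I : Type u} (D : CartanDatum I)

/-- `d_i = i·i / 2`. -/
def d (i : I) : ℤ := D.form i i / 2

/-- The Cartan matrix, `c_ij = i·j / d_i`. -/
def c (i j : I) : ℤ := D.form i j / D.d i

theorem two_mul_d (i : I) : 2 * D.d i = D.form i i :=
  Int.mul_ediv_cancel' (D.even i).two_dvd

theorem d_mul_c {i j : I} (h : i ≠ j) : D.d i * D.c i j = D.form i j := by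
  obtain ⟨c, hc⟩ := D.off_diag i j h
  refine Int.mul_ediv_cancel' ⟨-c, ?_⟩
  have := D.two_mul_d i
  nlinarith

end CartanDatum

/-- A Cartan datum with an automorphism `a` of finite order whose orbits consist of mutually
orthogonal elements, together with a compatible family of polynomials `Q i j` over `k` in the two
variables `u = X 0` and `v = X 1`. -/
structure FoldingDatum (k : Type u) [Field k] (I : Type u) extends CartanDatum I where
  a : Equiv.Perm I
  form_a : ∀ i j, form (a i) (a j) = form i j
  finite_order : IsOfFinOrder a
  orthogonal : ∀ (i : I) (t : ℕ), (a ^ t) i ≠ i → form i ((a ^ t) i) = 0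
  Q : I → I → MvPolynomial (Fin 2) k
  Q_self : ∀ i, Q i i = 0
  Q_homogeneous : ∀ i j, i ≠ j →
    (Q i j).IsWeightedHomogeneous ![toCartanDatum.d i, toCartanDatum.d j]
      (-(toCartanDatum.d i * toCartanDatum.c i j))
  Q_coeff_u : ∀ i j, i ≠ j →
    (Q i j).coeff (Finsupp.single 0 (-toCartanDatum.c i j).toNat) ≠ 0
  Q_coeff_v : ∀ i j, i ≠ j →
    (Q i j).coeff (Finsupp.single 1 (-toCartanDatum.c j i).toNat) ≠ 0
  Q_symm : ∀ i j, Q i j = MvPolynomial.rename (Equiv.swap 0 1) (Q j i)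
  Q_a : ∀ i j, Q (a i) (a j) = Q i j

namespace FoldingDatum

variable {k : Type u} [Field k] {I : Type u} (D : FoldingDatum k I)

/-- The order of the automorphism. -/
def n : ℕ := orderOf D.a

/-- `ℕ J`, embedded in `ℕ I` as the elements that are fixed by `a`. -/
def NJ : AddSubmonoid (I →₀ ℕ) where
  carrier := {ν | ν.mapDomain D.a = ν}
  add_mem' {x y} hx hy := by
    change Finsupp.mapDomain D.a (x + y) = x + y
    rw [Finsupp.mapDomain_add, show x.mapDomain D.a = x from hx, show y.mapDomain D.a = y from hy]
  zero_mem' := Finsupp.mapDomain_zero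

variable {D} in
theorem mapDomain_a {ν : I →₀ ℕ} (h : ν ∈ D.NJ) : ν.mapDomain D.a = ν := h

end FoldingDatum

/-! ### The algebras `R(ν)` -/

/-- The sequences of weight `ν`. -/
def Seq {I : Type u} (ν : I →₀ ℕ) : Type u :=
  {i : Fin ν.degree → I // ∑ p, Finsupp.single (i p) 1 = ν}

namespace Seq

variable {I : Type u} {ν : I →₀ ℕ}

instance : CoeFun (Seq ν) fun _ => Fin ν.degree → I := ⟨Subtype.val⟩

theorem ext {i j : Seq ν} (h : ∀ p, i p = j p) : i = j := Subtype.ext (funext h)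

theorem mem_support (i : Seq ν) (p : Fin ν.degree) : i p ∈ ν.support := by
  classical
  have h : ∑ p, Finsupp.single (i p) 1 = ν := i.2
  rw [Finsupp.mem_support_iff]
  intro h0
  have h1 := DFunLike.congr_fun h (i p)
  rw [Finsupp.finsetSum_apply, h0, Finset.sum_eq_zero_iff] at h1
  simpa using h1 p (Finset.mem_univ _)

instance : Finite (Seq ν) :=
  Finite.of_injective (fun (i : Seq ν) (p : Fin ν.degree) => (⟨i p, i.mem_support p⟩ : ν.support))
    fun _ _ h => Seq.ext fun p => congrArg Subtype.val (congrFun h p)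

instance : Fintype (Seq ν) := Fintype.ofFinite _

/-- The sequence obtained by interchanging two entries. -/
def swap (p q : Fin ν.degree) (i : Seq ν) : Seq ν :=
  ⟨fun l => i (Equiv.swap p q l),
    (Equiv.sum_comp (Equiv.swap p q) fun l => Finsupp.single (i l) 1).trans i.2⟩

@[simp] theorem swap_apply (p q : Fin ν.degree) (i : Seq ν) (l : Fin ν.degree) :
    swap p q i l = i (Equiv.swap p q l) := rfl

@[simp] theorem swap_swap (p q : Fin ν.degree) (i : Seq ν) : swap p q (swap p q i) = i :=
  Seq.ext fun l => by simp

/-- The sequence obtained by applying a permutation of the set of colours that fixes `ν`. -/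
def map (b : Equiv.Perm I) (hb : ν.mapDomain b = ν) (i : Seq ν) : Seq ν :=
  ⟨fun l => b (i l), by
    have h : ∑ p, Finsupp.single (i p) 1 = ν := i.2
    calc ∑ p, Finsupp.single (b (i p)) 1 = (∑ p, Finsupp.single (i p) 1).mapDomain b := by
          rw [Finsupp.mapDomain_finsetSum]; simp
      _ = ν := by rw [h, hb]⟩

@[simp] theorem map_apply (b : Equiv.Perm I) (hb : ν.mapDomain b = ν) (i : Seq ν)
    (l : Fin ν.degree) : map b hb i l = b (i l) := rfl

end Seq

section Polynomials

variable {k : Type u} [Field k] {B : Type u} [Ring B] [Algebra k B]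

/-- `Q(u, v)`. -/
def evalQ (Q : MvPolynomial (Fin 2) k) (u v : B) : B :=
  ∑ m ∈ Q.support, Q.coeff m • (u ^ m 0 * v ^ m 1)

/-- `(Q(u, v) - Q(w, v)) / (u - w)`, written as a polynomial in `u`, `v`, `w`. -/
def evalDQ (Q : MvPolynomial (Fin 2) k) (u v w : B) : B :=
  ∑ m ∈ Q.support,
    Q.coeff m • ((∑ s ∈ Finset.range (m 0), u ^ s * w ^ (m 0 - 1 - s)) * v ^ m 1)

theorem evalDQ_mul (Q : MvPolynomial (Fin 2) k) {u v w : B} (huv : Commute u v)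
    (huw : Commute u w) (hvw : Commute v w) :
    evalDQ Q u v w * (u - w) = evalQ Q u v - evalQ Q w v := by
  rw [evalDQ, evalQ, evalQ, Finset.sum_mul, ← Finset.sum_sub_distrib]
  refine Finset.sum_congr rfl fun m _ => ?_
  have h : Commute (v ^ m 1) (u - w) := (huv.symm.sub_right hvw).pow_left _
  rw [smul_mul_assoc, mul_assoc, h.eq, ← mul_assoc, huw.geom_sum₂_mul, sub_mul, smul_sub]

variable {B' : Type u} [Ring B'] [Algebra k B']

theorem map_evalQ (f : B →ₐ[k] B') (Q : MvPolynomial (Fin 2) k) (u v : B) :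
    f (evalQ Q u v) = evalQ Q (f u) (f v) := by
  simp [evalQ]

theorem map_evalDQ (f : B →ₐ[k] B') (Q : MvPolynomial (Fin 2) k) (u v w : B) :
    f (evalDQ Q u v w) = evalDQ Q (f u) (f v) (f w) := by
  simp [evalDQ]

end Polynomials

section KLR

variable {k : Type u} [Field k] {I : Type u} (D : FoldingDatum k I) (ν : I →₀ ℕ)

/-- The generators of `R(ν)`: `e i` for every sequence `i` of weight `ν`, `y p` for every position
`p`, and `tau p q` for every two adjacent positions `p`, `q = p + 1`. -/
inductive Gen {I : Type u} (ν : I →₀ ℕ) : Type u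
  | e (i : Seq ν)
  | y (p : Fin ν.degree)
  | tau (p q : Fin ν.degree) (h : (p : ℕ) + 1 = q)

namespace Free

/-- A generator, in the free algebra. -/
abbrev e (k : Type u) [Field k] {I : Type u} {ν : I →₀ ℕ} (i : Seq ν) : FreeAlgebra k (Gen ν) :=
  FreeAlgebra.ι k (Gen.e i)

/-- A generator, in the free algebra. -/
abbrev y (k : Type u) [Field k] {I : Type u} {ν : I →₀ ℕ} (p : Fin ν.degree) :
    FreeAlgebra k (Gen ν) :=
  FreeAlgebra.ι k (Gen.y p)

/-- A generator, in the free algebra. -/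
abbrev tau (k : Type u) [Field k] {I : Type u} {ν : I →₀ ℕ} (p q : Fin ν.degree)
    (h : (p : ℕ) + 1 = q) : FreeAlgebra k (Gen ν) :=
  FreeAlgebra.ι k (Gen.tau p q h)

end Free

open Free in
/-- The defining relations of `R(ν)`. -/
inductive Rel : FreeAlgebra k (Gen ν) → FreeAlgebra k (Gen ν) → Prop
  | e_mul_self (i) : Rel (e k i * e k i) (e k i)
  | e_mul_ne (i j) : i ≠ j → Rel (e k i * e k j) 0
  | sum_e : Rel (∑ i, e k i) 1
  | y_comm (p q) : Rel (y k p * y k q) (y k q * y k p)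
  | y_e (p i) : Rel (y k p * e k i) (e k i * y k p)
  | tau_e (p q h i) : Rel (tau k p q h * e k i) (e k (i.swap p q) * tau k p q h)
  | tau_comm (p q h p' q' h') : q < p' →
      Rel (tau k p q h * tau k p' q' h') (tau k p' q' h' * tau k p q h)
  | tau_sq (p q h i) :
      Rel (tau k p q h * tau k p q h * e k i) (evalQ (D.Q (i p) (i q)) (y k p) (y k q) * e k i)
  | tau_y_left (p q h) (i : Seq ν) : i p = i q →
      Rel ((tau k p q h * y k p - y k q * tau k p q h) * e k i) (-e k i)
  | tau_y_right (p q h) (i : Seq ν) : i p = i q →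
      Rel ((tau k p q h * y k q - y k p * tau k p q h) * e k i) (e k i)
  | tau_y (p q h l) (i : Seq ν) : ¬ (i p = i q ∧ (l = p ∨ l = q)) →
      Rel ((tau k p q h * y k l - y k (Equiv.swap p q l) * tau k p q h) * e k i) 0
  | braid_eq (p q r h h') (i : Seq ν) : i p = i r →
      Rel ((tau k q r h' * tau k p q h * tau k q r h' -
        tau k p q h * tau k q r h' * tau k p q h) * e k i)
        (evalDQ (D.Q (i p) (i q)) (y k p) (y k q) (y k r) * e k i)
  | braid_ne (p q r h h') (i : Seq ν) : i p ≠ i r →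
      Rel ((tau k q r h' * tau k p q h * tau k q r h' -
        tau k p q h * tau k q r h' * tau k p q h) * e k i) 0

/-- The KLR algebra `R(ν)`. -/
def KLR : Type u := RingQuot (Rel D ν)

instance : Ring (KLR D ν) := inferInstanceAs (Ring (RingQuot (Rel D ν)))

instance : Algebra k (KLR D ν) := inferInstanceAs (Algebra k (RingQuot (Rel D ν)))

/-- A family of elements of an algebra that satisfies all the defining relations of `R(ν)` except
possibly that the idempotents add up to `1`. -/
structure IsFamily {B : Type u} [Ring B] [Algebra k B] (E : Seq ν → B) (Y : Fin ν.degree → B)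
    (T : ∀ p q : Fin ν.degree, (p : ℕ) + 1 = q → B) : Prop where
  e_mul_self : ∀ i, E i * E i = E i
  e_mul_ne : ∀ i j, i ≠ j → E i * E j = 0
  y_comm : ∀ p q, Y p * Y q = Y q * Y p
  y_e : ∀ p i, Y p * E i = E i * Y p
  tau_e : ∀ p q h i, T p q h * E i = E (i.swap p q) * T p q h
  tau_comm : ∀ p q h p' q' h', q < p' → T p q h * T p' q' h' = T p' q' h' * T p q h
  tau_sq : ∀ p q h i, T p q h * T p q h * E i = evalQ (D.Q (i p) (i q)) (Y p) (Y q) * E i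
  tau_y_left : ∀ p q h (i : Seq ν), i p = i q →
    (T p q h * Y p - Y q * T p q h) * E i = -E i
  tau_y_right : ∀ p q h (i : Seq ν), i p = i q →
    (T p q h * Y q - Y p * T p q h) * E i = E i
  tau_y : ∀ p q h l (i : Seq ν), ¬ (i p = i q ∧ (l = p ∨ l = q)) →
    (T p q h * Y l - Y (Equiv.swap p q l) * T p q h) * E i = 0
  braid_eq : ∀ p q r h h' (i : Seq ν), i p = i r →
    (T q r h' * T p q h * T q r h' - T p q h * T q r h' * T p q h) * E i =
      evalDQ (D.Q (i p) (i q)) (Y p) (Y q) (Y r) * E i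
  braid_ne : ∀ p q r h h' (i : Seq ν), i p ≠ i r →
    (T q r h' * T p q h * T q r h' - T p q h * T q r h' * T p q h) * E i = 0

namespace KLR

variable {D ν}

/-- The quotient map. -/
def mk : FreeAlgebra k (Gen ν) →ₐ[k] KLR D ν := RingQuot.mkAlgHom k (Rel D ν)

theorem mk_surjective : Function.Surjective (mk (D := D) (ν := ν)) :=
  RingQuot.mkAlgHom_surjective k _

theorem mk_rel {x y : FreeAlgebra k (Gen ν)} (h : Rel D ν x y) : mk (D := D) x = mk y :=
  RingQuot.mkAlgHom_rel k h

variable (D)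

/-- The idempotent of a sequence. -/
def e (i : Seq ν) : KLR D ν := mk (Free.e k i)

/-- The generator `y_p`. -/
def y (p : Fin ν.degree) : KLR D ν := mk (Free.y k p)

/-- The generator `τ_p`, where `q = p + 1`. -/
def tau (p q : Fin ν.degree) (h : (p : ℕ) + 1 = q) : KLR D ν := mk (Free.tau k p q h)

theorem sum_e : ∑ i, e D i = (1 : KLR D ν) := by
  have := mk_rel (D := D) (ν := ν) Rel.sum_e
  rwa [map_sum, map_one] at this

theorem isFamily : IsFamily D ν (e D) (y D) (tau D) where
  e_mul_self i := by simpa [e, y, tau] using mk_rel (D := D) (Rel.e_mul_self i)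
  e_mul_ne i j h := by simpa [e, y, tau] using mk_rel (D := D) (Rel.e_mul_ne i j h)
  y_comm p q := by simpa [e, y, tau] using mk_rel (D := D) (Rel.y_comm p q)
  y_e p i := by simpa [e, y, tau] using mk_rel (D := D) (Rel.y_e p i)
  tau_e p q h i := by simpa [e, y, tau] using mk_rel (D := D) (Rel.tau_e p q h i)
  tau_comm p q h p' q' h' hq := by simpa [e, y, tau] using mk_rel (D := D) (Rel.tau_comm p q h p' q' h' hq)
  tau_sq p q h i := by simpa [e, y, tau, map_evalQ] using mk_rel (D := D) (Rel.tau_sq p q h i)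
  tau_y_left p q h i hi := by simpa [e, y, tau] using mk_rel (D := D) (Rel.tau_y_left p q h i hi)
  tau_y_right p q h i hi := by simpa [e, y, tau] using mk_rel (D := D) (Rel.tau_y_right p q h i hi)
  tau_y p q h l i hi := by simpa [e, y, tau] using mk_rel (D := D) (Rel.tau_y p q h l i hi)
  braid_eq p q r h h' i hi := by
    simpa [e, y, tau, map_evalDQ] using mk_rel (D := D) (Rel.braid_eq p q r h h' i hi)
  braid_ne p q r h h' i hi := by simpa [e, y, tau] using mk_rel (D := D) (Rel.braid_ne p q r h h' i hi)

/-- A family that satisfies all the relations defines a homomorphism. -/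
def lift {B : Type u} [Ring B] [Algebra k B] {E : Seq ν → B} {Y : Fin ν.degree → B}
    {T : ∀ p q : Fin ν.degree, (p : ℕ) + 1 = q → B} (hf : IsFamily D ν E Y T)
    (h1 : ∑ i, E i = 1) : KLR D ν →ₐ[k] B :=
  RingQuot.liftAlgHom k ⟨FreeAlgebra.lift k fun g : Gen ν => match g with
    | .e i => E i
    | .y p => Y p
    | .tau p q h => T p q h, by
    intro x y hxy
    cases hxy with
    | e_mul_self i => simpa using hf.e_mul_self i
    | e_mul_ne i j h => simpa using hf.e_mul_ne i j h
    | sum_e => simpa using h1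
    | y_comm p q => simpa using hf.y_comm p q
    | y_e p i => simpa using hf.y_e p i
    | tau_e p q h i => simpa using hf.tau_e p q h i
    | tau_comm p q h p' q' h' hq => simpa using hf.tau_comm p q h p' q' h' hq
    | tau_sq p q h i => simpa [map_evalQ] using hf.tau_sq p q h i
    | tau_y_left p q h i hi => simpa using hf.tau_y_left p q h i hi
    | tau_y_right p q h i hi => simpa using hf.tau_y_right p q h i hi
    | tau_y p q h l i hi => simpa using hf.tau_y p q h l i hi
    | braid_eq p q r h h' i hi => simpa [map_evalDQ] using hf.braid_eq p q r h h' i hi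
    | braid_ne p q r h h' i hi => simpa using hf.braid_ne p q r h h' i hi⟩

section Lift

variable {B : Type u} [Ring B] [Algebra k B] {E : Seq ν → B} {Y : Fin ν.degree → B}
    {T : ∀ p q : Fin ν.degree, (p : ℕ) + 1 = q → B} (hf : IsFamily D ν E Y T)
    (h1 : ∑ i, E i = 1)

@[simp] theorem lift_e (i : Seq ν) : lift D hf h1 (e D i) = E i :=
  (RingQuot.liftAlgHom_mkAlgHom_apply k _ _ _).trans (FreeAlgebra.lift_ι_apply _ _)

@[simp] theorem lift_y (p : Fin ν.degree) : lift D hf h1 (y D p) = Y p :=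
  (RingQuot.liftAlgHom_mkAlgHom_apply k _ _ _).trans (FreeAlgebra.lift_ι_apply _ _)

@[simp] theorem lift_tau (p q : Fin ν.degree) (h : (p : ℕ) + 1 = q) :
    lift D hf h1 (tau D p q h) = T p q h :=
  (RingQuot.liftAlgHom_mkAlgHom_apply k _ _ _).trans (FreeAlgebra.lift_ι_apply _ _)

end Lift

@[elab_as_elim]
theorem induction {P : KLR D ν → Prop} (he : ∀ i, P (e D i)) (hy : ∀ p, P (y D p))
    (htau : ∀ p q h, P (tau D p q h)) (hadd : ∀ x y, P x → P y → P (x + y))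
    (hmul : ∀ x y, P x → P y → P (x * y)) (hk : ∀ c, P (algebraMap k (KLR D ν) c))
    (x : KLR D ν) : P x := by
  obtain ⟨x, rfl⟩ := mk_surjective x
  induction x using FreeAlgebra.induction with
  | grade0 c => simpa using hk c
  | grade1 g =>
    cases g with
    | e i => exact he i
    | y p => exact hy p
    | tau p q h => exact htau p q h
  | mul x y hx hy => rw [map_mul]; exact hmul _ _ hx hy
  | add x y hx hy => rw [map_add]; exact hadd _ _ hx hy

theorem algHom_ext {B : Type u} [Ring B] [Algebra k B] {f g : KLR D ν →ₐ[k] B}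
    (he : ∀ i, f (e D i) = g (e D i)) (hy : ∀ p, f (y D p) = g (y D p))
    (htau : ∀ p q h, f (tau D p q h) = g (tau D p q h)) : f = g := by
  refine AlgHom.ext fun x => ?_
  induction x using KLR.induction with
  | he i => exact he i
  | hy p => exact hy p
  | htau p q h => exact htau p q h
  | hadd x y hx hy => rw [map_add, map_add, hx, hy]
  | hmul x y hx hy => rw [map_mul, map_mul, hx, hy]
  | hk c => rw [AlgHom.commutes, AlgHom.commutes]

/-- Two elements are equal if they agree after multiplication by all the idempotents. -/
theorem eq_of_mul_e {x x' : KLR D ν} (h : ∀ i, x * e D i = x' * e D i) : x = x' := by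
  rw [← mul_one x, ← mul_one x', ← sum_e, Finset.mul_sum, Finset.mul_sum]
  exact Finset.sum_congr rfl fun i _ => h i

/-! #### The automorphism -/

variable {D}

theorem aut_isFamily (b : Equiv.Perm I) (hb : ν.mapDomain b = ν)
    (hQ : ∀ i j, D.Q (b i) (b j) = D.Q i j) :
    IsFamily D ν (fun i => e D (i.map b hb)) (y D) (tau D) where
  e_mul_self i := (isFamily D).e_mul_self _
  e_mul_ne i j h := (isFamily D).e_mul_ne _ _ fun h' => h (Seq.ext fun p => by
    have := congrArg (fun i : Seq ν => i p) h'
    simpa using this)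
  y_comm := (isFamily D).y_comm
  y_e p i := (isFamily D).y_e p _
  tau_e p q h i := (isFamily D).tau_e p q h _
  tau_comm := (isFamily D).tau_comm
  tau_sq p q h i := by
    rw [(isFamily D).tau_sq, Seq.map_apply, Seq.map_apply, hQ]
  tau_y_left p q h i hi := (isFamily D).tau_y_left p q h _ (by simp [hi])
  tau_y_right p q h i hi := (isFamily D).tau_y_right p q h _ (by simp [hi])
  tau_y p q h l i hi := (isFamily D).tau_y p q h l _ (by simpa using hi)
  braid_eq p q r h h' i hi := by
    rw [(isFamily D).braid_eq p q r h h' _ (by simp [hi]), Seq.map_apply, Seq.map_apply, hQ]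
  braid_ne p q r h h' i hi := (isFamily D).braid_ne p q r h h' _ (by simpa using hi)

theorem sum_e_map (b : Equiv.Perm I) (hb : ν.mapDomain b = ν) :
    ∑ i : Seq ν, e D (i.map b hb) = 1 := by
  have hinj : Function.Injective (Seq.map (ν := ν) b hb) := fun i j h => Seq.ext fun p => by
    have := congrArg (fun i : Seq ν => i p) h
    simpa using this
  rw [← sum_e]
  exact (Equiv.ofBijective _ (Finite.injective_iff_bijective.1 hinj)).sum_comp (e D)

/-- The endomorphism of `R(ν)` given by a permutation of the colours. -/
def autHom (b : Equiv.Perm I) (hb : ν.mapDomain b = ν) (hQ : ∀ i j, D.Q (b i) (b j) = D.Q i j) :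
    KLR D ν →ₐ[k] KLR D ν :=
  lift D (aut_isFamily b hb hQ) (sum_e_map b hb)

theorem mapDomain_symm {b : Equiv.Perm I} (hb : ν.mapDomain b = ν) : ν.mapDomain b.symm = ν := by
  conv_lhs => rw [← hb]
  rw [← Finsupp.mapDomain_comp]
  simp

/-- The automorphism `a` of `R(ν)`: it sends `e i` to `e (a i)` and fixes the generators `y`
and `τ`. -/
def aut (hν : ν ∈ D.NJ) : KLR D ν ≃ₐ[k] KLR D ν :=
  AlgEquiv.ofAlgHom (autHom D.a (FoldingDatum.mapDomain_a hν) D.Q_a)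
    (autHom D.a.symm (mapDomain_symm (FoldingDatum.mapDomain_a hν)) fun i j => by simp [← D.Q_a (D.a.symm i)])
    (algHom_ext D (fun i => by
      simp only [autHom, AlgHom.comp_apply, lift_e, AlgHom.id_apply]
      exact congrArg _ (Seq.ext fun p => by simp)) (by simp [autHom]) (by simp [autHom]))
    (algHom_ext D (fun i => by
      simp only [autHom, AlgHom.comp_apply, lift_e, AlgHom.id_apply]
      exact congrArg _ (Seq.ext fun p => by simp)) (by simp [autHom]) (by simp [autHom]))

@[simp] theorem aut_e (hν : ν ∈ D.NJ) (i : Seq ν) : aut hν (e D i) = e D (i.map D.a (FoldingDatum.mapDomain_a hν)) :=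
  lift_e D _ _ i

@[simp] theorem aut_y (hν : ν ∈ D.NJ) (p : Fin ν.degree) : aut hν (y D p) = y D p :=
  lift_y D _ _ p

@[simp] theorem aut_tau (hν : ν ∈ D.NJ) (p q : Fin ν.degree) (h : (p : ℕ) + 1 = q) :
    aut hν (tau D p q h) = tau D p q h :=
  lift_tau D _ _ p q h

theorem aut_pow (hν : ν ∈ D.NJ) : aut hν ^ D.n = 1 := by
  have he : ∀ (t : ℕ) (i : Seq ν), ∃ j : Seq ν, (∀ p, j p = (D.a ^ t) (i p)) ∧
      (aut hν ^ t) (e D i) = e D j := by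
    intro t
    induction t with
    | zero => exact fun i => ⟨i, fun p => rfl, rfl⟩
    | succ t ih =>
      intro i
      obtain ⟨j, hj, hj'⟩ := ih i
      refine ⟨j.map D.a (FoldingDatum.mapDomain_a hν), fun p => ?_, ?_⟩
      · rw [Seq.map_apply, hj, pow_succ']; rfl
      · rw [pow_succ', AlgEquiv.mul_apply, hj', aut_e]
  have hy : ∀ (t : ℕ) (p : Fin ν.degree), (aut hν ^ t) (y D p) = y D p := by
    intro t p
    induction t with
    | zero => rfl
    | succ t ih => rw [pow_succ', AlgEquiv.mul_apply, ih, aut_y]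
  have htau : ∀ (t : ℕ) (p q : Fin ν.degree) (h : (p : ℕ) + 1 = q),
      (aut hν ^ t) (tau D p q h) = tau D p q h := by
    intro t p q h
    induction t with
    | zero => rfl
    | succ t ih => rw [pow_succ', AlgEquiv.mul_apply, ih, aut_tau]
  have key : (aut hν ^ D.n).toAlgHom = AlgHom.id k (KLR D ν) := by
    refine algHom_ext D (fun i => ?_) (hy _) (htau _)
    obtain ⟨j, hj, hj'⟩ := he D.n i
    refine hj'.trans (congrArg _ (Seq.ext fun p => ?_))
    rw [hj, FoldingDatum.n, pow_orderOf_eq_one]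
    rfl
  exact AlgEquiv.ext fun x => DFunLike.congr_fun key x

/-! #### The grading -/

variable (D)

/-- Products of the elements `e i`, `y_p e i` and `τ_p e i`, together with their degrees. -/
inductive IsWord : ℤ → KLR D ν → Prop
  | e (i : Seq ν) : IsWord 0 (e D i)
  | y (p : Fin ν.degree) (i : Seq ν) : IsWord (D.form (i p) (i p)) (y D p * e D i)
  | tau (p q : Fin ν.degree) (h : (p : ℕ) + 1 = q) (i : Seq ν) :
      IsWord (-D.form (i p) (i q)) (tau D p q h * e D i)
  | mul {c d : ℤ} {x y : KLR D ν} : IsWord c x → IsWord d y → IsWord (c + d) (x * y)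

/-- The part of degree `d` of `R(ν)`. -/
def gr (ν : I →₀ ℕ) (d : ℤ) : Submodule k (KLR D ν) := Submodule.span k {x | IsWord D d x}

variable {D}

theorem one_mem_gr : (1 : KLR D ν) ∈ gr D ν 0 := by
  rw [← sum_e]
  exact sum_mem fun i _ => Submodule.subset_span (IsWord.e i)

theorem mul_mem_gr {c d : ℤ} {x y : KLR D ν} (hx : x ∈ gr D ν c) (hy : y ∈ gr D ν d) :
    x * y ∈ gr D ν (c + d) := by
  induction hx using Submodule.span_induction with
  | mem x hx =>
    induction hy using Submodule.span_induction with
    | mem y hy => exact Submodule.subset_span (IsWord.mul hx hy)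
    | zero => rw [mul_zero]; exact zero_mem _
    | add x y _ _ hx hy => rw [mul_add]; exact add_mem hx hy
    | smul a x _ hx => rw [mul_smul_comm]; exact Submodule.smul_mem _ _ hx
  | zero => rw [zero_mul]; exact zero_mem _
  | add x y _ _ hx hy => rw [add_mul]; exact add_mem hx hy
  | smul a x _ hx => rw [smul_mul_assoc]; exact Submodule.smul_mem _ _ hx

theorem gr_iSup : ⨆ d, gr D ν d = ⊤ := by
  rw [eq_top_iff]
  rintro x -
  have hone : (1 : KLR D ν) ∈ ⨆ d, gr D ν d := Submodule.mem_iSup_of_mem 0 one_mem_gr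
  have hsum : ∀ z : KLR D ν, (∀ i, z * e D i ∈ ⨆ d, gr D ν d) → z ∈ ⨆ d, gr D ν d := by
    intro z hz
    rw [← mul_one z, ← sum_e, Finset.mul_sum]
    exact sum_mem fun i _ => hz i
  induction x using KLR.induction with
  | he i => exact Submodule.mem_iSup_of_mem _ (Submodule.subset_span (IsWord.e i))
  | hy p =>
    exact hsum _ fun i => Submodule.mem_iSup_of_mem _ (Submodule.subset_span (IsWord.y p i))
  | htau p q h =>
    exact hsum _ fun i => Submodule.mem_iSup_of_mem _ (Submodule.subset_span (IsWord.tau p q h i))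
  | hadd x y hx hy => exact add_mem hx hy
  | hmul x y hx hy =>
    refine Submodule.iSup_induction _ (motive := fun x => x * y ∈ ⨆ d, gr D ν d) hx ?_ ?_ ?_
    · intro c x hx
      refine Submodule.iSup_induction _ (motive := fun y => x * y ∈ ⨆ d, gr D ν d) hy ?_ ?_ ?_
      · exact fun d y hy => Submodule.mem_iSup_of_mem _ (mul_mem_gr hx hy)
      · rw [mul_zero]; exact zero_mem _
      · intro y z hy hz; rw [mul_add]; exact add_mem hy hz
    · rw [zero_mul]; exact zero_mem _
    · intro y z hy hz; rw [add_mul]; exact add_mem hy hz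
  | hk c => rw [Algebra.algebraMap_eq_smul_one]; exact Submodule.smul_mem _ _ hone

theorem aut_mem_gr (hν : ν ∈ D.NJ) {d : ℤ} {x : KLR D ν} (hx : x ∈ gr D ν d) :
    aut hν x ∈ gr D ν d := by
  induction hx using Submodule.span_induction with
  | mem x hx =>
    refine Submodule.subset_span ?_
    change IsWord D d (aut hν x)
    induction hx with
    | e i => rw [aut_e]; exact IsWord.e _
    | y p i =>
      rw [map_mul, aut_e, aut_y, ← D.form_a]
      exact IsWord.y p (i.map D.a (FoldingDatum.mapDomain_a hν))
    | tau p q h i =>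
      rw [map_mul, aut_e, aut_tau, ← D.form_a]
      exact IsWord.tau p q h (i.map D.a (FoldingDatum.mapDomain_a hν))
    | mul _ _ hx hy => rw [map_mul]; exact IsWord.mul hx hy
  | zero => rw [map_zero]; exact zero_mem _
  | add x y _ _ hx hy => rw [map_add]; exact add_mem hx hy
  | smul a x _ hx => rw [map_smul]; exact Submodule.smul_mem _ _ hx

/-- `X` maps the `i`-weight space to the `j`-weight space, where `X'` is `c • X`. -/
structure IsScaled (X X' : KLR D ν) (c : kˣ) (i j : Seq ν) : Prop where
  scale : X' * e D i = (c : k) • (X * e D i)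
  weight : X * e D i = e D j * X

theorem IsScaled.mul {X X' Z Z' : KLR D ν} {c c' : kˣ} {i j l : Seq ν}
    (hZ : IsScaled Z Z' c' j l) (hX : IsScaled X X' c i j) :
    IsScaled (Z * X) (Z' * X') (c' * c) i l where
  scale := by
    rw [mul_assoc, hX.scale, mul_smul_comm, hX.weight, ← mul_assoc, hZ.scale, smul_mul_assoc,
      smul_smul, Units.val_mul, mul_comm (c : k), mul_assoc, mul_assoc, hX.weight]
  weight := by rw [mul_assoc, hX.weight, ← mul_assoc, hZ.weight, mul_assoc]

theorem IsScaled.one (i : Seq ν) : IsScaled (1 : KLR D ν) 1 1 i i where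
  scale := by simp
  weight := by simp

theorem IsScaled.pow {X X' : KLR D ν} {c : kˣ} {i : Seq ν} (h : IsScaled X X' c i i) (t : ℕ) :
    IsScaled (X ^ t) (X' ^ t) (c ^ t) i i := by
  induction t with
  | zero => simpa using IsScaled.one i
  | succ t ih => rw [pow_succ, pow_succ, pow_succ]; exact ih.mul h

section Scaling

variable (D) (ν) (z : kˣ)

/-- `y_p`, rescaled by the degree. -/
def scaledY (p : Fin ν.degree) : KLR D ν :=
  ∑ i : Seq ν, ((z ^ D.form (i p) (i p) : kˣ) : k) • (y D p * e D i)

/-- `τ_p`, rescaled by the degree. -/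
def scaledTau (p q : Fin ν.degree) (h : (p : ℕ) + 1 = q) : KLR D ν :=
  ∑ i : Seq ν, ((z ^ (-D.form (i p) (i q)) : kˣ) : k) • (tau D p q h * e D i)

variable {D ν}

theorem sum_smul_mul_e (x : KLR D ν) (w : Seq ν → k) (i : Seq ν) :
    (∑ j, w j • (x * e D j)) * e D i = w i • (x * e D i) := by
  rw [Finset.sum_mul, Finset.sum_eq_single i]
  · rw [smul_mul_assoc, mul_assoc, (isFamily D).e_mul_self]
  · intro j _ hj
    rw [smul_mul_assoc, mul_assoc, (isFamily D).e_mul_ne _ _ hj, mul_zero, smul_zero]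
  · intro h; exact absurd (Finset.mem_univ _) h

theorem scaledY_isScaled (p : Fin ν.degree) (i : Seq ν) :
    IsScaled (y D p) (scaledY D ν z p) (z ^ D.form (i p) (i p)) i i :=
  ⟨sum_smul_mul_e _ _ _, (isFamily D).y_e p i⟩

theorem scaledTau_isScaled (p q : Fin ν.degree) (h : (p : ℕ) + 1 = q) (i : Seq ν) :
    IsScaled (tau D p q h) (scaledTau D ν z p q h) (z ^ (-D.form (i p) (i q))) i (i.swap p q) :=
  ⟨sum_smul_mul_e _ _ _, (isFamily D).tau_e p q h i⟩

theorem Q_degree {i j : I} {m : Fin 2 →₀ ℕ} (hm : m ∈ (D.Q i j).support) :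
    (m 0 : ℤ) * D.form i i + m 1 * D.form j j = -2 * D.form i j := by
  rw [MvPolynomial.mem_support_iff] at hm
  have hij : i ≠ j := by
    rintro rfl
    rw [D.Q_self] at hm
    simp at hm
  have h := D.Q_homogeneous i j hij hm
  rw [Finsupp.weight_apply, Finsupp.sum_fintype _ _ (by simp), Fin.sum_univ_two,
    D.d_mul_c hij] at h
  simp only [nsmul_eq_mul, Matrix.cons_val_zero, Matrix.cons_val_one] at h
  rw [← D.two_mul_d i, ← D.two_mul_d j]
  linarith

theorem scaled_evalQ (p q : Fin ν.degree) (i : Seq ν) :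
    evalQ (D.Q (i p) (i q)) (scaledY D ν z p) (scaledY D ν z q) * e D i =
      ((z ^ (-2 * D.form (i p) (i q)) : kˣ) : k) •
        (evalQ (D.Q (i p) (i q)) (y D p) (y D q) * e D i) := by
  rw [evalQ, evalQ, Finset.sum_mul, Finset.sum_mul, Finset.smul_sum]
  refine Finset.sum_congr rfl fun m hm => ?_
  have h := ((scaledY_isScaled (D := D) z p i).pow (m 0)).mul ((scaledY_isScaled z q i).pow (m 1))
  rw [smul_mul_assoc, h.scale, smul_mul_assoc, smul_comm, ← Q_degree hm, zpow_add, mul_comm (m 0 : ℤ),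
    mul_comm (m 1 : ℤ), zpow_mul, zpow_mul, zpow_natCast, zpow_natCast]

theorem scaled_evalDQ (p q r : Fin ν.degree) (i : Seq ν) (hi : i p = i r) :
    evalDQ (D.Q (i p) (i q)) (scaledY D ν z p) (scaledY D ν z q) (scaledY D ν z r) * e D i =
      ((z ^ (-2 * D.form (i p) (i q) - D.form (i p) (i p)) : kˣ) : k) •
        (evalDQ (D.Q (i p) (i q)) (y D p) (y D q) (y D r) * e D i) := by
  rw [evalDQ, evalDQ, Finset.sum_mul, Finset.sum_mul, Finset.smul_sum]
  refine Finset.sum_congr rfl fun m hm => ?_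
  simp only [Finset.sum_mul, Finset.smul_sum]
  refine Finset.sum_congr rfl fun s hs => ?_
  have h := (((scaledY_isScaled (D := D) z p i).pow s).mul
    ((scaledY_isScaled z r i).pow (m 0 - 1 - s))).mul ((scaledY_isScaled z q i).pow (m 1))
  have hs' : s + (m 0 - 1 - s) + 1 = m 0 := by
    have := Finset.mem_range.1 hs
    omega
  have hd : ((m 0 - 1 - s : ℕ) : ℤ) = m 0 - 1 - s := by omega
  have hexp : (-2 * D.form (i p) (i q) - D.form (i p) (i p) : ℤ) =
      D.form (i p) (i p) * s + D.form (i r) (i r) * (m 0 - 1 - s : ℕ) +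
        D.form (i q) (i q) * m 1 := by
    rw [← Q_degree hm, hd, ← hi]; ring
  rw [smul_mul_assoc, h.scale, smul_mul_assoc, smul_comm, hexp, zpow_add, zpow_add, zpow_mul,
    zpow_mul, zpow_mul, zpow_natCast, zpow_natCast, zpow_natCast]

theorem IsScaled.sub {X X' Z Z' : KLR D ν} {c c' : kˣ} {i j j' : Seq ν}
    (hZ : IsScaled Z Z' c i j) (hX : IsScaled X X' c' i j') (h : c = c') :
    (Z' - X') * e D i = (c : k) • ((Z - X) * e D i) := by
  rw [sub_mul, sub_mul, hZ.scale, hX.scale, h, smul_sub]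

theorem scaled_isFamily : IsFamily D ν (e D) (scaledY D ν z) (scaledTau D ν z) where
  e_mul_self := (isFamily D).e_mul_self
  e_mul_ne := (isFamily D).e_mul_ne
  y_comm p q := eq_of_mul_e D fun i => by
    rw [((scaledY_isScaled z p i).mul (scaledY_isScaled z q i)).scale,
      ((scaledY_isScaled z q i).mul (scaledY_isScaled z p i)).scale, mul_comm,
      (isFamily D).y_comm p q]
  y_e p i := by
    simp only [scaledY, Finset.sum_mul, Finset.mul_sum]
    refine Finset.sum_congr rfl fun j _ => ?_
    by_cases hj : i = j
    · subst hj
      rw [smul_mul_assoc, mul_smul_comm, ← mul_assoc, ← (isFamily D).y_e]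
    · rw [smul_mul_assoc, mul_smul_comm, mul_assoc, (isFamily D).e_mul_ne _ _ (Ne.symm hj),
        ← mul_assoc, ← (isFamily D).y_e, mul_assoc, (isFamily D).e_mul_ne _ _ hj]
  tau_e p q h i := by
    rw [(scaledTau_isScaled z p q h i).scale, (isFamily D).tau_e, scaledTau, Finset.mul_sum,
      Finset.sum_eq_single i]
    · rw [(isFamily D).tau_e, mul_smul_comm, ← mul_assoc, (isFamily D).e_mul_self]
    · intro j _ hj
      rw [(isFamily D).tau_e, mul_smul_comm, ← mul_assoc, (isFamily D).e_mul_ne, zero_mul, smul_zero]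
      intro h'
      apply hj
      rw [← Seq.swap_swap p q j, ← h', Seq.swap_swap]
    · intro h; exact absurd (Finset.mem_univ _) h
  tau_comm p q h p' q' h' hq := eq_of_mul_e D fun i => by
    have hp1 : p' ≠ p := fun hh => by omega
    have hp2 : p' ≠ q := fun hh => by omega
    have hq1 : q' ≠ p := fun hh => by omega
    have hq2 : q' ≠ q := fun hh => by omega
    rw [((scaledTau_isScaled z p q h _).mul (scaledTau_isScaled z p' q' h' i)).scale,
      ((scaledTau_isScaled z p' q' h' _).mul (scaledTau_isScaled z p q h i)).scale,
      (isFamily D).tau_comm p q h p' q' h' hq]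
    simp only [Seq.swap_apply, Equiv.swap_apply_of_ne_of_ne hp1 hp2,
      Equiv.swap_apply_of_ne_of_ne hq1 hq2, Equiv.swap_apply_of_ne_of_ne hp1.symm hq1.symm,
      Equiv.swap_apply_of_ne_of_ne hp2.symm hq2.symm]
    rw [mul_comm]
  tau_sq p q h i := by
    rw [((scaledTau_isScaled z p q h _).mul (scaledTau_isScaled z p q h i)).scale,
      (isFamily D).tau_sq, scaled_evalQ, ← zpow_add]
    simp only [Seq.swap_apply, Equiv.swap_apply_left, Equiv.swap_apply_right]
    rw [D.symm (i q) (i p)]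
    congr 3
    ring
  tau_y_left p q h i hi := by
    rw [((scaledTau_isScaled z p q h i).mul (scaledY_isScaled z p i)).sub
      ((scaledY_isScaled z q (i.swap p q)).mul (scaledTau_isScaled z p q h i)),
      (isFamily D).tau_y_left p q h i hi]
    · simp [hi]
    · simp [hi, mul_comm]
  tau_y_right p q h i hi := by
    rw [((scaledTau_isScaled z p q h i).mul (scaledY_isScaled z q i)).sub
      ((scaledY_isScaled z p (i.swap p q)).mul (scaledTau_isScaled z p q h i)),
      (isFamily D).tau_y_right p q h i hi]
    · simp [hi]
    · simp [hi, mul_comm]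
  tau_y p q h l i hi := by
    rw [((scaledTau_isScaled z p q h i).mul (scaledY_isScaled z l i)).sub
      ((scaledY_isScaled z _ (i.swap p q)).mul (scaledTau_isScaled z p q h i)),
      (isFamily D).tau_y p q h l i hi, smul_zero]
    simp [mul_comm]
  braid_eq p q r h h' i hi := by
    have h1 : p ≠ q := fun hh => by omega
    have h2 : p ≠ r := fun hh => by omega
    have h3 : q ≠ r := fun hh => by omega
    rw [(((scaledTau_isScaled z q r h' _).mul (scaledTau_isScaled z p q h _)).mul
        (scaledTau_isScaled z q r h' i)).sub
      (((scaledTau_isScaled z p q h _).mul (scaledTau_isScaled z q r h' _)).mul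
        (scaledTau_isScaled z p q h i)), (isFamily D).braid_eq p q r h h' i hi,
      scaled_evalDQ z p q r i hi, ← zpow_add, ← zpow_add]
    · simp only [Seq.swap_apply, Equiv.swap_apply_left, Equiv.swap_apply_right,
        Equiv.swap_apply_of_ne_of_ne h1 h2, Equiv.swap_apply_of_ne_of_ne h2.symm h3.symm]
      rw [← hi, D.symm (i q) (i p)]
      congr 3
      ring
    · simp only [Seq.swap_apply, Equiv.swap_apply_left, Equiv.swap_apply_right,
        Equiv.swap_apply_of_ne_of_ne h1 h2, Equiv.swap_apply_of_ne_of_ne h2.symm h3.symm]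
      rw [mul_comm, ← mul_assoc, mul_right_comm]
  braid_ne p q r h h' i hi := by
    have h1 : p ≠ q := fun hh => by omega
    have h2 : p ≠ r := fun hh => by omega
    have h3 : q ≠ r := fun hh => by omega
    rw [(((scaledTau_isScaled z q r h' _).mul (scaledTau_isScaled z p q h _)).mul
        (scaledTau_isScaled z q r h' i)).sub
      (((scaledTau_isScaled z p q h _).mul (scaledTau_isScaled z q r h' _)).mul
        (scaledTau_isScaled z p q h i)), (isFamily D).braid_ne p q r h h' i hi, smul_zero]
    simp only [Seq.swap_apply, Equiv.swap_apply_left, Equiv.swap_apply_right,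
        Equiv.swap_apply_of_ne_of_ne h1 h2, Equiv.swap_apply_of_ne_of_ne h2.symm h3.symm]
    rw [mul_comm, ← mul_assoc, mul_right_comm]

/-- The endomorphism that multiplies the part of degree `d` by `z ^ d`. -/
def scale : KLR D ν →ₐ[k] KLR D ν := lift D (scaled_isFamily z) (sum_e D)

theorem scale_apply {d : ℤ} {x : KLR D ν} (hx : x ∈ gr D ν d) :
    scale z x = ((z ^ d : kˣ) : k) • x := by
  induction hx using Submodule.span_induction with
  | mem x hx =>
    change IsWord D d x at hx
    induction hx with
    | e i => simp [scale]
    | y p i =>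
      rw [map_mul, scale, lift_e, lift_y, (scaledY_isScaled z p i).scale]
    | tau p q h i =>
      rw [map_mul, scale, lift_e, lift_tau, (scaledTau_isScaled z p q h i).scale]
    | mul _ _ hx hy =>
      rw [map_mul, hx, hy, smul_mul_smul_comm, zpow_add, Units.val_mul]
  | zero => rw [map_zero, smul_zero]
  | add x y _ _ hx hy => rw [map_add, hx, hy, smul_add]
  | smul a x _ hx => rw [map_smul, hx, smul_comm]

end Scaling

variable (D ν) in
theorem gr_internal [Infinite k] : DirectSum.IsInternal (gr D ν) :=
  isInternal_of_scaling _ gr_iSup (fun z => (scale z).toLinearMap) fun z _ _ hx => scale_apply z hx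

/-! #### Homomorphisms from `R(ν)` that need not preserve the unit -/

end KLR

section Family

variable {D ν}

variable {B B' : Type u} [Ring B] [Algebra k B] [Ring B'] [Algebra k B'] {E : Seq ν → B}
  {Y : Fin ν.degree → B} {T : ∀ p q : Fin ν.degree, (p : ℕ) + 1 = q → B}

theorem IsFamily.map (hf : IsFamily D ν E Y T) (g : B →ₐ[k] B') :
    IsFamily D ν (fun i => g (E i)) (fun p => g (Y p)) fun p q h => g (T p q h) where
  e_mul_self i := by simpa using congrArg g (hf.e_mul_self i)
  e_mul_ne i j h := by simpa using congrArg g (hf.e_mul_ne i j h)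
  y_comm p q := by simpa using congrArg g (hf.y_comm p q)
  y_e p i := by simpa using congrArg g (hf.y_e p i)
  tau_e p q h i := by simpa using congrArg g (hf.tau_e p q h i)
  tau_comm p q h p' q' h' hq := by simpa using congrArg g (hf.tau_comm p q h p' q' h' hq)
  tau_sq p q h i := by simpa [map_evalQ] using congrArg g (hf.tau_sq p q h i)
  tau_y_left p q h i hi := by simpa using congrArg g (hf.tau_y_left p q h i hi)
  tau_y_right p q h i hi := by simpa using congrArg g (hf.tau_y_right p q h i hi)
  tau_y p q h l i hi := by simpa using congrArg g (hf.tau_y p q h l i hi)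
  braid_eq p q r h h' i hi := by
    simpa [map_evalDQ] using congrArg g (hf.braid_eq p q r h h' i hi)
  braid_ne p q r h h' i hi := by simpa using congrArg g (hf.braid_ne p q r h h' i hi)

theorem IsFamily.of_injective (g : B →ₐ[k] B') (hg : Function.Injective g)
    (hf : IsFamily D ν (fun i => g (E i)) (fun p => g (Y p)) fun p q h => g (T p q h)) :
    IsFamily D ν E Y T where
  e_mul_self i := hg (by simpa using hf.e_mul_self i)
  e_mul_ne i j h := hg (by simpa using hf.e_mul_ne i j h)
  y_comm p q := hg (by simpa using hf.y_comm p q)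
  y_e p i := hg (by simpa using hf.y_e p i)
  tau_e p q h i := hg (by simpa using hf.tau_e p q h i)
  tau_comm p q h p' q' h' hq := hg (by simpa using hf.tau_comm p q h p' q' h' hq)
  tau_sq p q h i := hg (by simpa [map_evalQ] using hf.tau_sq p q h i)
  tau_y_left p q h i hi := hg (by simpa using hf.tau_y_left p q h i hi)
  tau_y_right p q h i hi := hg (by simpa using hf.tau_y_right p q h i hi)
  tau_y p q h l i hi := hg (by simpa using hf.tau_y p q h l i hi)
  braid_eq p q r h h' i hi := hg (by simpa [map_evalDQ] using hf.braid_eq p q r h h' i hi)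
  braid_ne p q r h h' i hi := hg (by simpa using hf.braid_ne p q r h h' i hi)

section Corner

variable {u : B} (hu : IsIdempotentElem u)

theorem coe_corner_mul (x y : hu.Corner) : (x * y).1 = x.1 * y.1 := rfl

instance cornerAlgebra : Algebra k hu.Corner :=
  RingHom.toAlgebra'
    { toFun := fun c => ⟨c • u, c • 1, by simp [hu.eq]⟩
      map_one' := Subtype.ext (one_smul k u)
      map_mul' := fun c d => Subtype.ext (by
        change (c * d) • u = (c • u) * (d • u)
        rw [smul_mul_smul_comm, hu.eq])
      map_zero' := Subtype.ext (zero_smul k u)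
      map_add' := fun c d => Subtype.ext (add_smul c d u) }
    fun c x => Subtype.ext (by
      have hx := (Subsemigroup.mem_corner_iff hu).1 x.2
      change (c • u) * x.1 = x.1 * (c • u)
      rw [smul_mul_assoc, mul_smul_comm, hx.1, hx.2])

/-- The inclusion of `u B u` in `B`. -/
def cornerVal : hu.Corner →ₗ[k] B where
  toFun := Subtype.val
  map_add' _ _ := rfl
  map_smul' c x := by
    rw [Algebra.smul_def]
    change (c • u) * x.1 = c • x.1
    rw [smul_mul_assoc, ((Subsemigroup.mem_corner_iff hu).1 x.2).1]

/-- Multiplication by `u`, on the centralizer of `u`. -/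
def toCorner : Subalgebra.centralizer k {u} →ₐ[k] hu.Corner where
  toFun x := ⟨u * x.1, x.1, by
    change u * x.1 * u = u * x.1
    rw [mul_assoc, ← (Subalgebra.mem_centralizer_iff k).1 x.2 u rfl, ← mul_assoc, hu.eq]⟩
  map_one' := Subtype.ext (mul_one u)
  map_mul' x y := Subtype.ext (by
    change u * (x.1 * y.1) = (u * x.1) * (u * y.1)
    rw [mul_assoc u x.1, ← mul_assoc x.1, ← (Subalgebra.mem_centralizer_iff k).1 x.2 u rfl,
      mul_assoc, ← mul_assoc u u, hu.eq])
  map_zero' := Subtype.ext (mul_zero u)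
  map_add' x y := Subtype.ext (mul_add u _ _)
  commutes' c := Subtype.ext (by
    change u * algebraMap k B c = c • u
    rw [← Algebra.commutes, ← Algebra.smul_def])

end Corner

variable {u : B}

theorem IsFamily.mul_e (hf : IsFamily D ν E Y T) (hE : ∑ i, E i = u) (i : Seq ν) : u * E i = E i := by
  rw [← hE, Finset.sum_mul, Finset.sum_eq_single i]
  · exact hf.e_mul_self i
  · exact fun j _ hj => hf.e_mul_ne j i hj
  · intro h; exact absurd (Finset.mem_univ _) h

theorem IsFamily.e_mul (hf : IsFamily D ν E Y T) (hE : ∑ i, E i = u) (i : Seq ν) : E i * u = E i := by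
  rw [← hE, Finset.mul_sum, Finset.sum_eq_single i]
  · exact hf.e_mul_self i
  · exact fun j _ hj => hf.e_mul_ne i j hj.symm
  · intro h; exact absurd (Finset.mem_univ _) h

theorem IsFamily.idem (hf : IsFamily D ν E Y T) (hE : ∑ i, E i = u) : IsIdempotentElem u := by
  change u * u = u
  conv_lhs => rw [← hE]
  conv_rhs => rw [← hE]
  rw [Finset.sum_mul]
  refine Finset.sum_congr rfl fun i _ => ?_
  exact (congrArg _ hE).trans (hf.e_mul hE i)

theorem mem_centralizer {x : B} (h : Commute u x) : x ∈ Subalgebra.centralizer k {u} := by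
  rw [Subalgebra.mem_centralizer_iff]
  rintro _ rfl
  exact h

theorem IsFamily.centralizer (hf : IsFamily D ν E Y T) (hE : ∑ i, E i = u)
    (hY : ∀ p, Commute u (Y p)) (hT : ∀ p q h, Commute u (T p q h)) :
    IsFamily D ν (B := Subalgebra.centralizer k {u})
      (fun i => ⟨E i, mem_centralizer ((hf.mul_e hE i).trans (hf.e_mul hE i).symm)⟩)
      (fun p => ⟨Y p, mem_centralizer (hY p)⟩)
      (fun p q h => ⟨T p q h, mem_centralizer (hT p q h)⟩) :=
  IsFamily.of_injective (Subalgebra.val _) Subtype.val_injective hf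

namespace KLR

variable (hf : IsFamily D ν E Y T) (hE : ∑ i, E i = u)
  (hY : ∀ p, Commute u (Y p)) (hT : ∀ p q h, Commute u (T p q h))

/-- A family that satisfies all the relations, except that its idempotents add up to an element
`u` instead of `1`, and that commutes with `u`, defines a homomorphism that takes the unit
to `u`. -/
def liftCorner : KLR D ν →ₗ[k] B :=
  cornerVal (hf.idem hE) ∘ₗ (lift D ((hf.centralizer hE hY hT).map (toCorner (hf.idem hE)))
    (Subtype.ext (by
      rw [← map_sum]
      change u * (∑ i, _ : Subalgebra.centralizer k {u}).1 = u
      rw [AddSubmonoidClass.coe_finsetSum, hE]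
      exact hf.idem hE))).toLinearMap

theorem liftCorner_mul (x y : KLR D ν) :
    liftCorner hf hE hY hT (x * y) = liftCorner hf hE hY hT x * liftCorner hf hE hY hT y := by
  simp only [liftCorner, LinearMap.comp_apply, AlgHom.toLinearMap_apply, map_mul]
  rfl

theorem liftCorner_one : liftCorner hf hE hY hT 1 = u := by
  simp only [liftCorner, LinearMap.comp_apply, AlgHom.toLinearMap_apply, map_one]
  rfl

theorem liftCorner_e (i : Seq ν) : liftCorner hf hE hY hT (e D i) = E i :=
  (congrArg (cornerVal (k := k) _) (lift_e D _ _ i)).trans (hf.mul_e hE i)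

theorem liftCorner_y (p : Fin ν.degree) : liftCorner hf hE hY hT (y D p) = u * Y p :=
  (congrArg (cornerVal (k := k) _) (lift_y D _ _ p)).trans rfl

theorem liftCorner_tau (p q : Fin ν.degree) (h : (p : ℕ) + 1 = q) :
    liftCorner hf hE hY hT (tau D p q h) = u * T p q h :=
  (congrArg (cornerVal (k := k) _) (lift_tau D _ _ p q h)).trans rfl

end KLR

end Family

namespace KLR

variable {D ν}

/-! #### Concatenation of sequences -/

section Blocks

variable {κ : I →₀ ℕ} {l : ℕ} {ν : Fin l → I →₀ ℕ} (h : ∑ j, ν j = κ)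

theorem sum_degree_lt (j : Fin l) (p : Fin (ν j).degree) :
    ∑ j' ∈ Finset.Iio j, (ν j').degree + (p : ℕ) < ∑ j' ∈ Finset.Iic j, (ν j').degree := by
  have h1 : Finset.Iic j = insert j (Finset.Iio j) := by
    ext x
    simp [le_iff_eq_or_lt]
  rw [h1, Finset.sum_insert (by simp)]
  omega

/-- The position, in a concatenation of sequences of weights `ν 0, ν 1, …`, of the `p`-th entry of
the `j`-th sequence. -/
def pos (j : Fin l) (p : Fin (ν j).degree) : Fin κ.degree :=
  ⟨∑ j' ∈ Finset.Iio j, (ν j').degree + p, (sum_degree_lt j p).trans_le (by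
    rw [← h, map_sum]
    exact Finset.sum_le_sum_of_subset (Finset.subset_univ _))⟩

theorem pos_succ {j : Fin l} {p q : Fin (ν j).degree} (hpq : (p : ℕ) + 1 = q) :
    (pos h j p : ℕ) + 1 = pos h j q := by
  simp only [pos, ← hpq, add_assoc]

theorem pos_lt {j j' : Fin l} (hj : j < j') (p : Fin (ν j).degree) (p' : Fin (ν j').degree) :
    pos h j p < pos h j' p' := by
  refine Fin.mk_lt_mk.2 ((sum_degree_lt j p).trans_le (le_trans ?_ (Nat.le_add_right _ _)))
  refine Finset.sum_le_sum_of_subset fun x hx => ?_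
  simp only [Finset.mem_Iic, Finset.mem_Iio] at *
  exact hx.trans_lt hj

theorem pos_ne {j j' : Fin l} (hj : j ≠ j') (p : Fin (ν j).degree) (p' : Fin (ν j').degree) :
    pos h j p ≠ pos h j' p' := by
  rcases lt_or_gt_of_ne hj with hj | hj
  · exact (pos_lt h hj p p').ne
  · exact (pos_lt h hj p' p).ne'

theorem pos_injective (j : Fin l) : Function.Injective (pos h j) := fun p q hpq => by
  have := congrArg Fin.val hpq
  simp only [pos] at this
  omega

/-- The sequence `i` is the concatenation of sequences of weights `ν 0, ν 1, …`. -/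
def IsConcat (i : Seq κ) : Prop := ∀ j, ∑ p, Finsupp.single (i (pos h j p)) 1 = ν j

/-- The sequence `i` is a concatenation, and its `j`-th part is `f`. -/
def HasBlock (j : Fin l) (f : Seq (ν j)) (i : Seq κ) : Prop :=
  IsConcat h i ∧ ∀ p, i (pos h j p) = f p

theorem IsConcat.swap {i : Seq κ} (hi : IsConcat h i) (j : Fin l) (p q : Fin (ν j).degree) :
    IsConcat h (i.swap (pos h j p) (pos h j q)) := by
  intro j'
  by_cases hj : j = j'
  · subst hj
    simp only [Seq.swap_apply, (pos_injective h j).swap_apply]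
    exact (Equiv.sum_comp (Equiv.swap p q) fun l => Finsupp.single (i (pos h j l)) 1).trans (hi j)
  · simp only [Seq.swap_apply, Equiv.swap_apply_of_ne_of_ne (pos_ne h (Ne.symm hj) _ _)
      (pos_ne h (Ne.symm hj) _ _)]
    exact hi j'

theorem isConcat_swap {i : Seq κ} (j : Fin l) (p q : Fin (ν j).degree) :
    IsConcat h i ↔ IsConcat h (i.swap (pos h j p) (pos h j q)) :=
  ⟨fun hi => hi.swap h j p q, fun hi => by simpa using hi.swap h j p q⟩

theorem hasBlock_swap {i : Seq κ} (j : Fin l) (p q : Fin (ν j).degree) (f : Seq (ν j)) :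
    HasBlock h j f i ↔ HasBlock h j (f.swap p q) (i.swap (pos h j p) (pos h j q)) := by
  refine and_congr (isConcat_swap h j p q) ?_
  simp only [Seq.swap_apply, (pos_injective h j).swap_apply]
  exact (Equiv.forall_congr_right (q := fun l => i (pos h j l) = f l) (Equiv.swap p q)).symm

theorem hasBlock_swap_ne {i : Seq κ} {j j' : Fin l} (hj : j ≠ j') (p q : Fin (ν j).degree)
    (f : Seq (ν j')) :
    HasBlock h j' f i ↔ HasBlock h j' f (i.swap (pos h j p) (pos h j q)) := by
  refine and_congr (isConcat_swap h j p q) ?_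
  simp only [Seq.swap_apply, Equiv.swap_apply_of_ne_of_ne (pos_ne h (Ne.symm hj) _ _)
      (pos_ne h (Ne.symm hj) _ _)]

theorem isConcat_map (b : Equiv.Perm I) (hκ : κ.mapDomain b = κ)
    (hν : ∀ j, (ν j).mapDomain b = ν j) {i : Seq κ} :
    IsConcat h i ↔ IsConcat h (i.map b hκ) := by
  refine forall_congr' fun j => ?_
  have h1 : ∑ p, Finsupp.single (b (i (pos h j p))) 1 =
      (∑ p, Finsupp.single (i (pos h j p)) 1).mapDomain b := by
    rw [Finsupp.mapDomain_finsetSum]; simp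
  simp only [Seq.map_apply]
  rw [h1]
  refine ⟨fun h2 => by rw [h2, hν], fun h2 => ?_⟩
  exact Finsupp.mapDomain_injective b.injective (h2.trans (hν j).symm)

theorem hasBlock_map (b : Equiv.Perm I) (hκ : κ.mapDomain b = κ)
    (hν : ∀ j, (ν j).mapDomain b = ν j) {i : Seq κ} (j : Fin l) (f : Seq (ν j)) :
    HasBlock h j f i ↔ HasBlock h j (f.map b (hν j)) (i.map b hκ) :=
  and_congr (isConcat_map h b hκ hν) (forall_congr' fun p => by simp)

variable (D) in
open Classical in
/-- The sum of the idempotents of the sequences with a given property. -/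
def eSum (P : Seq κ → Prop) : KLR D κ := ∑ i with P i, e D i

theorem mul_eSum {P : Seq κ → Prop} {x x' : KLR D κ} (hx : ∀ i, P i → x * e D i = x' * e D i) :
    x * eSum D P = x' * eSum D P := by
  classical
  rw [eSum, Finset.mul_sum, Finset.mul_sum]
  exact Finset.sum_congr rfl fun i hi => hx i (Finset.mem_filter.1 hi).2

theorem e_mul_eSum (P : Seq κ → Prop) (i : Seq κ) [Decidable (P i)] :
    e D i * eSum D P = if P i then e D i else 0 := by
  classical
  rw [eSum, Finset.mul_sum]
  by_cases hP : P i
  · rw [if_pos hP, Finset.sum_eq_single i, (isFamily D).e_mul_self]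
    · exact fun j _ hj => (isFamily D).e_mul_ne _ _ hj.symm
    · exact fun hi => absurd (Finset.mem_filter.2 ⟨Finset.mem_univ _, hP⟩) hi
  · rw [if_neg hP]
    refine Finset.sum_eq_zero fun j hj => (isFamily D).e_mul_ne _ _ ?_
    rintro rfl
    exact hP (Finset.mem_filter.1 hj).2

theorem eSum_mul_e (P : Seq κ → Prop) (i : Seq κ) [Decidable (P i)] :
    eSum D P * e D i = if P i then e D i else 0 := by
  classical
  rw [eSum, Finset.sum_mul]
  by_cases hP : P i
  · rw [if_pos hP, Finset.sum_eq_single i, (isFamily D).e_mul_self]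
    · exact fun j _ hj => (isFamily D).e_mul_ne _ _ hj
    · exact fun hi => absurd (Finset.mem_filter.2 ⟨Finset.mem_univ _, hP⟩) hi
  · rw [if_neg hP]
    refine Finset.sum_eq_zero fun j hj => (isFamily D).e_mul_ne _ _ ?_
    rintro rfl
    exact hP (Finset.mem_filter.1 hj).2

theorem eSum_mul_self (P : Seq κ → Prop) : eSum D P * eSum D P = eSum D P := by
  classical
  conv_rhs => rw [← one_mul (eSum D P)]
  exact mul_eSum fun i hi => by rw [eSum_mul_e, if_pos hi, one_mul]

theorem eSum_mul_eq_zero {P P' : Seq κ → Prop} (hP : ∀ i, P i → ¬ P' i) :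
    eSum D P' * eSum D P = 0 := by
  classical
  rw [← zero_mul (eSum D P)]
  exact mul_eSum fun i hi => by rw [eSum_mul_e, if_neg (hP i hi), zero_mul]

theorem eSum_commute (P P' : Seq κ → Prop) : Commute (eSum D P) (eSum D P') := by
  classical
  refine eq_of_mul_e D fun i => ?_
  rw [mul_assoc, mul_assoc, eSum_mul_e, eSum_mul_e]
  split_ifs <;> simp [eSum_mul_e, *]

theorem y_commute_eSum (p : Fin κ.degree) (P : Seq κ → Prop) : Commute (y D p) (eSum D P) :=
  Commute.sum_right _ _ _ fun i _ => (isFamily D).y_e p i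

theorem tau_mul_eSum (p q : Fin κ.degree) (hpq : (p : ℕ) + 1 = q) {P P' : Seq κ → Prop}
    (hP : ∀ i, P i ↔ P' (i.swap p q)) : tau D p q hpq * eSum D P = eSum D P' * tau D p q hpq := by
  classical
  refine eq_of_mul_e D fun i => ?_
  rw [mul_assoc, mul_assoc, eSum_mul_e, (isFamily D).tau_e, ← mul_assoc, eSum_mul_e]
  simp only [hP i]
  split_ifs
  · rw [(isFamily D).tau_e]
  · simp

theorem eSum_mem_gr (P : Seq κ → Prop) : eSum D P ∈ gr D κ 0 :=
  sum_mem fun i _ => Submodule.subset_span (IsWord.e i)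

theorem aut_eSum (hκ : κ ∈ D.NJ) {P P' : Seq κ → Prop}
    (hP : ∀ i, P i ↔ P' (i.map D.a (FoldingDatum.mapDomain_a hκ))) :
    aut hκ (eSum D P) = eSum D P' := by
  have hinj : Function.Injective (Seq.map (ν := κ) D.a (FoldingDatum.mapDomain_a hκ)) :=
    fun i j h => Seq.ext fun p => by
      have := congrArg (fun i : Seq κ => i p) h
      simpa using this
  rw [eSum, eSum, map_sum]
  refine Finset.sum_equiv (Equiv.ofBijective _ (Finite.injective_iff_bijective.1 hinj)) ?_ ?_
  · intro i
    simp [hP i]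
  · intro i _
    rw [aut_e]
    rfl

theorem block_isFamily (j : Fin l) :
    IsFamily D (ν j) (fun f => eSum D (HasBlock h j f)) (fun p => y D (pos h j p))
      (fun p q hpq => tau D (pos h j p) (pos h j q) (pos_succ h hpq)) where
  e_mul_self f := eSum_mul_self _
  e_mul_ne f f' hf := eSum_mul_eq_zero fun i hi hi' =>
    hf (Seq.ext fun p => (hi'.2 p).symm.trans (hi.2 p))
  y_comm p q := (isFamily D).y_comm _ _
  y_e p f := y_commute_eSum _ _
  tau_e p q hpq f := tau_mul_eSum _ _ _ fun i => hasBlock_swap h j p q f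
  tau_comm p q hpq p' q' hpq' hq := (isFamily D).tau_comm _ _ _ _ _ _ (by
    have := Fin.lt_def.1 hq
    refine Fin.lt_def.2 ?_
    simp only [pos]
    omega)
  tau_sq p q hpq f := mul_eSum fun i hi => by
    rw [(isFamily D).tau_sq, hi.2, hi.2]
  tau_y_left p q hpq f hf := by
    rw [← neg_one_mul]
    exact mul_eSum fun i hi => by
      rw [(isFamily D).tau_y_left _ _ _ _ (by rw [hi.2, hi.2, hf]), neg_one_mul]
  tau_y_right p q hpq f hf := by
    conv_rhs => rw [← one_mul (eSum D _)]
    exact mul_eSum fun i hi => by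
      rw [(isFamily D).tau_y_right _ _ _ _ (by rw [hi.2, hi.2, hf]), one_mul]
  tau_y p q hpq l f hf := by
    rw [← zero_mul (eSum D _), ← (pos_injective h j).swap_apply]
    exact mul_eSum fun i hi => by
      rw [(isFamily D).tau_y _ _ _ _ _ (by
        rwa [hi.2, hi.2, (pos_injective h j).eq_iff, (pos_injective h j).eq_iff]), zero_mul]
  braid_eq p q r hpq hqr f hf := mul_eSum fun i hi => by
    rw [(isFamily D).braid_eq _ _ _ _ _ _ (by rw [hi.2, hi.2, hf]), hi.2, hi.2]
  braid_ne p q r hpq hqr f hf := by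
    rw [← zero_mul (eSum D _)]
    exact mul_eSum fun i hi => by
      rw [(isFamily D).braid_ne _ _ _ _ _ _ (by rwa [hi.2, hi.2]), zero_mul]

variable (D) in
theorem sum_eSum_hasBlock (j : Fin l) : ∑ f, eSum D (HasBlock h j f) = eSum D (IsConcat h) := by
  classical
  simp only [eSum, Finset.sum_filter]
  rw [Finset.sum_comm]
  refine Finset.sum_congr rfl fun i _ => ?_
  by_cases hi : IsConcat h i
  · obtain ⟨f, hf⟩ : ∃ f : Seq (ν j), ∀ p, f p = i (pos h j p) :=
      ⟨⟨fun p => i (pos h j p), hi j⟩, fun _ => rfl⟩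
    rw [if_pos hi, Finset.sum_eq_single f, if_pos]
    · exact ⟨hi, fun p => (hf p).symm⟩
    · intro f' _ hf'
      rw [if_neg]
      exact fun hi' => hf' (Seq.ext fun p => (hi'.2 p).symm.trans (hf p).symm)
    · intro h'; exact absurd (Finset.mem_univ _) h'
  · rw [if_neg hi]
    exact Finset.sum_eq_zero fun f _ => if_neg fun hf => hi hf.1

variable (D) in
/-- The map `R(ν_j) → R(κ)`, for `κ = ν_0 + ν_1 + ⋯`, that places the generators in the `j`-th block
of positions. -/
def block (j : Fin l) : KLR D (ν j) →ₗ[k] KLR D κ :=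
  liftCorner (block_isFamily h j) (sum_eSum_hasBlock D h j)
    (fun p => (y_commute_eSum _ _).symm)
    (fun p q _ => (tau_mul_eSum _ _ _ fun i => isConcat_swap h j p q).symm)

theorem block_mul (j : Fin l) (x x' : KLR D (ν j)) :
    block D h j (x * x') = block D h j x * block D h j x' :=
  liftCorner_mul _ _ _ _ _ _

theorem block_one (j : Fin l) : block D h j 1 = eSum D (IsConcat h) :=
  liftCorner_one _ _ _ _

theorem block_e (j : Fin l) (f : Seq (ν j)) : block D h j (e D f) = eSum D (HasBlock h j f) :=
  liftCorner_e _ _ _ _ _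

theorem block_y (j : Fin l) (p : Fin (ν j).degree) :
    block D h j (y D p) = eSum D (IsConcat h) * y D (pos h j p) :=
  liftCorner_y _ _ _ _ _

theorem block_tau (j : Fin l) (p q : Fin (ν j).degree) (hpq : (p : ℕ) + 1 = q) :
    block D h j (tau D p q hpq) =
      eSum D (IsConcat h) * tau D (pos h j p) (pos h j q) (pos_succ h hpq) :=
  liftCorner_tau _ _ _ _ _ _ _

theorem block_algebraMap (j : Fin l) (c : k) :
    block D h j (algebraMap k (KLR D (ν j)) c) = c • eSum D (IsConcat h) := by
  rw [Algebra.algebraMap_eq_smul_one, map_smul, block_one]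

theorem block_mem_gr (j : Fin l) {d : ℤ} {x : KLR D (ν j)} (hx : x ∈ gr D (ν j) d) :
    block D h j x ∈ gr D κ d := by
  classical
  induction hx using Submodule.span_induction with
  | mem x hx =>
    change IsWord D d x at hx
    induction hx with
    | e f => rw [block_e]; exact eSum_mem_gr _
    | y p f =>
      rw [block_mul, block_y, block_e, mul_assoc]
      rw [← zero_add (D.form _ _)]
      refine mul_mem_gr (eSum_mem_gr _) ?_
      rw [eSum, Finset.mul_sum]
      refine sum_mem fun i hi => Submodule.subset_span ?_
      rw [← (Finset.mem_filter.1 hi).2.2 p]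
      exact IsWord.y _ i
    | tau p q hpq f =>
      rw [block_mul, block_tau, block_e, mul_assoc]
      rw [← zero_add (-D.form _ _)]
      refine mul_mem_gr (eSum_mem_gr _) ?_
      rw [eSum, Finset.mul_sum]
      refine sum_mem fun i hi => Submodule.subset_span ?_
      rw [← (Finset.mem_filter.1 hi).2.2 p, ← (Finset.mem_filter.1 hi).2.2 q]
      exact IsWord.tau _ _ _ i
    | mul _ _ hx hy => rw [block_mul]; exact mul_mem_gr hx hy
  | zero => rw [map_zero]; exact zero_mem _
  | add x y _ _ hx hy => rw [map_add]; exact add_mem hx hy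
  | smul a x _ hx => rw [map_smul]; exact Submodule.smul_mem _ _ hx

theorem aut_concat (hκ : κ ∈ D.NJ) (hν : ∀ j, ν j ∈ D.NJ) :
    aut hκ (eSum D (IsConcat h)) = eSum D (IsConcat h) :=
  aut_eSum hκ fun _ => isConcat_map h _ _ fun j => FoldingDatum.mapDomain_a (hν j)

theorem block_aut (hκ : κ ∈ D.NJ) (hν : ∀ j, ν j ∈ D.NJ) (j : Fin l) (x : KLR D (ν j)) :
    block D h j (aut (hν j) x) = aut hκ (block D h j x) := by
  have hu := aut_concat h hκ hν
  induction x using KLR.induction with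
  | he f =>
    rw [aut_e, block_e, block_e]
    exact (aut_eSum hκ fun i =>
      hasBlock_map h _ _ (fun j => FoldingDatum.mapDomain_a (hν j)) j f).symm
  | hy p => rw [aut_y, block_y, map_mul, aut_y, hu]
  | htau p q hpq => rw [aut_tau, block_tau, map_mul, aut_tau, hu]
  | hadd x y hx hy => simp only [map_add, hx, hy]
  | hmul x y hx hy => rw [map_mul, block_mul, hx, hy, block_mul, map_mul]
  | hk c => rw [AlgEquiv.commutes, block_algebraMap, map_smul, hu]

theorem block_commute_of {j : Fin l} {v : KLR D κ} (hu : Commute (eSum D (IsConcat h)) v)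
    (he : ∀ f, Commute (eSum D (HasBlock h j f)) v) (hy : ∀ p, Commute (y D (pos h j p)) v)
    (htau : ∀ p q hpq, Commute (tau D (pos h j p) (pos h j q) (pos_succ h hpq)) v)
    (x : KLR D (ν j)) : Commute (block D h j x) v := by
  induction x using KLR.induction with
  | he f => rw [block_e]; exact he f
  | hy p => rw [block_y]; exact hu.mul_left (hy p)
  | htau p q hpq => rw [block_tau]; exact hu.mul_left (htau p q hpq)
  | hadd x y hx hy => rw [map_add]; exact hx.add_left hy
  | hmul x y hx hy => rw [block_mul]; exact hx.mul_left hy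
  | hk c => rw [block_algebraMap]; exact hu.smul_left c

theorem tau_commute_y {p q p' : Fin κ.degree} (hpq : (p : ℕ) + 1 = q) (h1 : p' ≠ p)
    (h2 : p' ≠ q) : Commute (tau D p q hpq) (y D p') := by
  refine eq_of_mul_e D fun i => ?_
  have := (isFamily D).tau_y p q hpq p' i (by tauto)
  rw [Equiv.swap_apply_of_ne_of_ne h1 h2, sub_mul] at this
  exact sub_eq_zero.1 this

theorem block_commute {j j' : Fin l} (hj : j ≠ j') (x : KLR D (ν j)) (x' : KLR D (ν j')) :
    Commute (block D h j x) (block D h j' x') := by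
  have hy : ∀ j p, Commute (eSum D (IsConcat h)) (y D (pos h j p)) :=
    fun j p => (y_commute_eSum _ _).symm
  have ht : ∀ j p q hpq,
      Commute (eSum D (IsConcat h)) (tau D (pos h j p) (pos h j q) (pos_succ h hpq)) :=
    fun j p q hpq => (tau_mul_eSum _ _ _ fun i => isConcat_swap h j p q).symm
  have hte : ∀ {j j' : Fin l} (_ : j ≠ j') p q hpq f, Commute
      (tau D (pos h j p) (pos h j q) (pos_succ h hpq)) (eSum D (HasBlock h j' f)) :=
    fun hj p q hpq f => tau_mul_eSum _ _ _ fun i => hasBlock_swap_ne h hj p q f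
  have key : ∀ (v : KLR D κ), Commute (eSum D (IsConcat h)) v →
      (∀ f, Commute (eSum D (HasBlock h j' f)) v) → (∀ p, Commute (y D (pos h j' p)) v) →
      (∀ p q hpq, Commute (tau D (pos h j' p) (pos h j' q) (pos_succ h hpq)) v) →
      Commute v (block D h j' x') := fun v h1 h2 h3 h4 => (block_commute_of h h1 h2 h3 h4 x').symm
  refine block_commute_of h ?_ (fun f => ?_) (fun p => ?_) (fun p q hpq => ?_) x
  · exact key _ (Commute.refl _) (fun f => eSum_commute _ _) (fun p => y_commute_eSum _ _)
      fun p q hpq => (ht _ _ _ hpq).symm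
  · exact key _ (eSum_commute _ _) (fun f => eSum_commute _ _) (fun p => y_commute_eSum _ _)
      fun p q hpq => hte hj.symm _ _ hpq _
  · exact key _ (hy _ _) (fun f => (y_commute_eSum _ _).symm) (fun p' => (isFamily D).y_comm _ _)
      fun p' q' hpq => tau_commute_y (pos_succ h hpq) (pos_ne h hj _ _) (pos_ne h hj _ _)
  · refine key _ (ht _ _ _ hpq) (fun f => (hte hj _ _ hpq _).symm)
      (fun p' => (tau_commute_y (pos_succ h hpq) (pos_ne h hj.symm _ _) (pos_ne h hj.symm _ _)).symm)
      fun p' q' hpq' => ?_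
    rcases lt_or_gt_of_ne hj with hj | hj
    · exact ((isFamily D).tau_comm _ _ _ _ _ _ (pos_lt h hj _ _)).symm
    · exact (isFamily D).tau_comm _ _ _ _ _ _ (pos_lt h hj _ _)

end Blocks
end KLR

end KLR

namespace FoldingDatum

variable {k : Type u} [Field k] {I : Type u} {D : FoldingDatum k I}

theorem sum_coe {l : ℕ} {ν : Fin l → D.NJ} {κ : D.NJ} (h : ∑ j, ν j = κ) :
    ∑ j, (ν j : I →₀ ℕ) = (κ : I →₀ ℕ) := by
  rw [← h, AddSubmonoid.coe_finsetSum]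

variable [Infinite k] (D)

/-- The algebra `R(ν)`, for `ν ∈ ℕ J`, with its grading and its automorphism. -/
def R (ν : D.NJ) : FoldedAlg k D.n where
  carrier := KLR D (ν : I →₀ ℕ)
  gr := KLR.gr D (ν : I →₀ ℕ)
  internal := KLR.gr_internal D (ν : I →₀ ℕ)
  one_mem := KLR.one_mem_gr
  mul_mem := KLR.mul_mem_gr
  aut := KLR.aut ν.2
  aut_mem := KLR.aut_mem_gr ν.2
  aut_pow := KLR.aut_pow ν.2

variable {D}

/-- The homomorphism `R(ν_0) ⊗ R(ν_1) ⊗ ⋯ → R(κ)`, for `κ = ν_0 + ν_1 + ⋯`, that places the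
generators of the tensor factors side by side. It takes the unit to the sum of the `e i` over the
concatenations `i` of sequences of weights `ν_0, ν_1, …`. -/
def concat {l : ℕ} (ν : Fin l → D.NJ) (κ : D.NJ) (h : ∑ j, ν j = κ) :
    FoldedHom (FoldedAlg.pi fun j => D.R (ν j)) (D.R κ) :=
  FoldedHom.ofCommuting
    (fun j =>
      { toLin := KLR.block D (sum_coe h) j
        map_mul := KLR.block_mul (D := D) (ν := fun j => (ν j : I →₀ ℕ)) (sum_coe h) j
        map_mem := KLR.block_mem_gr (D := D) (ν := fun j => (ν j : I →₀ ℕ)) (sum_coe h) j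
        comm := KLR.block_aut _ κ.2 (fun j => (ν j).2) j })
    (KLR.eSum D (KLR.IsConcat (sum_coe h))) (KLR.eSum_mul_self _) (KLR.eSum_mem_gr _)
    (KLR.aut_concat _ κ.2 fun j => (ν j).2) (fun j => KLR.block_one _ j)
    fun _ _ hj x y => KLR.block_commute (D := D) (ν := fun j => (ν j : I →₀ ℕ)) (sum_coe h) hj x y

variable (D)

/-- The category `C_{λ_0 ⊔ λ_1 ⊔ ⋯}`: the objects `(M, σ)` for the algebra
`R(λ_0) ⊗ R(λ_1) ⊗ ⋯`. -/
abbrev C {r : ℕ} (lam : Fin r → D.NJ) : Type (u + 1) :=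
  FMod (FoldedAlg.pi fun i => D.R (lam i))

variable {D}

/-- The induction functor to `C_κ`. -/
abbrev Ind {r : ℕ} (lam : Fin r → D.NJ) (κ : D.NJ) (h : ∑ i, lam i = κ) :
    D.C lam ⥤ FMod (D.R κ) :=
  (concat lam κ h).ind

/-- The restriction functor from `C_κ`. -/
abbrev Res {s : ℕ} (mu : Fin s → D.NJ) (κ : D.NJ) (h : ∑ j, mu j = κ) :
    FMod (D.R κ) ⥤ D.C mu :=
  (concat mu κ h).res

/-- The functor `Ind ∘ τ ∘ Res` attached to `ν_ij` with `∑_j ν_ij = λ_i` and `∑_i ν_ij = μ_j`: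
restrict every `R(λ_i)` to `R(ν_i0) ⊗ R(ν_i1) ⊗ ⋯`, permute the tensor factors, and induce from
`R(ν_0j) ⊗ R(ν_1j) ⊗ ⋯` to every `R(μ_j)`. -/
def mackeyFunctor {r s : ℕ} {lam : Fin r → D.NJ} {mu : Fin s → D.NJ} (ν : Fin r → Fin s → D.NJ)
    (hlam : ∀ i, ∑ j, ν i j = lam i) (hmu : ∀ j, ∑ i, ν i j = mu j) : D.C lam ⥤ D.C mu :=
  (FoldedHom.pi fun i => concat (ν i) (lam i) (hlam i)).res ⋙
    (FoldedHom.swap fun i j => D.R (ν i j)).res ⋙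
      (FoldedHom.pi fun j => concat (fun i => ν i j) (mu j) (hmu j)).ind

end FoldingDatum

end

end FoldedKLR

namespace FoldedKLR
noncomputable section

/-! ### Permutations and reduced words -/

section Words

variable {n : ℕ}

/-- A pair of adjacent positions. -/
abbrev Letter (n : ℕ) := {x : Fin n × Fin n // (x.1 : ℕ) + 1 = x.2}

theorem Letter.lt (x : Letter n) : x.1.1 < x.1.2 := Fin.lt_def.2 (by have := x.2; omega)

theorem Letter.ext_left {x z : Letter n} (h : x.1.1 = z.1.1) : x = z :=
  Subtype.ext (Prod.ext h (Fin.ext (by have := x.2; have := z.2; rw [h] at *; omega)))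

/-- The transposition of two adjacent positions. -/
def sw (x : Letter n) : Equiv.Perm (Fin n) := Equiv.swap x.1.1 x.1.2

@[simp] theorem sw_left (x : Letter n) : sw x x.1.1 = x.1.2 := Equiv.swap_apply_left _ _
@[simp] theorem sw_right (x : Letter n) : sw x x.1.2 = x.1.1 := Equiv.swap_apply_right _ _
theorem sw_of_ne (x : Letter n) {a : Fin n} (h1 : a ≠ x.1.1) (h2 : a ≠ x.1.2) : sw x a = a :=
  Equiv.swap_apply_of_ne_of_ne h1 h2
@[simp] theorem sw_sw (x : Letter n) (a : Fin n) : sw x (sw x a) = a := Equiv.swap_apply_self _ _ _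
@[simp] theorem sw_mul_self (x : Letter n) : sw x * sw x = 1 := Equiv.swap_mul_self _ _
@[simp] theorem sw_inv (x : Letter n) : (sw x)⁻¹ = sw x := Equiv.swap_inv _ _
@[simp] theorem sw_mul_sw_mul (x : Letter n) (w : Equiv.Perm (Fin n)) : sw x * (sw x * w) = w := by
  rw [← mul_assoc, sw_mul_self, one_mul]
@[simp] theorem mul_sw_mul_sw (x : Letter n) (w : Equiv.Perm (Fin n)) : w * sw x * sw x = w := by
  rw [mul_assoc, sw_mul_self, mul_one]

theorem sw_lt (x : Letter n) {a b : Fin n} (hab : a < b) (h : (a, b) ≠ x.1) : sw x a < sw x b := by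
  obtain ⟨⟨p, q⟩, hx⟩ := x
  simp only [ne_eq, Prod.mk.injEq, not_and, Fin.ext_iff, Fin.lt_def, sw,
    Equiv.swap_apply_def] at *
  change (p : ℕ) + 1 = q at hx
  split_ifs <;> omega

/-- The set of inversions. -/
def invSet (w : Equiv.Perm (Fin n)) : Finset (Fin n × Fin n) :=
  Finset.univ.filter fun ab => ab.1 < ab.2 ∧ w ab.2 < w ab.1

theorem mem_invSet {w : Equiv.Perm (Fin n)} {a b : Fin n} :
    (a, b) ∈ invSet w ↔ a < b ∧ w b < w a := by simp [invSet]

/-- The number of inversions. -/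
def inv (w : Equiv.Perm (Fin n)) : ℕ := (invSet w).card

theorem invSet_mul_sw (w : Equiv.Perm (Fin n)) (x : Letter n) (h : w x.1.1 < w x.1.2) :
    invSet (w * sw x) = insert x.1 ((invSet w).image fun ab => (sw x ab.1, sw x ab.2)) := by
  ext ⟨a, b⟩
  simp only [Finset.mem_insert, Finset.mem_image, Prod.exists, mem_invSet, Equiv.Perm.mul_apply,
    Prod.mk.injEq]
  constructor
  · rintro ⟨hab, hw⟩
    by_cases hx : (a, b) = x.1
    · exact Or.inl hx
    · exact Or.inr ⟨sw x a, sw x b, ⟨sw_lt x hab hx, hw⟩, sw_sw _ _, sw_sw _ _⟩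
  · rintro (hx | ⟨c, d, ⟨hcd, hw⟩, rfl, rfl⟩)
    · obtain ⟨rfl, rfl⟩ := Prod.ext_iff.1 hx
      exact ⟨x.lt, by simpa using h⟩
    · refine ⟨sw_lt x hcd ?_, by simpa using hw⟩
      rintro hx
      obtain ⟨rfl, rfl⟩ := Prod.ext_iff.1 hx
      exact lt_asymm h hw

theorem inv_mul_sw (w : Equiv.Perm (Fin n)) (x : Letter n) (h : w x.1.1 < w x.1.2) :
    inv (w * sw x) = inv w + 1 := by
  rw [inv, invSet_mul_sw w x h, Finset.card_insert_of_notMem, Finset.card_image_of_injective, inv]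
  · rintro ⟨a, b⟩ ⟨c, d⟩ hh
    simpa using hh
  · simp only [Finset.mem_image, Prod.exists, mem_invSet, not_exists, not_and]
    rintro a b ⟨hab, _⟩ hx
    obtain ⟨h1, h2⟩ := Prod.ext_iff.1 hx
    have h1' : a = x.1.2 := by rw [← sw_left, ← h1]; simp
    have h2' : b = x.1.1 := by rw [← sw_right, ← h2]; simp
    subst h1' h2'
    exact lt_asymm hab x.lt

theorem inv_mul_sw_of_gt (w : Equiv.Perm (Fin n)) (x : Letter n) (h : w x.1.2 < w x.1.1) :
    inv (w * sw x) + 1 = inv w := by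
  have := inv_mul_sw (w * sw x) x (by simpa using h)
  simpa using this.symm

theorem inv_inv (w : Equiv.Perm (Fin n)) : inv w⁻¹ = inv w := by
  refine Finset.card_bij' (fun ab _ => (w⁻¹ ab.2, w⁻¹ ab.1)) (fun ab _ => (w ab.2, w ab.1)) ?_ ?_
    ?_ ?_
  · rintro ⟨a, b⟩ h
    rw [mem_invSet] at h
    simpa [mem_invSet] using h.symm
  · rintro ⟨a, b⟩ h
    rw [mem_invSet] at h
    simpa [mem_invSet] using h.symm
  · simp
  · simp

theorem inv_sw_mul (w : Equiv.Perm (Fin n)) (x : Letter n) (h : w⁻¹ x.1.1 < w⁻¹ x.1.2) :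
    inv (sw x * w) = inv w + 1 := by
  rw [← inv_inv, mul_inv_rev, sw_inv, inv_mul_sw _ _ h, inv_inv]

theorem inv_sw_mul_of_gt (w : Equiv.Perm (Fin n)) (x : Letter n) (h : w⁻¹ x.1.2 < w⁻¹ x.1.1) :
    inv (sw x * w) + 1 = inv w := by
  rw [← inv_inv, mul_inv_rev, sw_inv, inv_mul_sw_of_gt _ _ h, inv_inv]

theorem inv_sw_mul_cases (w : Equiv.Perm (Fin n)) (x : Letter n) :
    (w⁻¹ x.1.1 < w⁻¹ x.1.2 ∧ inv (sw x * w) = inv w + 1) ∨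
      (w⁻¹ x.1.2 < w⁻¹ x.1.1 ∧ inv (sw x * w) + 1 = inv w) := by
  rcases lt_or_gt_of_ne (fun h => x.lt.ne (w⁻¹.injective h)) with h | h
  · exact Or.inl ⟨h, inv_sw_mul _ _ h⟩
  · exact Or.inr ⟨h, inv_sw_mul_of_gt _ _ h⟩

@[simp] theorem inv_one : inv (1 : Equiv.Perm (Fin n)) = 0 := by
  rw [inv, Finset.card_eq_zero, Finset.eq_empty_iff_forall_notMem]
  rintro ⟨a, b⟩ h
  rw [mem_invSet] at h
  exact lt_asymm h.1 h.2

theorem eq_one_of_lt (w : Equiv.Perm (Fin n)) (h : ∀ a b, a < b → w a < w b) : w = 1 := by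
  have hm : StrictMono w := fun a b hab => h a b hab
  have h1 : (hm.orderIsoOfSurjective _ w.surjective : Fin n ≃o Fin n) = OrderIso.refl _ :=
    Subsingleton.elim _ _
  ext a
  exact congrArg Fin.val (DFunLike.congr_fun h1 a)

theorem inv_mul_of (u w : Equiv.Perm (Fin n)) (h : ∀ a b, a < b → w b < w a → u (w b) < u (w a)) :
    inv (u * w) = inv u + inv w := by
  have h1 : invSet (u * w) = invSet w ∪ (invSet u).image fun ab => (w⁻¹ ab.1, w⁻¹ ab.2) := by
    ext ⟨a, b⟩
    simp only [Finset.mem_union, Finset.mem_image, Prod.exists, mem_invSet, Equiv.Perm.mul_apply,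
      Prod.mk.injEq]
    constructor
    · rintro ⟨hab, hu⟩
      rcases lt_or_gt_of_ne (fun h => hab.ne (w.injective h)) with hw | hw
      · exact Or.inr ⟨w a, w b, ⟨hw, hu⟩, by simp, by simp⟩
      · exact Or.inl ⟨hab, hw⟩
    · rintro (⟨hab, hw⟩ | ⟨c, d, ⟨hcd, hu⟩, rfl, rfl⟩)
      · exact ⟨hab, h a b hab hw⟩
      · refine ⟨?_, by simpa using hu⟩
        rcases lt_or_gt_of_ne (fun h => hcd.ne (w⁻¹.injective h)) with hw | hw
        · exact hw
        · have : u c < u d := by simpa using h _ _ hw (by simpa using hcd)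
          exact absurd hu (lt_asymm this)
  rw [inv, h1, Finset.card_union_of_disjoint, Finset.card_image_of_injective, inv, inv, add_comm]
  · rintro ⟨a, b⟩ ⟨c, d⟩ hh
    simpa using hh
  · rw [Finset.disjoint_left]
    rintro ⟨a, b⟩ h1 h2
    simp only [Finset.mem_image, Prod.exists, mem_invSet, Prod.mk.injEq] at h1 h2
    obtain ⟨c, d, ⟨hcd, hu⟩, rfl, rfl⟩ := h2
    rw [← Equiv.Perm.mul_apply, ← Equiv.Perm.mul_apply, mul_inv_cancel] at h1
    exact lt_asymm hcd h1.2

theorem eq_of_lt_iff (u w : Equiv.Perm (Fin n)) (h : ∀ a b, u a < u b → w a < w b) : u = w := by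
  have : w * u⁻¹ = 1 := eq_one_of_lt _ fun a b hab => h _ _ (by simpa using hab)
  rw [← mul_inv_eq_one.1 this]

theorem eq_of_invSet_eq (u w : Equiv.Perm (Fin n)) (h : invSet u = invSet w) : u = w := by
  refine eq_of_lt_iff u w fun a b hab => ?_
  have key : ∀ a b, a < b → (u b < u a ↔ w b < w a) := fun a b hab => by
    have := (Finset.ext_iff.1 h) (a, b)
    rw [mem_invSet, mem_invSet] at this
    tauto
  rcases lt_trichotomy a b with h1 | h1 | h1
  · by_contra hw
    have hne : w a ≠ w b := fun h => h1.ne (w.injective h)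
    exact lt_asymm hab ((key _ _ h1).2 (lt_of_le_of_ne (not_lt.1 hw) hne.symm))
  · exact absurd hab (by simp [h1])
  · exact (key _ _ h1).1 hab

/-- The permutation of a word. -/
def wordPerm (ω : List (Letter n)) : Equiv.Perm (Fin n) := (ω.map sw).prod

@[simp] theorem wordPerm_nil : wordPerm ([] : List (Letter n)) = 1 := rfl
@[simp] theorem wordPerm_cons (x : Letter n) (ω) : wordPerm (x :: ω) = sw x * wordPerm ω := by
  simp [wordPerm]
@[simp] theorem wordPerm_append (ω ω' : List (Letter n)) :
    wordPerm (ω ++ ω') = wordPerm ω * wordPerm ω' := by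
  simp [wordPerm]

theorem inv_wordPerm_le (ω : List (Letter n)) : inv (wordPerm ω) ≤ ω.length := by
  induction ω with
  | nil => simp
  | cons x ω ih =>
    rw [wordPerm_cons, List.length_cons]
    rcases inv_sw_mul_cases (wordPerm ω) x with ⟨_, h⟩ | ⟨_, h⟩ <;> omega

/-- A word is reduced. -/
def IsRed (ω : List (Letter n)) : Prop := ω.length = inv (wordPerm ω)

theorem IsRed.of_cons {x : Letter n} {ω} (h : IsRed (x :: ω)) : IsRed ω := by
  have h1 := inv_wordPerm_le ω
  rw [IsRed, wordPerm_cons, List.length_cons] at h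
  rw [IsRed]
  rcases inv_sw_mul_cases (wordPerm ω) x with ⟨_, h⟩ | ⟨_, h⟩ <;> omega

theorem IsRed.cons_lt {x : Letter n} {ω} (h : IsRed (x :: ω)) :
    (wordPerm ω)⁻¹ x.1.1 < (wordPerm ω)⁻¹ x.1.2 := by
  have h1 := inv_wordPerm_le ω
  rw [IsRed, wordPerm_cons, List.length_cons] at h
  rcases inv_sw_mul_cases (wordPerm ω) x with ⟨h, _⟩ | ⟨_, h⟩
  · exact h
  · omega

theorem IsRed.cons_gt {x : Letter n} {ω} (h : IsRed (x :: ω)) :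
    (wordPerm (x :: ω))⁻¹ x.1.2 < (wordPerm (x :: ω))⁻¹ x.1.1 := by
  simpa using h.cons_lt

theorem isRed_cons {x : Letter n} {ω} (h : IsRed ω)
    (hx : (wordPerm ω)⁻¹ x.1.1 < (wordPerm ω)⁻¹ x.1.2) : IsRed (x :: ω) := by
  rw [IsRed, wordPerm_cons, List.length_cons, inv_sw_mul _ _ hx, h]

variable {o : Type} {β : Fin n → o}

/-- All the letters of the word interchange positions of the same block. -/
def IsBlockWord (β : Fin n → o) (ω : List (Letter n)) : Prop := ∀ x ∈ ω, β x.1.1 = β x.1.2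

theorem isBlockWord_nil : IsBlockWord β [] := by simp [IsBlockWord]

theorem isBlockWord_cons {x : Letter n} {ω} :
    IsBlockWord β (x :: ω) ↔ β x.1.1 = β x.1.2 ∧ IsBlockWord β ω := by
  simp [IsBlockWord]

theorem isBlockWord_append {ω ω' : List (Letter n)} :
    IsBlockWord β (ω ++ ω') ↔ IsBlockWord β ω ∧ IsBlockWord β ω' := by
  simp only [IsBlockWord, List.mem_append]
  exact ⟨fun h => ⟨fun x hx => h x (Or.inl hx), fun x hx => h x (Or.inr hx)⟩,
    fun h x hx => hx.elim (h.1 x) (h.2 x)⟩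

theorem apply_sw {x : Letter n} (hx : β x.1.1 = β x.1.2) (a : Fin n) : β (sw x a) = β a := by
  by_cases h1 : a = x.1.1
  · rw [h1, sw_left, hx]
  · by_cases h2 : a = x.1.2
    · rw [h2, sw_right, hx]
    · rw [sw_of_ne x h1 h2]

theorem IsBlockWord.apply {ω : List (Letter n)} (h : IsBlockWord β ω) (a : Fin n) :
    β (wordPerm ω a) = β a := by
  induction ω with
  | nil => rfl
  | cons x ω ih =>
    rw [isBlockWord_cons] at h
    rw [wordPerm_cons, Equiv.Perm.mul_apply, apply_sw h.1, ih h.2]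

theorem apply_inv {w : Equiv.Perm (Fin n)} (h : ∀ a, β (w a) = β a) (a : Fin n) :
    β (w⁻¹ a) = β a := by
  rw [← h]; simp

variable [LinearOrder o]

/-- The permutation `w` preserves the order inside the blocks. -/
def MonoOnBlocks (β : Fin n → o) (w : Equiv.Perm (Fin n)) : Prop :=
  ∀ a b, a < b → β a = β b → w a < w b

theorem monoOnBlocks_of_letters (hβ : Monotone β) {w : Equiv.Perm (Fin n)}
    (h : ∀ x : Letter n, β x.1.1 = β x.1.2 → w x.1.1 < w x.1.2) : MonoOnBlocks β w := by
  have key : ∀ (t : ℕ) (a b : Fin n), (a : ℕ) + t + 1 = b → β a = β b → w a < w b := by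
    intro t
    induction t with
    | zero => exact fun a b hab hb => h ⟨(a, b), hab⟩ hb
    | succ t ih =>
      intro a b hab hb
      have hc : (a : ℕ) + 1 < n := by have := b.2; omega
      have h1 : β a ≤ β ⟨a + 1, hc⟩ := hβ (Fin.le_def.2 (by simp))
      have h2 : β ⟨a + 1, hc⟩ ≤ β b := hβ (Fin.le_def.2 (by simp; omega))
      have h3 : β a = β ⟨a + 1, hc⟩ := le_antisymm h1 (hb ▸ h2)
      exact (h ⟨(a, ⟨a + 1, hc⟩), rfl⟩ h3).trans
        (ih ⟨a + 1, hc⟩ b (by simp; omega) (h3 ▸ hb))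
  intro a b hab hb
  exact key (b - a - 1) a b (by have := Fin.lt_def.1 hab; omega) hb

theorem exists_letter_of_not_mono (hβ : Monotone β) {w : Equiv.Perm (Fin n)}
    (h : ¬ MonoOnBlocks β w) : ∃ x : Letter n, β x.1.1 = β x.1.2 ∧ w x.1.2 < w x.1.1 := by
  by_contra! h'
  exact h (monoOnBlocks_of_letters hβ fun x hx =>
    lt_of_le_of_ne (h' x hx) fun h => x.lt.ne (w.injective h))

theorem eq_one_of_monoOnBlocks (hβ : Monotone β) {w : Equiv.Perm (Fin n)}
    (h : MonoOnBlocks β w) (hw : ∀ a, β (w a) = β a) : w = 1 := by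
  refine eq_one_of_lt w fun a b hab => ?_
  rcases (hβ hab.le).lt_or_eq with h1 | h1
  · rw [← hw a, ← hw b] at h1
    exact hβ.reflect_lt h1
  · exact h a b hab h1

theorem exists_reduced (hβ : Monotone β) (w : Equiv.Perm (Fin n)) (hw : ∀ a, β (w a) = β a) :
    ∃ ω, IsBlockWord β ω ∧ IsRed ω ∧ wordPerm ω = w := by
  induction hm : inv w using Nat.strong_induction_on generalizing w with
  | _ m ih =>
    by_cases h1 : w = 1
    · exact ⟨[], isBlockWord_nil, by simp [IsRed], h1.symm⟩
    · have h2 : ¬ MonoOnBlocks β w⁻¹ := fun h =>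
        h1 (inv_eq_one.1 (eq_one_of_monoOnBlocks hβ h (apply_inv hw)))
      obtain ⟨x, hx, hxw⟩ := exists_letter_of_not_mono hβ h2
      have h3 := inv_sw_mul_of_gt w x hxw
      obtain ⟨ω, hω, hr, hp⟩ := ih (inv (sw x * w)) (by omega) (sw x * w)
        (fun a => by rw [Equiv.Perm.mul_apply, apply_sw hx, hw]) rfl
      refine ⟨x :: ω, isBlockWord_cons.2 ⟨hx, hω⟩, ?_, by simp [hp]⟩
      rw [IsRed, List.length_cons, hr, wordPerm_cons, hp, sw_mul_sw_mul, h3]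

/-- A reduced word of a permutation, with letters inside the blocks. -/
def redWord (hβ : Monotone β) (w : Equiv.Perm (Fin n)) (hw : ∀ a, β (w a) = β a) :
    List (Letter n) := (exists_reduced hβ w hw).choose

theorem redWord_block (hβ : Monotone β) (w : Equiv.Perm (Fin n)) (hw : ∀ a, β (w a) = β a) :
    IsBlockWord β (redWord hβ w hw) := (exists_reduced hβ w hw).choose_spec.1

theorem redWord_red (hβ : Monotone β) (w : Equiv.Perm (Fin n)) (hw : ∀ a, β (w a) = β a) :
    IsRed (redWord hβ w hw) := (exists_reduced hβ w hw).choose_spec.2.1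

@[simp] theorem wordPerm_redWord (hβ : Monotone β) (w : Equiv.Perm (Fin n))
    (hw : ∀ a, β (w a) = β a) : wordPerm (redWord hβ w hw) = w :=
  (exists_reduced hβ w hw).choose_spec.2.2

/-- Two monotone maps with the same fibre cardinalities are equal. -/
theorem eq_of_monotone_of_card {X : Type*} [LinearOrder X] {f g : Fin n → X} (hf : Monotone f)
    (hg : Monotone g) (h : ∀ x, (Finset.univ.filter fun a => f a = x).card =
      (Finset.univ.filter fun a => g a = x).card) : f = g := by
  have hc : ∀ (f : Fin n → X) x, (List.ofFn f).count x =
      (Finset.univ.filter fun a => f a = x).card := by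
    intro f x
    rw [← Multiset.coe_count, ← Fin.univ_val_map, Multiset.count_map, Finset.card_def,
      Finset.filter_val]
    simp only [eq_comm]
  have hp : (List.ofFn f).Perm (List.ofFn g) :=
    List.perm_iff_count.2 fun x => by rw [hc, hc]; convert h x
  exact List.ofFn_injective
    (hp.eq_of_pairwise' hf.sortedLE_ofFn.pairwise hg.sortedLE_ofFn.pairwise)

end Words

/-! ### Words in the generators `τ` -/

section Act

variable {I : Type u} {ν : I →₀ ℕ}

/-- The action of permutations on sequences. -/
def Seq.act (w : Equiv.Perm (Fin ν.degree)) (i : Seq ν) : Seq ν :=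
  ⟨fun l => i (w⁻¹ l), (Equiv.sum_comp w⁻¹ fun l => Finsupp.single (i l) 1).trans i.2⟩

@[simp] theorem Seq.act_apply (w : Equiv.Perm (Fin ν.degree)) (i : Seq ν) (l : Fin ν.degree) :
    i.act w l = i (w⁻¹ l) := rfl

@[simp] theorem Seq.act_one (i : Seq ν) : i.act 1 = i := rfl

theorem Seq.act_act (w w' : Equiv.Perm (Fin ν.degree)) (i : Seq ν) :
    (i.act w').act w = i.act (w * w') :=
  Seq.ext fun l => by simp

theorem Seq.act_sw (x : Letter ν.degree) (i : Seq ν) : i.act (sw x) = i.swap x.1.1 x.1.2 :=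
  Seq.ext fun l => by simp [sw]

theorem Seq.act_eq_iff {w : Equiv.Perm (Fin ν.degree)} {i j : Seq ν} :
    i.act w = j ↔ i = j.act w⁻¹ := by
  constructor
  · rintro rfl
    rw [Seq.act_act, inv_mul_cancel, Seq.act_one]
  · rintro rfl
    rw [Seq.act_act, mul_inv_cancel, Seq.act_one]

theorem Seq.act_injective (w : Equiv.Perm (Fin ν.degree)) :
    Function.Injective (Seq.act (ν := ν) w) := fun i j h => by
  rw [Seq.act_eq_iff.1 h, Seq.act_act, inv_mul_cancel, Seq.act_one]

end Act

namespace KLR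

variable {k : Type u} [Field k] {I : Type u} {D : FoldingDatum k I} {ν : I →₀ ℕ}

variable (D) in
/-- The generator `τ` attached to a letter. -/
abbrev tl (x : Letter ν.degree) : KLR D ν := tau D x.1.1 x.1.2 x.2

variable (D) in
/-- The product of generators `τ` along a word. -/
def tw (ω : List (Letter ν.degree)) : KLR D ν := (ω.map (tl D)).prod

@[simp] theorem tw_nil : tw D ([] : List (Letter ν.degree)) = 1 := rfl
@[simp] theorem tw_cons (x : Letter ν.degree) (ω) : tw D (x :: ω) = tl D x * tw D ω := by
  simp [tw]
@[simp] theorem tw_append (ω ω' : List (Letter ν.degree)) :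
    tw D (ω ++ ω') = tw D ω * tw D ω' := by
  simp [tw]

theorem tl_e (x : Letter ν.degree) (i : Seq ν) : tl D x * e D i = e D (i.act (sw x)) * tl D x := by
  rw [Seq.act_sw]; exact (isFamily D).tau_e _ _ _ _

theorem tw_e (ω : List (Letter ν.degree)) (i : Seq ν) :
    tw D ω * e D i = e D (i.act (wordPerm ω)) * tw D ω := by
  induction ω with
  | nil => simp
  | cons x ω ih =>
    rw [tw_cons, mul_assoc, ih, ← mul_assoc, tl_e, mul_assoc, Seq.act_act, wordPerm_cons]

variable (D ν) in
/-- The subalgebra generated by the `y`'s and the `e`'s. -/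
def polySub : Subalgebra k (KLR D ν) :=
  Algebra.adjoin k (Set.range (y D) ∪ Set.range (e D))

theorem y_mem_polySub (p : Fin ν.degree) : y D p ∈ polySub D ν :=
  Algebra.subset_adjoin (Or.inl ⟨p, rfl⟩)

theorem e_mem_polySub (i : Seq ν) : e D i ∈ polySub D ν :=
  Algebra.subset_adjoin (Or.inr ⟨i, rfl⟩)

theorem eSum_mem_polySub (P : Seq ν → Prop) : eSum D P ∈ polySub D ν :=
  sum_mem fun i _ => e_mem_polySub i

theorem commute_e_of_mem {f : KLR D ν} (hf : f ∈ polySub D ν) (i : Seq ν) :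
    Commute f (e D i) := by
  induction hf using Algebra.adjoin_induction with
  | mem x hx =>
    rcases hx with ⟨p, rfl⟩ | ⟨j, rfl⟩
    · exact (isFamily D).y_e p i
    · by_cases h : j = i
      · rw [h]
      · rw [Commute, SemiconjBy, (isFamily D).e_mul_ne _ _ h, (isFamily D).e_mul_ne _ _ (Ne.symm h)]
  | algebraMap c => exact Algebra.commutes c _
  | add x y _ _ hx hy => exact hx.add_left hy
  | mul x y _ _ hx hy => exact hx.mul_left hy

theorem mem_polySub_of_e {z : KLR D ν} (h : ∀ i, z * e D i ∈ polySub D ν) : z ∈ polySub D ν := by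
  rw [← mul_one z, ← sum_e, Finset.mul_sum]
  exact sum_mem fun i _ => h i

theorem evalQ_mem_polySub (Q : MvPolynomial (Fin 2) k) (p q : Fin ν.degree) :
    evalQ Q (y D p) (y D q) ∈ polySub D ν :=
  sum_mem fun _ _ => Subalgebra.smul_mem _ (mul_mem (pow_mem (y_mem_polySub p) _)
    (pow_mem (y_mem_polySub q) _)) _

theorem evalDQ_mem_polySub (Q : MvPolynomial (Fin 2) k) (p q r : Fin ν.degree) :
    evalDQ Q (y D p) (y D q) (y D r) ∈ polySub D ν :=
  sum_mem fun _ _ => Subalgebra.smul_mem _ (mul_mem (sum_mem fun _ _ =>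
    mul_mem (pow_mem (y_mem_polySub p) _) (pow_mem (y_mem_polySub r) _))
    (pow_mem (y_mem_polySub q) _)) _

theorem tl_sq_mem (x : Letter ν.degree) : tl D x * tl D x ∈ polySub D ν :=
  mem_polySub_of_e fun i => by
    rw [(isFamily D).tau_sq]
    exact mul_mem (evalQ_mem_polySub _ _ _) (e_mem_polySub i)

theorem tl_braid_mem (x x' : Letter ν.degree) (h : x.1.2 = x'.1.1) :
    tl D x' * tl D x * tl D x' - tl D x * tl D x' * tl D x ∈ polySub D ν := by
  obtain ⟨⟨p, q⟩, hx⟩ := x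
  obtain ⟨⟨q', r⟩, hx'⟩ := x'
  obtain rfl : q = q' := h
  refine mem_polySub_of_e fun i => ?_
  by_cases hi : i p = i r
  · rw [(isFamily D).braid_eq p q r hx hx' i hi]
    exact mul_mem (evalDQ_mem_polySub _ _ _ _) (e_mem_polySub i)
  · rw [(isFamily D).braid_ne p q r hx hx' i hi]
    exact zero_mem _

theorem tl_comm (x x' : Letter ν.degree) (h : x.1.2 < x'.1.1 ∨ x'.1.2 < x.1.1) :
    tl D x * tl D x' = tl D x' * tl D x := by
  rcases h with h | h
  · exact (isFamily D).tau_comm _ _ _ _ _ _ h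
  · exact ((isFamily D).tau_comm _ _ _ _ _ _ h).symm

theorem y_tl_sub_mem (x : Letter ν.degree) (l : Fin ν.degree) :
    y D (sw x l) * tl D x - tl D x * y D l ∈ polySub D ν := by
  refine mem_polySub_of_e fun i => ?_
  rw [← neg_sub, neg_mul]
  refine neg_mem ?_
  by_cases hi : i x.1.1 = i x.1.2 ∧ (l = x.1.1 ∨ l = x.1.2)
  · obtain ⟨hi, rfl | rfl⟩ := hi
    · rw [sw_left, (isFamily D).tau_y_left _ _ _ _ hi]
      exact neg_mem (e_mem_polySub i)
    · rw [sw_right, (isFamily D).tau_y_right _ _ _ _ hi]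
      exact e_mem_polySub i
  · rw [sw, (isFamily D).tau_y _ _ _ _ _ hi]
    exact zero_mem _

theorem poly_tl (x : Letter ν.degree) {f : KLR D ν} (hf : f ∈ polySub D ν) :
    ∃ g ∈ polySub D ν, ∃ h ∈ polySub D ν, f * tl D x = tl D x * g + h := by
  induction hf using Algebra.adjoin_induction with
  | mem f hf =>
    rcases hf with ⟨l, rfl⟩ | ⟨i, rfl⟩
    · refine ⟨_, y_mem_polySub (sw x l), _, y_tl_sub_mem x (sw x l), ?_⟩
      rw [sw_sw]; abel
    · refine ⟨_, e_mem_polySub (i.act (sw x)), 0, zero_mem _, ?_⟩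
      rw [tl_e, Seq.act_act, sw_mul_self, Seq.act_one, add_zero]
  | algebraMap c =>
    exact ⟨_, Subalgebra.algebraMap_mem _ c, 0, zero_mem _, by rw [Algebra.commutes, add_zero]⟩
  | add f f' _ _ hf hf' =>
    obtain ⟨g, hg, h, hh, h1⟩ := hf
    obtain ⟨g', hg', h', hh', h1'⟩ := hf'
    exact ⟨_, add_mem hg hg', _, add_mem hh hh', by rw [add_mul, h1, h1']; noncomm_ring⟩
  | mul f f' hfm _ hf hf' =>
    obtain ⟨g, hg, h, hh, h1⟩ := hf
    obtain ⟨g', hg', h', hh', h1'⟩ := hf'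
    refine ⟨_, mul_mem hg hg', _, add_mem (mul_mem hh hg') (mul_mem hfm hh'), ?_⟩
    rw [mul_assoc, h1', mul_add, ← mul_assoc, h1]; noncomm_ring

section Low

variable {o : Type} {β : Fin ν.degree → o}

variable (D) in
/-- The span of the products of fewer than `m` generators `τ` that act inside the blocks, and of a
polynomial. -/
def low {o : Type} (β : Fin ν.degree → o) (m : ℤ) : Submodule k (KLR D ν) :=
  Submodule.span k {z | ∃ ω, IsBlockWord β ω ∧ (ω.length : ℤ) < m ∧ ∃ f ∈ polySub D ν,
    z = tw D ω * f}

theorem tw_mul_mem_low {m : ℤ} {ω} (hω : IsBlockWord β ω) (hm : (ω.length : ℤ) < m)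
    {f : KLR D ν} (hf : f ∈ polySub D ν) : tw D ω * f ∈ low D β m :=
  Submodule.subset_span ⟨ω, hω, hm, f, hf, rfl⟩

theorem tw_mem_low {m : ℤ} {ω} (hω : IsBlockWord β ω) (hm : (ω.length : ℤ) < m) :
    tw D ω ∈ low D β m := by
  simpa using tw_mul_mem_low (D := D) hω hm (one_mem _)

theorem poly_mem_low {m : ℤ} (hm : 0 < m) {f : KLR D ν} (hf : f ∈ polySub D ν) :
    f ∈ low D β m := by
  simpa using tw_mul_mem_low (D := D) (β := β) isBlockWord_nil (by simpa using hm) hf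

theorem low_mono {m m' : ℤ} (h : m ≤ m') {z : KLR D ν} (hz : z ∈ low D β m) : z ∈ low D β m' := by
  refine Submodule.span_mono ?_ hz
  rintro _ ⟨ω, hω, hm, f, hf, rfl⟩
  exact ⟨ω, hω, hm.trans_le h, f, hf, rfl⟩

theorem low_mul_poly {m : ℤ} {z f : KLR D ν} (hz : z ∈ low D β m) (hf : f ∈ polySub D ν) :
    z * f ∈ low D β m := by
  induction hz using Submodule.span_induction with
  | mem z hz =>
    obtain ⟨ω, hω, hm, g, hg, rfl⟩ := hz
    rw [mul_assoc]
    exact tw_mul_mem_low hω hm (mul_mem hg hf)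
  | zero => rw [zero_mul]; exact zero_mem _
  | add x y _ _ hx hy => rw [add_mul]; exact add_mem hx hy
  | smul a x _ hx => rw [smul_mul_assoc]; exact Submodule.smul_mem _ _ hx

theorem tl_mul_low {m m' : ℤ} (h : m + 1 ≤ m') {z : KLR D ν} {x : Letter ν.degree}
    (hx : β x.1.1 = β x.1.2) (hz : z ∈ low D β m) : tl D x * z ∈ low D β m' := by
  induction hz using Submodule.span_induction with
  | mem z hz =>
    obtain ⟨ω, hω, hm, g, hg, rfl⟩ := hz
    rw [← mul_assoc, ← tw_cons]
    exact tw_mul_mem_low (isBlockWord_cons.2 ⟨hx, hω⟩) (by push_cast [List.length_cons]; omega) hg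
  | zero => rw [mul_zero]; exact zero_mem _
  | add x y _ _ hx hy => rw [mul_add]; exact add_mem hx hy
  | smul a x _ hx => rw [mul_smul_comm]; exact Submodule.smul_mem _ _ hx

theorem poly_mul_tw {ω} (hω : IsBlockWord β ω) {f : KLR D ν} (hf : f ∈ polySub D ν) :
    f * tw D ω ∈ low D β (ω.length + 1) := by
  induction ω generalizing f with
  | nil => simpa using poly_mem_low (D := D) (β := β) one_pos hf
  | cons x ω ih =>
    rw [isBlockWord_cons] at hω
    obtain ⟨g, hg, h, hh, h1⟩ := poly_tl x hf
    rw [tw_cons, ← mul_assoc, h1, add_mul, mul_assoc]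
    refine add_mem (tl_mul_low (by push_cast [List.length_cons]; omega) hω.1 (ih hω.2 hg))
      (low_mono (by push_cast [List.length_cons]; omega) (ih hω.2 hh))

theorem poly_mul_low {m : ℤ} {z f : KLR D ν} (hf : f ∈ polySub D ν) (hz : z ∈ low D β m) :
    f * z ∈ low D β m := by
  induction hz using Submodule.span_induction with
  | mem z hz =>
    obtain ⟨ω, hω, hm, g, hg, rfl⟩ := hz
    rw [← mul_assoc]
    exact low_mul_poly (low_mono (by omega) (poly_mul_tw hω hf)) hg
  | zero => rw [mul_zero]; exact zero_mem _
  | add x y _ _ hx hy => rw [mul_add]; exact add_mem hx hy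
  | smul a x _ hx => rw [mul_smul_comm]; exact Submodule.smul_mem _ _ hx

theorem tw_mul_low {m m' : ℤ} {ω : List (Letter ν.degree)} (h : m + ω.length ≤ m') {z : KLR D ν}
    (hω : IsBlockWord β ω) (hz : z ∈ low D β m) : tw D ω * z ∈ low D β m' := by
  induction ω generalizing m' with
  | nil => simpa using low_mono (by simpa using h) hz
  | cons x ω ih =>
    rw [isBlockWord_cons] at hω
    rw [tw_cons, mul_assoc]
    refine tl_mul_low (m := m + ω.length) ?_ hω.1 (ih le_rfl hω.2)
    push_cast [List.length_cons] at h
    omega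

theorem y_tw_sub_mem {ω} (hω : IsBlockWord β ω) (l : Fin ν.degree) :
    y D (wordPerm ω l) * tw D ω - tw D ω * y D l ∈ low D β ω.length := by
  induction ω with
  | nil => simp
  | cons x ω ih =>
    rw [isBlockWord_cons] at hω
    have h1 := tl_mul_low (m' := ω.length + 1) le_rfl hω.1 (ih hω.2)
    have h2 := poly_mul_tw hω.2 (y_tl_sub_mem (D := D) x (wordPerm ω l))
    have h3 := add_mem h1 h2
    simp only [wordPerm_cons, Equiv.Perm.mul_apply, tw_cons, List.length_cons]
    push_cast
    convert h3 using 1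
    noncomm_ring

variable [LinearOrder o]

theorem tw_sub_mem (hβ : Monotone β) : ∀ (m : ℕ) (ω ω' : List (Letter ν.degree)),
    IsBlockWord β ω → IsBlockWord β ω' → IsRed ω → IsRed ω' → wordPerm ω = wordPerm ω' →
    ω.length = m → tw D ω - tw D ω' ∈ low D β (m - 1) := by
  intro m
  induction m using Nat.strong_induction_on with
  | _ m ih =>
    intro ω ω' hω hω' hr hr' hp hm
    have hl : ω'.length = m := by rw [← hm, hr, hr', hp]
    cases ω with
    | nil =>
      obtain rfl : ω' = [] := List.length_eq_zero_iff.1 (by rw [hl, ← hm]; rfl)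
      simp
    | cons x u =>
    cases ω' with
    | nil => simp at hl hm; omega
    | cons x' u' =>
    rw [List.length_cons] at hm hl
    have hbx := (isBlockWord_cons.1 hω).1
    have hbx' := (isBlockWord_cons.1 hω').1
    have hbu := (isBlockWord_cons.1 hω).2
    have hbu' := (isBlockWord_cons.1 hω').2
    have gx := hr.cons_gt
    have gx' := hr'.cons_gt
    rw [← hp] at gx'
    set w := wordPerm (x :: u) with hw
    have hwβ : ∀ a, β (w a) = β a := hω.apply
    have hu : wordPerm u = sw x * w := by rw [hw, wordPerm_cons, sw_mul_sw_mul]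
    have hu' : wordPerm u' = sw x' * w := by rw [hp, wordPerm_cons, sw_mul_sw_mul]
    -- comparison of a word beginning with `x` with another word of the same permutation
    have cmp : ∀ (x : Letter ν.degree) (u v : List (Letter ν.degree)), β x.1.1 = β x.1.2 →
        IsBlockWord β u → IsBlockWord β v → IsRed u → IsRed v → wordPerm u = wordPerm v →
        u.length + 1 = m → tl D x * tw D u - tl D x * tw D v ∈ low D β (m - 1) := by
      intro x u v hx hu hv hru hrv huv hum
      rw [← mul_sub]
      exact tl_mul_low (by push_cast [← hum]; omega) hx
        (ih u.length (by omega) u v hu hv hru hrv huv rfl)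
    by_cases hxx : x = x'
    · subst hxx
      rw [tw_cons, tw_cons]
      exact cmp x u u' hbx hbu hbu' hr.of_cons hr'.of_cons (by rw [hu, hu']) hm
    · have h1 : inv (sw x * w) + 1 = m := by
        rw [← hu, ← hr.of_cons, hm]
      have h1' : inv (sw x' * w) + 1 = m := by
        rw [← hu', ← hr'.of_cons, hl]
      by_cases hfar : x.1.2 < x'.1.1 ∨ x'.1.2 < x.1.1
      · have e1 := x.2
        have e2 := x'.2
        have hfar' := hfar
        simp only [Fin.lt_def] at hfar'
        have ne1 : x'.1.1 ≠ x.1.1 := fun h => by have := congrArg Fin.val h; omega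
        have ne2 : x'.1.1 ≠ x.1.2 := fun h => by have := congrArg Fin.val h; omega
        have ne3 : x'.1.2 ≠ x.1.1 := fun h => by have := congrArg Fin.val h; omega
        have ne4 : x'.1.2 ≠ x.1.2 := fun h => by have := congrArg Fin.val h; omega
        have hz : inv (sw x' * (sw x * w)) + 1 = inv (sw x * w) :=
          inv_sw_mul_of_gt _ _ (by
            rw [mul_inv_rev, sw_inv, Equiv.Perm.mul_apply, Equiv.Perm.mul_apply,
              sw_of_ne x ne1 ne2, sw_of_ne x ne3 ne4]
            exact gx')
        have hcomm : sw x' * (sw x * w) = sw x * (sw x' * w) := by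
          rw [← mul_assoc, ← mul_assoc]
          congr 1
          change sw x' * Equiv.swap x.1.1 x.1.2 = _
          rw [Equiv.mul_swap_eq_swap_mul, sw_of_ne x' ne1.symm ne3.symm,
            sw_of_ne x' ne2.symm ne4.symm]
          rfl
        obtain ⟨ζ, hζ, hζr, hζp⟩ := exists_reduced hβ (sw x' * (sw x * w)) (fun a => by
          rw [Equiv.Perm.mul_apply, Equiv.Perm.mul_apply, apply_sw hbx', apply_sw hbx, hwβ])
        have p1 : wordPerm (x' :: ζ) = sw x * w := by rw [wordPerm_cons, hζp, sw_mul_sw_mul]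
        have p2 : wordPerm (x :: ζ) = sw x' * w := by
          rw [wordPerm_cons, hζp, hcomm, sw_mul_sw_mul]
        have r1 : IsRed (x' :: ζ) := by rw [IsRed, p1, List.length_cons, hζr, hζp, hz]
        have r2 : IsRed (x :: ζ) := by rw [IsRed, p2, List.length_cons, hζr, hζp]; omega
        have c1 := cmp x u (x' :: ζ) hbx hbu (isBlockWord_cons.2 ⟨hbx', hζ⟩) hr.of_cons r1
          (by rw [hu, p1]) hm
        have c2 := cmp x' u' (x :: ζ) hbx' hbu' (isBlockWord_cons.2 ⟨hbx, hζ⟩) hr'.of_cons r2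
          (by rw [hu', p2]) hl
        have c3 := sub_mem c1 c2
        rw [tw_cons, tw_cons]
        rw [tw_cons, tw_cons, ← mul_assoc, ← mul_assoc, tl_comm x x' hfar] at c3
        simpa using c3
      · -- adjacent letters
        have adj : ∀ (x x' : Letter ν.degree) (u u' : List (Letter ν.degree)), x.1.2 = x'.1.1 →
            β x.1.1 = β x.1.2 → β x'.1.1 = β x'.1.2 → IsBlockWord β u → IsBlockWord β u' →
            IsRed u → IsRed u' → wordPerm u = sw x * w → wordPerm u' = sw x' * w →
            w⁻¹ x.1.2 < w⁻¹ x.1.1 → w⁻¹ x'.1.2 < w⁻¹ x'.1.1 → u.length + 1 = m →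
            u'.length + 1 = m → tl D x * tw D u - tl D x' * tw D u' ∈ low D β (m - 1) := by
          intro x x' u u' hadj hbx hbx' hbu hbu' hru hru' hu hu' gx gx' hm hl
          have hxx : x.1.1 ≠ x'.1.1 := hadj ▸ x.lt.ne
          have hxr : x.1.1 ≠ x'.1.2 := (x.lt.trans (hadj ▸ x'.lt)).ne
          have s1 : sw x x'.1.1 = x.1.1 := by rw [← hadj, sw_right]
          have s2 : sw x x'.1.2 = x'.1.2 := sw_of_ne x hxr.symm (hadj ▸ x'.lt.ne')
          have s3 : sw x' x.1.1 = x.1.1 := sw_of_ne x' hxx hxr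
          have s4 : sw x' x.1.2 = x'.1.2 := by rw [hadj, sw_left]
          have i1 : inv (sw x * w) + 1 = m := by rw [← hu, ← hru, hm]
          have i1' : inv (sw x' * w) + 1 = m := by rw [← hu', ← hru', hl]
          have z1 : inv (sw x' * (sw x * w)) + 1 = inv (sw x * w) := inv_sw_mul_of_gt _ _ (by
            rw [mul_inv_rev, sw_inv, Equiv.Perm.mul_apply, Equiv.Perm.mul_apply, s1, s2]
            rw [hadj] at gx; exact gx'.trans gx)
          have z1' : inv (sw x * (sw x' * w)) + 1 = inv (sw x' * w) := inv_sw_mul_of_gt _ _ (by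
            rw [mul_inv_rev, sw_inv, Equiv.Perm.mul_apply, Equiv.Perm.mul_apply, s3, s4]
            rw [hadj] at gx; exact gx'.trans gx)
          have z2 : inv (sw x * (sw x' * (sw x * w))) + 1 = inv (sw x' * (sw x * w)) :=
            inv_sw_mul_of_gt _ _ (by
              simp only [mul_inv_rev, sw_inv, Equiv.Perm.mul_apply]
              rw [s3, s4, sw_left, s2, hadj]; exact gx')
          have hbr : sw x * (sw x' * (sw x * w)) = sw x' * (sw x * (sw x' * w)) := by
            simp only [← mul_assoc]
            congr 1
            ext a
            congr 1
            simp only [Equiv.Perm.mul_apply]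
            by_cases ha1 : a = x.1.1
            · subst ha1
              rw [s3, sw_left, s4, s2]
            · by_cases ha2 : a = x'.1.1
              · subst ha2
                rw [s1, s3, sw_left, sw_left, s2, sw_right, hadj]
              · by_cases ha3 : a = x'.1.2
                · subst ha3
                  rw [s2, sw_right, s1, s3]
                · have ha4 : a ≠ x.1.2 := hadj ▸ ha2
                  rw [sw_of_ne x ha1 ha4, sw_of_ne x' ha2 ha3, sw_of_ne x ha1 ha4,
                    sw_of_ne x' ha2 ha3]
          obtain ⟨ζ, hζ, hζr, hζp⟩ := exists_reduced hβ (sw x * (sw x' * (sw x * w)))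
            (fun a => by
              simp only [Equiv.Perm.mul_apply]
              rw [apply_sw hbx, apply_sw hbx', apply_sw hbx, hwβ])
          have p1 : wordPerm (x' :: x :: ζ) = sw x * w := by simp [hζp]
          have p2 : wordPerm (x :: x' :: ζ) = sw x' * w := by simp [hζp, hbr]
          have r1 : IsRed (x' :: x :: ζ) := by
            rw [IsRed, p1, List.length_cons, List.length_cons, hζr, hζp]; omega
          have r2 : IsRed (x :: x' :: ζ) := by
            rw [IsRed, p2, List.length_cons, List.length_cons, hζr, hζp]; omega
          have c1 := cmp x u (x' :: x :: ζ) hbx hbu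
            (isBlockWord_cons.2 ⟨hbx', isBlockWord_cons.2 ⟨hbx, hζ⟩⟩) hru r1 (by rw [hu, p1]) hm
          have c2 := cmp x' u' (x :: x' :: ζ) hbx' hbu'
            (isBlockWord_cons.2 ⟨hbx, isBlockWord_cons.2 ⟨hbx', hζ⟩⟩) hru' r2 (by rw [hu', p2]) hl
          have c3 := poly_mul_tw hζ (tl_braid_mem (D := D) x x' hadj)
          have c4 := sub_mem (sub_mem c1 c2) (low_mono (m' := m - 1) (by
            rw [hζr, hζp]; omega) c3)
          convert c4 using 1
          simp only [tw_cons]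
          noncomm_ring
        rw [tw_cons, tw_cons]
        rcases lt_trichotomy x.1.1 x'.1.1 with h | h | h
        · have hadj : x.1.2 = x'.1.1 := Fin.ext (by
            have := x.2; have := x'.2; simp only [Fin.lt_def, not_or, not_lt] at *; omega)
          exact adj x x' u u' hadj hbx hbx' hbu hbu' hr.of_cons hr'.of_cons hu hu' gx gx' hm hl
        · exact absurd (Letter.ext_left h) hxx
        · have hadj : x'.1.2 = x.1.1 := Fin.ext (by
            have := x.2; have := x'.2; simp only [Fin.lt_def, not_or, not_lt] at *; omega)
          have := neg_mem
            (adj x' x u' u hadj hbx' hbx hbu' hbu hr'.of_cons hr.of_cons hu' hu gx' gx hl hm)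
          rwa [neg_sub] at this

theorem tw_mem_of_not_red (hβ : Monotone β) {ω : List (Letter ν.degree)} (hω : IsBlockWord β ω)
    (hr : ¬ IsRed ω) : tw D ω ∈ low D β ω.length := by
  induction ω with
  | nil => exact absurd (by simp [IsRed]) hr
  | cons x u ih =>
    obtain ⟨hx, hu⟩ := isBlockWord_cons.1 hω
    rw [tw_cons, List.length_cons]
    push_cast
    by_cases hru : IsRed u
    · rcases inv_sw_mul_cases (wordPerm u) x with ⟨h, _⟩ | ⟨_, h⟩
      · exact absurd (isRed_cons hru h) hr
      · obtain ⟨ζ, hζ, hζr, hζp⟩ := exists_reduced hβ (sw x * wordPerm u) (fun a => by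
          rw [Equiv.Perm.mul_apply, apply_sw hx, hu.apply])
        have p1 : wordPerm (x :: ζ) = wordPerm u := by simp [hζp]
        have r1 : IsRed (x :: ζ) := by rw [IsRed, p1, List.length_cons, hζr, hζp, h]
        have c1 := tl_mul_low (m' := u.length) (by omega) hx
          (tw_sub_mem (D := D) hβ _ u (x :: ζ) hu (isBlockWord_cons.2 ⟨hx, hζ⟩) hru r1 p1.symm rfl)
        have c2 := poly_mul_tw hζ (tl_sq_mem (D := D) x)
        have hlen : ζ.length + 1 = u.length := by rw [hru, ← p1, ← r1, List.length_cons]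
        have c3 := add_mem (low_mono (m' := (u.length : ℤ) + 1) (by omega) c1)
          (low_mono (m' := (u.length : ℤ) + 1) (by omega) c2)
        convert c3 using 1
        simp only [tw_cons]
        noncomm_ring
    · exact tl_mul_low le_rfl hx (ih hu hru)

end Low
end KLR

/-! ### The polynomial representation -/

section RationalFunctions

variable (k : Type u) [Field k] (n : ℕ)

/-- The field of rational functions in `n` variables. -/
abbrev Rat' := FractionRing (MvPolynomial (Fin n) k)

variable {k n}

instance : Field (Rat' k n) := inferInstance

instance : CommRing (Rat' k n) := inferInstance

instance : Ring (Rat' k n) := inferInstance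

instance : AddCommGroup (Rat' k n) := inferInstance

instance : AddCommMonoid (Rat' k n) := inferInstance

instance : Algebra k (Rat' k n) := inferInstance

instance : Module k (Rat' k n) := inferInstance

/-- A variable, as a rational function. -/
def xv (l : Fin n) : Rat' k n := algebraMap (MvPolynomial (Fin n) k) _ (MvPolynomial.X l)

/-- The action of a permutation on rational functions. -/
def pact (w : Equiv.Perm (Fin n)) : Rat' k n ≃ₐ[k] Rat' k n :=
  IsFractionRing.algEquivOfAlgEquiv (MvPolynomial.renameEquiv k w)

theorem pact_algebraMap (w : Equiv.Perm (Fin n)) (f : MvPolynomial (Fin n) k) :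
    pact w (algebraMap _ (Rat' k n) f) = algebraMap _ _ (MvPolynomial.rename w f) := by
  simp [pact]

@[simp] theorem pact_xv (w : Equiv.Perm (Fin n)) (l : Fin n) :
    pact (k := k) w (xv l) = xv (w l) := by
  rw [xv, pact_algebraMap, MvPolynomial.rename_X, xv]

@[simp] theorem pact_one (f : Rat' k n) : pact 1 f = f := by
  obtain ⟨x, y, -, rfl⟩ := IsFractionRing.div_surjective (MvPolynomial (Fin n) k) f
  simp [pact_algebraMap]

@[simp] theorem pact_pact (w w' : Equiv.Perm (Fin n)) (f : Rat' k n) :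
    pact w (pact w' f) = pact (w * w') f := by
  obtain ⟨x, y, -, rfl⟩ := IsFractionRing.div_surjective (MvPolynomial (Fin n) k) f
  simp [pact_algebraMap, MvPolynomial.rename_rename]

theorem xv_injective : Function.Injective (xv (k := k) (n := n)) :=
  (IsFractionRing.injective _ _).comp (MvPolynomial.X_injective)

theorem pact_injective {w w' : Equiv.Perm (Fin n)} (h : ∀ f, pact (k := k) w f = pact w' f) :
    w = w' :=
  Equiv.ext fun l => xv_injective (k := k) (by simpa using h (xv l))

theorem xv_sub_ne (x : Letter n) : xv (k := k) x.1.1 - xv x.1.2 ≠ 0 :=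
  sub_ne_zero.2 fun h => x.lt.ne (xv_injective h)

/-- A polynomial in two variables, evaluated at two rational functions. -/
def pv (P : MvPolynomial (Fin 2) k) (a b : Rat' k n) : Rat' k n := MvPolynomial.aeval ![a, b] P

theorem pact_pv (w : Equiv.Perm (Fin n)) (P : MvPolynomial (Fin 2) k) (a b : Rat' k n) :
    pact w (pv P a b) = pv P (pact w a) (pact w b) := by
  have : pact w (pv P a b) = (pact w).toAlgHom (pv P a b) := rfl
  rw [this, pv, pv, MvPolynomial.aeval_def, ← AlgHom.coe_toRingHom, MvPolynomial.hom_eval₂]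
  simp only [MvPolynomial.aeval_def]
  congr 1
  · ext; simp
  · funext i
    fin_cases i <;> rfl

theorem evalQ_eq_pv (P : MvPolynomial (Fin 2) k) (a b : Rat' k n) : evalQ P a b = pv P a b := by
  rw [pv, MvPolynomial.aeval_def, MvPolynomial.eval₂_eq', evalQ]
  refine Finset.sum_congr rfl fun m _ => ?_
  rw [Algebra.smul_def]
  simp [Fin.prod_univ_two]

theorem pv_rename (P : MvPolynomial (Fin 2) k) (a b : Rat' k n) :
    pv (MvPolynomial.rename (Equiv.swap 0 1) P) a b = pv P b a := by
  rw [pv, MvPolynomial.aeval_rename, pv]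
  congr 2
  funext i
  fin_cases i <;> simp

theorem pv_ne_zero {P : MvPolynomial (Fin 2) k} (hP : P ≠ 0) {p q : Fin n} (h : p ≠ q) :
    pv P (xv (k := k) p) (xv q) ≠ 0 := by
  have h1 : pv P (xv (k := k) p) (xv q) = algebraMap _ _ (MvPolynomial.rename ![p, q] P) := by
    rw [← MvPolynomial.aeval_X_left_apply (MvPolynomial.rename ![p, q] P),
      MvPolynomial.aeval_rename, pv, ← MvPolynomial.aeval_algebraMap_apply]
    congr 2
    funext i
    fin_cases i <;> rfl
  rw [h1, Ne, FaithfulSMul.algebraMap_eq_zero_iff,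
    map_eq_zero_iff _ (MvPolynomial.rename_injective _ _)]
  · exact hP
  · intro i j hij
    fin_cases i <;> fin_cases j <;> simp_all

end RationalFunctions

/-- A factorization `Q i j (u, v) = P i j (u, v) P j i (v, u)`. -/
structure Factorization {k : Type u} [Field k] {I : Type u} (D : FoldingDatum k I) where
  P : I → I → MvPolynomial (Fin 2) k
  spec : ∀ i j, i ≠ j → P i j * MvPolynomial.rename (Equiv.swap 0 1) (P j i) = D.Q i j

section Rep

variable {k : Type u} [Field k] {I : Type u} {D : FoldingDatum k I} (F : Factorization D)
  {ν : I →₀ ℕ}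

theorem FoldingDatum.Q_ne_zero {i j : I} (h : i ≠ j) : D.Q i j ≠ 0 := fun h0 => by
  have := D.Q_coeff_u i j h
  rw [h0] at this
  simp at this

theorem Factorization.P_ne_zero {i j : I} (h : i ≠ j) : F.P i j ≠ 0 := by
  intro h0
  have := F.spec i j h
  rw [h0, zero_mul] at this
  exact D.Q_ne_zero h this.symm

theorem Factorization.pv_mul {n : ℕ} {i j : I} (h : i ≠ j) (a b : Rat' k n) :
    pv (F.P i j) a b * pv (F.P j i) b a = pv (D.Q i j) a b := by
  rw [← F.spec i j h, ← pv_rename (F.P j i), pv, pv, pv, map_mul]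

/-- The space of the representation. -/
abbrev RepSpace (k : Type u) [Field k] {I : Type u} (ν : I →₀ ℕ) := Seq ν → Rat' k ν.degree

open Classical in
variable (k) in
/-- The operator that multiplies the `j`-component by a rational function. -/
def mulOp (c : Seq ν → Rat' k ν.degree) : Module.End k (RepSpace k ν) where
  toFun f j := c j * f j
  map_add' f g := funext fun j => mul_add _ _ _
  map_smul' a f := funext fun j => by simp

open Classical in
/-- The operator by which `τ` acts. -/
def tauOp (x : Letter ν.degree) : Module.End k (RepSpace k ν) where
  toFun f j := if j x.1.1 = j x.1.2 then (pact (sw x) (f j) - f j) / (xv x.1.1 - xv x.1.2) else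
    pv (F.P (j x.1.2) (j x.1.1)) (xv x.1.2) (xv x.1.1) * pact (sw x) (f (j.act (sw x)))
  map_add' f g := funext fun j => by
    simp only [Pi.add_apply, map_add]
    split_ifs <;> ring
  map_smul' a f := funext fun j => by
    simp only [Pi.smul_apply, map_smul, RingHom.id_apply]
    split_ifs
    · rw [← smul_sub, smul_div_assoc]
    · rw [mul_smul_comm]

theorem mulOp_apply (c : Seq ν → Rat' k ν.degree) (f : RepSpace k ν) (j : Seq ν) :
    mulOp k c f j = c j * f j := rfl

theorem tauOp_eq (x : Letter ν.degree) (f : RepSpace k ν) {j : Seq ν} (h : j x.1.1 = j x.1.2) :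
    tauOp F x f j = (pact (sw x) (f j) - f j) / (xv x.1.1 - xv x.1.2) := if_pos h

theorem tauOp_ne (x : Letter ν.degree) (f : RepSpace k ν) {j : Seq ν} (h : j x.1.1 ≠ j x.1.2) :
    tauOp F x f j = pv (F.P (j x.1.2) (j x.1.1)) (xv x.1.2) (xv x.1.1) *
      pact (sw x) (f (j.act (sw x))) := if_neg h

theorem act_eq_self (x : Letter ν.degree) {j : Seq ν} (h : j x.1.1 = j x.1.2) :
    j.act (sw x) = j := by
  refine Seq.ext fun l => ?_
  rw [Seq.act_apply, sw_inv]
  by_cases h1 : l = x.1.1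
  · rw [h1, sw_left, h]
  · by_cases h2 : l = x.1.2
    · rw [h2, sw_right, h]
    · rw [sw_of_ne x h1 h2]

theorem tauOp_sq (x : Letter ν.degree) : tauOp F x * tauOp F x =
    mulOp k fun j : Seq ν => pv (D.Q (j x.1.1) (j x.1.2)) (xv x.1.1) (xv x.1.2) := by
  refine LinearMap.ext fun f => funext fun j => ?_
  rw [Module.End.mul_apply, mulOp_apply]
  have hx := xv_sub_ne (k := k) x
  have hx' : xv (k := k) x.1.2 - xv x.1.1 ≠ 0 := fun h => hx (by rw [← neg_sub, h, neg_zero])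
  by_cases h : j x.1.1 = j x.1.2
  · rw [tauOp_eq F x _ h, tauOp_eq F x _ h]
    simp only [map_div₀, map_sub, pact_pact, pact_xv, sw_mul_self, pact_one, sw_left, sw_right]
    rw [← h, D.Q_self]
    simp only [pv, map_zero, zero_mul]
    field_simp
    ring
  · have h2 : (j.act (sw x)) x.1.1 ≠ (j.act (sw x)) x.1.2 := by
      simpa using Ne.symm h
    rw [tauOp_ne F x _ h, tauOp_ne F x _ h2, map_mul, pact_pv, pact_pact, Seq.act_act]
    simp only [Seq.act_apply, sw_inv, sw_left, sw_right, pact_xv, sw_mul_self, Seq.act_one,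
      pact_one]
    rw [← F.pv_mul h]
    ring

theorem tauOp_comm (x x' : Letter ν.degree) (h : x.1.2 < x'.1.1) :
    tauOp F x * tauOp F x' = tauOp F x' * tauOp F x := by
  have e1 := x.2
  have e2 := x'.2
  rw [Fin.lt_def] at h
  have ne1 : x'.1.1 ≠ x.1.1 := fun h => by have := congrArg Fin.val h; omega
  have ne2 : x'.1.1 ≠ x.1.2 := fun h => by have := congrArg Fin.val h; omega
  have ne3 : x'.1.2 ≠ x.1.1 := fun h => by have := congrArg Fin.val h; omega
  have ne4 : x'.1.2 ≠ x.1.2 := fun h => by have := congrArg Fin.val h; omega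
  have s1 := sw_of_ne x ne1 ne2
  have s2 := sw_of_ne x ne3 ne4
  have s3 := sw_of_ne x' ne1.symm ne3.symm
  have s4 := sw_of_ne x' ne2.symm ne4.symm
  have hcomm : sw x' * sw x = sw x * sw x' := by
    change sw x' * Equiv.swap x.1.1 x.1.2 = _
    rw [Equiv.mul_swap_eq_swap_mul, s3, s4]
    rfl
  have hx := xv_sub_ne (k := k) x
  have hx' := xv_sub_ne (k := k) x'
  refine LinearMap.ext fun f => funext fun j => ?_
  rw [Module.End.mul_apply, Module.End.mul_apply]
  have g1 : ∀ j : Seq ν, (j.act (sw x)) x'.1.1 = j x'.1.1 := fun j => by simp [s1]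
  have g2 : ∀ j : Seq ν, (j.act (sw x)) x'.1.2 = j x'.1.2 := fun j => by simp [s2]
  have g3 : ∀ j : Seq ν, (j.act (sw x')) x.1.1 = j x.1.1 := fun j => by simp [s3]
  have g4 : ∀ j : Seq ν, (j.act (sw x')) x.1.2 = j x.1.2 := fun j => by simp [s4]
  by_cases h1 : j x.1.1 = j x.1.2 <;> by_cases h2 : j x'.1.1 = j x'.1.2
  · rw [tauOp_eq F x _ h1, tauOp_eq F x' _ h2, tauOp_eq F x' _ h2, tauOp_eq F x _ h1]
    simp only [map_div₀, map_sub, pact_pact, pact_xv, s1, s2, s3, s4, hcomm]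
    field_simp
    ring
  · rw [tauOp_eq F x _ h1, tauOp_ne F x' _ h2, tauOp_ne F x' _ h2,
      tauOp_eq F x _ (by rwa [g3, g4])]
    simp only [map_div₀, map_sub, map_mul, pact_pv, pact_pact, pact_xv, s1, s2, s3, s4, hcomm]
    field_simp
  · rw [tauOp_ne F x _ h1, tauOp_eq F x' _ (by rwa [g1, g2]), tauOp_eq F x' _ h2,
      tauOp_ne F x _ h1]
    simp only [map_div₀, map_sub, map_mul, pact_pv, pact_pact, pact_xv, s1, s2, s3, s4, hcomm]
    field_simp
  · rw [tauOp_ne F x _ h1, tauOp_ne F x' _ (by rwa [g1, g2]), tauOp_ne F x' _ h2,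
      tauOp_ne F x _ (by rwa [g3, g4])]
    simp only [map_mul, pact_pv, pact_pact, pact_xv, s1, s2, s3, s4, g1, g2, g3, g4, Seq.act_act,
      hcomm]
    ring

open Classical in
theorem tauOp_braid (x x' : Letter ν.degree) (h : x.1.2 = x'.1.1) :
    tauOp F x' * tauOp F x * tauOp F x' - tauOp F x * tauOp F x' * tauOp F x =
      mulOp k fun j : Seq ν => if j x.1.1 = j x'.1.2 then
        (pv (D.Q (j x.1.1) (j x.1.2)) (xv x.1.1) (xv x.1.2) -
          pv (D.Q (j x.1.1) (j x.1.2)) (xv x'.1.2) (xv x.1.2)) / (xv x.1.1 - xv x'.1.2) else 0 := by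
  have hxx : x.1.1 ≠ x'.1.1 := h ▸ x.lt.ne
  have hxr : x.1.1 ≠ x'.1.2 := (x.lt.trans (h ▸ x'.lt)).ne
  have s1 : sw x x'.1.1 = x.1.1 := by rw [← h, sw_right]
  have s2 : sw x x'.1.2 = x'.1.2 := sw_of_ne x hxr.symm (h ▸ x'.lt.ne')
  have s3 : sw x' x.1.1 = x.1.1 := sw_of_ne x' hxx hxr
  have s0 : sw x x.1.1 = x'.1.1 := by rw [← h, sw_left]
  have hbr : sw x' * (sw x * sw x') = sw x * (sw x' * sw x) := by
    ext a
    congr 1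
    simp only [Equiv.Perm.mul_apply]
    by_cases ha1 : a = x.1.1
    · subst ha1
      rw [s3, s0, sw_left, s2]
    · by_cases ha2 : a = x'.1.1
      · subst ha2
        rw [s1, s3, sw_left, s2, sw_right, s0]
      · by_cases ha3 : a = x'.1.2
        · subst ha3
          rw [s2, sw_right, s1, s3]
        · have ha4 : a ≠ x.1.2 := h ▸ ha2
          rw [sw_of_ne x ha1 ha4, sw_of_ne x' ha2 ha3, sw_of_ne x ha1 ha4,
            sw_of_ne x' ha2 ha3]
  have d1 : xv (k := k) x.1.1 - xv x'.1.1 ≠ 0 := h ▸ xv_sub_ne (k := k) x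
  have d2 := xv_sub_ne (k := k) x'
  have d3 : xv (k := k) x.1.1 - xv x'.1.2 ≠ 0 := sub_ne_zero.2 fun h => hxr (xv_injective h)
  have c1 : ∀ j : Seq ν, (j.act (sw x)) x.1.1 = j x'.1.1 := fun j => by simp [h]
  have c2 : ∀ j : Seq ν, (j.act (sw x)) x'.1.1 = j x.1.1 := fun j => by simp [s1]
  have c3 : ∀ j : Seq ν, (j.act (sw x)) x'.1.2 = j x'.1.2 := fun j => by simp [s2]
  have c4 : ∀ j : Seq ν, (j.act (sw x')) x.1.1 = j x.1.1 := fun j => by simp [s3]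
  have c5 : ∀ j : Seq ν, (j.act (sw x')) x'.1.1 = j x'.1.2 := fun j => by simp
  have c6 : ∀ j : Seq ν, (j.act (sw x')) x'.1.2 = j x'.1.1 := fun j => by simp
  have e1 := sw_left x'
  have e2 := sw_right x'
  have q1 := sw_mul_self x
  have q2 := sw_mul_self x'
  have pe : ∀ f (j : Seq ν), tauOp F x f j = if j x.1.1 = j x'.1.1 then
      (pact (sw x) (f j) - f j) / (xv x.1.1 - xv x'.1.1) else
      pv (F.P (j x'.1.1) (j x.1.1)) (xv x'.1.1) (xv x.1.1) *
      pact (sw x) (f (j.act (sw x))) := fun f j => h ▸ rfl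
  have pe' : ∀ f (j : Seq ν), tauOp F x' f j = if j x'.1.1 = j x'.1.2 then
      (pact (sw x') (f j) - f j) / (xv x'.1.1 - xv x'.1.2) else
      pv (F.P (j x'.1.2) (j x'.1.1)) (xv x'.1.2) (xv x'.1.1) *
      pact (sw x') (f (j.act (sw x'))) := fun f j => rfl
  refine LinearMap.ext fun f => funext fun j => ?_
  rw [LinearMap.sub_apply, Pi.sub_apply, mulOp_apply, h]
  simp only [Module.End.mul_apply]
  have hF := fun {i i' : I} (hi : i ≠ i') (a b : Rat' k ν.degree) => F.pv_mul hi a b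
  have hss : ∀ j : Seq ν, (j.act (sw x)).act (sw x) = j := fun j => by
    rw [Seq.act_act, q1, Seq.act_one]
  have hss' : ∀ j : Seq ν, (j.act (sw x')).act (sw x') = j := fun j => by
    rw [Seq.act_act, q2, Seq.act_one]
  have hbs : ∀ j : Seq ν, ((j.act (sw x')).act (sw x)).act (sw x') =
      ((j.act (sw x)).act (sw x')).act (sw x) := fun j => by
    simp only [Seq.act_act, hbr]
  have d1' : xv (k := k) x'.1.1 - xv x.1.1 ≠ 0 := fun h => d1 (by rw [← neg_sub, h, neg_zero])
  have d2' : xv (k := k) x'.1.2 - xv x'.1.1 ≠ 0 := fun h => d2 (by rw [← neg_sub, h, neg_zero])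
  have d3' : xv (k := k) x'.1.2 - xv x.1.1 ≠ 0 := fun h => d3 (by rw [← neg_sub, h, neg_zero])
  have q1' : ∀ w, sw x * (sw x * w) = w := sw_mul_sw_mul x
  have q2' : ∀ w, sw x' * (sw x' * w) = w := sw_mul_sw_mul x'
  clear h hxx hxr
  generalize x.1.1 = p, x'.1.1 = q, x'.1.2 = r, sw x = s, sw x' = s', tauOp F x = A,
    tauOp F x' = B at *
  by_cases hab : j p = j q
  · by_cases hbc : j q = j r
    · have hac := hab.trans hbc
      simp only [pe, pe', c1, c2, c3, c4, c5, c6, hab, hbc, if_true, map_sub, map_div₀, pact_pact,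
        pact_xv, e1, e2, s1, s2, s3, s0, mul_assoc, hbr, q1, q2, q1', q2', pact_one, D.Q_self]
      simp only [pv, map_zero]
      field_simp
      ring
    · have hac : ¬ j p = j r := fun h => hbc (hab.symm.trans h)
      simp only [pe, pe', c1, c2, c3, c4, c5, c6, hab, hbc, if_true, if_false, map_sub, map_div₀,
        pact_pact, map_mul, pact_pv, pact_xv, e1, e2, s1, s2, s3, s0, hbr, q1, q2, pact_one,
        mul_assoc]
      field_simp
      ring
  · by_cases hbc : j q = j r
    · have hba : ¬ j r = j p := fun h => hab (h.symm.trans hbc.symm)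
      have hac : ¬ j p = j r := fun h => hab (h.trans hbc.symm)
      have hca : ¬ j p = j r := fun h => hab (h.trans hbc.symm)
      simp only [pe, pe', c1, c2, c3, c4, c5, c6, hab, hbc, hac, hba, hca, if_true, if_false,
        map_sub, map_div₀, pact_pact, map_mul, pact_pv, pact_xv, e1, e2, s1, s2, s3, s0, hbr, q1,
        q2, pact_one, mul_assoc]
      field_simp
      ring
    · by_cases hac : j p = j r
      · have hab' : ¬ j r = j q := fun h => hbc h.symm
        simp only [pe, pe', c1, c2, c3, c4, c5, c6, hac, hab', hbc, if_true, if_false,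
          map_sub, map_div₀, pact_pact, map_mul, pact_pv, pact_xv, e1, e2, s1, s2, s3, s0, hbr, q1,
          q2, q1', q2', hss, hss', pact_one, mul_assoc]
        rw [← hF hab', ← hF hab']
        field_simp
        ring
      · have hba : ¬ j q = j p := fun h => hab h.symm
        have hca : ¬ j r = j p := fun h => hac h.symm
        simp only [pe, pe', c1, c2, c3, c4, c5, c6, hab, hac, hbc, hba, hca, if_false,
          pact_pact, map_mul, pact_pv, pact_xv, e1, e2, s1, s2, s3, s0, hbr, hbs, mul_assoc]
        ring

end Rep

section Rep

variable {k : Type u} [Field k] {I : Type u} {D : FoldingDatum k I} (F : Factorization D)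
  {ν : I →₀ ℕ}

theorem mulOp_eq_lmul (c : Seq ν → Rat' k ν.degree) :
    mulOp k c = Algebra.lmul k (Seq ν → Rat' k ν.degree) c := rfl

theorem mulOp_mul (c c' : Seq ν → Rat' k ν.degree) : mulOp k c * mulOp k c' = mulOp k (c * c') := by
  simp only [mulOp_eq_lmul, map_mul]

open Classical in
variable (k) in
/-- The projection to a component. -/
def projOp (i : Seq ν) : Module.End k (RepSpace k ν) := mulOp k (Pi.single i 1)

variable (k) in
/-- The multiplication by a variable. -/
def varOp (p : Fin ν.degree) : Module.End k (RepSpace k ν) := mulOp k fun _ => xv p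

theorem varOp_apply (p : Fin ν.degree) (f : RepSpace k ν) (j : Seq ν) :
    varOp k p f j = xv p * f j := rfl

open Classical in
theorem projOp_apply (i : Seq ν) (f : RepSpace k ν) (j : Seq ν) :
    projOp k i f j = if j = i then f j else 0 := by
  rw [projOp, mulOp_apply, Pi.single_apply]
  split_ifs <;> simp

theorem evalQ_varOp (Q : MvPolynomial (Fin 2) k) (p q : Fin ν.degree) :
    evalQ Q (varOp k (ν := ν) p) (varOp k q) = mulOp k fun _ => pv Q (xv p) (xv q) := by
  rw [varOp, varOp, mulOp_eq_lmul, mulOp_eq_lmul, ← map_evalQ, mulOp_eq_lmul]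
  congr 1
  funext j
  rw [← evalQ_eq_pv]
  exact map_evalQ (Pi.evalAlgHom k (fun _ : Seq ν => Rat' k ν.degree) j) _ _ _

theorem evalDQ_varOp (Q : MvPolynomial (Fin 2) k) {p q r : Fin ν.degree} (hpr : p ≠ r) :
    evalDQ Q (varOp k (ν := ν) p) (varOp k q) (varOp k r) = mulOp k fun _ =>
      (pv Q (xv p) (xv q) - pv Q (xv r) (xv q)) / (xv p - xv r) := by
  rw [varOp, varOp, varOp, mulOp_eq_lmul, mulOp_eq_lmul, mulOp_eq_lmul, ← map_evalDQ, mulOp_eq_lmul]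
  congr 1
  funext j
  have h := map_evalDQ (Pi.evalAlgHom k (fun _ : Seq ν => Rat' k ν.degree) j) Q
    (fun _ => xv p) (fun _ => xv q) (fun _ => xv r)
  refine Eq.trans h ?_
  rw [← evalQ_eq_pv, ← evalQ_eq_pv,
    ← evalDQ_mul Q (Commute.all _ _) (Commute.all _ _) (Commute.all _ _)]
  rw [mul_div_cancel_right₀]
  · rfl
  · exact sub_ne_zero.2 fun h => hpr (xv_injective h)

theorem eq_zero_of_swap {x : Letter ν.degree} {i j : Seq ν} (h : i ≠ j)
    (hj : j x.1.1 = j x.1.2) : i.act (sw x) ≠ j := fun h' =>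
  h (by rw [Seq.act_eq_iff.1 h', sw_inv, act_eq_self x hj])

theorem repFamily : IsFamily D ν (projOp k) (varOp k)
    (fun p q h => tauOp F (⟨(p, q), h⟩ : Letter ν.degree)) where
  e_mul_self i := by
    classical
    rw [projOp, mulOp_mul]
    congr 1
    rw [← Pi.single_mul, mul_one]
  e_mul_ne i j hij := by
    classical
    refine LinearMap.ext fun f => funext fun l => ?_
    rw [Module.End.mul_apply, projOp_apply, projOp_apply]
    split_ifs with h1 h2
    · exact absurd (h1.symm.trans h2) hij
    · rfl
    · rfl
  y_comm p q := by simp only [varOp, mulOp_mul, mul_comm]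
  y_e p i := by simp only [varOp, projOp, mulOp_mul, mul_comm]
  tau_e p q h i := by
    classical
    set x : Letter ν.degree := ⟨(p, q), h⟩ with hx
    refine LinearMap.ext fun f => funext fun j => ?_
    rw [Module.End.mul_apply, Module.End.mul_apply, projOp_apply,
      ← show i.act (sw x) = i.swap p q from Seq.act_sw x i]
    by_cases hj : j x.1.1 = j x.1.2
    · rw [tauOp_eq F x _ hj, tauOp_eq F x _ hj, projOp_apply]
      by_cases hij : j = i
      · subst hij
        simp only [act_eq_self x hj, if_true]
      · rw [if_neg hij, if_neg (eq_zero_of_swap (Ne.symm hij) hj).symm]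
        simp
    · rw [tauOp_ne F x _ hj, tauOp_ne F x _ hj, projOp_apply]
      by_cases hij : j = i.act (sw x)
      · rw [if_pos hij, if_pos]
        rw [hij, Seq.act_act, sw_mul_self, Seq.act_one]
      · rw [if_neg hij, if_neg]
        · simp
        · intro h'
          exact hij (by rw [← h', Seq.act_act, sw_mul_self, Seq.act_one])
  tau_comm p q h p' q' h' hq := tauOp_comm F _ _ hq
  tau_sq p q h i := by
    classical
    rw [tauOp_sq, evalQ_varOp]
    refine LinearMap.ext fun f => funext fun j => ?_
    rw [Module.End.mul_apply, Module.End.mul_apply, mulOp_apply, mulOp_apply, projOp_apply]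
    split_ifs with hj
    · rw [hj]
    · simp
  tau_y_left p q h i hi := by
    classical
    set x : Letter ν.degree := ⟨(p, q), h⟩ with hx
    have hx := xv_sub_ne (k := k) x
    refine LinearMap.ext fun f => funext fun j => ?_
    simp only [Module.End.mul_apply, LinearMap.sub_apply, LinearMap.neg_apply, Pi.sub_apply,
      Pi.neg_apply, varOp_apply]
    by_cases hj : j x.1.1 = j x.1.2
    · rw [tauOp_eq F x _ hj, tauOp_eq F x _ hj, varOp_apply, projOp_apply]
      split_ifs
      · rw [map_mul, show p = x.1.1 from rfl, pact_xv, sw_left, show q = x.1.2 from rfl]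
        field_simp
        ring
      · simp
    · rw [tauOp_ne F x _ hj, tauOp_ne F x _ hj, varOp_apply, projOp_apply, projOp_apply, if_neg,
        if_neg]
      · simp
      · rintro rfl; exact hj hi
      · intro h'
        rw [Seq.act_eq_iff, sw_inv, act_eq_self x hi] at h'
        exact hj (h' ▸ hi)
  tau_y_right p q h i hi := by
    classical
    set x : Letter ν.degree := ⟨(p, q), h⟩ with hx
    have hx := xv_sub_ne (k := k) x
    refine LinearMap.ext fun f => funext fun j => ?_
    simp only [Module.End.mul_apply, LinearMap.sub_apply, LinearMap.neg_apply, Pi.sub_apply,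
      Pi.neg_apply, varOp_apply]
    by_cases hj : j x.1.1 = j x.1.2
    · rw [tauOp_eq F x _ hj, tauOp_eq F x _ hj, varOp_apply, projOp_apply]
      split_ifs
      · rw [map_mul, show q = x.1.2 from rfl, pact_xv, sw_right, show p = x.1.1 from rfl]
        field_simp
        ring
      · simp
    · rw [tauOp_ne F x _ hj, tauOp_ne F x _ hj, varOp_apply, projOp_apply, projOp_apply, if_neg,
        if_neg]
      · simp
      · rintro rfl; exact hj hi
      · intro h'
        rw [Seq.act_eq_iff, sw_inv, act_eq_self x hi] at h'
        exact hj (h' ▸ hi)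
  tau_y p q h l i hi := by
    classical
    set x : Letter ν.degree := ⟨(p, q), h⟩ with hx
    refine LinearMap.ext fun f => funext fun j => ?_
    simp only [Module.End.mul_apply, LinearMap.sub_apply, LinearMap.zero_apply, Pi.sub_apply,
      Pi.zero_apply, varOp_apply]
    rw [← show sw x l = Equiv.swap p q l from rfl]
    by_cases hj : j x.1.1 = j x.1.2
    · rw [tauOp_eq F x _ hj, tauOp_eq F x _ hj, varOp_apply, projOp_apply]
      split_ifs with hji
      · have hl : sw x l = l := by
          rw [← hji] at hi
          refine sw_of_ne x (fun h => hi ⟨hj, Or.inl h⟩) (fun h => hi ⟨hj, Or.inr h⟩)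
        rw [map_mul, pact_xv, hl]
        ring
      · simp
    · rw [tauOp_ne F x _ hj, tauOp_ne F x _ hj, varOp_apply, map_mul, pact_xv]
      ring
  braid_eq p q r h h' i hi := by
    classical
    rw [tauOp_braid F ⟨(p, q), h⟩ ⟨(q, r), h'⟩ rfl, evalDQ_varOp _ (by
      rintro rfl; omega)]
    refine LinearMap.ext fun f => funext fun j => ?_
    rw [Module.End.mul_apply, Module.End.mul_apply, mulOp_apply, mulOp_apply, projOp_apply]
    by_cases hj : j = i
    · subst hj
      simp only [if_true]
      rw [if_pos hi]
    · simp [hj]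
  braid_ne p q r h h' i hi := by
    classical
    rw [tauOp_braid F ⟨(p, q), h⟩ ⟨(q, r), h'⟩ rfl]
    refine LinearMap.ext fun f => funext fun j => ?_
    rw [Module.End.mul_apply, mulOp_apply, projOp_apply]
    by_cases hj : j = i
    · subst hj
      simp only [if_true]
      rw [if_neg hi]
      simp
    · simp [hj]

theorem sum_projOp : ∑ i : Seq ν, projOp k i = 1 := by
  classical
  refine LinearMap.ext fun f => funext fun j => ?_
  rw [LinearMap.sum_apply, Finset.sum_apply]
  simp [projOp_apply]

/-- The representation on vectors of rational functions. -/
def rep : KLR D ν →ₐ[k] Module.End k (RepSpace k ν) := KLR.lift D (repFamily F) sum_projOp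

@[simp] theorem rep_e (i : Seq ν) : rep F (KLR.e D i) = projOp k i :=
  KLR.lift_e _ (repFamily F) sum_projOp i
@[simp] theorem rep_y (p : Fin ν.degree) : rep F (KLR.y D p) = varOp k p :=
  KLR.lift_y _ (repFamily F) sum_projOp p
@[simp] theorem rep_tl (x : Letter ν.degree) : rep F (KLR.tl D x) = tauOp F x :=
  KLR.lift_tau _ (repFamily F) sum_projOp _ _ _

theorem tauOp_single [DecidableEq (Seq ν)] (x : Letter ν.degree) (i : Seq ν) :
    ∃ c d : Rat' k ν.degree, c ≠ 0 ∧ ∀ g, tauOp F x (Pi.single i g) =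
      Pi.single (i.act (sw x)) (c * pact (sw x) g) + Pi.single i (d * g) := by
  by_cases hi : i x.1.1 = i x.1.2
  · have hx := xv_sub_ne (k := k) x
    refine ⟨(xv x.1.1 - xv x.1.2)⁻¹, -(xv x.1.1 - xv x.1.2)⁻¹, inv_ne_zero hx,
      fun g => funext fun j => ?_⟩
    rw [act_eq_self x hi, ← Pi.single_add]
    by_cases hj : j x.1.1 = j x.1.2
    · rw [tauOp_eq F x _ hj]
      by_cases hij : j = i
      · subst hij
        simp only [Pi.single_eq_same]
        field_simp
        ring
      · simp [hij]
    · have hij : j ≠ i := by rintro rfl; exact hj hi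
      have hij' : j.act (sw x) ≠ i := fun h' => by
        rw [Seq.act_eq_iff, sw_inv, act_eq_self x hi] at h'
        exact hij h'
      rw [tauOp_ne F x _ hj, Pi.single_eq_of_ne hij, Pi.single_eq_of_ne hij']
      simp
  · refine ⟨pv (F.P (i x.1.1) (i x.1.2)) (xv x.1.2) (xv x.1.1), 0,
      pv_ne_zero (F.P_ne_zero hi) x.lt.ne', fun g => funext fun j => ?_⟩
    simp only [zero_mul, Pi.single_zero, add_zero]
    by_cases hj : j x.1.1 = j x.1.2
    · have hij : j ≠ i := by rintro rfl; exact hi hj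
      have hij' : j ≠ i.act (sw x) := fun h' => by
        rw [h'] at hj
        simp at hj
        exact hi hj.symm
      rw [tauOp_eq F x _ hj, Pi.single_eq_of_ne hij, Pi.single_eq_of_ne hij']
      simp
    · rw [tauOp_ne F x _ hj]
      by_cases hij : j.act (sw x) = i
      · have hij' : j = i.act (sw x) := by rw [← hij, Seq.act_act, sw_mul_self, Seq.act_one]
        rw [hij, hij']
        simp
      · have hij' : j ≠ i.act (sw x) := fun h' => by
          rw [h', Seq.act_act, sw_mul_self, Seq.act_one] at hij
          exact hij rfl
        rw [Pi.single_eq_of_ne hij, Pi.single_eq_of_ne hij']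
        simp

/-- The action of a product of generators `τ`, to leading order. -/
theorem rep_tw_single [DecidableEq (Seq ν)] (ω : List (Letter ν.degree)) (i : Seq ν) :
    ∃ c : Equiv.Perm (Fin ν.degree) → Rat' k ν.degree,
      (∀ g, rep F (KLR.tw D ω) (Pi.single i g) =
        ∑ v, Pi.single (i.act v) (c v * pact v g)) ∧
      (∀ v, c v ≠ 0 → inv v ≤ ω.length ∧ (inv v = ω.length → v = wordPerm ω)) ∧
      (IsRed ω → c (wordPerm ω) ≠ 0) := by
  induction ω with
  | nil =>
    refine ⟨Pi.single 1 1, fun g => ?_, fun v hv => ?_, fun _ => ?_⟩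
    · rw [Finset.sum_eq_single 1]
      · simp
      · intro v _ hv; simp [hv]
      · simp
    · have : v = 1 := by by_contra h; simp [h] at hv
      simp [this]
    · simp
  | cons x ω ih =>
    obtain ⟨c, hc1, hc2, hc3⟩ := ih
    choose d d' hd hdd using tauOp_single F (ν := ν) x
    have key : ∀ u, inv u = ω.length + 1 → c u = 0 := fun u hu => by
      by_contra h
      have := (hc2 u h).1
      omega
    refine ⟨fun u => d (i.act (sw x * u)) * pact (sw x) (c (sw x * u)) + d' (i.act u) * c u,
      fun g => ?_, fun u hu => ?_, fun hr => ?_⟩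
    · rw [KLR.tw_cons, map_mul, Module.End.mul_apply, hc1, rep_tl, map_sum]
      simp only [hdd, map_mul, pact_pact, Seq.act_act, add_mul, Pi.single_add,
        Finset.sum_add_distrib]
      congr 1
      · rw [← Equiv.sum_comp (Equiv.mulLeft (sw x))]
        simp [mul_assoc]
      · simp [mul_assoc]
    · have hlen := inv_sw_mul_cases u x
      rw [List.length_cons]
      have h0 : c (sw x * u) ≠ 0 ∨ c u ≠ 0 := by
        by_contra! h
        simp [h.1, h.2] at hu
      refine ⟨?_, fun hl => ?_⟩
      · rcases h0 with h0 | h0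
        · have := (hc2 _ h0).1; omega
        · have := (hc2 _ h0).1; omega
      · have h1 := key u hl
        have h2 : c (sw x * u) ≠ 0 := by tauto
        have h3 := (hc2 _ h2).2 (by have := (hc2 _ h2).1; omega)
        rw [wordPerm_cons, ← h3, sw_mul_sw_mul]
    · have h1 := key (wordPerm (x :: ω)) (by rw [← hr, List.length_cons])
      simp only [h1, mul_zero, add_zero]
      rw [wordPerm_cons, sw_mul_sw_mul]
      exact mul_ne_zero (hd _) (by simpa using hc3 hr.of_cons)

end Rep

namespace KLR

variable {k : Type u} [Field k] {I : Type u} {D : FoldingDatum k I} {ν : I →₀ ℕ}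

variable (D ν) in
/-- The subalgebra generated by the `y`'s. -/
def ySub : Subalgebra k (KLR D ν) := Algebra.adjoin k (Set.range (y D))

theorem ySub_comm (a b : ySub D ν) : a * b = b * a := by
  have h : ∀ a ∈ Set.range (y D (ν := ν)), ∀ b ∈ Set.range (y D (ν := ν)), a * b = b * a := by
    rintro _ ⟨p, rfl⟩ _ ⟨q, rfl⟩
    exact (isFamily D).y_comm p q
  exact (Algebra.isMulCommutative_adjoin k h).is_comm.comm a b

instance : CommRing (ySub D ν) := { (ySub D ν).toRing with mul_comm := ySub_comm }

variable (D ν) in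
/-- The evaluation of polynomials at the `y`'s. -/
def ev : MvPolynomial (Fin ν.degree) k →ₐ[k] KLR D ν :=
  (ySub D ν).val.comp (MvPolynomial.aeval fun p =>
    (⟨y D p, Algebra.subset_adjoin ⟨p, rfl⟩⟩ : ySub D ν))

@[simp] theorem ev_X (p : Fin ν.degree) : ev D ν (MvPolynomial.X p) = y D p := by
  simp [ev]

theorem ev_mem (f : MvPolynomial (Fin ν.degree) k) : ev D ν f ∈ polySub D ν :=
  (Algebra.adjoin_mono (Set.subset_union_left) :
    ySub D ν ≤ polySub D ν) (Subtype.property _)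

theorem exists_ev {f : KLR D ν} (hf : f ∈ polySub D ν) (i : Seq ν) :
    ∃ g, f * e D i = ev D ν g * e D i := by
  induction hf using Algebra.adjoin_induction with
  | mem x hx =>
    rcases hx with ⟨p, rfl⟩ | ⟨j, rfl⟩
    · exact ⟨MvPolynomial.X p, by rw [ev_X]⟩
    · by_cases h : j = i
      · exact ⟨1, by rw [h, (isFamily D).e_mul_self, map_one, one_mul]⟩
      · exact ⟨0, by rw [(isFamily D).e_mul_ne _ _ h, map_zero, zero_mul]⟩
  | algebraMap c => exact ⟨MvPolynomial.C c, by
      rw [← MvPolynomial.algebraMap_eq, AlgHom.commutes]⟩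
  | add x y _ _ hx hy =>
    obtain ⟨g, hg⟩ := hx
    obtain ⟨g', hg'⟩ := hy
    exact ⟨g + g', by rw [add_mul, hg, hg', map_add, add_mul]⟩
  | mul x y hxm hym hx hy =>
    obtain ⟨g, hg⟩ := hx
    obtain ⟨g', hg'⟩ := hy
    refine ⟨g * g', ?_⟩
    rw [mul_assoc, hg', ← mul_assoc, mul_assoc, (commute_e_of_mem (ev_mem g') i).eq, ← mul_assoc,
      hg, mul_assoc, ← (commute_e_of_mem (ev_mem g') i).eq, ← mul_assoc, map_mul]

theorem rep_ev (F : Factorization D) (f : MvPolynomial (Fin ν.degree) k) :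
    rep F (ev D ν f) = mulOp k fun _ => algebraMap _ (Rat' k ν.degree) f := by
  have : (rep F).comp (ev D ν) = (Algebra.lmul k (Seq ν → Rat' k ν.degree)).comp
      (Pi.algHom k (fun _ : Seq ν => Rat' k ν.degree) fun _ => IsScalarTower.toAlgHom k _ _) := by
    refine MvPolynomial.algHom_ext fun p => ?_
    rw [AlgHom.comp_apply, ev_X, rep_y, varOp, mulOp_eq_lmul]
    rfl
  exact DFunLike.congr_fun this f

/-- The products of reduced words of different permutations are linearly independent over the
polynomials. -/
theorem eq_zero_of_sum_tw (F : Factorization D) {Z : Type*} (s : Finset Z)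
    (ω : Z → List (Letter ν.degree))
    (hred : ∀ z, IsRed (ω z)) (hinj : Function.Injective fun z => wordPerm (ω z)) (i : Seq ν)
    (f : Z → MvPolynomial (Fin ν.degree) k)
    (h : ∑ z ∈ s, tw D (ω z) * ev D ν (f z) * e D i = 0) : ∀ z ∈ s, f z = 0 := by
  classical
  choose c hc1 hc2 hc3 using fun z => rep_tw_single F (ω z) i
  have h1 : ∀ (z) (g : Rat' k ν.degree), rep F (tw D (ω z) * ev D ν (f z) * e D i) (Pi.single i g) =
      ∑ v, Pi.single (i.act v) (c z v * pact v (algebraMap _ _ (f z)) * pact v g) := by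
    intro z g
    have h2 : projOp k i (Pi.single i g) = Pi.single i g := by
      funext j
      rw [projOp_apply]
      split_ifs with h
      · rfl
      · rw [Pi.single_eq_of_ne h]
    have h3 : (mulOp k fun _ => algebraMap _ (Rat' k ν.degree) (f z)) (Pi.single i g) =
        Pi.single i (algebraMap _ _ (f z) * g) := by
      funext j
      rw [mulOp_apply]
      by_cases h : j = i
      · subst h; simp
      · simp [h]
    rw [map_mul, map_mul, Module.End.mul_apply, Module.End.mul_apply, rep_e, rep_ev, h2, h3, hc1]
    simp only [map_mul, mul_assoc]
  have h2 : ∀ v, ∑ z ∈ s, c z v * pact v (algebraMap _ _ (f z)) = 0 := by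
    have hli := linearIndependent_monoidHom (Rat' k ν.degree) (Rat' k ν.degree)
    have hinj' : Function.Injective
        (fun v : Equiv.Perm (Fin ν.degree) => (pact (k := k) v : Rat' k ν.degree →* _)) :=
      fun v v' hv => pact_injective (k := k) fun g =>
        congrArg (fun m : Rat' k ν.degree →* Rat' k ν.degree => m g) hv
    have := Fintype.linearIndependent_iff.1 (hli.comp _ hinj')
      (fun v => ∑ z ∈ s, c z v * pact v (algebraMap _ _ (f z))) ?_
    · exact this
    · funext g
      have h4 := congrArg (fun a => ∑ j, rep F a (Pi.single i g) j) h
      simp only [map_sum, LinearMap.sum_apply, h1, Finset.sum_apply, map_zero,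
        LinearMap.zero_apply, Pi.zero_apply, Finset.sum_const_zero] at h4
      rw [Finset.sum_comm] at h4
      simp only [Finset.sum_comm (s := (Finset.univ : Finset (Seq ν))), Finset.sum_pi_single',
        Finset.mem_univ, Pi.single_apply, if_true, Finset.sum_ite_eq', Finset.sum_ite_eq] at h4
      rw [Finset.sum_comm] at h4
      simpa [Finset.sum_mul] using h4
  by_contra! hne
  obtain ⟨z0, hz0, hf0⟩ := hne
  obtain ⟨z, hz, hmax⟩ := Finset.exists_max_image (s.filter fun z => f z ≠ 0)
    (fun z => (ω z).length) ⟨z0, Finset.mem_filter.2 ⟨hz0, hf0⟩⟩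
  rw [Finset.mem_filter] at hz
  have h3 := h2 (wordPerm (ω z))
  rw [Finset.sum_eq_single_of_mem z hz.1] at h3
  · have h5 : algebraMap _ (Rat' k ν.degree) (f z) = 0 := by
      simpa [hc3 z (hred z)] using h3
    rw [FaithfulSMul.algebraMap_eq_zero_iff] at h5
    exact hz.2 h5
  · intro z' hz' hzz
    by_cases hf : f z' = 0
    · simp [hf]
    · have hle := hmax z' (Finset.mem_filter.2 ⟨hz', hf⟩)
      have : c z' (wordPerm (ω z)) = 0 := by
        by_contra hne
        have h4 := hc2 z' _ hne
        rw [← hred z] at h4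
        exact hzz (hinj (h4.2 (by omega)).symm)
      rw [this, zero_mul]

end KLR

namespace KLR

section Positions

variable {I : Type u} {κ : I →₀ ℕ} {l : ℕ} {ν : Fin l → I →₀ ℕ} (h : ∑ j, ν j = κ)

theorem pos_bijective :
    Function.Bijective fun x : Σ j, Fin (ν j).degree => pos h x.1 x.2 := by
  refine (Fintype.bijective_iff_injective_and_card _).2 ⟨?_, ?_⟩
  · rintro ⟨j, p⟩ ⟨j', p'⟩ hp
    by_cases hj : j = j'
    · subst hj
      obtain rfl := pos_injective h j hp
      rfl
    · exact absurd hp (pos_ne h hj p p')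
  · rw [Fintype.card_sigma, Fintype.card_fin, ← h, map_sum]
    simp only [Fintype.card_fin]

/-- The positions of a concatenation. -/
def posEquiv : (Σ j, Fin (ν j).degree) ≃ Fin κ.degree := Equiv.ofBijective _ (pos_bijective h)

/-- The block of a position. -/
def blk (c : Fin κ.degree) : Fin l := ((posEquiv h).symm c).1

@[simp] theorem posEquiv_symm_pos (j : Fin l) (p : Fin (ν j).degree) :
    (posEquiv h).symm (pos h j p) = ⟨j, p⟩ :=
  (posEquiv h).symm_apply_apply ⟨j, p⟩

@[simp] theorem blk_pos (j : Fin l) (p : Fin (ν j).degree) : blk h (pos h j p) = j := by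
  rw [blk, posEquiv_symm_pos]

theorem exists_pos (c : Fin κ.degree) : ∃ p, pos h (blk h c) p = c :=
  ⟨((posEquiv h).symm c).2, (posEquiv h).apply_symm_apply c⟩

theorem exists_pos_of {c : Fin κ.degree} {j : Fin l} (hc : blk h c = j) : ∃ p, pos h j p = c := by
  subst hc
  exact exists_pos h c

theorem pos_lt_iff (j : Fin l) {p q : Fin (ν j).degree} : pos h j p < pos h j q ↔ p < q := by
  rw [Fin.lt_def, Fin.lt_def]
  exact Nat.add_lt_add_iff_left

theorem monotone_blk : Monotone (blk h) := by
  intro c d hcd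
  obtain ⟨p, hp⟩ := exists_pos h c
  obtain ⟨q, hq⟩ := exists_pos h d
  by_contra hlt
  rw [not_le] at hlt
  have := pos_lt h hlt q p
  rw [hp, hq] at this
  exact absurd hcd this.not_ge

/-- A letter of a block. -/
def posLetter (j : Fin l) (x : Letter (ν j).degree) : Letter κ.degree :=
  ⟨(pos h j x.1.1, pos h j x.1.2), pos_succ h x.2⟩

theorem sw_posLetter (j : Fin l) (x : Letter (ν j).degree) (p : Fin (ν j).degree) :
    sw (posLetter h j x) (pos h j p) = pos h j (sw x p) :=
  (pos_injective h j).swap_apply _ _ _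

theorem sw_posLetter_of_ne {j j' : Fin l} (hj : j' ≠ j) (x : Letter (ν j).degree)
    (p : Fin (ν j').degree) : sw (posLetter h j x) (pos h j' p) = pos h j' p :=
  sw_of_ne _ (pos_ne h hj _ _) (pos_ne h hj _ _)

theorem exists_posLetter {x : Letter κ.degree} (hx : blk h x.1.1 = blk h x.1.2) :
    ∃ j x', posLetter h j x' = x := by
  obtain ⟨p, hp⟩ := exists_pos h x.1.1
  obtain ⟨q, hq⟩ := exists_pos_of h hx.symm
  refine ⟨blk h x.1.1, ⟨(p, q), ?_⟩, Letter.ext_left hp⟩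
  have h1 := congrArg Fin.val hp
  have h2 := congrArg Fin.val hq
  have h3 := x.2
  simp only [pos] at h1 h2
  simp only
  omega

theorem blk_posLetter (j : Fin l) (x : Letter (ν j).degree) :
    blk h (posLetter h j x).1.1 = blk h (posLetter h j x).1.2 := by
  simp [posLetter]

theorem wordPerm_map_posLetter (j : Fin l) (ω : List (Letter (ν j).degree))
    (p : Fin (ν j).degree) :
    wordPerm (ω.map (posLetter h j)) (pos h j p) = pos h j (wordPerm ω p) := by
  induction ω with
  | nil => rfl
  | cons x ω ih =>
    rw [List.map_cons, wordPerm_cons, Equiv.Perm.mul_apply, ih, sw_posLetter, wordPerm_cons,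
      Equiv.Perm.mul_apply]

theorem wordPerm_map_posLetter_of_ne {j j' : Fin l} (hj : j' ≠ j)
    (ω : List (Letter (ν j).degree)) (p : Fin (ν j').degree) :
    wordPerm (ω.map (posLetter h j)) (pos h j' p) = pos h j' p := by
  induction ω with
  | nil => rfl
  | cons x ω ih =>
    rw [List.map_cons, wordPerm_cons, Equiv.Perm.mul_apply, ih, sw_posLetter_of_ne h hj]

/-- The concatenation of words, one for every block. -/
def catWord (ω : ∀ j, List (Letter (ν j).degree)) : List (Letter κ.degree) :=
  (List.ofFn fun j => (ω j).map (posLetter h j)).flatten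

theorem catWord_block (ω : ∀ j, List (Letter (ν j).degree)) :
    IsBlockWord (blk h) (catWord h ω) := by
  intro x hx
  simp only [catWord, List.mem_flatten, List.mem_ofFn', Set.mem_range] at hx
  obtain ⟨_, ⟨j, rfl⟩, hx⟩ := hx
  obtain ⟨y, _, rfl⟩ := List.mem_map.1 hx
  exact blk_posLetter h j y

theorem list_prod_perm_apply {n m : ℕ} (f : Fin m → Equiv.Perm (Fin n)) (j : Fin m)
    {S : Set (Fin n)} (h1 : ∀ i, i ≠ j → ∀ a ∈ S, f i a = a) (h2 : ∀ a ∈ S, f j a ∈ S) {a : Fin n}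
    (ha : a ∈ S) : (List.ofFn f).prod a = f j a := by
  induction m with
  | zero => exact j.elim0
  | succ m ih =>
    rw [List.ofFn_succ, List.prod_cons, Equiv.Perm.mul_apply]
    induction j using Fin.cases with
    | zero =>
      have : ∀ (l : List (Equiv.Perm (Fin n))), (∀ g ∈ l, g a = a) → l.prod a = a := by
        intro l hl
        induction l with
        | nil => rfl
        | cons g l ih =>
          rw [List.prod_cons, Equiv.Perm.mul_apply, ih fun g hg => hl g (List.mem_cons_of_mem _ hg),
            hl g List.mem_cons_self]
      rw [this]
      intro g hg
      obtain ⟨i, rfl⟩ := (List.mem_ofFn' _ _).1 hg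
      exact h1 _ (Fin.succ_ne_zero i) a ha
    | succ j =>
      rw [ih (fun i => f i.succ) j (fun i hi => h1 _ fun h => hi (Fin.succ_injective _ h)) h2,
        h1 0 (Fin.succ_ne_zero j).symm _ (h2 a ha)]

theorem wordPerm_catWord (ω : ∀ j, List (Letter (ν j).degree)) (j : Fin l)
    (p : Fin (ν j).degree) :
    wordPerm (catWord h ω) (pos h j p) = pos h j (wordPerm (ω j) p) := by
  have h1 : wordPerm (catWord h ω) =
      (List.ofFn fun j => wordPerm ((ω j).map (posLetter h j))).prod := by
    rw [catWord, wordPerm, List.map_flatten, List.prod_flatten, List.map_map, List.map_ofFn]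
    rfl
  rw [h1, list_prod_perm_apply _ j (S := Set.range (pos h j)), wordPerm_map_posLetter]
  · rintro i hi _ ⟨p, rfl⟩
    exact wordPerm_map_posLetter_of_ne h hi.symm _ _
  · rintro _ ⟨p, rfl⟩
    exact ⟨_, (wordPerm_map_posLetter h j _ p).symm⟩
  · exact ⟨p, rfl⟩

theorem catWord_red {ω : ∀ j, List (Letter (ν j).degree)} (hω : ∀ j, IsRed (ω j)) :
    IsRed (catWord h ω) := by
  have h1 : (catWord h ω).length = ∑ j, (ω j).length := by
    rw [catWord, List.length_flatten, List.map_ofFn, List.sum_ofFn]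
    simp
  rw [IsRed, h1]
  have h2 : ∑ j, (ω j).length = (Finset.univ.sigma fun j => invSet (wordPerm (ω j))).card := by
    rw [Finset.card_sigma]
    exact Finset.sum_congr rfl fun j _ => hω j
  rw [h2, inv]
  refine Finset.card_bij (fun x _ => (pos h x.1 x.2.1, pos h x.1 x.2.2)) ?_ ?_ ?_
  · rintro ⟨j, p, q⟩ hx
    simp only [Finset.mem_sigma, Finset.mem_univ, true_and, mem_invSet] at hx ⊢
    rw [wordPerm_catWord, wordPerm_catWord, pos_lt_iff, pos_lt_iff]
    exact hx
  · rintro ⟨j, p, q⟩ _ ⟨j', p', q'⟩ _ hx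
    rw [Prod.mk.injEq] at hx
    have hj : j = j' := by
      by_contra hj
      exact pos_ne h hj _ _ hx.1
    subst hj
    obtain rfl := pos_injective h j hx.1
    obtain rfl := pos_injective h j hx.2
    rfl
  · rintro ⟨c, d⟩ hx
    rw [mem_invSet] at hx
    have hb := (catWord_block h ω).apply
    have hj : blk h c = blk h d := le_antisymm (monotone_blk h hx.1.le) (by
      rw [← hb c, ← hb d]
      exact monotone_blk h hx.2.le)
    obtain ⟨p, hp⟩ := exists_pos h c
    obtain ⟨q, hq⟩ := exists_pos_of h hj.symm
    refine ⟨⟨blk h c, p, q⟩, ?_, by simp [hp, hq]⟩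
    simp only [Finset.mem_sigma, Finset.mem_univ, true_and, mem_invSet]
    rw [← pos_lt_iff h, ← pos_lt_iff h, ← wordPerm_catWord, ← wordPerm_catWord, hp, hq]
    exact hx

/-- The concatenation of sequences. -/
def catSeq (i : ∀ j, Seq (ν j)) : Seq κ :=
  ⟨fun c => i _ ((posEquiv h).symm c).2, by
    rw [← Equiv.sum_comp (posEquiv h)]
    have h1 : ∀ x : Σ j, Fin (ν j).degree,
        i _ ((posEquiv h).symm (posEquiv h x)).2 = i x.1 x.2 := fun x => by
      rw [Equiv.symm_apply_apply]
    simp only [h1]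
    rw [Fintype.sum_sigma]
    exact (Finset.sum_congr rfl fun j _ => (i j).2).trans h⟩

@[simp] theorem catSeq_pos (i : ∀ j, Seq (ν j)) (j : Fin l) (p : Fin (ν j).degree) :
    catSeq h i (pos h j p) = i j p := by
  change i _ ((posEquiv h).symm (pos h j p)).2 = _
  rw [posEquiv_symm_pos]

theorem isConcat_catSeq (i : ∀ j, Seq (ν j)) : IsConcat h (catSeq h i) := by
  intro j
  simp only [catSeq_pos]
  exact (i j).2

theorem eq_catSeq {i : Seq κ} (hi : IsConcat h i) :
    i = catSeq h fun j => (⟨fun p => i (pos h j p), hi j⟩ : Seq (ν j)) := by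
  refine Seq.ext fun c => ?_
  obtain ⟨p, hp⟩ := exists_pos h c
  rw [← hp]
  exact (catSeq_pos h (fun j => (⟨fun p => i (pos h j p), hi j⟩ : Seq (ν j))) _ p).symm

theorem isConcat_act {i : Seq κ} {w : Equiv.Perm (Fin κ.degree)}
    (hw : ∀ c, blk h (w c) = blk h c) (hi : IsConcat h i) : IsConcat h (i.act w) := by
  intro j
  have hmem : ∀ p : Fin (ν j).degree, ∃ q, pos h j q = w⁻¹ (pos h j p) := fun p =>
    exists_pos_of h (by rw [apply_inv hw, blk_pos])
  choose g hg using hmem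
  have hinj : Function.Injective g := fun p q hpq => by
    have := congrArg (pos h j) hpq
    rw [hg, hg] at this
    exact pos_injective h j (w⁻¹.injective this)
  have hbij := Finite.injective_iff_bijective.1 hinj
  refine Eq.trans ?_ (hi j)
  rw [← hbij.sum_comp fun p => Finsupp.single (i (pos h j p)) 1]
  simp only [hg, Seq.act_apply]

end Positions

section BlockImages

variable {k : Type u} [Field k] {I : Type u} {D : FoldingDatum k I} {κ : I →₀ ℕ} {l : ℕ}
  {ν : Fin l → I →₀ ℕ} (h : ∑ j, ν j = κ)

theorem eSum_commute_poly (P : Seq κ → Prop) {f : KLR D κ} (hf : f ∈ polySub D κ) :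
    Commute (eSum D P) f :=
  Commute.sum_left _ _ _ fun i _ => (commute_e_of_mem hf i).symm

theorem tw_mul_eSum (ω : List (Letter κ.degree)) {P P' : Seq κ → Prop}
    (hP : ∀ i, P i ↔ P' (i.act (wordPerm ω))) : tw D ω * eSum D P = eSum D P' * tw D ω := by
  classical
  refine eq_of_mul_e D fun i => ?_
  rw [mul_assoc, mul_assoc, eSum_mul_e, tw_e, ← mul_assoc, eSum_mul_e]
  simp only [hP i]
  split_ifs
  · rw [tw_e]
  · simp

theorem eSum_concat_commute_tw {ω : List (Letter κ.degree)} (hω : IsBlockWord (blk h) ω) :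
    Commute (eSum D (IsConcat h)) (tw D ω) :=
  (tw_mul_eSum ω fun i => ⟨isConcat_act h hω.apply, fun hi => by
    have := isConcat_act h (w := (wordPerm ω)⁻¹) (apply_inv hω.apply) hi
    rwa [Seq.act_act, inv_mul_cancel, Seq.act_one] at this⟩).symm

theorem block_tw (j : Fin l) (ω : List (Letter (ν j).degree)) :
    block D h j (tw D ω) = eSum D (IsConcat h) * tw D (ω.map (posLetter h j)) := by
  induction ω with
  | nil => rw [tw_nil, block_one, List.map_nil, tw_nil, mul_one]
  | cons x ω ih =>
    have hx : Commute (eSum D (IsConcat h)) (tl D (posLetter h j x)) := by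
      simpa using eSum_concat_commute_tw (D := D) h (ω := [posLetter h j x]) (by
        simpa [IsBlockWord] using blk_posLetter h j x)
    rw [tw_cons, block_mul, ih, List.map_cons, tw_cons]
    change block D h j (tau D _ _ _) * _ = _
    rw [block_tau]
    change _ * tl D (posLetter h j x) * _ = _
    rw [hx.eq, mul_assoc, ← mul_assoc (eSum D _), eSum_mul_self, ← mul_assoc, ← hx.eq, mul_assoc]

theorem block_ev (j : Fin l) (f : MvPolynomial (Fin (ν j).degree) k) :
    block D h j (ev D (ν j) f) =
      eSum D (IsConcat h) * ev D κ (MvPolynomial.rename (pos h j) f) := by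
  induction f using MvPolynomial.induction_on with
  | C c =>
    rw [MvPolynomial.rename_C, ← MvPolynomial.algebraMap_eq, ← MvPolynomial.algebraMap_eq,
      AlgHom.commutes, AlgHom.commutes, block_algebraMap, Algebra.algebraMap_eq_smul_one,
      mul_smul_comm, mul_one]
  | add p q hp hq => rw [map_add, map_add, hp, hq, map_add, map_add, mul_add]
  | mul_X p i hp =>
    rw [map_mul, block_mul, hp, ev_X, block_y, map_mul, map_mul, MvPolynomial.rename_X, ev_X,
      (eSum_commute_poly (IsConcat h) (ev_mem _)).eq, mul_assoc, ← mul_assoc (eSum D _) (eSum D _),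
      eSum_mul_self, ← mul_assoc, ← (eSum_commute_poly (IsConcat h) (ev_mem _)).eq, mul_assoc]

theorem mul_list_prod_ofFn {M : Type*} [Monoid M] {l : ℕ} {E : M} (hE : E * E = E) (z : Fin l → M)
    (hz : ∀ j, Commute E (z j)) :
    E * (List.ofFn fun j => E * z j).prod = E * (List.ofFn z).prod := by
  induction l with
  | zero => simp
  | succ l ih =>
    rw [List.ofFn_succ, List.ofFn_succ, List.prod_cons, List.prod_cons, ← mul_assoc, ← mul_assoc,
      hE, (hz 0).eq, mul_assoc, ih _ fun j => hz _, ← mul_assoc, ← (hz 0).eq, mul_assoc]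

theorem list_prod_eSum_mul_e {m : ℕ} (P : Fin m → Seq κ → Prop) (i : Seq κ)
    [Decidable (∀ j, P j i)] :
    (List.ofFn fun j => eSum D (P j)).prod * e D i = if ∀ j, P j i then e D i else 0 := by
  classical
  induction m with
  | zero => simp
  | succ m ih =>
    rw [List.ofFn_succ, List.prod_cons, mul_assoc, ih]
    by_cases h1 : ∀ j : Fin m, P j.succ i
    · rw [if_pos h1, eSum_mul_e]
      simp only [Fin.forall_fin_succ, h1]
      simp
    · rw [if_neg h1, if_neg, mul_zero]
      exact fun h2 => h1 fun j => h2 j.succ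

end BlockImages
end KLR

namespace KLR

section Span

variable {k : Type u} [Field k] {I : Type u} {D : FoldingDatum k I} {ν : I →₀ ℕ}
  {o : Type} {β : Fin ν.degree → o}

theorem monomial_eq_smul {n : ℕ} (α : Fin n →₀ ℕ) (c : k) :
    MvPolynomial.monomial α c = c • MvPolynomial.monomial α 1 := by
  rw [MvPolynomial.smul_monomial, smul_eq_mul, mul_one]

theorem poly_induction {N : Submodule k (KLR D ν)} {z f : KLR D ν}
    (h : ∀ i, z * f * e D i ∈ N) : z * f ∈ N := by
  rw [← mul_one (z * f), ← sum_e, Finset.mul_sum]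
  exact sum_mem fun i _ => h i

theorem low_le [LinearOrder o] (hβ : Monotone β) (N : Submodule k (KLR D ν)) : ∀ (t : ℕ) (m : ℤ),
    m ≤ t → (∀ w (_ : ∀ a, β (w a) = β a), (inv w : ℤ) < m → ∀ i : Seq ν, ∃ ω, IsBlockWord β ω ∧
      IsRed ω ∧ wordPerm ω = w ∧ ∀ f ∈ polySub D ν, tw D ω * f * e D i ∈ N) →
    low D β m ≤ N := by
  intro t
  induction t with
  | zero =>
    intro m hm _
    refine Submodule.span_le.2 ?_
    rintro _ ⟨ω, _, h, _⟩
    omega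
  | succ t ih =>
    intro m hm H
    refine Submodule.span_le.2 ?_
    rintro _ ⟨ω, hω, hlen, f, hf, rfl⟩
    have ih' : ∀ m' : ℤ, m' ≤ ω.length → low D β m' ≤ N := fun m' hm' =>
      ih m' (by push_cast at hm; omega) fun w hw hwm => H w hw (by omega)
    by_cases hr : IsRed ω
    · refine poly_induction fun i => ?_
      obtain ⟨ω', hω', hr', hp, hN⟩ := H (wordPerm ω) hω.apply (by rwa [← hr]) i
      have h1 := tw_sub_mem (D := D) hβ _ ω ω' hω hω' hr hr' hp.symm rfl
      have h2 := ih' _ (by omega) (low_mul_poly h1 (mul_mem hf (e_mem_polySub i)))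
      have h3 := add_mem h2 (hN f hf)
      convert h3 using 1
      noncomm_ring
    · exact ih' _ le_rfl (low_mul_poly (tw_mem_of_not_red hβ hω hr) hf)

theorem mul_mem_low {m m' : ℤ} {z z' : KLR D ν} (hz : z ∈ low D β m) (hz' : z' ∈ low D β m') :
    z * z' ∈ low D β (m + m') := by
  induction hz using Submodule.span_induction with
  | mem z hz =>
    obtain ⟨ω, hω, hm, g, hg, rfl⟩ := hz
    rw [mul_assoc]
    exact tw_mul_low (by omega) hω (poly_mul_low hg hz')
  | zero => rw [zero_mul]; exact zero_mem _
  | add x y _ _ hx hy => rw [add_mul]; exact add_mem hx hy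
  | smul a x _ hx => rw [smul_mul_assoc]; exact Submodule.smul_mem _ _ hx

theorem exists_mem_low (x : KLR D ν) : ∃ m : ℕ, x ∈ low D (fun _ => (0 : Fin 1)) m := by
  induction x using KLR.induction with
  | he i => exact ⟨1, poly_mem_low (by simp) (e_mem_polySub i)⟩
  | hy p => exact ⟨1, poly_mem_low (by simp) (y_mem_polySub p)⟩
  | htau p q h =>
    refine ⟨2, ?_⟩
    have := tw_mem_low (D := D) (β := fun _ : Fin ν.degree => (0 : Fin 1)) (m := 2)
      (ω := [⟨(p, q), h⟩]) (by simp [IsBlockWord]) (by simp)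
    simpa using this
  | hadd x y hx hy =>
    obtain ⟨m, hm⟩ := hx
    obtain ⟨m', hm'⟩ := hy
    exact ⟨m + m', add_mem (low_mono (by push_cast; omega) hm) (low_mono (by push_cast; omega) hm')⟩
  | hmul x y hx hy =>
    obtain ⟨m, hm⟩ := hx
    obtain ⟨m', hm'⟩ := hy
    exact ⟨m + m', by push_cast; exact mul_mem_low hm hm'⟩
  | hk c => exact ⟨1, poly_mem_low (by simp) (Subalgebra.algebraMap_mem _ c)⟩

/-- A reduced word of a permutation. -/
def rw1 {n : ℕ} (w : Equiv.Perm (Fin n)) : List (Letter n) :=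
  redWord (β := fun _ => (0 : Fin 1)) monotone_const w fun _ => rfl

@[simp] theorem wordPerm_rw1 {n : ℕ} (w : Equiv.Perm (Fin n)) : wordPerm (rw1 w) = w :=
  wordPerm_redWord _ _ _

theorem rw1_red {n : ℕ} (w : Equiv.Perm (Fin n)) : IsRed (rw1 w) := redWord_red _ _ _

variable (D ν) in
/-- The elements of the basis of `R(ν)`. -/
def pbw (x : Equiv.Perm (Fin ν.degree) × (Fin ν.degree →₀ ℕ) × Seq ν) : KLR D ν :=
  tw D (rw1 x.1) * ev D ν (MvPolynomial.monomial x.2.1 1) * e D x.2.2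

theorem tw_ev_e_mem (w : Equiv.Perm (Fin ν.degree)) (g : MvPolynomial (Fin ν.degree) k)
    (i : Seq ν) : tw D (rw1 w) * ev D ν g * e D i ∈ Submodule.span k (Set.range (pbw D ν)) := by
  rw [MvPolynomial.as_sum g, map_sum, Finset.mul_sum, Finset.sum_mul]
  refine sum_mem fun α _ => ?_
  rw [monomial_eq_smul, map_smul, mul_smul_comm, smul_mul_assoc]
  exact Submodule.smul_mem _ _ (Submodule.subset_span ⟨(w, α, i), rfl⟩)

theorem span_pbw : Submodule.span k (Set.range (pbw D ν)) = ⊤ := by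
  rw [eq_top_iff]
  rintro x -
  obtain ⟨m, hm⟩ := exists_mem_low x
  refine low_le (β := fun _ => (0 : Fin 1)) monotone_const _ m m le_rfl (fun w _ _ i => ?_) hm
  refine ⟨rw1 w, redWord_block _ _ _, rw1_red w, wordPerm_rw1 w, fun f hf => ?_⟩
  obtain ⟨g, hg⟩ := exists_ev hf i
  rw [mul_assoc, hg, ← mul_assoc]
  exact tw_ev_e_mem w g i

/-- Products of reduced words, monomials and idempotents are linearly independent. -/
theorem linearIndependent_tw (F : Factorization D) {Z T : Type*} [Finite Z]
    (ω : Z → Seq ν → List (Letter ν.degree)) (z : T → Z) (α : T → Fin ν.degree →₀ ℕ)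
    (i : T → Seq ν) (hT : Function.Injective fun t => (z t, α t, i t))
    (hred : ∀ t, IsRed (ω (z t) (i t)))
    (hinj : ∀ t t', i t = i t' → wordPerm (ω (z t) (i t)) = wordPerm (ω (z t') (i t')) →
      z t = z t') :
    LinearIndependent k fun t =>
      tw D (ω (z t) (i t)) * ev D ν (MvPolynomial.monomial (α t) 1) * e D (i t) := by
  classical
  have := Fintype.ofFinite Z
  rw [linearIndependent_iff']
  intro s g hg t0 ht0
  set i0 := i t0 with hi0
  -- the part of the relation with the idempotent `i0`
  have h1 : ∑ t ∈ s.filter (fun t => i t = i0), g t • (tw D (ω (z t) i0) *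
      ev D ν (MvPolynomial.monomial (α t) 1) * e D i0) = 0 := by
    have := congrArg (fun x => x * e D i0) hg
    simp only [zero_mul, Finset.sum_mul, smul_mul_assoc] at this
    rw [← this, Finset.sum_filter]
    refine Finset.sum_congr rfl fun t _ => ?_
    split_ifs with h
    · rw [h, mul_assoc _ (e D i0), (isFamily D).e_mul_self]
    · rw [mul_assoc _ (e D (i t)), (isFamily D).e_mul_ne _ _ h, mul_zero, smul_zero]
  let Z0 := {c : Z // ∃ t, z t = c ∧ i t = i0}
  have h2 := eq_zero_of_sum_tw F (Finset.univ : Finset Z0) (fun c => ω c.1 i0)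
    (fun c => by obtain ⟨_, t, rfl, ht⟩ := c; simpa [ht] using hred t)
    (fun c c' hc => by
      obtain ⟨_, t, rfl, ht⟩ := c
      obtain ⟨_, t', rfl, ht'⟩ := c'
      exact Subtype.ext (hinj t t' (ht.trans ht'.symm) (by simpa [ht, ht'] using hc))) i0
    (fun c => ∑ t ∈ s.filter (fun t => i t = i0), if z t = c.1 then
      MvPolynomial.monomial (α t) (g t) else 0) (by
      rw [← h1]
      simp only [map_sum, Finset.mul_sum, Finset.sum_mul]
      rw [Finset.sum_comm]
      refine Finset.sum_congr rfl fun t ht => ?_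
      rw [Finset.sum_eq_single (⟨z t, t, rfl, (Finset.mem_filter.1 ht).2⟩ : Z0)]
      · rw [if_pos rfl, monomial_eq_smul, map_smul, mul_smul_comm, smul_mul_assoc]
      · intro c _ hc
        rw [if_neg]
        · simp
        · intro h; exact hc (Subtype.ext h.symm)
      · intro h; exact absurd (Finset.mem_univ _) h)
  have h3 := congrArg (MvPolynomial.coeff (α t0)) (h2 ⟨z t0, t0, rfl, rfl⟩ (Finset.mem_univ _))
  simp only [MvPolynomial.coeff_sum, MvPolynomial.coeff_zero] at h3
  rw [Finset.sum_eq_single t0] at h3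
  · simpa using h3
  · intro t ht hne
    split_ifs with h
    · rw [MvPolynomial.coeff_monomial, if_neg]
      intro hα
      refine hne (hT ?_)
      simp only [h, hα, (Finset.mem_filter.1 ht).2, hi0]
    · simp
  · intro h
    exact absurd (Finset.mem_filter.2 ⟨ht0, hi0.symm⟩) h

theorem linearIndependent_pbw (F : Factorization D) : LinearIndependent k (pbw D ν) := by
  have := linearIndependent_tw F (ν := ν) (T := Equiv.Perm (Fin ν.degree) × (Fin ν.degree →₀ ℕ) × Seq ν)
    (fun w _ => rw1 w) (fun t => t.1) (fun t => t.2.1) (fun t => t.2.2)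
    (fun _ _ h => h) (fun t => rw1_red _) fun t t' _ h => by simpa using h
  exact this

variable (ν) in
/-- The basis of `R(ν)`. -/
def pbwBasis (F : Factorization D) :
    Module.Basis (Equiv.Perm (Fin ν.degree) × (Fin ν.degree →₀ ℕ) × Seq ν) k (KLR D ν) :=
  Module.Basis.mk (v := pbw D ν)
    (linearIndependent_pbw F)
    span_pbw.ge

end Span

end KLR

namespace FoldingDatum

open KLR

variable {k : Type u} [Field k] [Infinite k] {I : Type u} {D : FoldingDatum k I} {l : ℕ}
  {ν : Fin l → D.NJ} {κ : D.NJ} (h : ∑ j, ν j = κ)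

theorem concat_tprod (x : ∀ j, (D.R (ν j)).carrier) :
    (concat ν κ h).toLin (PiTensorProduct.tprod k x) =
      eSum D (IsConcat (sum_coe h)) * (List.ofFn fun j => block D (sum_coe h) j (x j)).prod :=
  FoldedHom.ofCommuting_tprod _ _ _ _ _ _ _ _

theorem concat_one : (concat ν κ h).e = eSum D (IsConcat (sum_coe h)) := by
  rw [FoldedHom.e, PiTensorProduct.one_def, concat_tprod]
  simp only [Pi.one_apply]
  have h1 : ∀ j, block D (sum_coe h) j (1 : KLR D (ν j : I →₀ ℕ)) =
      eSum D (IsConcat (sum_coe h)) * 1 := fun j => by rw [block_one, mul_one]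
  have h2 : ∀ j, block D (sum_coe h) j (1 : (D.R (ν j)).carrier) =
      eSum D (IsConcat (sum_coe h)) * 1 := h1
  simp only [h2]
  rw [mul_list_prod_ofFn (eSum_mul_self _) (fun _ => 1) fun _ => Commute.one_right _]
  simp
  rfl

theorem concat_tprod_tw (ω : ∀ j, List (Letter (ν j : I →₀ ℕ).degree)) :
    (concat ν κ h).toLin (PiTensorProduct.tprod k fun j => (tw D (ω j) : KLR D (ν j : I →₀ ℕ))) =
      eSum D (IsConcat (sum_coe h)) * tw D (catWord (sum_coe h) ω) := by
  refine (concat_tprod h _).trans ?_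
  simp only [block_tw]
  rw [mul_list_prod_ofFn (eSum_mul_self _)]
  · rw [catWord, tw, List.map_flatten, List.prod_flatten, List.map_map, List.map_ofFn]
    rfl
  · intro j
    refine eSum_concat_commute_tw (sum_coe h) fun x hx => ?_
    obtain ⟨y, _, rfl⟩ := List.mem_map.1 hx
    exact blk_posLetter (sum_coe h) j y

theorem concat_tprod_ev (f : ∀ j, MvPolynomial (Fin (ν j : I →₀ ℕ).degree) k) :
    (concat ν κ h).toLin
        (PiTensorProduct.tprod k fun j => (ev D _ (f j) : KLR D (ν j : I →₀ ℕ))) =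
      eSum D (IsConcat (sum_coe h)) *
        ev D _ (∏ j, MvPolynomial.rename (pos (sum_coe h) j) (f j)) := by
  refine (concat_tprod h _).trans ?_
  simp only [block_ev]
  rw [mul_list_prod_ofFn (eSum_mul_self _)]
  · rw [← List.prod_ofFn, map_list_prod, List.map_ofFn]
    rfl
  · intro j
    exact eSum_commute_poly _ (ev_mem _)

theorem concat_tprod_e (i : ∀ j, Seq (ν j : I →₀ ℕ)) :
    (concat ν κ h).toLin (PiTensorProduct.tprod k fun j => (e D (i j) : KLR D (ν j : I →₀ ℕ))) =
      e D (catSeq (sum_coe h) i) := by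
  classical
  refine (concat_tprod h _).trans ?_
  simp only [block_e]
  refine eq_of_mul_e D fun i' => ?_
  rw [mul_assoc, list_prod_eSum_mul_e]
  by_cases hi : i' = catSeq (sum_coe h) i
  · subst hi
    rw [if_pos, eSum_mul_e, if_pos (isConcat_catSeq _ _), (isFamily D).e_mul_self]
    exact fun j => ⟨isConcat_catSeq _ _, fun p => catSeq_pos _ _ _ _⟩
  · rw [(isFamily D).e_mul_ne _ _ (Ne.symm hi)]
    split_ifs with hb
    · rw [eSum_mul_e, if_neg]
      intro hc
      refine hi ((eq_catSeq _ hc).trans ?_)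
      congr 1
      funext j
      exact Seq.ext fun p => (hb j).2 p
    · rw [mul_zero]

theorem concat_tprod_pbw (ω : ∀ j, List (Letter (ν j : I →₀ ℕ).degree))
    (f : ∀ j, MvPolynomial (Fin (ν j : I →₀ ℕ).degree) k) (i : ∀ j, Seq (ν j : I →₀ ℕ)) :
    (concat ν κ h).toLin (PiTensorProduct.tprod k fun j =>
        (tw D (ω j) * ev D _ (f j) * e D (i j) : KLR D (ν j : I →₀ ℕ))) =
      tw D (catWord (sum_coe h) ω) *
        ev D _ (∏ j, MvPolynomial.rename (pos (sum_coe h) j) (f j)) *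
          e D (catSeq (sum_coe h) i) := by
  classical
  have h1 : (PiTensorProduct.tprod k fun j =>
        (tw D (ω j) * ev D _ (f j) * e D (i j) : KLR D (ν j : I →₀ ℕ)) :
        (FoldedAlg.pi fun j => D.R (ν j)).carrier) =
      (PiTensorProduct.tprod k fun j => (tw D (ω j) : KLR D (ν j : I →₀ ℕ)) :
        (FoldedAlg.pi fun j => D.R (ν j)).carrier) *
      (PiTensorProduct.tprod k fun j => (ev D _ (f j) : KLR D (ν j : I →₀ ℕ)) :
        (FoldedAlg.pi fun j => D.R (ν j)).carrier) *
      (PiTensorProduct.tprod k fun j => (e D (i j) : KLR D (ν j : I →₀ ℕ)) :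
        (FoldedAlg.pi fun j => D.R (ν j)).carrier) := by
    refine Eq.trans ?_ (congrArg (· * _) (PiTensorProduct.tprod_mul_tprod _ _).symm)
    exact (PiTensorProduct.tprod_mul_tprod _ _).symm
  rw [h1, (concat ν κ h).map_mul, (concat ν κ h).map_mul, concat_tprod_tw, concat_tprod_ev,
    concat_tprod_e]
  change (_ : KLR D (κ : I →₀ ℕ)) = _
  have c1 := (eSum_concat_commute_tw (D := D) (sum_coe h) (catWord_block (sum_coe h) ω)).eq
  have c2 := (eSum_commute_poly (D := D) (IsConcat (sum_coe h))
    (ev_mem (∏ j, MvPolynomial.rename (pos (sum_coe h) j) (f j)))).eq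
  have c3 : eSum D (IsConcat (sum_coe h)) * e D (catSeq (sum_coe h) i) =
      e D (catSeq (sum_coe h) i) := by
    rw [eSum_mul_e, if_pos (isConcat_catSeq _ _)]
  have c4 := eSum_mul_self (D := D) (IsConcat (sum_coe h))
  generalize eSum D (IsConcat (sum_coe h)) = E at *
  generalize e D (catSeq (sum_coe h) i) = e0 at *
  generalize tw D (catWord (sum_coe h) ω) = t at *
  generalize ev D (κ : I →₀ ℕ) _ = g at *
  calc E * t * (E * g) * e0 = t * (E * E) * g * e0 := by rw [c1]; simp only [mul_assoc]
    _ = t * (E * g) * e0 := by rw [c4]; simp only [mul_assoc]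
    _ = t * g * (E * e0) := by rw [c2]; simp only [mul_assoc]
    _ = t * g * e0 := by rw [c3]

end FoldingDatum

namespace FoldingDatum

open KLR

variable {k : Type u} [Field k] [Infinite k] {I : Type u} {D : FoldingDatum k I} {l : ℕ}
  {ν : Fin l → D.NJ} {κ : D.NJ} (h : ∑ j, ν j = κ)

/-- The homomorphism that places the tensor factors side by side, as a map into the KLR algebra. -/
def cmap : (FoldedAlg.pi fun j => D.R (ν j)).carrier →ₗ[k] KLR D (κ : I →₀ ℕ) :=
  (concat ν κ h).toLin

theorem cmap_mul (x y : (FoldedAlg.pi fun j => D.R (ν j)).carrier) :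
    cmap h (x * y) = cmap h x * cmap h y := (concat ν κ h).map_mul x y

theorem cmap_one : cmap h 1 = eSum D (IsConcat (sum_coe h)) := concat_one h

/-- The index set of the basis of a tensor product. -/
abbrev CatIndex (ν : Fin l → D.NJ) : Type u :=
  ∀ j, Equiv.Perm (Fin (ν j : I →₀ ℕ).degree) × (Fin (ν j : I →₀ ℕ).degree →₀ ℕ) ×
    Seq (ν j : I →₀ ℕ)

/-- The word of a basis element. -/
def catW (w : ∀ j, Equiv.Perm (Fin (ν j : I →₀ ℕ).degree)) :
    List (Letter (κ : I →₀ ℕ).degree) := catWord (sum_coe h) fun j => rw1 (w j)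

/-- The exponent of a basis element. -/
def catExp (α : ∀ j, Fin (ν j : I →₀ ℕ).degree →₀ ℕ) : Fin (κ : I →₀ ℕ).degree →₀ ℕ :=
  ∑ j, (α j).mapDomain (pos (sum_coe h) j)

theorem catExp_pos (α : ∀ j, Fin (ν j : I →₀ ℕ).degree →₀ ℕ) (j : Fin l)
    (p : Fin (ν j : I →₀ ℕ).degree) : catExp h α (pos (sum_coe h) j p) = α j p := by
  rw [catExp, Finsupp.finsetSum_apply, Finset.sum_eq_single j]
  · exact Finsupp.mapDomain_apply (pos_injective (ν := fun j => (ν j : I →₀ ℕ)) (sum_coe h) j) _ _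
  · intro j' _ hj
    refine Finsupp.mapDomain_of_notMem_range _ _ ?_
    rintro ⟨q, hq⟩
    exact pos_ne (ν := fun j => (ν j : I →₀ ℕ)) (sum_coe h) hj _ _ hq
  · intro h'; exact absurd (Finset.mem_univ _) h'

/-- The basis of a tensor factor. -/
def facBasis (F : Factorization D) (ν : D.NJ) : Module.Basis (Equiv.Perm
    (Fin (ν : I →₀ ℕ).degree) × (Fin (ν : I →₀ ℕ).degree →₀ ℕ) × Seq (ν : I →₀ ℕ)) k
    (D.R ν).carrier :=
  pbwBasis (ν : I →₀ ℕ) F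

theorem facBasis_apply (F : Factorization D) (ν : D.NJ) (t : Equiv.Perm
    (Fin (ν : I →₀ ℕ).degree) × (Fin (ν : I →₀ ℕ).degree →₀ ℕ) × Seq (ν : I →₀ ℕ)) :
    (facBasis F ν t : KLR D (ν : I →₀ ℕ)) =
      tw D (rw1 t.1) * ev D _ (MvPolynomial.monomial t.2.1 1) * e D t.2.2 := by
  change pbwBasis (ν : I →₀ ℕ) F t = _
  exact Module.Basis.mk_apply _ _ _

theorem piTensorProduct_basis_apply {n : ℕ} {ι : Type} [Finite ι] {B : ι → FoldedAlg k n}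
    {K : ι → Type*} (b : ∀ j, Module.Basis (K j) k (B j).carrier) (t : ∀ j, K j) :
    Basis.piTensorProduct b t = PiTensorProduct.tprod k fun j => b j (t j) :=
  Basis.piTensorProduct_apply b t

/-- The basis of a tensor product. -/
def catBasis (F : Factorization D) (ν : Fin l → D.NJ) :
    Module.Basis (CatIndex ν) k (FoldedAlg.pi fun j => D.R (ν j)).carrier :=
  Basis.piTensorProduct (M := fun j => (D.R (ν j)).carrier) fun j => facBasis F (ν j)

theorem concat_catBasis (F : Factorization D) (t : CatIndex ν) :
    cmap h (catBasis F ν t) =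
      (tw D (catW h fun j => (t j).1) *
        ev D _ (MvPolynomial.monomial (catExp h fun j => (t j).2.1) 1) *
          e D (catSeq (sum_coe h) fun j => (t j).2.2) : KLR D (κ : I →₀ ℕ)) := by
  have h1 : catBasis F ν t = PiTensorProduct.tprod k (fun j =>
      (tw D (rw1 (t j).1) * ev D _ (MvPolynomial.monomial (t j).2.1 1) * e D (t j).2.2 :
        KLR D (ν j : I →₀ ℕ)) : ∀ j, (D.R (ν j)).carrier) := by
    refine (piTensorProduct_basis_apply (B := fun j => D.R (ν j))
      (fun j => facBasis F (ν j)) t).trans ?_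
    congr 1
    funext j
    exact facBasis_apply F (ν j) (t j)
  rw [h1]
  refine (concat_tprod_pbw h _ _ _).trans ?_
  rw [catExp, MvPolynomial.monomial_sum_one]
  simp only [MvPolynomial.rename_monomial]
  rfl

theorem catSeq_injective {i i' : ∀ j, Seq (ν j : I →₀ ℕ)}
    (hi : catSeq (sum_coe h) i = catSeq (sum_coe h) i') : i = i' := by
  funext j
  refine Seq.ext fun p => ?_
  rw [← catSeq_pos (ν := fun j => (ν j : I →₀ ℕ)) (sum_coe h) i, hi, catSeq_pos]

theorem catIndex_ext {t t' : CatIndex ν} (h1 : (fun j => (t j).1) = fun j => (t' j).1)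
    (h2 : catExp h (fun j => (t j).2.1) = catExp h fun j => (t' j).2.1)
    (h3 : catSeq (sum_coe h) (fun j => (t j).2.2) = catSeq (sum_coe h) fun j => (t' j).2.2) :
    t = t' := by
  funext j
  refine Prod.ext (congrFun h1 j) (Prod.ext ?_ (congrFun (catSeq_injective h h3) j))
  ext p
  rw [← catExp_pos h (fun j => (t j).2.1), h2, catExp_pos]

theorem catW_block (w : ∀ j, Equiv.Perm (Fin (ν j : I →₀ ℕ).degree)) :
    IsBlockWord (blk (sum_coe h)) (catW h w) := catWord_block _ _

theorem catW_red (w : ∀ j, Equiv.Perm (Fin (ν j : I →₀ ℕ).degree)) : IsRed (catW h w) :=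
  catWord_red _ fun _ => rw1_red _

theorem catW_injective {w w' : ∀ j, Equiv.Perm (Fin (ν j : I →₀ ℕ).degree)}
    (hw : wordPerm (catW h w) = wordPerm (catW h w')) : w = w' := by
  funext j
  ext p
  have h1 := DFunLike.congr_fun hw (pos (sum_coe h) j p)
  rw [catW, catW, wordPerm_catWord, wordPerm_catWord, wordPerm_rw1, wordPerm_rw1] at h1
  exact congrArg Fin.val (pos_injective (ν := fun j => (ν j : I →₀ ℕ)) (sum_coe h) j h1)

theorem linearIndependent_mul_concat (F : Factorization D) {X : Type*} [Finite X]
    (ω : X → List (Letter (κ : I →₀ ℕ).degree)) (P : X → Seq (κ : I →₀ ℕ) → Prop)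
    (hred : ∀ x v, (∀ c, blk (sum_coe h) (v c) = blk (sum_coe h) c) →
      inv (wordPerm (ω x) * v) = (ω x).length + inv v)
    (hinj : ∀ x x' (i : Seq (κ : I →₀ ℕ)) v v', P x (i.act v) → P x' (i.act v') →
      (∀ c, blk (sum_coe h) (v c) = blk (sum_coe h) c) →
      (∀ c, blk (sum_coe h) (v' c) = blk (sum_coe h) c) →
      wordPerm (ω x) * v = wordPerm (ω x') * v' → x = x' ∧ v = v') :
    LinearIndependent k fun t : {p : X × CatIndex ν //
        P p.1 ((catSeq (sum_coe h) fun j => (p.2 j).2.2).act (wordPerm (catW h fun j => (p.2 j).1)))} =>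
      (tw D (ω t.1.1) * cmap h (catBasis F ν t.1.2) : KLR D (κ : I →₀ ℕ)) := by
  have key := linearIndependent_tw F
    (T := {p : X × CatIndex ν // P p.1 ((catSeq (sum_coe h) fun j => (p.2 j).2.2).act (wordPerm (catW h fun j => (p.2 j).1)))})
    (Z := X × ∀ j, Equiv.Perm (Fin (ν j : I →₀ ℕ).degree))
    (fun c _ => ω c.1 ++ catW h c.2) (fun t => (t.1.1, fun j => (t.1.2 j).1))
    (fun t => catExp h fun j => (t.1.2 j).2.1)
    (fun t => catSeq (sum_coe h) fun j => (t.1.2 j).2.2)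
    (fun t t' ht => by
      simp only [Prod.mk.injEq] at ht
      exact Subtype.ext (Prod.ext ht.1.1 (catIndex_ext h ht.1.2 ht.2.1 ht.2.2)))
    (fun t => by
      rw [IsRed, wordPerm_append, List.length_append,
        hred _ _ (catW_block h _).apply, ← catW_red h])
    (fun t t' hi ht => by
      have ht2 := t'.2
      rw [← hi] at ht2
      simp only [wordPerm_append] at ht
      have := hinj _ _ _ _ _ t.2 ht2 (catW_block h _).apply
        (catW_block h _).apply ht
      exact Prod.ext this.1 (catW_injective h this.2))
  convert key using 2 with t
  rw [concat_catBasis, tw_append]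
  simp only [mul_assoc]

theorem concat_injective (F : Factorization D) : Function.Injective (cmap h) := by
  have key := linearIndependent_mul_concat h F (X := Unit) (fun _ => []) (fun _ _ => True)
    (fun _ v _ => by simp) (fun _ _ _ _ _ _ _ _ _ h => ⟨rfl, by simpa using h⟩)
  refine LinearMap.injective_of_linearIndependent (catBasis F ν).span_eq ?_
  have := key.comp (fun t : CatIndex ν => ⟨((), t), trivial⟩) fun t t' ht => by simpa using ht
  have h2 : ((fun t : {p : Unit × CatIndex ν // True} =>
      (tw D [] * cmap h (catBasis F ν t.1.2) : KLR D (κ : I →₀ ℕ))) ∘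
        fun t : CatIndex ν => ⟨((), t), trivial⟩) = cmap h ∘ catBasis F ν := by
    funext t
    simp
  rw [← h2]
  exact this

/-- Products of reduced words with elements of the image of the tensor product vanish only
trivially. -/
theorem eq_zero_of_sum_mul_concat (F : Factorization D) {X : Type*} [Fintype X]
    (ω : X → List (Letter (κ : I →₀ ℕ).degree)) (P : X → Seq (κ : I →₀ ℕ) → Prop)
    (hred : ∀ x v, (∀ c, blk (sum_coe h) (v c) = blk (sum_coe h) c) →
      inv (wordPerm (ω x) * v) = (ω x).length + inv v)
    (hinj : ∀ x x' (i : Seq (κ : I →₀ ℕ)) v v', P x (i.act v) → P x' (i.act v') →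
      (∀ c, blk (sum_coe h) (v c) = blk (sum_coe h) c) →
      (∀ c, blk (sum_coe h) (v' c) = blk (sum_coe h) c) →
      wordPerm (ω x) * v = wordPerm (ω x') * v' → x = x' ∧ v = v')
    (z : X → (FoldedAlg.pi fun j => D.R (ν j)).carrier)
    (hz : ∀ x, (eSum D (P x) * cmap h (z x) : KLR D (κ : I →₀ ℕ)) = cmap h (z x))
    (hsum : ∑ x, (tw D (ω x) * cmap h (z x) : KLR D (κ : I →₀ ℕ)) = 0) (x : X) :
    z x = 0 := by
  classical
  have hli := linearIndependent_mul_concat h F ω P hred hinj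
  set φ := cmap h with hφ
  set b := catBasis F ν with hb
  have hP : ∀ x t, (eSum D (P x) * φ (b t) : KLR D (κ : I →₀ ℕ)) =
      if P x ((catSeq (sum_coe h) fun j => (t j).2.2).act (wordPerm (catW h fun j => (t j).1))) then φ (b t) else 0 := by
    intro x t
    have h1 : (φ (b t) : KLR D (κ : I →₀ ℕ)) = KLR.e D ((catSeq (sum_coe h) fun j => (t j).2.2).act
        (wordPerm (catW h fun j => (t j).1))) *
          (tw D (catW h fun j => (t j).1) * ev D (κ : I →₀ ℕ)
            (MvPolynomial.monomial (catExp h fun j => (t j).2.1) 1)) := by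
      rw [hb, hφ, concat_catBasis, mul_assoc, (commute_e_of_mem (ev_mem _) _).eq, ← mul_assoc, tw_e,
        mul_assoc]
    rw [h1, ← mul_assoc, eSum_mul_e]
    split_ifs <;> simp
  have hexp : ∀ x, (φ (z x) : KLR D (κ : I →₀ ℕ)) = ∑ t ∈ (b.repr (z x)).support,
      if P x ((catSeq (sum_coe h) fun j => (t j).2.2).act (wordPerm (catW h fun j => (t j).1))) then
        b.repr (z x) t • (φ (b t) : KLR D (κ : I →₀ ℕ)) else 0 := by
    intro x
    rw [← hz x]
    conv_lhs => rw [← b.linearCombination_repr (z x)]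
    rw [Finsupp.linearCombination_apply, Finsupp.sum, map_sum]
    rw [Finset.mul_sum]
    refine Finset.sum_congr rfl fun t _ => ?_
    rw [map_smul, mul_smul_comm, hP]
    split_ifs <;> simp
  have hcoef : ∀ x t, P x ((catSeq (sum_coe h) fun j => (t j).2.2).act (wordPerm (catW h fun j => (t j).1))) → b.repr (z x) t = 0 := by
    intro x0 t0 h0
    rw [linearIndependent_iff'] at hli
    let S : Finset (X × CatIndex ν) :=
      (Finset.univ : Finset X) ×ˢ (Finset.univ.biUnion fun x => (b.repr (z x)).support)
    by_cases hS : (x0, t0) ∈ S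
    · refine hli (S.subtype fun p => P p.1 ((catSeq (sum_coe h) fun j => (p.2 j).2.2).act (wordPerm (catW h fun j => (p.2 j).1))))
        (fun p => b.repr (z p.1.1) p.1.2) ?_ ⟨(x0, t0), h0⟩ (by simpa using hS)
      rw [Finset.sum_subtype_eq_sum_filter (p := fun p : X × CatIndex ν =>
          P p.1 ((catSeq (sum_coe h) fun j => (p.2 j).2.2).act (wordPerm (catW h fun j => (p.2 j).1)))) (f := fun p =>
        b.repr (z p.1) p.2 • (tw D (ω p.1) * φ (b p.2) : KLR D (κ : I →₀ ℕ))),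
        Finset.sum_filter, Finset.sum_product]
      refine Eq.trans ?_ hsum
      refine Finset.sum_congr rfl fun x _ => ?_
      rw [hexp, Finset.mul_sum]
      symm
      refine Finset.sum_subset_zero_on_sdiff ?_ ?_ ?_
      · exact Finset.subset_biUnion_of_mem (fun x => (b.repr (z x)).support) (Finset.mem_univ x)
      · intro t ht
        have : b.repr (z x) t = 0 := by simpa using (Finset.mem_sdiff.1 ht).2
        rw [this]
        simp
      · intro t _
        split_ifs
        · rw [mul_smul_comm]
        · rw [mul_zero]
    · have : t0 ∉ (b.repr (z x0)).support := fun h => hS (by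
        simp only [S, Finset.mem_product, Finset.mem_univ, true_and, Finset.mem_biUnion]
        exact ⟨x0, h⟩)
      simpa using this
  have h0 : φ (z x) = 0 := by
    refine (hexp x).trans (Finset.sum_eq_zero fun t _ => ?_)
    split_ifs with h
    · rw [hcoef x t h, zero_smul]
    · rfl
  exact concat_injective h F (h0.trans (map_zero _).symm)

theorem concat_single (j : Fin l) (x : (D.R (ν j)).carrier) :
    cmap h ((FoldedHom.single (fun j => D.R (ν j)) j).toLin x) =
      block D (sum_coe h) j x := by
  classical
  rw [FoldedHom.single_apply]
  refine (concat_tprod h _).trans ?_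
  have h1 : ∀ j', block D (sum_coe h) j'
      ((Pi.mulSingle j x : ∀ j, (D.R (ν j)).carrier) j') =
      eSum D (IsConcat (sum_coe h)) *
        if j' = j then block D (sum_coe h) j x else 1 := by
    intro j'
    by_cases hj : j' = j
    · subst hj
      rw [if_pos rfl, Pi.mulSingle_eq_same]
      have := block_mul (D := D) (ν := fun j => (ν j : I →₀ ℕ)) (sum_coe h) j' 1 x
      exact (congrArg (block D (sum_coe h) j') (one_mul (x : KLR D (ν j' : I →₀ ℕ)))).symm.trans
        (this.trans (congrArg (· * _) (block_one _ _)))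
    · rw [if_neg hj, Pi.mulSingle_eq_of_ne hj, mul_one]
      exact block_one _ _
  simp only [h1]
  refine (mul_list_prod_ofFn (M := KLR D (κ : I →₀ ℕ)) (eSum_mul_self _) _ ?_).trans ?_
  · intro j'
    by_cases hj : j' = j
    · rw [if_pos hj]
      have h2 := block_mul (D := D) (ν := fun j => (ν j : I →₀ ℕ)) (sum_coe h) j 1 x
      have h3 := block_mul (D := D) (ν := fun j => (ν j : I →₀ ℕ)) (sum_coe h) j x 1
      have h2' := (congrArg (block D (sum_coe h) j) (one_mul (x : KLR D (ν j : I →₀ ℕ)))).symm.trans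
        (h2.trans (congrArg (· * _) (block_one _ _)))
      have h3' := (congrArg (block D (sum_coe h) j) (mul_one (x : KLR D (ν j : I →₀ ℕ)))).symm.trans
        (h3.trans (congrArg (_ * ·) (block_one _ _)))
      exact h2'.symm.trans h3'
    · rw [if_neg hj]; exact Commute.one_right _
  · rw [list_prod_ofFn_eq _ j (fun j' hj => if_neg hj), if_pos rfl]
    have := block_mul (D := D) (ν := fun j => (ν j : I →₀ ℕ)) (sum_coe h) j 1 x
    exact ((congrArg (block D (sum_coe h) j) (one_mul (x : KLR D (ν j : I →₀ ℕ)))).symm.trans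
      (this.trans (congrArg (· * _) (block_one _ _)))).symm

theorem exists_concat_poly {f : KLR D (κ : I →₀ ℕ)} (hf : f ∈ polySub D (κ : I →₀ ℕ)) :
    ∃ z, cmap h z = (f * eSum D (IsConcat (sum_coe h)) : KLR D (κ : I →₀ ℕ)) := by
  classical
  induction hf using Algebra.adjoin_induction with
  | mem x hx =>
    rcases hx with ⟨c, rfl⟩ | ⟨i, rfl⟩
    · obtain ⟨p, hp⟩ := exists_pos (ν := fun j => (ν j : I →₀ ℕ)) (sum_coe h) c
      refine ⟨_, (concat_single h _ (y D p : KLR D _)).trans ?_⟩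
      rw [block_y, hp]
      exact (y_commute_eSum _ _).eq.symm
    · by_cases hi : IsConcat (sum_coe h) i
      · rw [eq_catSeq _ hi]
        refine ⟨_, (concat_tprod_e h (fun j => (⟨fun p => i (pos (sum_coe h) j p), hi j⟩ : Seq (ν j : I →₀ ℕ)))).trans ?_⟩
        exact (e_mul_eSum _ _).trans (if_pos (isConcat_catSeq (sum_coe h) _)) |>.symm
      · refine ⟨0, ?_⟩
        rw [map_zero, e_mul_eSum, if_neg hi]
  | algebraMap c =>
    refine ⟨c • 1, ?_⟩
    rw [map_smul, cmap_one, Algebra.algebraMap_eq_smul_one, smul_mul_assoc, one_mul]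
  | add x y _ _ hx hy =>
    obtain ⟨z, hz⟩ := hx
    obtain ⟨z', hz'⟩ := hy
    refine ⟨z + z', ?_⟩
    rw [map_add, hz, hz', add_mul]
  | mul x y hxm hym hx hy =>
    obtain ⟨z, hz⟩ := hx
    obtain ⟨z', hz'⟩ := hy
    refine ⟨z * z', ?_⟩
    rw [cmap_mul, hz, hz']
    have c := (eSum_commute_poly (IsConcat (sum_coe h)) hym).eq
    have c4 := eSum_mul_self (D := D) (IsConcat (sum_coe h))
    generalize eSum D (IsConcat (sum_coe h)) = E at *
    rw [mul_assoc x, ← mul_assoc E, c, mul_assoc y, c4, mul_assoc]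

theorem exists_concat {ω : List (Letter (κ : I →₀ ℕ).degree)}
    (hω : IsBlockWord (blk (sum_coe h)) ω)
    {f : KLR D (κ : I →₀ ℕ)} (hf : f ∈ polySub D (κ : I →₀ ℕ)) :
    ∃ z, cmap h z =
      (tw D ω * f * eSum D (IsConcat (sum_coe h)) : KLR D (κ : I →₀ ℕ)) := by
  induction ω with
  | nil => rw [tw_nil, one_mul]; exact exists_concat_poly h hf
  | cons x ω ih =>
    rw [isBlockWord_cons] at hω
    obtain ⟨z, hz⟩ := ih hω.2
    obtain ⟨j, x', rfl⟩ := exists_posLetter (ν := fun j => (ν j : I →₀ ℕ)) (sum_coe h) hω.1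
    refine ⟨(FoldedHom.single (fun j => D.R (ν j)) j).toLin (tl D x' : KLR D _) * z, ?_⟩
    rw [cmap_mul, hz]
    have hb : block D (ν := fun j => (ν j : I →₀ ℕ)) (sum_coe h) j (tl D x') =
        eSum D (IsConcat (sum_coe h)) *
          tl D (posLetter (ν := fun j => (ν j : I →₀ ℕ)) (sum_coe h) j x') :=
      block_tau _ _ _ _ _
    refine (congrArg (· * _) ((concat_single h j _).trans hb)).trans ?_
    have c1 := (eSum_concat_commute_tw (D := D) (sum_coe h) (isBlockWord_cons.2 hω)).eq
    have c2 := (eSum_commute_poly (IsConcat (sum_coe h)) hf).eq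
    have c4 := eSum_mul_self (D := D) (IsConcat (sum_coe h))
    rw [tw_cons] at c1 ⊢
    generalize eSum D (IsConcat (sum_coe h)) = E at *
    generalize tl D (posLetter (ν := fun j => (ν j : I →₀ ℕ)) (sum_coe h) j x') = T at *
    calc E * T * (tw D ω * f * E) = E * (T * tw D ω) * f * E := by simp only [mul_assoc]
      _ = T * tw D ω * (E * f) * E := by rw [c1]; simp only [mul_assoc]
      _ = T * tw D ω * f * (E * E) := by rw [c2]; simp only [mul_assoc]
      _ = _ := by rw [c4]

end FoldingDatum

section Graded

variable {k : Type u} [Field k]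

theorem mem_gr_of_map_mem {V W : Type u} [AddCommGroup V] [Module k V] [AddCommGroup W] [Module k W]
    {grV : ℤ → Submodule k V} {grW : ℤ → Submodule k W} (hV : DirectSum.IsInternal grV)
    (hW : DirectSum.IsInternal grW) (f : V →ₗ[k] W) (hinj : Function.Injective f)
    (hf : ∀ d, ∀ x ∈ grV d, f x ∈ grW d) {d : ℤ} {y : V} (hy : f y ∈ grW d) : y ∈ grV d := by
  classical
  have h := hW.submodule_iSupIndep
  rw [iSupIndep_iff_finsetSum_eq_zero_imp_eq_zero] at h
  have hy' : y ∈ ⨆ d, grV d := by rw [hV.submodule_iSup_eq_top]; trivial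
  obtain ⟨z, hz, hsum⟩ := (Submodule.mem_iSup_iff_exists_finsupp _ _).1 hy'
  have hsum' : ∑ c ∈ insert d z.support, z c = y := by
    rw [← hsum, Finsupp.sum]
    symm
    refine Finset.sum_subset (Finset.subset_insert _ _) fun c _ hc => ?_
    simpa using hc
  have key : ∀ c ∈ insert d z.support, f (z c) - (if c = d then f y else 0) = 0 := by
    refine h _ (fun c => f (z c) - (if c = d then f y else 0)) (fun c _ => ?_) ?_
    · refine sub_mem (hf _ _ (hz c)) ?_
      split_ifs with hcd
      · rw [hcd]; exact hy
      · exact zero_mem _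
    · rw [Finset.sum_sub_distrib, ← map_sum, hsum']
      simp
  have hfd := key d (Finset.mem_insert_self _ _)
  rw [if_pos rfl, sub_eq_zero] at hfd
  rw [← hinj hfd]
  exact hz d

theorem map_pow_apply {V W : Type u} [AddCommGroup V] [Module k V] [AddCommGroup W] [Module k W]
    (f : V →ₗ[k] V) (g : W →ₗ[k] W) (π : V →ₗ[k] W) (h : ∀ x, π (f x) = g (π x)) (t : ℕ) (x : V) :
    π ((f ^ t) x) = (g ^ t) (π x) := by
  induction t with
  | zero => rfl
  | succ t ih => rw [pow_succ', pow_succ', Module.End.mul_apply, Module.End.mul_apply, h, ih]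

end Graded

namespace FMod

variable {k : Type u} [Field k] {n : ℕ} {A B : FoldedAlg k n}

theorem isIso_of_bijective {M N : FMod A} (f : M ⟶ N) (hf : Function.Bijective (Hom.toLin f)) :
    IsIso f := by
  let e := LinearEquiv.ofBijective (Hom.toLin f) hf
  have he : ∀ x, Hom.toLin f (e.symm x) = x := fun x => e.apply_symm_apply x
  refine ⟨⟨⟨e.symm.toLinearMap, fun {d x} hx => ?_, fun x => ?_⟩, ?_, ?_⟩⟩
  · refine mem_gr_of_map_mem M.internal N.internal ((Hom.toLin f).restrictScalars k) hf.1
      (fun d x hx => Hom.map_mem f hx) ?_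
    change Hom.toLin f (e.symm x) ∈ _
    rwa [he]
  · apply hf.1
    change Hom.toLin f (e.symm _) = Hom.toLin f (M.σ (e.symm x))
    rw [he, Hom.comm f, he]
  · refine hom_ext (LinearMap.ext fun x => ?_)
    exact e.symm_apply_apply x
  · refine hom_ext (LinearMap.ext fun x => ?_)
    exact e.apply_symm_apply x

theorem mem_iSup_gr (M : FMod A) (x : M.carrier) : x ∈ ⨆ d, M.gr d := by
  rw [M.internal.submodule_iSup_eq_top]; trivial

theorem σ_smul' (M : FMod A) (r : A.carrier) (m : M.carrier) :
    M.σ (r • m) = A.aut.symm r • M.σ m := by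
  rw [← M.σ_smul, AlgEquiv.apply_symm_apply]

theorem σ_bijective (M : FMod A) (hn : 0 < n) : Function.Bijective M.σ := by
  obtain ⟨n', rfl⟩ := Nat.exists_eq_succ_of_ne_zero hn.ne'
  constructor
  · intro x y h
    have hx := DFunLike.congr_fun M.σ_pow x
    have hy := DFunLike.congr_fun M.σ_pow y
    rw [pow_succ, Module.End.mul_apply] at hx hy
    rw [h, hy] at hx
    exact hx.symm
  · intro x
    refine ⟨(M.σ ^ n') x, ?_⟩
    have hx := DFunLike.congr_fun M.σ_pow x
    rwa [pow_succ', Module.End.mul_apply] at hx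

/-- A submodule generated by homogeneous elements is graded. -/
theorem graded_span (M : FMod A) (s : Set M.carrier) (hs : ∀ x ∈ s, x ∈ ⨆ d,
    ((Submodule.span A.carrier s).restrictScalars k) ⊓ M.gr d) {x : M.carrier}
    (hx : x ∈ Submodule.span A.carrier s) :
    x ∈ ⨆ d, ((Submodule.span A.carrier s).restrictScalars k) ⊓ M.gr d := by
  induction hx using Submodule.span_induction with
  | mem x hx => exact hs x hx
  | zero => exact zero_mem _
  | add x y _ _ hx hy => exact add_mem hx hy
  | smul a x hx' hx =>
    clear hx'
    induction a using FoldedHom.hom_induction A.internal with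
    | h0 => rw [zero_smul]; exact zero_mem _
    | hadd x y hx hy => rw [add_smul]; exact add_mem hx hy
    | hmem c a ha =>
      induction hx using Submodule.iSup_induction' with
      | mem d x hx =>
        exact Submodule.mem_iSup_of_mem (c + d)
          ⟨Submodule.smul_mem (Submodule.span A.carrier s) a hx.1, M.smul_mem ha hx.2⟩
      | zero => rw [smul_zero]; exact zero_mem _
      | add x y _ _ hx hy => rw [smul_add]; exact add_mem hx hy

/-- A graded submodule that is stable under `σ`. -/
structure GrSub (M : FMod A) where
  toSub : Submodule A.carrier M.carrier
  graded : ∀ x ∈ toSub, x ∈ ⨆ d, (toSub.restrictScalars k) ⊓ M.gr d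
  σ_mem : ∀ x ∈ toSub, M.σ x ∈ toSub

namespace GrSub

variable {M : FMod A} (N : GrSub M)

/-- A graded `σ`-stable submodule, as an object. -/
abbrev sub : FMod A where
  carrier := N.toSub
  gr d := (M.gr d).comap (N.toSub.subtype.restrictScalars k)
  internal := by
    refine DirectSum.isInternal_submodule_of_iSupIndep_of_iSup_eq_top ?_ ?_
    · have h := M.internal.submodule_iSupIndep
      rw [iSupIndep_iff_finsetSum_eq_zero_imp_eq_zero] at h ⊢
      intro s v hv hsum d hd
      refine Subtype.ext (h s (fun d => (v d : M.carrier)) (fun i hi => hv i hi) ?_ d hd)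
      simpa using congrArg Subtype.val hsum
    · rw [eq_top_iff]
      rintro ⟨m, hm⟩ -
      have key : ∀ x ∈ ⨆ d, (N.toSub.restrictScalars k) ⊓ M.gr d, ∃ hx : x ∈ N.toSub,
          (⟨x, hx⟩ : N.toSub) ∈
          ⨆ d, (M.gr d).comap (N.toSub.subtype.restrictScalars k) := by
        intro x hx
        induction hx using Submodule.iSup_induction' with
        | mem d x hx => exact ⟨hx.1, Submodule.mem_iSup_of_mem d hx.2⟩
        | zero => exact ⟨zero_mem _, zero_mem _⟩
        | add x y _ _ hx hy => exact ⟨add_mem hx.1 hy.1, add_mem hx.2 hy.2⟩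
      exact (key m (N.graded m hm)).2
  smul_mem hr hm := M.smul_mem hr hm
  σ := M.σ.restrict (p := N.toSub.restrictScalars k) (q := N.toSub.restrictScalars k) N.σ_mem
  σ_mem h := M.σ_mem h
  σ_smul r m := Subtype.ext (M.σ_smul r m)
  σ_pow := by
    refine LinearMap.ext fun x => Subtype.ext ?_
    refine (map_pow_apply (M.σ.restrict (p := N.toSub.restrictScalars k)
      (q := N.toSub.restrictScalars k) N.σ_mem) M.σ
      (N.toSub.restrictScalars k).subtype (fun _ => rfl) n x).trans ?_
    rw [M.σ_pow]
    rfl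

/-- A linear map over the field that vanishes on the submodule descends to the quotient. -/
def qlift {V : Type u} [AddCommGroup V] [Module k V] (f : M.carrier →ₗ[k] V)
    (hf : ∀ x ∈ N.toSub, f x = 0) : (M.carrier ⧸ N.toSub) →ₗ[k] V :=
  (N.toSub.restrictScalars k).liftQ f hf ∘ₗ
    (Submodule.Quotient.restrictScalarsEquiv k N.toSub).symm.toLinearMap

theorem qlift_mk {V : Type u} [AddCommGroup V] [Module k V] (f : M.carrier →ₗ[k] V)
    (hf : ∀ x ∈ N.toSub, f x = 0) (x : M.carrier) : N.qlift f hf (N.toSub.mkQ x) = f x := rfl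

theorem scaling_mem [Infinite k] (z : kˣ) {x : M.carrier} (hx : x ∈ N.toSub) :
    scaling M.gr M.internal z x ∈ N.toSub := by
  have hx' := N.graded x hx
  clear hx
  induction hx' using Submodule.iSup_induction' with
  | mem d x hx =>
    rw [scaling_apply _ _ _ hx.2]
    exact (N.toSub.restrictScalars k).smul_mem _ hx.1
  | zero => rw [map_zero]; exact zero_mem _
  | add x y _ _ hx hy => rw [map_add]; exact add_mem hx hy

/-- The quotient by a graded `σ`-stable submodule. -/
abbrev quot [Infinite k] : FMod A where
  carrier := M.carrier ⧸ N.toSub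
  gr d := (M.gr d).map (N.toSub.mkQ.restrictScalars k)
  internal := by
    refine isInternal_of_scaling _ ?_ (fun z => N.qlift
      ((N.toSub.mkQ.restrictScalars k) ∘ₗ scaling M.gr M.internal z) fun x hx => ?_) ?_
    · rw [← Submodule.map_iSup, M.internal.submodule_iSup_eq_top, Submodule.map_top,
        LinearMap.range_eq_top]
      exact N.toSub.mkQ_surjective
    · exact (Submodule.Quotient.mk_eq_zero _).2 (N.scaling_mem z hx)
    · rintro z d _ ⟨x, hx, rfl⟩
      refine (N.qlift_mk _ _ x).trans ?_
      rw [LinearMap.comp_apply, scaling_apply _ _ _ hx, map_smul]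
  smul_mem {c d r m} hr hm := by
    obtain ⟨x, hx, rfl⟩ := hm
    exact ⟨r • x, M.smul_mem hr hx, rfl⟩
  σ := N.qlift ((N.toSub.mkQ.restrictScalars k) ∘ₗ M.σ) fun x hx =>
    (Submodule.Quotient.mk_eq_zero _).2 (N.σ_mem x hx)
  σ_mem {d m} hm := by
    obtain ⟨x, hx, rfl⟩ := hm
    exact ⟨M.σ x, M.σ_mem hx, rfl⟩
  σ_smul r m := by
    obtain ⟨x, rfl⟩ := N.toSub.mkQ_surjective m
    exact congrArg N.toSub.mkQ (M.σ_smul r x)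
  σ_pow := by
    refine LinearMap.ext fun x => ?_
    obtain ⟨x, rfl⟩ := N.toSub.mkQ_surjective x
    refine (map_pow_apply M.σ _ (N.toSub.mkQ.restrictScalars k) (fun _ => rfl) n x).symm.trans ?_
    rw [M.σ_pow]
    rfl

/-- The intersection with a larger submodule. -/
def comap {N N' : GrSub M} (h : N.toSub ≤ N'.toSub) : GrSub N'.sub where
  toSub := N.toSub.comap N'.toSub.subtype
  graded x hx := by
    have key : ∀ x ∈ ⨆ d, (N.toSub.restrictScalars k) ⊓ M.gr d, ∃ hx : x ∈ N'.toSub,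
        (⟨x, hx⟩ : N'.toSub) ∈ ⨆ d,
          ((N.toSub.comap N'.toSub.subtype).restrictScalars k) ⊓ N'.sub.gr d := by
      intro x hx
      induction hx using Submodule.iSup_induction' with
      | mem d x hx => exact ⟨h hx.1, Submodule.mem_iSup_of_mem d ⟨hx.1, hx.2⟩⟩
      | zero => exact ⟨zero_mem _, zero_mem _⟩
      | add x y _ _ hx hy => exact ⟨add_mem hx.1 hy.1, add_mem hx.2 hy.2⟩
    exact (key x.1 (N.graded _ hx)).2
  σ_mem x hx := N.σ_mem _ hx

end GrSub

/-- A natural family of graded `σ`-stable submodules of the values of a functor. -/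
structure SubFamily (G : FMod A ⥤ FMod B) where
  obj : ∀ M, GrSub (G.obj M)
  map_mem : ∀ {M M' : FMod A} (f : M ⟶ M'), ∀ x ∈ (obj M).toSub,
    Hom.toLin (G.map f) x ∈ (obj M').toSub

namespace SubFamily

variable {G : FMod A ⥤ FMod B} (N N' : SubFamily G)

/-- The subfunctor. -/
def sub : FMod A ⥤ FMod B where
  obj M := (N.obj M).sub
  map {M M'} f := ⟨(Hom.toLin (G.map f)).restrict (N.map_mem f),
    fun h => Hom.map_mem (G.map f) h, fun m => Subtype.ext (Hom.comm (G.map f) m.1)⟩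
  map_id M := hom_ext (LinearMap.ext fun x => Subtype.ext (by
    change Hom.toLin (G.map (𝟙 M)) x.1 = x.1
    rw [G.map_id]; rfl))
  map_comp f g := hom_ext (LinearMap.ext fun x => Subtype.ext (by
    change Hom.toLin (G.map (f ≫ g)) x.1 = Hom.toLin (G.map g) (Hom.toLin (G.map f) x.1)
    rw [G.map_comp]; rfl))

/-- The quotient functor. -/
def quot [Infinite k] : FMod A ⥤ FMod B where
  obj M := (N.obj M).quot
  map {M M'} f := ⟨Submodule.mapQ _ _ (Hom.toLin (G.map f)) (N.map_mem f), by
      rintro d _ ⟨x, hx, rfl⟩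
      exact ⟨Hom.toLin (G.map f) x, Hom.map_mem (G.map f) hx, rfl⟩, fun m => by
      obtain ⟨x, rfl⟩ := Submodule.mkQ_surjective _ m
      exact congrArg (N.obj M').toSub.mkQ (Hom.comm (G.map f) x)⟩
  map_id M := hom_ext (LinearMap.ext fun x => by
    obtain ⟨x, rfl⟩ := Submodule.mkQ_surjective _ x
    change (N.obj M).toSub.mkQ (Hom.toLin (G.map (𝟙 M)) x) = _
    rw [G.map_id]; rfl)
  map_comp {M M' M''} f g := hom_ext (LinearMap.ext fun x => by
    obtain ⟨x, rfl⟩ := Submodule.mkQ_surjective _ x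
    change (N.obj M'').toSub.mkQ (Hom.toLin (G.map (f ≫ g)) x) =
      (N.obj M'').toSub.mkQ (Hom.toLin (G.map g) (Hom.toLin (G.map f) x))
    rw [G.map_comp]; rfl)

variable {N N'}

/-- A subfunctor of a larger subfunctor. -/
def comap (h : ∀ M, (N.obj M).toSub ≤ (N'.obj M).toSub) : SubFamily N'.sub where
  obj M := GrSub.comap (h M)
  map_mem f x hx := N.map_mem f x.1 hx

/-- The inclusion between two subfunctors. -/
def inc (h : ∀ M, (N.obj M).toSub ≤ (N'.obj M).toSub) : N.sub ⟶ N'.sub where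
  app M := ⟨Submodule.inclusion (h M), fun hx => hx, fun _ => rfl⟩
  naturality _ _ _ := rfl

/-- The projection onto a quotient of a subfunctor. -/
def proj [Infinite k] (h : ∀ M, (N.obj M).toSub ≤ (N'.obj M).toSub) :
    N'.sub ⟶ (comap h).quot where
  app M := ⟨Submodule.mkQ _, fun {d m} hm => ⟨m, hm, rfl⟩, fun _ => rfl⟩
  naturality _ _ _ := rfl

theorem isShortExact [Infinite k] (h : ∀ M, (N.obj M).toSub ≤ (N'.obj M).toSub) (M : FMod A) :
    IsShortExact ((inc h).app M) ((proj h).app M) where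
  injective := Submodule.inclusion_injective (h M)
  exact x := by
    refine (Submodule.Quotient.mk_eq_zero _).trans ⟨fun hx => ⟨⟨x.1, hx⟩, rfl⟩, ?_⟩
    rintro ⟨y, rfl⟩
    exact y.2
  surjective := Submodule.mkQ_surjective _

/-- The inclusion of a subfunctor. -/
def incl (N : SubFamily G) : N.sub ⟶ G where
  app M := ⟨Submodule.subtype _, fun hx => hx, fun _ => rfl⟩
  naturality _ _ _ := rfl

/-- The subfunctor given by all of `G` is isomorphic to `G`. -/
def isoOfTop (N : SubFamily G) (h : ∀ M, (N.obj M).toSub = ⊤) : N.sub ≅ G :=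
  haveI : ∀ M, IsIso (N.incl.app M) := fun M => isIso_of_bijective _
    ⟨Subtype.val_injective, fun x => ⟨⟨x, by rw [h]; trivial⟩, rfl⟩⟩
  haveI : IsIso N.incl := NatIso.isIso_of_isIso_app _
  asIso N.incl

end SubFamily

/-- A functor is exact if, as a functor to sets, it is a product of functors `M ↦ ε M` with
idempotents `ε`. -/
theorem isExactFunctor_of_coords (F : FMod A ⥤ FMod B) {X : Type*} (ε : X → A.carrier)
    (hε : ∀ q, ε q * ε q = ε q) (s : ∀ M : FMod A, (X → M.carrier) →+ (F.obj M).carrier)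
    (hmap : ∀ {M M' : FMod A} (f : M ⟶ M') (x : X → M.carrier),
      Hom.toLin (F.map f) (s M x) = s M' fun q => Hom.toLin f (x q))
    (hsurj : ∀ M, Function.Surjective (s M))
    (hzero : ∀ M x, s M x = 0 ↔ ∀ q, ε q • x q = 0) : IsExactFunctor F := by
  have hs : ∀ M x, s M (fun q => ε q • x q) = s M x := by
    intro M x
    rw [← sub_eq_zero, ← map_sub, hzero]
    intro q
    simp [smul_sub, smul_smul, hε]
  intro M N P f g hfg
  refine ⟨?_, ?_, ?_⟩
  · rw [injective_iff_map_eq_zero]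
    intro y hy
    obtain ⟨x, rfl⟩ := hsurj M y
    rw [hmap, hzero] at hy
    rw [hzero]
    intro q
    apply hfg.injective
    rw [map_smul, hy q, map_zero]
  · intro y
    obtain ⟨x, rfl⟩ := hsurj N y
    constructor
    · intro hy
      rw [hmap, hzero] at hy
      have : ∀ q, ∃ m, Hom.toLin f m = ε q • x q := fun q =>
        (hfg.exact _).1 (by rw [map_smul]; exact hy q)
      choose m hm using this
      refine ⟨s M m, ?_⟩
      rw [hmap, ← hs N x]
      simp only [hm]
    · rintro ⟨y, hy⟩
      obtain ⟨x', rfl⟩ := hsurj M y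
      rw [← hy, hmap, hmap, hzero]
      intro q
      rw [(hfg.exact _).2 ⟨_, rfl⟩, smul_zero]
  · intro y
    obtain ⟨x, rfl⟩ := hsurj P y
    choose m hm using fun q => hfg.surjective (x q)
    refine ⟨s N m, ?_⟩
    rw [hmap]
    simp only [hm]

end FMod

open FMod

variable {k : Type u} [Field k] {n : ℕ} {A B : FoldedAlg k n}

/-- A stratification of a functor: natural maps `tMk ν : M → G M`, for `ν` in a finite set on which
`a` acts, and elements `b q` of `B`, such that `G M` is the direct sum of the spaces
`b q • tMk (pr q) (ε (pr q) M)`, and the spans of the images of the `tMk ν` for `ν` in lower sets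
are submodules. -/
structure Strat (G : FMod A ⥤ FMod B) (T X : Type u) [Fintype X] where
  α : Equiv.Perm T
  α_pow : α.symm ^ n = 1
  g : T → ℕ
  g_α : ∀ ν, g (α.symm ν) = g ν
  g_eq : ∀ ν ν', g ν = g ν' → ∃ j : ℕ, α.symm^[j] ν' = ν
  pr : X → T
  ε : T → A.carrier
  ε_idem : ∀ ν, ε ν * ε ν = ε ν
  b : X → B.carrier
  c : T → ℤ
  tMk : ∀ (_ : T) (M : FMod A), M.carrier →ₗ[k] (G.obj M).carrier
  tMk_ε : ∀ ν M m, tMk ν M (ε ν • m) = tMk ν M m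
  tMk_mem : ∀ ν (M : FMod A) d, ∀ m ∈ M.gr d, tMk ν M m ∈ (G.obj M).gr (c ν + d)
  tMk_map : ∀ ν {M M' : FMod A} (f : M ⟶ M') m,
    Hom.toLin (G.map f) (tMk ν M m) = tMk ν M' (Hom.toLin f m)
  tMk_σ : ∀ ν (M : FMod A) m, (G.obj M).σ (tMk ν M m) = tMk (α.symm ν) M (M.σ m)
  surj : ∀ (M : FMod A) (y : (G.obj M).carrier), ∃ x : X → M.carrier, y = ∑ q, b q • tMk (pr q) M (x q)
  inj : ∀ (M : FMod A) (x : X → M.carrier), ∑ q : X, b q • tMk (pr q) M (x q) = 0 →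
    ∀ q, ε (pr q) • x q = 0
  stab : ∀ (M : FMod A) (b' : B.carrier) (ν : T) (m : M.carrier), ∃ x : X → M.carrier, b' • tMk ν M m =
    ∑ q, b q • tMk (pr q) M (x q) ∧ ∀ q, x q ≠ 0 → pr q = ν ∨ g (pr q) < g ν

namespace Strat

variable {G : FMod A ⥤ FMod B} {T X : Type u} [Fintype X] (Z : Strat G T X)

/-- The elements with coordinates in a given set. -/
def supported (M : FMod A) (P : T → Prop) : AddSubmonoid (G.obj M).carrier where
  carrier := {y | ∃ x : X → M.carrier, y = ∑ q, Z.b q • Z.tMk (Z.pr q) M (x q) ∧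
    ∀ q, x q ≠ 0 → P (Z.pr q)}
  zero_mem' := ⟨fun _ => 0, by simp, fun q h => absurd rfl h⟩
  add_mem' := by
    rintro _ _ ⟨x, rfl, hx⟩ ⟨y, rfl, hy⟩
    refine ⟨fun q => x q + y q, by simp [Finset.sum_add_distrib], fun q hq => ?_⟩
    by_cases h : x q = 0
    · exact hy q fun h' => hq (by change x q + y q = 0; rw [h, h', add_zero])
    · exact hx q h

theorem smul_mem_supported {M : FMod A} {P : T → Prop}
    (hP : ∀ ν ν', P ν → Z.g ν' < Z.g ν → P ν') (b : B.carrier) {y : (G.obj M).carrier}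
    (hy : y ∈ Z.supported M P) : b • y ∈ Z.supported M P := by
  obtain ⟨x, rfl, hx⟩ := hy
  rw [Finset.smul_sum]
  refine sum_mem fun q _ => ?_
  by_cases h : x q = 0
  · rw [h, map_zero, smul_zero, smul_zero]; exact zero_mem _
  · rw [smul_smul]
    obtain ⟨x', h1, h2⟩ := Z.stab M (b * Z.b q) (Z.pr q) (x q)
    refine ⟨x', h1, fun q' hq' => ?_⟩
    rcases h2 q' hq' with h3 | h3
    · rw [h3]; exact hx q h
    · exact hP _ _ (hx q h) h3

theorem tMk_mem_supported {M : FMod A} {P : T → Prop}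
    (hP : ∀ ν ν', P ν → Z.g ν' < Z.g ν → P ν') {ν : T} (hν : P ν) (m : M.carrier) :
    Z.tMk ν M m ∈ Z.supported M P := by
  obtain ⟨x', h1, h2⟩ := Z.stab M 1 ν m
  rw [one_smul] at h1
  refine ⟨x', h1, fun q' hq' => ?_⟩
  rcases h2 q' hq' with h3 | h3
  · rwa [h3]
  · exact hP _ _ hν h3

/-- The generators of the `p`-th step of the filtration. -/
def gens (p : ℕ) (M : FMod A) : Set (G.obj M).carrier :=
  {y | ∃ ν m, Z.g ν < p ∧ y = Z.tMk ν M m}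

theorem tMk_mem_iSup {M : FMod A} (N : Submodule B.carrier (G.obj M).carrier) (ν : T)
    (h : ∀ m, Z.tMk ν M m ∈ N) (m : M.carrier) :
    Z.tMk ν M m ∈ ⨆ d, (N.restrictScalars k) ⊓ (G.obj M).gr d := by
  induction M.mem_iSup_gr m using Submodule.iSup_induction' with
  | mem d x hx => exact Submodule.mem_iSup_of_mem _ ⟨h x, Z.tMk_mem ν M d x hx⟩
  | zero => rw [map_zero]; exact zero_mem _
  | add x y _ _ hx hy => rw [map_add]; exact add_mem hx hy

/-- A step of the filtration. -/
def filObj (p : ℕ) (M : FMod A) : GrSub (G.obj M) where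
  toSub := Submodule.span B.carrier (Z.gens p M)
  graded x hx := graded_span _ _ (by
    rintro _ ⟨ν, m, hν, rfl⟩
    exact Z.tMk_mem_iSup (Submodule.span B.carrier (Z.gens p M)) ν
      (fun m => Submodule.subset_span ⟨ν, m, hν, rfl⟩) m) hx
  σ_mem x hx := by
    induction hx using Submodule.span_induction with
    | mem x hx =>
      obtain ⟨ν, m, hν, rfl⟩ := hx
      rw [Z.tMk_σ]
      exact Submodule.subset_span ⟨Z.α.symm ν, M.σ m, by rwa [Z.g_α], rfl⟩
    | zero => rw [map_zero]; exact zero_mem _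
    | add x y _ _ hx hy => rw [map_add]; exact add_mem hx hy
    | smul a x _ hx => rw [σ_smul']; exact Submodule.smul_mem _ _ hx

/-- The filtration. -/
def fil (p : ℕ) : SubFamily G where
  obj M := Z.filObj p M
  map_mem {M M'} f x hx := by
    change _ ∈ Submodule.span B.carrier (Z.gens p M')
    change x ∈ Submodule.span B.carrier (Z.gens p M) at hx
    induction hx using Submodule.span_induction with
    | mem x hx =>
      obtain ⟨ν, m, hν, rfl⟩ := hx
      rw [Z.tMk_map]
      exact Submodule.subset_span ⟨_, _, hν, rfl⟩
    | zero => rw [map_zero]; exact zero_mem _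
    | add x y _ _ hx hy => rw [map_add]; exact add_mem hx hy
    | smul a x _ hx => rw [map_smul]; exact Submodule.smul_mem _ _ hx

theorem tMk_mem_fil {p : ℕ} {M : FMod A} {ν : T} (hν : Z.g ν < p) (m : M.carrier) :
    Z.tMk ν M m ∈ ((Z.fil p).obj M).toSub := Submodule.subset_span ⟨ν, m, hν, rfl⟩

theorem mem_fil {p : ℕ} {M : FMod A} {y : (G.obj M).carrier} :
    y ∈ ((Z.fil p).obj M).toSub ↔ y ∈ Z.supported M fun ν => Z.g ν < p := by
  constructor
  · intro hy
    have hP : ∀ ν ν', Z.g ν < p → Z.g ν' < Z.g ν → Z.g ν' < p := fun _ _ h h' => h'.trans h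
    induction hy using Submodule.span_induction with
    | mem x hx =>
      obtain ⟨ν, m, hν, rfl⟩ := hx
      exact Z.tMk_mem_supported hP hν m
    | zero => exact zero_mem _
    | add x y _ _ hx hy => exact add_mem hx hy
    | smul a x _ hx => exact Z.smul_mem_supported hP a hx
  · rintro ⟨x, rfl, hx⟩
    refine sum_mem fun q _ => ?_
    by_cases h : x q = 0
    · rw [h, map_zero, smul_zero]; exact zero_mem _
    · exact Submodule.smul_mem _ _ (Z.tMk_mem_fil (hx q h) _)

theorem fil_le (p : ℕ) (M : FMod A) : ((Z.fil p).obj M).toSub ≤ ((Z.fil (p + 1)).obj M).toSub := by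
  refine Submodule.span_mono ?_
  rintro _ ⟨ν, m, hν, rfl⟩
  exact ⟨ν, m, by omega, rfl⟩

theorem fil_zero (M : FMod A) : Subsingleton ((Z.fil 0).sub.obj M).carrier := by
  refine ⟨fun x y => Subtype.ext ?_⟩
  have : ∀ x ∈ ((Z.fil 0).obj M).toSub, x = 0 := by
    intro x hx
    obtain ⟨z, rfl, hz⟩ := Z.mem_fil.1 hx
    refine Finset.sum_eq_zero fun q _ => ?_
    by_cases h : z q = 0
    · rw [h, map_zero, smul_zero]
    · exact absurd (hz q h) (by omega)
  exact (this _ x.2).trans (this _ y.2).symm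

theorem fil_top {m : ℕ} (hm : ∀ ν, Z.g ν < m) (M : FMod A) : ((Z.fil m).obj M).toSub = ⊤ := by
  rw [eq_top_iff]
  rintro y -
  obtain ⟨x, hx⟩ := Z.surj M y
  exact Z.mem_fil.2 ⟨x, hx, fun q _ => hm _⟩

variable [Infinite k]

/-- Extension of a family by zero. -/
def extendZero {M : Type*} [Zero M] (P : X → Prop) (x : {q // P q} → M) (q : X) : M :=
  open Classical in if h : P q then x ⟨q, h⟩ else 0

theorem extendZero_of {M : Type*} [Zero M] {P : X → Prop} (x : {q // P q} → M) {q : X} (h : P q) :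
    extendZero P x q = x ⟨q, h⟩ := dif_pos h

theorem sum_extendZero {M V : Type*} [Zero M] [AddCommMonoid V] {P : X → Prop} [Fintype {q // P q}]
    (f : X → M → V) (hf : ∀ q, f q 0 = 0) (x : {q // P q} → M) :
    ∑ q : {q // P q}, f q.1 (x q) = ∑ q, f q (extendZero P x q) := by
  classical
  rw [← Finset.sum_subset (Finset.subset_univ (Finset.univ.filter P))]
  · rw [Finset.sum_subtype (p := P) (Finset.univ.filter P) (by simp)]
    exact Finset.sum_congr rfl fun q _ => by rw [extendZero_of x q.2]
  · intro q _ hq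
    rw [extendZero, dif_neg (by simpa using hq), hf]

theorem sum_subtype_eq {V : Type*} [AddCommMonoid V] {P : X → Prop} [Fintype {q // P q}]
    (f : X → V) (hf : ∀ q, ¬ P q → f q = 0) : ∑ q : {q // P q}, f q.1 = ∑ q, f q := by
  classical
  rw [← Finset.sum_subset (Finset.subset_univ (Finset.univ.filter P))]
  · rw [Finset.sum_subtype (p := P) (Finset.univ.filter P) (by simp)]
  · intro q _ hq
    exact hf q (by simpa using hq)

theorem fil_exact (p : ℕ) : IsExactFunctor (Z.fil p).sub := by
  classical
  refine isExactFunctor_of_coords (X := {q // Z.g (Z.pr q) < p}) _ (fun q => Z.ε (Z.pr q))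
    (fun q => Z.ε_idem _)
    (fun M => { toFun := fun x => ⟨∑ q, Z.b q.1 • Z.tMk (Z.pr q.1) M (x q),
                  sum_mem fun q _ => Submodule.smul_mem _ _ (Z.tMk_mem_fil q.2 _)⟩
                map_zero' := Subtype.ext (by
                  change ∑ q : {q // Z.g (Z.pr q) < p}, _ = (0 : (G.obj M).carrier)
                  simp)
                map_add' := fun x y => Subtype.ext (by
                  change ∑ q : {q // Z.g (Z.pr q) < p}, Z.b q.1 • Z.tMk (Z.pr q.1) M (x q + y q) =
                    ∑ q : {q // Z.g (Z.pr q) < p}, Z.b q.1 • Z.tMk (Z.pr q.1) M (x q) +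
                    ∑ q : {q // Z.g (Z.pr q) < p}, Z.b q.1 • Z.tMk (Z.pr q.1) M (y q)
                  simp only [map_add, smul_add, Finset.sum_add_distrib]) }) ?_ ?_ ?_
  · intro M M' f x
    refine Subtype.ext ?_
    change Hom.toLin (G.map f) (∑ q, _) = ∑ q, _
    rw [map_sum]
    refine Finset.sum_congr rfl fun q _ => ?_
    rw [map_smul, Z.tMk_map]
  · rintro M ⟨y, hy⟩
    obtain ⟨x, rfl, hx⟩ := Z.mem_fil.1 hy
    refine ⟨fun q => x q.1, Subtype.ext ?_⟩
    refine sum_subtype_eq (fun q => Z.b q • Z.tMk (Z.pr q) M (x q)) fun q hq => ?_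
    rw [not_imp_comm.1 (hx q) hq, map_zero, smul_zero]
  · intro M x
    have h : (∑ q : {q // Z.g (Z.pr q) < p}, Z.b q.1 • Z.tMk (Z.pr q.1) M (x q)) =
        ∑ q, Z.b q • Z.tMk (Z.pr q) M (extendZero _ x q) :=
      sum_extendZero (fun q m => Z.b q • Z.tMk (Z.pr q) M m) (by simp) x
    constructor
    · intro h0 q
      have h1 := Z.inj M _ (h.symm.trans (congrArg Subtype.val h0)) q.1
      rwa [extendZero_of x q.2] at h1
    · intro h0
      refine Subtype.ext (Finset.sum_eq_zero fun q _ => ?_)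
      rw [← Z.tMk_ε, h0, map_zero, smul_zero]

/-- The subquotients of the filtration. -/
def gra (p : ℕ) : FMod A ⥤ FMod B := (SubFamily.comap (Z.fil_le p)).quot

/-- The projection onto the subquotient. -/
def gmk (p : ℕ) (M : FMod A) (y : (G.obj M).carrier) (hy : y ∈ ((Z.fil (p + 1)).obj M).toSub) :
    ((Z.gra p).obj M).carrier :=
  Submodule.mkQ ((SubFamily.comap (Z.fil_le p)).obj M).toSub ⟨y, hy⟩

theorem gmk_eq_iff {p : ℕ} {M : FMod A} {y y' : (G.obj M).carrier}
    (hy : y ∈ ((Z.fil (p + 1)).obj M).toSub) (hy' : y' ∈ ((Z.fil (p + 1)).obj M).toSub) :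
    Z.gmk p M y hy = Z.gmk p M y' hy' ↔ y - y' ∈ ((Z.fil p).obj M).toSub :=
  Submodule.Quotient.eq _

theorem gmk_surjective {p : ℕ} {M : FMod A} (x : ((Z.gra p).obj M).carrier) :
    ∃ y hy, x = Z.gmk p M y hy := by
  obtain ⟨⟨y, hy⟩, rfl⟩ := Submodule.mkQ_surjective _ x
  exact ⟨y, hy, rfl⟩

theorem gmk_add {p : ℕ} {M : FMod A} {y y' : (G.obj M).carrier}
    (hy : y ∈ ((Z.fil (p + 1)).obj M).toSub) (hy' : y' ∈ ((Z.fil (p + 1)).obj M).toSub) :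
    Z.gmk p M (y + y') (add_mem hy hy') = Z.gmk p M y hy + Z.gmk p M y' hy' := rfl

theorem gmk_zero {p : ℕ} {M : FMod A} : Z.gmk p M 0 (zero_mem _) = 0 := rfl

/-- The map `tMk ν` to the subquotient. -/
def vMk {p : ℕ} {ν : T} (hν : Z.g ν = p) (M : FMod A) :
    M.carrier →ₗ[k] ((Z.gra p).obj M).carrier :=
  ((Submodule.mkQ ((SubFamily.comap (Z.fil_le p)).obj M).toSub).restrictScalars k) ∘ₗ
    (Z.tMk ν M).codRestrict (((Z.fil (p + 1)).obj M).toSub.restrictScalars k)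
      fun m => Z.tMk_mem_fil (by omega) m

theorem vMk_eq {p : ℕ} {ν : T} (hν : Z.g ν = p) (M : FMod A) (m : M.carrier) :
    Z.vMk hν M m = Z.gmk p M (Z.tMk ν M m) (Z.tMk_mem_fil (by omega) m) := rfl

theorem smul_vMk {p : ℕ} {ν : T} (hν : Z.g ν = p) (M : FMod A) (b : B.carrier) (m : M.carrier) :
    b • Z.vMk hν M m = Z.gmk p M (b • Z.tMk ν M m)
      (Submodule.smul_mem _ _ (Z.tMk_mem_fil (by omega) m)) := rfl

theorem vMk_ε {p : ℕ} {ν : T} (hν : Z.g ν = p) (M : FMod A) (m : M.carrier) :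
    Z.vMk hν M (Z.ε ν • m) = Z.vMk hν M m := by
  simp only [vMk_eq, Z.tMk_ε]

theorem vMk_mem {p : ℕ} {ν : T} (hν : Z.g ν = p) (M : FMod A) {d : ℤ} {m : M.carrier}
    (hm : m ∈ M.gr d) : Z.vMk hν M m ∈ ((Z.gra p).obj M).gr (Z.c ν + d) :=
  ⟨⟨Z.tMk ν M m, Z.tMk_mem_fil (by omega) m⟩, Z.tMk_mem ν M d m hm, rfl⟩

theorem vMk_map {p : ℕ} {ν : T} (hν : Z.g ν = p) {M M' : FMod A} (f : M ⟶ M') (m : M.carrier) :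
    Hom.toLin ((Z.gra p).map f) (Z.vMk hν M m) = Z.vMk hν M' (Hom.toLin f m) := by
  have : Hom.toLin ((Z.gra p).map f) (Z.vMk hν M m) =
    Z.gmk p M' (Hom.toLin (G.map f) (Z.tMk ν M m))
      ((Z.fil (p + 1)).map_mem f _ (Z.tMk_mem_fil (by omega) m)) := rfl
  rw [this, vMk_eq]
  simp only [Z.tMk_map]

theorem vMk_σ {p : ℕ} {ν ν' : T} (hν : Z.g ν = p) (hν' : Z.g ν' = p) (h : Z.α.symm ν = ν')
    (M : FMod A) (m : M.carrier) :
    ((Z.gra p).obj M).σ (Z.vMk hν M m) = Z.vMk hν' M (M.σ m) := by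
  subst h
  have : ((Z.gra p).obj M).σ (Z.vMk hν M m) =
    Z.gmk p M ((G.obj M).σ (Z.tMk ν M m))
      (((Z.fil (p + 1)).obj M).σ_mem _ (Z.tMk_mem_fil (by omega) m)) := rfl
  rw [this, vMk_eq]
  simp only [Z.tMk_σ]

/-- The element with given coordinates. -/
def gsum (p : ℕ) (M : FMod A) (x : {q // Z.g (Z.pr q) = p} → M.carrier) :
    ((Z.gra p).obj M).carrier :=
  open Classical in ∑ q, Z.b q.1 • Z.vMk q.2 M (x q)

theorem gsum_eq (p : ℕ) (M : FMod A) (x : {q // Z.g (Z.pr q) = p} → M.carrier) :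
    ∃ hy, Z.gsum p M x = Z.gmk p M (∑ q, Z.b q • Z.tMk (Z.pr q) M (extendZero _ x q)) hy := by
  classical
  have h : (∑ q : {q // Z.g (Z.pr q) = p}, Z.b q.1 • Z.tMk (Z.pr q.1) M (x q)) =
        ∑ q, Z.b q • Z.tMk (Z.pr q) M (extendZero _ x q) :=
      sum_extendZero (fun q m => Z.b q • Z.tMk (Z.pr q) M m) (by simp) x
  refine ⟨?_, ?_⟩
  · rw [← h]
    exact sum_mem fun q _ => Submodule.smul_mem _ _ (Z.tMk_mem_fil (by omega) _)
  · simp only [← h]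
    have : ∀ s : Finset {q // Z.g (Z.pr q) = p}, ∑ q ∈ s, Z.b q.1 • Z.vMk q.2 M (x q) =
        Z.gmk p M (∑ q ∈ s, Z.b q.1 • Z.tMk (Z.pr q.1) M (x q)) (sum_mem fun q _ =>
          Submodule.smul_mem _ _ (Z.tMk_mem_fil (by omega) _)) := by
      intro s
      induction s using Finset.induction_on with
      | empty => rfl
      | insert q s hq ih =>
        rw [Finset.sum_insert hq, ih, smul_vMk, ← gmk_add]
        simp only [Finset.sum_insert hq]
    rw [gsum]
    convert this Finset.univ

theorem gsum_add (p : ℕ) (M : FMod A) (x y : {q // Z.g (Z.pr q) = p} → M.carrier) :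
    Z.gsum p M (x + y) = Z.gsum p M x + Z.gsum p M y := by
  simp [gsum, Finset.sum_add_distrib]

theorem gsum_zero (p : ℕ) (M : FMod A) : Z.gsum p M 0 = 0 := by
  simp [gsum]

theorem gsum_eq_zero_iff (p : ℕ) (M : FMod A) (x : {q // Z.g (Z.pr q) = p} → M.carrier) :
    Z.gsum p M x = 0 ↔ ∀ q, Z.ε (Z.pr q.1) • x q = 0 := by
  classical
  constructor
  · intro h q
    obtain ⟨hy, h1⟩ := Z.gsum_eq p M x
    rw [h1, ← Z.gmk_zero, gmk_eq_iff, sub_zero] at h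
    obtain ⟨x', h2, h3⟩ := Z.mem_fil.1 h
    have h4 := Z.inj M (fun q => extendZero _ x q - x' q) (by
      simp only [map_sub, smul_sub, Finset.sum_sub_distrib, h2, sub_self]) q.1
    have h5 : x' q.1 = 0 := by
      by_contra h5
      have := h3 _ h5
      have := q.2
      omega
    rw [extendZero_of x q.2, h5, sub_zero] at h4
    exact h4
  · intro h
    rw [gsum]
    refine Finset.sum_eq_zero fun q _ => ?_
    rw [← Z.vMk_ε, h, map_zero, smul_zero]

theorem exists_gsum_of (p : ℕ) (M : FMod A) (x : X → M.carrier)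
    (hx : ∀ q, x q ≠ 0 → Z.g (Z.pr q) < p + 1) (hy) :
    Z.gmk p M (∑ q, Z.b q • Z.tMk (Z.pr q) M (x q)) hy = Z.gsum p M fun q => x q.1 := by
  obtain ⟨hy', h1⟩ := Z.gsum_eq p M fun q => x q.1
  rw [h1, gmk_eq_iff, ← Finset.sum_sub_distrib]
  refine sum_mem fun q _ => ?_
  rw [← smul_sub, ← map_sub]
  by_cases h : x q = 0
  · have h' : extendZero (fun q => Z.g (Z.pr q) = p) (fun q => x q.1) q = 0 := by
      rw [extendZero]
      split_ifs <;> simp [h]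
    rw [h, h', sub_self, map_zero, smul_zero]
    exact zero_mem _
  · rcases Nat.lt_succ_iff_lt_or_eq.1 (hx q h) with h2 | h2
    · exact Submodule.smul_mem _ _ (Z.tMk_mem_fil h2 _)
    · rw [extendZero_of (P := fun q => Z.g (Z.pr q) = p) _ h2, sub_self, map_zero, smul_zero]
      exact zero_mem _

theorem exists_gsum (p : ℕ) (M : FMod A) (y : ((Z.gra p).obj M).carrier) :
    ∃ x, y = Z.gsum p M x := by
  obtain ⟨y, hy, rfl⟩ := Z.gmk_surjective y
  obtain ⟨x, rfl, hx⟩ := Z.mem_fil.1 hy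
  exact ⟨_, Z.exists_gsum_of p M x hx hy⟩

theorem gra_exact (p : ℕ) : IsExactFunctor (Z.gra p) := by
  classical
  refine isExactFunctor_of_coords (X := {q // Z.g (Z.pr q) = p}) _ (fun q => Z.ε (Z.pr q))
    (fun q => Z.ε_idem _) (fun M => ⟨⟨Z.gsum p M, Z.gsum_zero p M⟩, Z.gsum_add p M⟩) ?_ ?_ ?_
  · intro M M' f x
    change Hom.toLin ((Z.gra p).map f) (Z.gsum p M x) = Z.gsum p M' _
    rw [gsum, gsum, map_sum]
    refine Finset.sum_congr rfl fun q _ => ?_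
    rw [map_smul, Z.vMk_map]
  · intro M y
    obtain ⟨x, rfl⟩ := Z.exists_gsum p M y
    exact ⟨x, rfl⟩
  · exact Z.gsum_eq_zero_iff p

theorem smul_vMk_eq {p : ℕ} {ν : T} (hν : Z.g ν = p) (M : FMod A) (b : B.carrier) (m : M.carrier) :
    ∃ x, b • Z.vMk hν M m = Z.gsum p M x ∧ ∀ q, x q ≠ 0 → Z.pr q.1 = ν := by
  obtain ⟨x, h1, h2⟩ := Z.stab M b ν m
  refine ⟨fun q => x q.1, ?_, fun q hq => ?_⟩
  · rw [smul_vMk]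
    simp only [h1]
    refine Z.exists_gsum_of p M x (fun q hq => ?_) _
    rcases h2 q hq with h3 | h3
    · rw [h3]; omega
    · omega
  · have := q.2
    rcases h2 q.1 hq with h3 | h3
    · exact h3
    · omega

theorem gsum_eq_sum (p : ℕ) [Fintype {q // Z.g (Z.pr q) = p}] (M : FMod A)
    (x : {q // Z.g (Z.pr q) = p} → M.carrier) :
    Z.gsum p M x = ∑ q, Z.b q.1 • Z.vMk q.2 M (x q) := by
  rw [gsum]
  congr!

/-- The summands of a subquotient that belong to the members of an orbit. -/
def part {p : ℕ} {ν : T} (hν : Z.g ν = p) (M : FMod A) :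
    Submodule B.carrier ((Z.gra p).obj M).carrier :=
  Submodule.span B.carrier (Set.range (Z.vMk hν M))

theorem exists_of_mem_part {p : ℕ} {ν : T} (hν : Z.g ν = p) (M : FMod A)
    {y : ((Z.gra p).obj M).carrier} (hy : y ∈ Z.part hν M) :
    ∃ x, y = Z.gsum p M x ∧ ∀ q, x q ≠ 0 → Z.pr q.1 = ν := by
  induction hy using Submodule.span_induction with
  | mem y hy =>
    obtain ⟨m, rfl⟩ := hy
    obtain ⟨x, hx⟩ := Z.smul_vMk_eq hν M 1 m
    rw [one_smul] at hx
    exact ⟨x, hx⟩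
  | zero => exact ⟨0, (Z.gsum_zero p M).symm, fun q h => absurd rfl h⟩
  | add y y' _ _ hy hy' =>
    obtain ⟨x, rfl, hx⟩ := hy
    obtain ⟨x', rfl, hx'⟩ := hy'
    refine ⟨x + x', (Z.gsum_add p M x x').symm, fun q hq => ?_⟩
    by_cases h : x q = 0
    · refine hx' q fun h' => hq ?_
      rw [Pi.add_apply, h, h', add_zero]
    · exact hx q h
  | smul a y _ hy =>
    classical
    obtain ⟨x, rfl, hx⟩ := hy
    have key : ∀ q : {q // Z.g (Z.pr q) = p}, ∃ x', a • Z.b q.1 • Z.vMk q.2 M (x q) =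
        Z.gsum p M x' ∧ ∀ q, x' q ≠ 0 → Z.pr q.1 = ν := by
      intro q
      by_cases h : x q = 0
      · exact ⟨0, by rw [h, map_zero, smul_zero, smul_zero, gsum_zero], fun q h => absurd rfl h⟩
      · obtain ⟨x', h1, h2⟩ := Z.smul_vMk_eq q.2 M (a * Z.b q.1) (x q)
        refine ⟨x', by rw [smul_smul, h1], fun q' hq' => ?_⟩
        rw [h2 q' hq', hx q h]
    choose x' h1 h2 using key
    refine ⟨∑ q, x' q, ?_, fun q hq => ?_⟩
    · rw [Z.gsum_eq_sum, Finset.smul_sum]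
      simp only [h1]
      exact (map_sum (⟨⟨Z.gsum p M, Z.gsum_zero p M⟩, Z.gsum_add p M⟩ : _ →+ _) x' _).symm
    · rw [Finset.sum_apply] at hq
      obtain ⟨q', _, hq'⟩ := Finset.exists_ne_zero_of_sum_ne_zero hq
      exact h2 q' q hq'

theorem isTraceless (hn : 0 < n) {p : ℕ} {ν : T} (hν : Z.g ν = p) (hne : Z.α.symm ν ≠ ν) :
    IsTracelessFunctor (Z.gra p) := by
  classical
  intro M
  let β : T → T := fun ν => Z.α.symm ν
  set t := Function.minimalPeriod β ν with ht
  have hper : Function.IsPeriodicPt β n ν := by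
    have := DFunLike.congr_fun Z.α_pow ν
    rw [Equiv.Perm.coe_one, id, ← Equiv.Perm.iterate_eq_pow] at this
    exact this
  have ht0 : 0 < t := hper.minimalPeriod_pos hn
  have ht1 : t ≠ 1 := fun h => hne (Function.minimalPeriod_eq_one_iff_isFixedPt.1 h)
  have htn : t ∣ n := hper.minimalPeriod_dvd
  have : NeZero t := ⟨ht0.ne'⟩
  let orb : ZMod t → T := fun s => β^[s.val] ν
  have horb : ∀ s, Z.g (orb s) = p := by
    have : ∀ j : ℕ, Z.g (β^[j] ν) = p := by
      intro j
      induction j with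
      | zero => exact hν
      | succ j ih => rw [Function.iterate_succ_apply']; exact (Z.g_α _).trans ih
    exact fun s => this _
  have hnat : ∀ j : ℕ, orb (j : ZMod t) = β^[j] ν := by
    intro j
    change β^[(j : ZMod t).val] ν = _
    rw [ZMod.val_natCast, Function.iterate_mod_minimalPeriod_eq]
  have hsucc : ∀ s, Z.α.symm (orb s) = orb (s + 1) := by
    intro s
    have h1 : s + 1 = ((s.val + 1 : ℕ) : ZMod t) := by simp
    rw [h1, hnat, Function.iterate_succ_apply']
  have hinj : Function.Injective orb := by
    intro s s' h
    exact ZMod.val_injective t (Function.iterate_injOn_Iio_minimalPeriod (ZMod.val_lt s)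
      (ZMod.val_lt s') h)
  have hall : ∀ ν', Z.g ν' = p → ∃ s, orb s = ν' := by
    intro ν' h
    obtain ⟨j, hj⟩ := Z.g_eq ν' ν (h.trans hν.symm)
    exact ⟨j, (hnat j).trans hj⟩
  refine ⟨t, by omega, htn, fun s => Z.part (horb s) M, fun s => ?_, ?_, fun s => ?_⟩
  · refine le_antisymm (fun x hx => ?_) (iSup_le fun d => inf_le_left)
    refine graded_span _ _ ?_ hx
    rintro _ ⟨m, rfl⟩
    induction M.mem_iSup_gr m using Submodule.iSup_induction' with
    | mem d x hx =>
      exact Submodule.mem_iSup_of_mem _ ⟨Submodule.subset_span ⟨x, rfl⟩, Z.vMk_mem _ M hx⟩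
    | zero => rw [map_zero]; exact zero_mem _
    | add x y _ _ hx hy => rw [map_add]; exact add_mem hx hy
  · refine DirectSum.isInternal_submodule_of_iSupIndep_of_iSup_eq_top ?_ ?_
    · rw [iSupIndep_iff_finsetSum_eq_zero_imp_eq_zero]
      intro S v hv hsum d hd
      have : ∀ s, ∃ x, (s ∈ S → v s = Z.gsum p M x) ∧ ∀ q, x q ≠ 0 → Z.pr q.1 = orb s := by
        intro s
        by_cases hs : s ∈ S
        · obtain ⟨x, h1, h2⟩ := Z.exists_of_mem_part (horb s) M (hv s hs)
          exact ⟨x, fun _ => h1, h2⟩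
        · exact ⟨0, fun h => absurd h hs, fun q h => absurd rfl h⟩
      choose x h1 h2 using this
      have h3 : Z.gsum p M (∑ s ∈ S, x s) = 0 := by
        rw [← hsum]
        refine (map_sum (⟨⟨Z.gsum p M, Z.gsum_zero p M⟩, Z.gsum_add p M⟩ : _ →+ _) x _).trans ?_
        exact Finset.sum_congr rfl fun s hs => (h1 s hs).symm
      rw [gsum_eq_zero_iff] at h3
      rw [h1 d hd, gsum_eq_zero_iff]
      intro q
      by_cases hq : x d q = 0
      · rw [hq, smul_zero]
      · have h4 := h3 q
        rw [Finset.sum_apply, Finset.sum_eq_single d] at h4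
        · exact h4
        · intro s _ hs
          by_contra h5
          exact hs (hinj ((h2 s q h5).symm.trans (h2 d q hq)))
        · exact fun h => absurd hd h
    · rw [eq_top_iff]
      rintro y -
      obtain ⟨x, rfl⟩ := Z.exists_gsum p M y
      rw [gsum_eq_sum]
      refine sum_mem fun q _ => ?_
      obtain ⟨s, hs⟩ := hall _ q.2
      refine Submodule.mem_iSup_of_mem s (Submodule.smul_mem _ _ ?_)
      have : ∀ ν' (h : Z.g ν' = p), orb s = ν' → Z.vMk h M (x q) ∈ Z.part (horb s) M := by
        rintro ν' h rfl
        exact Submodule.subset_span ⟨_, rfl⟩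
      exact this _ q.2 hs
  · ext y
    constructor
    · rintro ⟨y, hy, rfl⟩
      change y ∈ Z.part (horb s) M at hy
      change _ ∈ Z.part (horb (s + 1)) M
      rw [part] at hy
      induction hy using Submodule.span_induction with
      | mem y hy =>
        obtain ⟨m, rfl⟩ := hy
        rw [Z.vMk_σ (horb s) (horb (s + 1)) (hsucc s)]
        exact Submodule.subset_span ⟨_, rfl⟩
      | zero => rw [map_zero]; exact zero_mem _
      | add y y' _ _ hy hy' => rw [map_add]; exact add_mem hy hy'
      | smul a y _ hy => rw [σ_smul']; exact Submodule.smul_mem _ _ hy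
    · intro hy
      change y ∈ Z.part (horb (s + 1)) M at hy
      change ∃ y', y' ∈ Z.part (horb s) M ∧ _ = y
      rw [part] at hy
      induction hy using Submodule.span_induction with
      | mem y hy =>
        obtain ⟨m, rfl⟩ := hy
        obtain ⟨m', rfl⟩ := (M.σ_bijective hn).2 m
        exact ⟨_, Submodule.subset_span ⟨m', rfl⟩, Z.vMk_σ (horb s) (horb (s + 1)) (hsucc s) M m'⟩
      | zero => exact ⟨0, zero_mem _, map_zero _⟩
      | add y y' _ _ hy hy' =>
        obtain ⟨z, hz, rfl⟩ := hy
        obtain ⟨z', hz', rfl⟩ := hy'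
        exact ⟨z + z', add_mem hz hz', map_add _ _ _⟩
      | smul a y _ hy =>
        obtain ⟨z, hz, rfl⟩ := hy
        exact ⟨B.aut a • z, Submodule.smul_mem _ _ hz, FMod.σ_smul _ _ _⟩

end Strat

open FMod

variable {k : Type u} [Field k] {n : ℕ} {A B : FoldedAlg k n} [Infinite k]

/-- The inclusion of an iterated restriction of a module. -/
def coeRes {A₁ A₂ : FoldedAlg k n} (χ : FoldedHom A₁ A) (θ : FoldedHom A₂ A₁) (M : FMod A) :
    ((χ.res ⋙ θ.res).obj M).carrier →ₗ[k] M.carrier :=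
  (χ.resSpace M).subtype ∘ₗ (θ.resSpace (χ.resObj M)).subtype

theorem coeRes_injective {A₁ A₂ : FoldedAlg k n} (χ : FoldedHom A₁ A) (θ : FoldedHom A₂ A₁)
    (M : FMod A) : Function.Injective (coeRes χ θ M) :=
  fun _ _ h => Subtype.ext (Subtype.ext h)

theorem coeRes_smul {A₁ A₂ : FoldedAlg k n} (χ : FoldedHom A₁ A) (θ : FoldedHom A₂ A₁)
    (M : FMod A) (x : A₂.carrier) (m : ((χ.res ⋙ θ.res).obj M).carrier) :
    coeRes χ θ M (x • m) = χ.toLin (θ.toLin x) • coeRes χ θ M m := rfl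

namespace Strat

variable {G : FMod A ⥤ FMod B} {T X : Type u} [Fintype X] (Z : Strat G T X)

section Fixed

variable {A₁ A₂ : FoldedAlg k n} (χ : FoldedHom A₁ A) (θ : FoldedHom A₂ A₁) (ω : FoldedHom A₂ B)
  {ν : T} (hν : Z.α.symm ν = ν) (hε : χ.toLin θ.e = Z.ε ν)
  (hω : ∀ x M m, ω.toLin x • Z.tMk ν M m - Z.tMk ν M (χ.toLin (θ.toLin x) • m) ∈
    ((Z.fil (Z.g ν)).obj M).toSub)
  (hb : ∀ b : B.carrier, ∃ z : X → A₂.carrier, b * ω.e = ∑ q, Z.b q * ω.toLin (z q) ∧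
    ∀ q, z q ≠ 0 → Z.pr q = ν)

include hω in
theorem smul_vMk_of_hom (x : A₂.carrier) (M : FMod A) (m : M.carrier) :
    ω.toLin x • Z.vMk (rfl : Z.g ν = _) M m =
      Z.vMk (rfl : Z.g ν = _) M (χ.toLin (θ.toLin x) • m) := by
  rw [smul_vMk, vMk_eq, gmk_eq_iff]
  exact hω x M m

/-- The map from an induced module to a subquotient of the filtration. -/
def indToGra (M : FMod A) : ω.IndSpace ((χ.res ⋙ θ.res).obj M) →ₗ[k]
    ((Z.gra (Z.g ν)).obj M).carrier :=
  ω.indLift _ (TensorProduct.lift (LinearMap.mk₂ k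
    (fun (b : B.carrier) (m : ((χ.res ⋙ θ.res).obj M).carrier) =>
      b • Z.vMk (rfl : Z.g ν = _) M (coeRes χ θ M m))
    (fun _ _ _ => add_smul _ _ _) (fun _ _ _ => smul_assoc _ _ _)
    (fun b m m' => by
      rw [map_add, map_add, smul_add])
    (fun c b m => by
      rw [map_smul, map_smul, smul_comm]))) (by
    intro b x m
    simp only [lift.tmul, LinearMap.mk₂_apply]
    rw [mul_smul, Z.smul_vMk_of_hom χ θ ω hω, coeRes_smul])

theorem indToGra_indMk (M : FMod A) (b : B.carrier) (m : ((χ.res ⋙ θ.res).obj M).carrier) :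
    Z.indToGra χ θ ω hω M (ω.indMk _ b m) = b • Z.vMk (rfl : Z.g ν = _) M (coeRes χ θ M m) := rfl

theorem indToGra_smul (M : FMod A) (b : B.carrier)
    (y : ω.IndSpace ((χ.res ⋙ θ.res).obj M)) :
    Z.indToGra χ θ ω hω M (b • y) = b • Z.indToGra χ θ ω hω M y := by
  induction y using ω.ind_induction with
  | h0 => rw [smul_zero, map_zero, smul_zero]
  | hadd x y hx hy => rw [smul_add, map_add, map_add, hx, hy, smul_add]
  | hmk r m => rw [ω.smul_indMk, indToGra_indMk, indToGra_indMk, mul_smul]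

theorem indToGra_mem (M : FMod A) {d : ℤ} {y : ω.IndSpace ((χ.res ⋙ θ.res).obj M)}
    (hy : y ∈ ω.indGr _ (d - Z.c ν)) :
    Z.indToGra χ θ ω hω M y ∈ ((Z.gra (Z.g ν)).obj M).gr d := by
  induction hy using Submodule.span_induction with
  | mem x hx =>
    obtain ⟨a, b, r, m, hr, hm, hab, rfl⟩ := hx
    rw [indToGra_indMk, show d = a + (Z.c ν + b) by omega]
    exact FMod.smul_mem _ hr (Z.vMk_mem _ M hm)
  | zero => rw [map_zero]; exact zero_mem _
  | add x y _ _ hx hy => rw [map_add]; exact add_mem hx hy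
  | smul a x _ hx => rw [map_smul]; exact Submodule.smul_mem _ _ hx

include hν in
theorem indToGra_σ (M : FMod A) (y : ω.IndSpace ((χ.res ⋙ θ.res).obj M)) :
    Z.indToGra χ θ ω hω M (ω.indσ _ y) =
      ((Z.gra (Z.g ν)).obj M).σ (Z.indToGra χ θ ω hω M y) := by
  induction y using ω.ind_induction with
  | h0 => simp only [map_zero]
  | hadd x y hx hy => rw [map_add, map_add, hx, hy, map_add, map_add]
  | hmk r m =>
    rw [ω.indσ_indMk, indToGra_indMk, indToGra_indMk, σ_smul', Z.vMk_σ rfl rfl hν]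
    rfl

include hb in
theorem exists_indMk_sum (M : FMod A) (y : ω.IndSpace ((χ.res ⋙ θ.res).obj M)) :
    ∃ x : X → ((χ.res ⋙ θ.res).obj M).carrier, y = ∑ q, ω.indMk _ (Z.b q) (x q) ∧
      ∀ q, x q ≠ 0 → Z.pr q = ν := by
  induction y using ω.ind_induction with
  | h0 => exact ⟨fun _ => 0, by simp only [ω.indMk_zero_right, Finset.sum_const_zero],
      fun q h => absurd rfl h⟩
  | hadd y y' hy hy' =>
    obtain ⟨x, rfl, hx⟩ := hy
    obtain ⟨x', rfl, hx'⟩ := hy'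
    refine ⟨fun q => x q + x' q, ?_, fun q hq => ?_⟩
    · simp only [ω.indMk_add_right, Finset.sum_add_distrib]
    · by_cases h : x q = 0
      · refine hx' q fun h' => hq ?_
        change x q + x' q = 0
        rw [h, h', add_zero]
      · exact hx q h
  | hmk r m =>
    obtain ⟨z, h1, h2⟩ := hb r
    refine ⟨fun q => z q • m, ?_, fun q hq => h2 q fun h => hq ?_⟩
    · have h3 : ω.indMk _ r m = ω.indMk _ (r * ω.e) m := by
        rw [FoldedHom.e, ω.indMk_map, one_smul]
      rw [h3, h1]
      have h4 : ∀ s : Finset X, ω.indMk ((χ.res ⋙ θ.res).obj M) (∑ q ∈ s, Z.b q * ω.toLin (z q)) m =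
          ∑ q ∈ s, ω.indMk _ (Z.b q) (z q • m) := by
        classical
        intro s
        induction s using Finset.induction_on with
        | empty => simp only [Finset.sum_empty, ω.indMk_zero_left]
        | insert q s hq ih =>
          rw [Finset.sum_insert hq, Finset.sum_insert hq, ω.indMk_add_left, ih, ω.indMk_map]
      exact h4 _
    · change z q • m = 0
      rw [h, zero_smul]

include hν in
theorem pr_eq_of_fixed {ν' : T} (h : Z.g ν' = Z.g ν) : ν' = ν := by
  obtain ⟨j, hj⟩ := Z.g_eq ν' ν h
  rw [← hj]
  clear hj
  induction j with
  | zero => rfl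
  | succ j ih => rw [Function.iterate_succ_apply', ih, hν]

include hε in
theorem smul_res_eq (M : FMod A) (m : ((χ.res ⋙ θ.res).obj M).carrier) :
    Z.ε ν • coeRes χ θ M m = coeRes χ θ M m := by
  rw [← hε]
  exact congrArg Subtype.val m.2

include hε hν hb in
theorem indToGra_bijective (M : FMod A) : Function.Bijective (Z.indToGra χ θ ω hω M) := by
  classical
  constructor
  · rw [injective_iff_map_eq_zero]
    intro y hy
    obtain ⟨x, rfl, hx⟩ := Z.exists_indMk_sum χ θ ω hb M y
    have h1 : Z.gsum (Z.g ν) M (fun q => coeRes χ θ M (x q.1)) = 0 := by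
      rw [← hy, map_sum, gsum_eq_sum]
      have : ∀ q (h : Z.g (Z.pr q) = Z.g ν), Z.b q • Z.vMk h M (coeRes χ θ M (x q)) =
          Z.indToGra χ θ ω hω M (ω.indMk _ (Z.b q) (x q)) := by
        intro q h
        rw [indToGra_indMk]
        have h' := Z.pr_eq_of_fixed hν h
        congr 2
        simp only [h']
      refine (Finset.sum_congr rfl fun q _ => this q.1 q.2).trans ?_
      refine sum_subtype_eq (P := fun q => Z.g (Z.pr q) = Z.g ν) (fun q => Z.indToGra χ θ ω hω M
        (ω.indMk _ (Z.b q) (x q))) fun q hq => ?_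
      have : x q = 0 := by
        by_contra h
        exact hq (by rw [hx q h])
      rw [this, ω.indMk_zero_right, map_zero]
    rw [gsum_eq_zero_iff] at h1
    refine Finset.sum_eq_zero fun q _ => ?_
    by_cases h : x q = 0
    · rw [h, ω.indMk_zero_right]
    · have h2 := hx q h
      have h3 := h1 ⟨q, by rw [h2]⟩
      simp only [h2] at h3
      rw [Z.smul_res_eq χ θ hε] at h3
      exact absurd (coeRes_injective χ θ M (h3.trans (map_zero _).symm)) h
  · intro y
    obtain ⟨x, rfl⟩ := Z.exists_gsum _ M y
    have hmem : ∀ m : M.carrier, ∃ m' : ((χ.res ⋙ θ.res).obj M).carrier, coeRes χ θ M m' = Z.ε ν • m := by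
      intro m
      have h1 : Z.ε ν • m ∈ χ.resSpace M := by
        rw [FoldedHom.mem_resSpace, smul_smul, ← hε, χ.e_mul_map]
      refine ⟨⟨⟨_, h1⟩, Subtype.ext ?_⟩, rfl⟩
      change χ.toLin θ.e • Z.ε ν • m = _
      rw [hε, smul_smul, Z.ε_idem]
    choose m' hm' using hmem
    refine ⟨∑ q : {q // Z.g (Z.pr q) = Z.g ν}, ω.indMk _ (Z.b q.1) (m' (x q)), ?_⟩
    rw [map_sum, gsum_eq_sum]
    refine Finset.sum_congr rfl fun q _ => ?_
    rw [indToGra_indMk, hm', vMk_ε]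
    have h' := Z.pr_eq_of_fixed hν q.2
    congr 2
    simp only [h']

include hε hν hb hω in
theorem gra_iso : Nonempty (Z.gra (Z.g ν) ≅
    (χ.res ⋙ θ.res ⋙ ω.ind) ⋙ FMod.shift _ (Z.c ν)) := by
  let F : (χ.res ⋙ θ.res ⋙ ω.ind) ⋙ FMod.shift _ (Z.c ν) ⟶ Z.gra (Z.g ν) :=
    { app := fun M => ⟨⟨⟨Z.indToGra χ θ ω hω M, map_add _⟩, Z.indToGra_smul χ θ ω hω M⟩,
        Z.indToGra_mem χ θ ω hω M, Z.indToGra_σ χ θ ω hν hω M⟩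
      naturality := fun M M' f => hom_ext (LinearMap.ext fun y => by
        change Z.indToGra χ θ ω hω M' (ω.indMap (θ.res.map (χ.res.map f)) y) =
          Hom.toLin ((Z.gra (Z.g ν)).map f) (Z.indToGra χ θ ω hω M y)
        induction y using ω.ind_induction with
        | h0 => simp only [map_zero]
        | hadd x y hx hy =>
          have h1 : ω.indMap (θ.res.map (χ.res.map f)) (x + y) = _ := map_add _ x y
          rw [h1, map_add, hx, hy, map_add, map_add]
        | hmk r m =>
          have h2 : Hom.toLin ((Z.gra (Z.g ν)).map f) (r • Z.vMk (rfl : Z.g ν = _) M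
              (coeRes χ θ M m)) = r • Z.vMk rfl M' (Hom.toLin f (coeRes χ θ M m)) := by
            rw [map_smul, Z.vMk_map]
          exact h2.symm) }
  have : ∀ M, IsIso (F.app M) := fun M =>
    isIso_of_bijective _ (Z.indToGra_bijective χ θ ω hν hε hω hb M)
  have : IsIso F := NatIso.isIso_of_isIso_app _
  exact ⟨(asIso F).symm⟩

end Fixed

end Strat

/-- A stratification of `ψ(1) R φ(1)`. -/
structure RingStrat {R : FoldedAlg k n} (φ : FoldedHom A R) (ψ : FoldedHom B R) (T X : Type u)
    [Fintype X] where
  α : Equiv.Perm T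
  α_pow : α.symm ^ n = 1
  g : T → ℕ
  g_α : ∀ ν, g (α.symm ν) = g ν
  g_eq : ∀ ν ν', g ν = g ν' → ∃ j : ℕ, α.symm^[j] ν' = ν
  pr : X → T
  ε : T → A.carrier
  ε_idem : ∀ ν, ε ν * ε ν = ε ν
  b : X → B.carrier
  c : T → ℤ
  t : T → R.carrier
  t_mem : ∀ ν, t ν ∈ R.gr (c ν)
  t_aut : ∀ ν, R.aut.symm (t ν) = t (α.symm ν)
  e_t : ∀ ν, ψ.e * t ν = t ν
  t_ε : ∀ ν, t ν * φ.toLin (ε ν) = t ν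
  surj : ∀ r, ∃ x : X → A.carrier, ψ.e * r * φ.e = ∑ q, ψ.toLin (b q) * t (pr q) * φ.toLin (x q)
  inj : ∀ x : X → A.carrier, (∀ q, ε (pr q) * x q = x q) →
    ∑ q, ψ.toLin (b q) * t (pr q) * φ.toLin (x q) = 0 → ∀ q, x q = 0
  stab : ∀ (b' : B.carrier) (ν : T), ∃ x : X → A.carrier, ψ.toLin b' * t ν =
    ∑ q, ψ.toLin (b q) * t (pr q) * φ.toLin (x q) ∧ ∀ q, x q ≠ 0 → pr q = ν ∨ g (pr q) < g ν

namespace RingStrat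

variable {R : FoldedAlg k n} {φ : FoldedHom A R} {ψ : FoldedHom B R} {T X : Type u} [Fintype X]
  (Z : RingStrat φ ψ T X)

theorem exists_coord (r : R.carrier) : ∃ x : X → A.carrier, (∀ q, Z.ε (Z.pr q) * x q = x q) ∧
    ψ.e * r * φ.e = ∑ q, ψ.toLin (Z.b q) * Z.t (Z.pr q) * φ.toLin (x q) := by
  obtain ⟨x, hx⟩ := Z.surj r
  refine ⟨fun q => Z.ε (Z.pr q) * x q, fun q => ?_, ?_⟩
  · rw [← mul_assoc, Z.ε_idem]
  · rw [hx]
    refine Finset.sum_congr rfl fun q _ => ?_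
    rw [φ.map_mul, ← mul_assoc _ (φ.toLin (Z.ε _)), mul_assoc _ (Z.t _) (φ.toLin (Z.ε _)), Z.t_ε]

/-- The coordinates of an element. -/
def coord (r : R.carrier) : X → A.carrier := (Z.exists_coord r).choose

theorem coord_ε (r : R.carrier) (q : X) : Z.ε (Z.pr q) * Z.coord r q = Z.coord r q :=
  (Z.exists_coord r).choose_spec.1 q

theorem coord_spec (r : R.carrier) : ψ.e * r * φ.e =
    ∑ q, ψ.toLin (Z.b q) * Z.t (Z.pr q) * φ.toLin (Z.coord r q) :=
  (Z.exists_coord r).choose_spec.2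

theorem coord_unique {r : R.carrier} {x : X → A.carrier} (hx : ∀ q, Z.ε (Z.pr q) * x q = x q)
    (h : ψ.e * r * φ.e = ∑ q, ψ.toLin (Z.b q) * Z.t (Z.pr q) * φ.toLin (x q)) :
    Z.coord r = x := by
  funext q
  rw [← sub_eq_zero]
  refine Z.inj (fun q => Z.coord r q - x q) (fun q => ?_) ?_ q
  · rw [mul_sub, Z.coord_ε, hx]
  · simp only [map_sub, mul_sub, Finset.sum_sub_distrib]
    rw [← h, ← Z.coord_spec, sub_self]

/-- The coordinates, as a linear map. -/
def coordLin : R.carrier →ₗ[k] X → A.carrier where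
  toFun := Z.coord
  map_add' r s := Z.coord_unique
    (fun q => by rw [Pi.add_apply, mul_add, Z.coord_ε, Z.coord_ε]) (by
      simp only [Pi.add_apply, map_add, mul_add, add_mul, Finset.sum_add_distrib, ← Z.coord_spec])
  map_smul' c r := Z.coord_unique
    (fun q => by rw [Pi.smul_apply, mul_smul_comm, RingHom.id_apply, Z.coord_ε]) (by
      simp only [Pi.smul_apply, RingHom.id_apply, map_smul, mul_smul_comm, smul_mul_assoc,
        ← Finset.smul_sum, ← Z.coord_spec])

theorem coord_mul (r : R.carrier) (a : A.carrier) (q : X) :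
    Z.coord (r * φ.toLin a) q = Z.coord r q * a := by
  have := Z.coord_unique (r := r * φ.toLin a) (x := fun q => Z.coord r q * a)
    (fun q => by rw [← mul_assoc, Z.coord_ε]) (by
      simp only [φ.map_mul, ← mul_assoc, ← Finset.sum_mul]
      rw [← Z.coord_spec, mul_assoc _ φ.e, φ.e_mul_map, mul_assoc _ (φ.toLin a), φ.map_mul_e])
  rw [this]

theorem coord_gen [DecidableEq X] (q : X) : Z.coord (ψ.toLin (Z.b q) * Z.t (Z.pr q)) =
    Pi.single q (Z.ε (Z.pr q)) := by
  refine Z.coord_unique (fun q' => ?_) ?_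
  · by_cases h : q' = q
    · subst h; rw [Pi.single_eq_same, Z.ε_idem]
    · rw [Pi.single_eq_of_ne h, mul_zero]
  · rw [Finset.sum_eq_single q, Pi.single_eq_same, ← mul_assoc, ψ.e_mul_map]
    · nth_rw 1 [← Z.t_ε]
      rw [mul_assoc, mul_assoc (Z.t _), φ.map_mul_e, mul_assoc]
    · intro q' _ h
      rw [Pi.single_eq_of_ne h, map_zero, mul_zero]
    · exact fun h => absurd (Finset.mem_univ _) h

/-- The coordinates on an induced module. -/
def indCoord (M : FMod A) : φ.IndSpace M →ₗ[k] X → M.carrier :=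
  φ.indLift M (TensorProduct.lift (LinearMap.mk₂ k (fun r m q => Z.coordLin r q • m)
    (fun r s m => by funext q; rw [map_add, Pi.add_apply, add_smul]; rfl)
    (fun c r m => by funext q; rw [map_smul, Pi.smul_apply, smul_assoc]; rfl)
    (fun r m m' => by funext q; rw [smul_add]; rfl)
    (fun c r m => by funext q; rw [smul_comm]; rfl))) (by
      intro r a m
      funext q
      change Z.coord (r * φ.toLin a) q • m = Z.coord r q • a • m
      rw [coord_mul, mul_smul])

theorem indCoord_indMk (M : FMod A) (r : R.carrier) (m : M.carrier) :
    Z.indCoord M (φ.indMk M r m) = fun q => Z.coord r q • m := rfl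

/-- The inclusion of the restriction of an induced module. -/
def coeInd (φ : FoldedHom A R) (ψ : FoldedHom B R) (M : FMod A) :
    ((φ.ind ⋙ ψ.res).obj M).carrier →ₗ[k] φ.IndSpace M := (ψ.resSpace (φ.indObj M)).subtype

theorem coeInd_injective (φ : FoldedHom A R) (ψ : FoldedHom B R) (M : FMod A) :
    Function.Injective (coeInd φ ψ M) := Subtype.val_injective

theorem coeInd_smul (φ : FoldedHom A R) (ψ : FoldedHom B R) (M : FMod A) (b : B.carrier)
    (y : ((φ.ind ⋙ ψ.res).obj M).carrier) :
    coeInd φ ψ M (b • y) = ψ.toLin b • coeInd φ ψ M y := rfl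

/-- The generators of the restriction of an induced module. -/
def gen (ν : T) (M : FMod A) : M.carrier →ₗ[k] ((φ.ind ⋙ ψ.res).obj M).carrier :=
  (φ.indMkQ M ∘ₗ TensorProduct.mk k _ _ (Z.t ν)).codRestrict (ψ.resSpace (φ.indObj M)) fun m => by
    change ψ.e • φ.indMk M (Z.t ν) m = φ.indMk M (Z.t ν) m
    rw [φ.smul_indMk, Z.e_t]

theorem coe_gen (ν : T) (M : FMod A) (m : M.carrier) :
    coeInd φ ψ M (Z.gen ν M m) = φ.indMk M (Z.t ν) m := rfl

theorem coe_sum_gen (M : FMod A) (b : X → B.carrier) (ν : X → T) (x : X → M.carrier) :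
    coeInd φ ψ M (∑ q, b q • Z.gen (ν q) M (x q)) =
      ∑ q, φ.indMk M (ψ.toLin (b q) * Z.t (ν q)) (x q) := by
  rw [map_sum]
  refine Finset.sum_congr rfl fun q _ => ?_
  rw [coeInd_smul, coe_gen, φ.smul_indMk]

theorem indMk_sum_left (M : FMod A) (r : X → R.carrier) (m : M.carrier) :
    φ.indMk M (∑ q, r q) m = ∑ q, φ.indMk M (r q) m :=
  map_sum (⟨⟨fun r => φ.indMk M r m, φ.indMk_zero_left M m⟩, fun r s =>
    φ.indMk_add_left M r s m⟩ : R.carrier →+ φ.IndSpace M) r _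

/-- The stratification of the functor. -/
def toStrat : Strat (φ.ind ⋙ ψ.res) T X where
  α := Z.α
  α_pow := Z.α_pow
  g := Z.g
  g_α := Z.g_α
  g_eq := Z.g_eq
  pr := Z.pr
  ε := Z.ε
  ε_idem := Z.ε_idem
  b := Z.b
  c := Z.c
  tMk := Z.gen
  tMk_ε ν M m := Subtype.ext (by
    change φ.indMk M (Z.t ν) (Z.ε ν • m) = φ.indMk M (Z.t ν) m
    rw [← φ.indMk_map, Z.t_ε])
  tMk_mem ν M d m hm := φ.indMk_mem M (Z.t_mem ν) hm
  tMk_map ν M M' f m := rfl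
  tMk_σ ν M m := Subtype.ext (by
    change φ.indMk M (R.aut.symm (Z.t ν)) (M.σ m) = φ.indMk M (Z.t (Z.α.symm ν)) (M.σ m)
    rw [Z.t_aut])
  surj M y := by
    obtain ⟨y, hy⟩ := y
    change ψ.e • y = y at hy
    have key : ∀ y : φ.IndSpace M, ∃ x : X → M.carrier,
        ψ.e • y = ∑ q, φ.indMk M (ψ.toLin (Z.b q) * Z.t (Z.pr q)) (x q) := by
      intro y
      induction y using φ.ind_induction with
      | h0 => exact ⟨0, by simp [φ.indMk_zero_right]⟩
      | hadd x y hx hy =>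
        obtain ⟨x', hx⟩ := hx
        obtain ⟨y', hy⟩ := hy
        refine ⟨x' + y', ?_⟩
        rw [smul_add, hx, hy, ← Finset.sum_add_distrib]
        exact Finset.sum_congr rfl fun q _ => (φ.indMk_add_right M _ _ _).symm
      | hmk r m =>
        obtain ⟨x, hx⟩ := Z.surj r
        refine ⟨fun q => x q • m, ?_⟩
        have h1 : φ.indMk M (ψ.e * r * φ.e) m = φ.indMk M (ψ.e * r) m := by
          conv_rhs => rw [← one_smul A.carrier m]
          rw [← φ.indMk_map]; rfl
        rw [φ.smul_indMk, ← h1, hx, indMk_sum_left]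
        exact Finset.sum_congr rfl fun q _ => φ.indMk_map M _ _ _
    obtain ⟨x, hx⟩ := key y
    refine ⟨x, Subtype.ext ?_⟩
    refine (hy.symm.trans hx).trans (Z.coe_sum_gen M Z.b (fun q => Z.pr q) x).symm
  inj M x h q := by
    classical
    have h1 := (Z.coe_sum_gen M Z.b (fun q => Z.pr q) x).symm.trans
      ((congrArg (coeInd φ ψ M) h).trans (map_zero _))
    have h2 := congrFun (congrArg (Z.indCoord M) h1) q
    rw [map_sum] at h2
    simp only [indCoord_indMk, coord_gen, Finset.sum_apply] at h2
    rw [Finset.sum_eq_single q] at h2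
    · rw [Pi.single_eq_same] at h2
      exact h2.trans (congrFun (map_zero (Z.indCoord M)) q)
    · intro q' _ hq
      rw [Pi.single_eq_of_ne hq.symm, zero_smul]
    · exact fun h => absurd (Finset.mem_univ _) h
  stab M b' ν m := by
    obtain ⟨x, h1, h2⟩ := Z.stab b' ν
    refine ⟨fun q => x q • m, Subtype.ext ?_, fun q hq => h2 q fun h => hq (by
      change x q • m = 0
      rw [h, zero_smul])⟩
    refine Eq.trans ?_ (Z.coe_sum_gen M Z.b (fun q => Z.pr q) fun q => x q • m).symm
    change ψ.toLin b' • φ.indMk M (Z.t ν) m = _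
    rw [φ.smul_indMk, h1, indMk_sum_left]
    exact Finset.sum_congr rfl fun q _ => φ.indMk_map M _ _ _

theorem sub_mem_fil {M : FMod A} {b' : B.carrier} {a : A.carrier} {ν : T}
    (h : ∃ x : X → A.carrier, ψ.toLin b' * Z.t ν - Z.t ν * φ.toLin a =
      ∑ q, ψ.toLin (Z.b q) * Z.t (Z.pr q) * φ.toLin (x q) ∧
        ∀ q, x q ≠ 0 → Z.g (Z.pr q) < Z.g ν) (m : M.carrier) :
    b' • Z.toStrat.tMk ν M m - Z.toStrat.tMk ν M (a • m) ∈
      ((Z.toStrat.fil (Z.g ν)).obj M).toSub := by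
  obtain ⟨x, h1, h2⟩ := h
  refine (Strat.mem_fil _).2 ⟨fun q => x q • m, Subtype.ext ?_, fun q hq => h2 q fun h => hq (by
    change x q • m = 0
    rw [h, zero_smul])⟩
  refine Eq.trans ?_ (Z.coe_sum_gen M Z.b (fun q => Z.pr q) fun q => x q • m).symm
  change ψ.toLin b' • φ.indMk M (Z.t ν) m - φ.indMk M (Z.t ν) (a • m) = _
  have h3 : ∑ q, φ.indMk M (ψ.toLin (Z.b q) * Z.t (Z.pr q)) (x q • m) =
      φ.indMk M (ψ.toLin b' * Z.t ν - Z.t ν * φ.toLin a) m := by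
    rw [h1, indMk_sum_left]
    exact Finset.sum_congr rfl fun q _ => (φ.indMk_map M _ _ _).symm
  rw [h3, φ.smul_indMk, ← φ.indMk_map, sub_eq_iff_eq_add, ← φ.indMk_add_left, sub_add_cancel]

end RingStrat

section Cosets

variable {n : ℕ} {o o' : Type} [LinearOrder o] [LinearOrder o'] {β : Fin n → o} {β' : Fin n → o'}

theorem inv_mul_of_mono (hβ : Monotone β) {x v : Equiv.Perm (Fin n)} (hx : MonoOnBlocks β x)
    (hv : ∀ a, β (v a) = β a) : inv (x * v) = inv x + inv v := by
  refine inv_mul_of x v fun a b hab hvab => hx _ _ hvab ?_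
  refine le_antisymm (hβ hvab.le) ?_
  rw [hv, hv]
  exact hβ hab.le

theorem inv_mul_of_mono_inv (hβ : Monotone β) {u z : Equiv.Perm (Fin n)} (hz : MonoOnBlocks β z⁻¹)
    (hu : ∀ a, β (u a) = β a) : inv (u * z) = inv u + inv z := by
  rw [← inv_inv (u * z), mul_inv_rev, inv_mul_of_mono hβ hz (apply_inv hu), inv_inv, inv_inv,
    add_comm]

theorem exists_mono_mul (hβ : Monotone β) (w : Equiv.Perm (Fin n)) :
    ∃ x v, w = x * v ∧ (∀ a, β (v a) = β a) ∧ MonoOnBlocks β x := by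
  induction hm : inv w using Nat.strong_induction_on generalizing w with
  | _ m ih =>
    by_cases h1 : MonoOnBlocks β w
    · exact ⟨w, 1, by simp, fun _ => rfl, h1⟩
    · obtain ⟨y, hy, hyw⟩ := exists_letter_of_not_mono hβ h1
      have h2 := inv_mul_sw_of_gt w y hyw
      obtain ⟨x, v, h3, hv, hx⟩ := ih (inv (w * sw y)) (by omega) _ rfl
      refine ⟨x, v * sw y, ?_, fun a => ?_, hx⟩
      · rw [← mul_assoc, ← h3, mul_assoc, sw_mul_self, mul_one]
      · rw [Equiv.Perm.mul_apply, hv, apply_sw hy]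

theorem mono_mul_unique (hβ : Monotone β) {x x' v v' : Equiv.Perm (Fin n)}
    (hx : MonoOnBlocks β x) (hx' : MonoOnBlocks β x') (hv : ∀ a, β (v a) = β a)
    (hv' : ∀ a, β (v' a) = β a) (h : x * v = x' * v') : x = x' ∧ v = v' := by
  have h1 : x' = x * (v * v'⁻¹) := by rw [← mul_assoc, h, mul_assoc, mul_inv_cancel, mul_one]
  have hy : ∀ a, β ((v * v'⁻¹) a) = β a := fun a => by
    rw [Equiv.Perm.mul_apply, hv, apply_inv hv']
  have h2 : v * v'⁻¹ = 1 := by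
    refine eq_one_of_monoOnBlocks hβ (fun a b hab hβab => ?_) hy
    have h3 := hx' a b hab hβab
    rw [h1, Equiv.Perm.mul_apply, Equiv.Perm.mul_apply] at h3
    by_contra h4
    rcases (not_lt.1 h4).lt_or_eq with h5 | h5
    · exact absurd (hx _ _ h5 (by rw [hy, hy, hβab])) h3.not_gt
    · exact hab.ne' ((v * v'⁻¹).injective h5)
  rw [h2, mul_one] at h1
  exact ⟨h1.symm, mul_inv_eq_one.1 h2⟩

/-- The permutation is the shortest in its double coset with respect to two block decompositions of
the positions. -/
structure IsShort (β : Fin n → o) (β' : Fin n → o') (z : Equiv.Perm (Fin n)) : Prop where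
  left : MonoOnBlocks β z
  right : MonoOnBlocks β' z⁻¹

/-- The block decomposition of the targets induced by a permutation. -/
def tgt (β : Fin n → o) (β' : Fin n → o') (z : Equiv.Perm (Fin n)) (c : Fin n) : o' ×ₗ o :=
  toLex (β' c, β (z⁻¹ c))

/-- The block decomposition of the sources induced by a permutation. -/
def src (β : Fin n → o) (β' : Fin n → o') (z : Equiv.Perm (Fin n)) (a : Fin n) : o ×ₗ o' :=
  toLex (β a, β' (z a))

theorem tgt_eq_iff {z : Equiv.Perm (Fin n)} {c d : Fin n} :
    tgt β β' z c = tgt β β' z d ↔ β' c = β' d ∧ β (z⁻¹ c) = β (z⁻¹ d) := by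
  simp [tgt, Prod.ext_iff]

theorem monotone_src (hβ : Monotone β) (hβ' : Monotone β') {z : Equiv.Perm (Fin n)}
    (hz : MonoOnBlocks β z) : Monotone (src β β' z) := by
  intro a b hab
  rcases hab.eq_or_lt with rfl | hab
  · exact le_rfl
  rw [src, src, Prod.Lex.toLex_le_toLex]
  rcases (hβ hab.le).lt_or_eq with h | h
  · exact Or.inl h
  · exact Or.inr ⟨h, hβ' (hz _ _ hab h).le⟩

theorem monotone_tgt (hβ : Monotone β) (hβ' : Monotone β') {z : Equiv.Perm (Fin n)}
    (hz : MonoOnBlocks β' z⁻¹) : Monotone (tgt β β' z) := monotone_src hβ' hβ hz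

theorem IsShort.eq_of_card (hβ : Monotone β) (hβ' : Monotone β') {z z' : Equiv.Perm (Fin n)}
    (hz : IsShort β β' z) (hz' : IsShort β β' z')
    (h : ∀ i j, (Finset.univ.filter fun a => β a = i ∧ β' (z a) = j).card =
      (Finset.univ.filter fun a => β a = i ∧ β' (z' a) = j).card) : z = z' := by
  have h1 : src β β' z = src β β' z' := by
    refine eq_of_monotone_of_card (monotone_src hβ hβ' hz.left) (monotone_src hβ hβ' hz'.left) ?_
    intro x
    have := h (ofLex x).1 (ofLex x).2
    convert this using 3 with a a
    · exact ⟨fun h => by rw [← h]; exact ⟨rfl, rfl⟩, fun h => congrArg toLex (Prod.ext h.1 h.2)⟩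
    · exact ⟨fun h => by rw [← h]; exact ⟨rfl, rfl⟩, fun h => congrArg toLex (Prod.ext h.1 h.2)⟩
  have h2 : ∀ a, β' (z a) = β' (z' a) := fun a => by
    have := congrFun h1 a
    simp only [src, EmbeddingLike.apply_eq_iff_eq, Prod.mk.injEq] at this
    exact this.2
  refine eq_of_lt_iff z z' fun a b hab => ?_
  rcases (hβ' hab.le).lt_or_eq with h3 | h3
  · rw [h2, h2] at h3
    by_contra h4
    exact h3.not_ge (hβ' (not_lt.1 h4))
  · have h4 : a < b := by simpa using hz.right _ _ hab h3
    rw [h2, h2] at h3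
    by_contra h5
    rcases (not_lt.1 h5).lt_or_eq with h6 | h6
    · have : b < a := by simpa using hz'.right _ _ h6 h3.symm
      exact h4.not_gt this
    · exact h4.ne' (z'.injective h6)

/-- The double coset decomposition, with lengths adding up. -/
theorem exists_double_coset (hβ : Monotone β) (hβ' : Monotone β') (w : Equiv.Perm (Fin n)) :
    ∃ u z v, w = u * z * v ∧ (∀ a, β' (u a) = β' a) ∧ IsShort β β' z ∧ (∀ a, β (v a) = β a) ∧
      MonoOnBlocks β (u * z) := by
  obtain ⟨x, v, rfl, hv, hx⟩ := exists_mono_mul hβ w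
  obtain ⟨y, v', h1, hv', hy⟩ := exists_mono_mul hβ' x⁻¹
  have h2 : x = v'⁻¹ * y⁻¹ := by rw [← mul_inv_rev, ← h1, _root_.inv_inv]
  refine ⟨v'⁻¹, y⁻¹, v, by rw [h2], apply_inv hv', ⟨fun a b hab hβab => ?_, by
    rwa [_root_.inv_inv]⟩, hv, by rwa [← h2]⟩
  have h3 := hx a b hab hβab
  by_contra h4
  rcases (not_lt.1 h4).lt_or_eq with h5 | h5
  · rcases (hβ' h5.le).lt_or_eq with h6 | h6
    · rw [← apply_inv hv' (y⁻¹ b), ← apply_inv hv' (y⁻¹ a), ← Equiv.Perm.mul_apply,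
        ← Equiv.Perm.mul_apply, ← h2] at h6
      exact h6.not_ge (hβ' h3.le)
    · have := hy _ _ h5 h6
      exact absurd hab (by simpa using this.le)
  · exact hab.ne' (y⁻¹.injective h5)

theorem IsShort.mono_mul_iff (hβ' : Monotone β') {z u : Equiv.Perm (Fin n)} (hz : IsShort β β' z)
    (hu : ∀ a, β' (u a) = β' a) : MonoOnBlocks β (u * z) ↔ MonoOnBlocks (tgt β β' z) u := by
  constructor
  · intro h c d hcd hcd'
    rw [tgt_eq_iff] at hcd'
    simpa using h _ _ (hz.right c d hcd hcd'.1) hcd'.2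
  · intro h a b hab hβab
    rw [Equiv.Perm.mul_apply, Equiv.Perm.mul_apply]
    have h1 := hz.left a b hab hβab
    rcases (hβ' h1.le).lt_or_eq with h2 | h2
    · rw [← hu, ← hu (z b)] at h2
      by_contra h3
      exact h2.not_ge (hβ' (not_lt.1 h3))
    · exact h _ _ h1 (tgt_eq_iff.2 ⟨h2, by simpa using hβab⟩)

theorem IsShort.inv_mul (hβ' : Monotone β') {z u : Equiv.Perm (Fin n)} (hz : IsShort β β' z)
    (hu : ∀ a, β' (u a) = β' a) : inv (u * z) = inv u + inv z :=
  inv_mul_of_mono_inv hβ' hz.right hu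

theorem IsShort.unique (hβ : Monotone β) (hβ' : Monotone β') {u z v u' z' v' : Equiv.Perm (Fin n)}
    (hz : IsShort β β' z) (hz' : IsShort β β' z') (hu : ∀ a, β' (u a) = β' a)
    (hu' : ∀ a, β' (u' a) = β' a) (hv : ∀ a, β (v a) = β a) (hv' : ∀ a, β (v' a) = β a)
    (hm : MonoOnBlocks β (u * z)) (hm' : MonoOnBlocks β (u' * z')) (h : u * z * v = u' * z' * v') :
    u = u' ∧ z = z' ∧ v = v' := by
  obtain ⟨h1, h2⟩ := mono_mul_unique hβ hm hm' hv hv' h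
  have h3 := congrArg (·⁻¹) h1
  simp only [mul_inv_rev] at h3
  obtain ⟨h4, h5⟩ := mono_mul_unique hβ' hz.right hz'.right (apply_inv hu) (apply_inv hu') h3
  exact ⟨inv_injective h5, inv_injective h4, h2⟩

theorem mem_invSet_iff_of_isShort (hβ : Monotone β) (hβ' : Monotone β') {z : Equiv.Perm (Fin n)}
    (hz : IsShort β β' z) (a b : Fin n) :
    (a, b) ∈ invSet z ↔ β a < β b ∧ β' (z b) < β' (z a) := by
  rw [mem_invSet]
  constructor
  · rintro ⟨h1, h2⟩
    constructor
    · refine lt_of_le_of_ne (hβ h1.le) fun h => ?_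
      exact h2.not_gt (hz.left _ _ h1 h)
    · refine lt_of_le_of_ne (hβ' h2.le) fun h => ?_
      have := hz.right _ _ h2 h
      exact absurd h1 (by simpa using this.le)
  · rintro ⟨h1, h2⟩
    constructor
    · by_contra h
      exact h1.not_ge (hβ (not_lt.1 h))
    · by_contra h
      exact h2.not_ge (hβ' (not_lt.1 h))

/-- A letter inside a target block comes from a letter inside a source block. -/
theorem IsShort.exists_letter {z : Equiv.Perm (Fin n)} (hz : IsShort β β' z) (hβ : Monotone β)
    (x : Letter n) (hx : tgt β β' z x.1.1 = tgt β β' z x.1.2) :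
    ∃ y : Letter n, z y.1.1 = x.1.1 ∧ z y.1.2 = x.1.2 := by
  rw [tgt_eq_iff] at hx
  have h1 := hz.right _ _ x.lt hx.1
  refine ⟨⟨(z⁻¹ x.1.1, z⁻¹ x.1.2), ?_⟩, by simp, by simp⟩
  change (z⁻¹ x.1.1 : ℕ) + 1 = z⁻¹ x.1.2
  by_contra h2
  have h3 : (z⁻¹ x.1.1 : ℕ) + 1 < z⁻¹ x.1.2 := by
    have := Fin.lt_def.1 h1
    omega
  let a : Fin n := ⟨(z⁻¹ x.1.1 : ℕ) + 1, by omega⟩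
  have ha1 : z⁻¹ x.1.1 < a := Fin.lt_def.2 (Nat.lt_succ_self _)
  have ha2 : a < z⁻¹ x.1.2 := Fin.lt_def.2 h3
  have hb : β (z⁻¹ x.1.1) = β a := le_antisymm (hβ ha1.le) (by rw [hx.2]; exact hβ ha2.le)
  have h4 := hz.left _ _ ha1 hb
  have h5 := hz.left _ _ ha2 (by rw [← hb, hx.2])
  rw [show ∀ c, z (z⁻¹ c) = c from z.apply_symm_apply] at h4 h5
  have h6 := x.2
  have := Fin.lt_def.1 h4
  have := Fin.lt_def.1 h5
  omega

theorem mul_sw_eq {z : Equiv.Perm (Fin n)} {x y : Letter n} (h1 : z y.1.1 = x.1.1)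
    (h2 : z y.1.2 = x.1.2) : z * sw y = sw x * z := by
  ext a
  rw [Equiv.Perm.mul_apply, Equiv.Perm.mul_apply]
  by_cases ha : a = y.1.1
  · rw [ha, sw_left, h1, sw_left, h2]
  by_cases hb : a = y.1.2
  · rw [hb, sw_right, h2, sw_right, h1]
  · rw [sw_of_ne y ha hb, sw_of_ne x]
    · exact fun h => ha (z.injective (h.trans h1.symm))
    · exact fun h => hb (z.injective (h.trans h2.symm))

end Cosets

namespace KLR

variable {I : Type u} {r s : ℕ}

/-- The matrices of weights with given row sums and column sums. -/
def Mat (L : Fin r → I →₀ ℕ) (M : Fin s → I →₀ ℕ) : Type u :=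
  {ν : Fin r → Fin s → I →₀ ℕ // (∀ c, ∑ d, ν c d = L c) ∧ ∀ d, ∑ c, ν c d = M d}

theorem fiberwise_sum {n : ℕ} {o o' : Type} [Fintype o] [DecidableEq o] [DecidableEq o']
    {N : Type*} [AddCommMonoid N] (f : Fin n → o) (g : Fin n → o') (x : Fin n → N) (d : o') :
    ∑ c, ∑ a with f a = c ∧ g a = d, x a = ∑ a with g a = d, x a := by
  rw [← Finset.sum_fiberwise_of_maps_to (s := Finset.univ.filter fun a => g a = d)
    (t := Finset.univ) (g := f) (fun _ _ => Finset.mem_univ _)]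
  refine Finset.sum_congr rfl fun c _ => ?_
  rw [Finset.filter_filter]
  simp only [and_comm]

theorem mem_support_of_sum_eq {l : ℕ} {ν : Fin l → I →₀ ℕ} {κ : I →₀ ℕ} (h : ∑ j, ν j = κ)
    (j : Fin l) (i : I) : ν j i ≤ κ i := by
  rw [← h, Finsupp.finsetSum_apply]
  exact Finset.single_le_sum (f := fun j => ν j i) (fun _ _ => Nat.zero_le _) (Finset.mem_univ j)

instance (L : Fin r → I →₀ ℕ) (M : Fin s → I →₀ ℕ) : Finite (Mat L M) := by
  classical
  have : ∀ c, Finite (Set.Iic (L c)) := fun c => Set.finite_Iic (L c)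
  refine Finite.of_injective (β := ∀ c, Fin s → Set.Iic (L c)) (fun ν c d => ⟨ν.1 c d, fun i =>
    mem_support_of_sum_eq (ν.2.1 c) d i⟩) fun ν ν' h => Subtype.ext ?_
  funext c d
  exact congrArg Subtype.val (congrFun (congrFun h c) d)

namespace Mat

variable {κ : I →₀ ℕ} {L : Fin r → I →₀ ℕ} {M : Fin s → I →₀ ℕ} (hL : ∑ c, L c = κ)
  (hM : ∑ d, M d = κ) (ν : Mat L M)

/-- The source position of an entry. -/
def spos (c : Fin r) (d : Fin s) (p : Fin (ν.1 c d).degree) : Fin κ.degree :=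
  pos hL c (pos (ν.2.1 c) d p)

/-- The target position of an entry. -/
def tpos (c : Fin r) (d : Fin s) (p : Fin (ν.1 c d).degree) : Fin κ.degree :=
  pos hM d (pos (ν.2.2 d) c p)

theorem spos_bijective : Function.Bijective fun x : Σ c, Σ d, Fin (ν.1 c d).degree =>
    ν.spos hL x.1 x.2.1 x.2.2 := by
  have := (pos_bijective hL).comp (f := fun x : Σ c, Σ d, Fin (ν.1 c d).degree =>
    (⟨x.1, posEquiv (ν.2.1 x.1) x.2⟩ : Σ c, Fin (L c).degree))
    (Equiv.sigmaCongrRight fun c => posEquiv (ν.2.1 c)).bijective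
  exact this

theorem tpos_bijective : Function.Bijective fun x : Σ c, Σ d, Fin (ν.1 c d).degree =>
    ν.tpos hM x.1 x.2.1 x.2.2 := by
  have := ((pos_bijective hM).comp (f := fun x : Σ d, Σ c, Fin (ν.1 c d).degree =>
    (⟨x.1, posEquiv (ν.2.2 x.1) x.2⟩ : Σ d, Fin (M d).degree))
    (Equiv.sigmaCongrRight fun d => posEquiv (ν.2.2 d)).bijective).comp
      (f := fun x : Σ c, Σ d, Fin (ν.1 c d).degree =>
        (⟨x.2.1, x.1, x.2.2⟩ : Σ d, Σ c, Fin (ν.1 c d).degree))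
      (Function.bijective_iff_has_inverse.2 ⟨fun x => ⟨x.2.1, x.1, x.2.2⟩, fun _ => rfl,
        fun _ => rfl⟩)
  exact this

/-- The shortest permutation that sorts the blocks of the sources into the blocks of the
targets. -/
def w : Equiv.Perm (Fin κ.degree) :=
  (Equiv.ofBijective _ (ν.spos_bijective hL)).symm.trans (Equiv.ofBijective _ (ν.tpos_bijective hM))

@[simp] theorem w_spos (c : Fin r) (d : Fin s) (p : Fin (ν.1 c d).degree) :
    ν.w hL hM (ν.spos hL c d p) = ν.tpos hM c d p := by
  have := (Equiv.ofBijective _ (ν.spos_bijective hL)).symm_apply_apply ⟨c, d, p⟩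
  change (Equiv.ofBijective _ (ν.tpos_bijective hM)) ((Equiv.ofBijective _
    (ν.spos_bijective hL)).symm (Equiv.ofBijective _ (ν.spos_bijective hL) ⟨c, d, p⟩)) = _
  rw [this]
  rfl

@[simp] theorem w_inv_tpos (c : Fin r) (d : Fin s) (p : Fin (ν.1 c d).degree) :
    (ν.w hL hM)⁻¹ (ν.tpos hM c d p) = ν.spos hL c d p := by
  rw [← w_spos hL hM]
  exact (ν.w hL hM).symm_apply_apply _

theorem exists_spos (a : Fin κ.degree) : ∃ c d p, ν.spos hL c d p = a := by
  obtain ⟨⟨c, d, p⟩, h⟩ := (ν.spos_bijective hL).2 a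
  exact ⟨c, d, p, h⟩

theorem exists_tpos (a : Fin κ.degree) : ∃ c d p, ν.tpos hM c d p = a := by
  obtain ⟨⟨c, d, p⟩, h⟩ := (ν.tpos_bijective hM).2 a
  exact ⟨c, d, p, h⟩

@[simp] theorem blk_spos (c : Fin r) (d : Fin s) (p : Fin (ν.1 c d).degree) :
    blk hL (ν.spos hL c d p) = c := blk_pos _ _ _

@[simp] theorem blk_tpos (c : Fin r) (d : Fin s) (p : Fin (ν.1 c d).degree) :
    blk hM (ν.tpos hM c d p) = d := blk_pos _ _ _

theorem isShort_w : IsShort (blk hL) (blk hM) (ν.w hL hM) where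
  left a b hab hβ := by
    obtain ⟨c, d, p, rfl⟩ := ν.exists_spos hL a
    obtain ⟨c', d', p', rfl⟩ := ν.exists_spos hL b
    rw [blk_spos, blk_spos] at hβ
    subst hβ
    rw [w_spos, w_spos]
    rw [spos, spos, pos_lt_iff] at hab
    rcases lt_trichotomy d d' with hd | rfl | hd
    · exact pos_lt _ hd _ _
    · rw [tpos, tpos, pos_lt_iff, pos_lt_iff]
      rwa [pos_lt_iff] at hab
    · exact absurd hab (pos_lt _ hd _ _).not_gt
  right a b hab hβ := by
    obtain ⟨c, d, p, rfl⟩ := ν.exists_tpos hM a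
    obtain ⟨c', d', p', rfl⟩ := ν.exists_tpos hM b
    rw [blk_tpos, blk_tpos] at hβ
    subst hβ
    rw [w_inv_tpos, w_inv_tpos]
    rw [tpos, tpos, pos_lt_iff] at hab
    rcases lt_trichotomy c c' with hd | rfl | hd
    · exact pos_lt _ hd _ _
    · rw [spos, spos, pos_lt_iff, pos_lt_iff]
      rwa [pos_lt_iff] at hab
    · exact absurd hab (pos_lt _ hd _ _).not_gt

theorem sum_spos {N : Type*} [AddCommMonoid N] (x : Fin κ.degree → N) (c : Fin r) (d : Fin s) :
    ∑ a with blk hL a = c ∧ blk hM (ν.w hL hM a) = d, x a = ∑ p, x (ν.spos hL c d p) := by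
  symm
  refine Finset.sum_bij (fun p _ => ν.spos hL c d p) ?_ ?_ ?_ (fun _ _ => rfl)
  · intro p _
    simp
  · intro p _ q _ h
    exact pos_injective _ _ (pos_injective _ _ h)
  · intro a ha
    obtain ⟨c', d', p, rfl⟩ := ν.exists_spos hL a
    simp only [Finset.mem_filter, Finset.mem_univ, blk_spos, w_spos, blk_tpos, true_and] at ha
    obtain ⟨rfl, rfl⟩ := ha
    exact ⟨p, Finset.mem_univ _, rfl⟩

/-- The sequence is, in every block, a concatenation of sequences whose weights are the entries. -/
def Fits (i : Seq κ) : Prop := ∀ c d, ∑ p, Finsupp.single (i (ν.spos hL c d p)) 1 = ν.1 c d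

theorem fits_iff {i : Seq κ} : ν.Fits hL i ↔ ∀ c d,
    ∑ a with blk hL a = c ∧ blk hM (ν.w hL hM a) = d, Finsupp.single (i a) 1 = ν.1 c d := by
  simp only [Fits, sum_spos]

theorem isConcat_iff {l : ℕ} {L : Fin l → I →₀ ℕ} (hL : ∑ c, L c = κ) {i : Seq κ} :
    IsConcat hL i ↔ ∀ c, ∑ a with blk hL a = c, Finsupp.single (i a) 1 = L c := by
  refine forall_congr' fun c => ?_
  have : ∑ a with blk hL a = c, Finsupp.single (i a) 1 =
      ∑ p, Finsupp.single (i (pos hL c p)) 1 := by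
    symm
    refine Finset.sum_bij (fun p _ => pos hL c p) ?_ ?_ ?_ (fun _ _ => rfl)
    · intro p _
      simp
    · intro p _ q _ h
      exact pos_injective _ _ h
    · intro a ha
      obtain ⟨p, hp⟩ := exists_pos_of hL (Finset.mem_filter.1 ha).2
      exact ⟨p, Finset.mem_univ _, hp⟩
  rw [this]

theorem Fits.isConcat {i : Seq κ} (h : ν.Fits hL i) : IsConcat hL i := by
  intro c
  rw [← (posEquiv (ν.2.1 c)).sum_comp, Fintype.sum_sigma]
  exact (Finset.sum_congr rfl fun d _ => h c d).trans (ν.2.1 c)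

theorem fits_iff_act {i : Seq κ} : ν.Fits hL i ↔
    ∀ c d, ∑ p, Finsupp.single (i.act (ν.w hL hM) (ν.tpos hM c d p)) 1 = ν.1 c d := by
  simp only [Fits, Seq.act_apply, w_inv_tpos]

theorem Fits.isConcat_act {i : Seq κ} (h : ν.Fits hL i) :
    IsConcat hM (i.act (ν.w hL hM)) := by
  rw [fits_iff_act hL hM] at h
  intro d
  rw [← (posEquiv (ν.2.2 d)).sum_comp, Fintype.sum_sigma]
  exact (Finset.sum_congr rfl fun c _ => h c d).trans (ν.2.2 d)

theorem act_sum {i : Seq κ} (w : Equiv.Perm (Fin κ.degree)) {l : ℕ} (β : Fin κ.degree → Fin l)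
    (d : Fin l) : ∑ a with β a = d, Finsupp.single (i.act w a) 1 =
      ∑ a with β (w a) = d, Finsupp.single (i a) 1 := by
  refine (Finset.sum_equiv w ?_ ?_).symm
  · simp
  · simp

/-- Every sequence and every shortest permutation that respect the two concatenations come from a
matrix. -/
theorem exists_fits {i : Seq κ} (hi : IsConcat hL i) {z : Equiv.Perm (Fin κ.degree)}
    (hz : IsShort (blk hL) (blk hM) z) (hi' : IsConcat hM (i.act z)) :
    ∃ ν : Mat L M, ν.w hL hM = z ∧ ν.Fits hL i := by
  let ν : Mat L M := ⟨fun c d => ∑ a with blk hL a = c ∧ blk hM (z a) = d, Finsupp.single (i a) 1,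
    fun c => by
      rw [isConcat_iff] at hi
      rw [← hi c, ← fiberwise_sum (fun a => blk hM (z a))]
      simp only [and_comm], fun d => by
      rw [isConcat_iff] at hi'
      rw [← hi' d, act_sum, fiberwise_sum]⟩
  have h1 : ν.w hL hM = z := by
    refine IsShort.eq_of_card (monotone_blk hL) (monotone_blk hM) (ν.isShort_w hL hM) hz
      fun c d => ?_
    have h2 := ν.sum_spos hL hM (fun _ => 1) c d
    rw [Finset.sum_const, smul_eq_mul, mul_one] at h2
    rw [h2]
    simp only [Finset.sum_const, smul_eq_mul, mul_one, Finset.card_univ, Fintype.card_fin]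
    change (∑ a with blk hL a = c ∧ blk hM (z a) = d, Finsupp.single (i a) 1 : I →₀ ℕ).degree = _
    simp
  refine ⟨ν, h1, ?_⟩
  rw [ν.fits_iff hL hM, h1]
  exact fun _ _ => rfl

theorem eq_of_fits {ν ν' : Mat L M} {i : Seq κ} (h : ν.Fits hL i) (h' : ν'.Fits hL i)
    (hw : ν.w hL hM = ν'.w hL hM) : ν = ν' := by
  rw [fits_iff hL hM] at h h'
  refine Subtype.ext ?_
  funext c d
  rw [← h c d, ← h' c d, hw]

theorem exists_seq (μ : I →₀ ℕ) : ∃ i : Fin μ.degree → I, ∑ p, Finsupp.single (i p) 1 = μ := by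
  classical
  have hc : μ.toMultiset.toList.length = μ.degree := by
    rw [Multiset.length_toList, Finsupp.card_toMultiset]
    rfl
  refine ⟨fun p => μ.toMultiset.toList.get (p.cast hc.symm), ?_⟩
  ext i
  have h1 : (∑ p : Fin μ.degree, Finsupp.single (μ.toMultiset.toList.get (p.cast hc.symm)) 1 : I →₀ ℕ)
      = ∑ p : Fin μ.toMultiset.toList.length, Finsupp.single (μ.toMultiset.toList.get p) 1 :=
    Equiv.sum_comp (finCongr hc.symm) fun p => (Finsupp.single (μ.toMultiset.toList.get p) 1 : I →₀ ℕ)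
  rw [h1]
  have h2 : (∑ p : Fin μ.toMultiset.toList.length, Finsupp.single (μ.toMultiset.toList.get p) 1 :
      I →₀ ℕ) = Multiset.toFinsupp (μ.toMultiset.toList : Multiset I) := by
    generalize μ.toMultiset.toList = l
    induction l with
    | nil => simp
    | cons a l ih =>
      rw [← Multiset.cons_coe, ← Multiset.singleton_add, map_add, ← ih]
      change ∑ p : Fin (l.length + 1), _ = _
      rw [Fin.sum_univ_succ]
      simp
  rw [h2, Multiset.coe_toList, Finsupp.toMultiset_toFinsupp]

/-- The bilinear form on weights. -/
def bil {k : Type u} [Field k] (D : FoldingDatum k I) : (I →₀ ℕ) →+ (I →₀ ℕ) →+ ℤ :=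
  Finsupp.liftAddHom fun i => multiplesHom _ (Finsupp.liftAddHom fun j => multiplesHom ℤ (D.form i j))

@[simp] theorem bil_single {k : Type u} [Field k] (D : FoldingDatum k I) (i j : I) :
    bil D (Finsupp.single i 1) (Finsupp.single j 1) = D.form i j := by
  simp [bil]

/-- The degree of the element that corresponds to a matrix. -/
def deg {k : Type u} [Field k] (D : FoldingDatum k I) : ℤ :=
  -∑ c, ∑ d, ∑ c', ∑ d', if c < c' ∧ d' < d then bil D (ν.1 c d) (ν.1 c' d') else 0

theorem Fits.sum_invSet {k : Type u} [Field k] (D : FoldingDatum k I) {i : Seq κ}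
    (h : ν.Fits hL i) :
    -∑ ab ∈ invSet (ν.w hL hM), D.form (i ab.1) (i ab.2) = ν.deg D := by
  have h1 : ∑ ab ∈ invSet (ν.w hL hM), D.form (i ab.1) (i ab.2) =
      ∑ a, ∑ b, if blk hL a < blk hL b ∧ blk hM (ν.w hL hM b) < blk hM (ν.w hL hM a) then
        D.form (i a) (i b) else 0 := by
    rw [← Fintype.sum_prod_type', ← Finset.sum_filter]
    refine Finset.sum_congr ?_ fun _ _ => rfl
    ext ⟨a, b⟩
    rw [mem_invSet_iff_of_isShort (monotone_blk hL) (monotone_blk hM) (ν.isShort_w hL hM)]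
    simp
  have h2 : ∀ {N : Type} [AddCommMonoid N] (x : Fin κ.degree → N),
      ∑ a, x a = ∑ c, ∑ d, ∑ p, x (ν.spos hL c d p) := by
    intro N _ x
    rw [← (Equiv.ofBijective _ (ν.spos_bijective hL)).sum_comp, Fintype.sum_sigma]
    exact Finset.sum_congr rfl fun c _ => Fintype.sum_sigma _
  rw [h1, deg, h2]
  congr 1
  refine Finset.sum_congr rfl fun c _ => Finset.sum_congr rfl fun d _ => ?_
  simp only [h2]
  rw [Finset.sum_comm]
  refine Finset.sum_congr rfl fun c' _ => ?_
  rw [Finset.sum_comm]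
  refine Finset.sum_congr rfl fun d' _ => ?_
  simp only [blk_spos, w_spos, blk_tpos]
  split_ifs with hcd
  · refine Eq.trans ?_ (congrArg₂ (fun x y => bil D x y) (h c d) (h c' d'))
    simp only [map_sum, AddMonoidHom.finsetSum_apply, bil_single]
    exact Finset.sum_comm
  · simp

end Mat

end KLR

theorem invSet_sw_mul {n : ℕ} (w : Equiv.Perm (Fin n)) (x : Letter n)
    (h : w⁻¹ x.1.1 < w⁻¹ x.1.2) :
    invSet (sw x * w) = insert (w⁻¹ x.1.1, w⁻¹ x.1.2) (invSet w) := by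
  ext ⟨a, b⟩
  have hw : ∀ c, w (w⁻¹ c) = c := w.apply_symm_apply
  rw [Finset.mem_insert, mem_invSet, mem_invSet, Equiv.Perm.mul_apply, Equiv.Perm.mul_apply,
    Prod.mk.injEq]
  constructor
  · rintro ⟨h1, h2⟩
    by_cases h3 : (w a, w b) = x.1
    · left
      rw [← h3]
      simp
    · right
      refine ⟨h1, ?_⟩
      by_contra h4
      have h5 : w a < w b := lt_of_le_of_ne (not_lt.1 h4) fun h => h1.ne (w.injective h)
      exact (sw_lt x h5 h3).not_gt h2
  · rintro (⟨rfl, rfl⟩ | ⟨h1, h2⟩)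
    · rw [hw, hw, sw_left, sw_right]
      exact ⟨h, x.lt⟩
    · refine ⟨h1, sw_lt x h2 fun h3 => ?_⟩
      rw [← h3] at h
      exact h1.not_gt (by simpa using h)

namespace KLR

variable {k : Type u} [Field k] {I : Type u} {D : FoldingDatum k I} {κ : I →₀ ℕ}

theorem eSum_mul_of_imp {P P' : Seq κ → Prop} (h : ∀ i, P i → P' i) :
    eSum D P * eSum D P' = eSum D P := by
  classical
  refine eq_of_mul_e D fun i => ?_
  rw [mul_assoc, eSum_mul_e]
  by_cases h1 : P i
  · rw [if_pos (h i h1)]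
  · rw [eSum_mul_e, if_neg h1]
    split_ifs
    · rw [eSum_mul_e, if_neg h1]
    · rw [mul_zero]

theorem eSum_mul_of_imp' {P P' : Seq κ → Prop} (h : ∀ i, P i → P' i) :
    eSum D P' * eSum D P = eSum D P := by
  rw [(eSum_commute _ _).eq, eSum_mul_of_imp h]

theorem tw_e_mem_gr {ω : List (Letter κ.degree)} (hω : IsRed ω) (i : Seq κ) :
    tw D ω * e D i ∈ gr D κ (-∑ ab ∈ invSet (wordPerm ω), D.form (i ab.1) (i ab.2)) := by
  induction ω with
  | nil =>
    have : invSet (1 : Equiv.Perm (Fin κ.degree)) = ∅ := by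
      ext ⟨a, b⟩
      rw [mem_invSet]
      simpa using fun h => le_of_lt h
    rw [wordPerm_nil, this, tw_nil, one_mul, Finset.sum_empty, neg_zero]
    exact Submodule.subset_span (IsWord.e i)
  | cons x ω ih =>
    have h1 : (x :: ω) = [x] ++ ω := rfl
    have h2 : tw D (x :: ω) * e D i =
        (tl D x * e D (i.act (wordPerm ω))) * (tw D ω * e D i) := by
      rw [tw_cons, mul_assoc, mul_assoc, tw_e, ← mul_assoc (e D _) (e D _),
        (isFamily D).e_mul_self]
    rw [h2, wordPerm_cons, invSet_sw_mul _ _ hω.cons_lt, Finset.sum_insert, neg_add]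
    · exact mul_mem_gr (Submodule.subset_span (IsWord.tau (D := D) x.1.1 x.1.2 x.2 (i.act _))) (ih hω.of_cons)
    · rw [mem_invSet]
      have hw : ∀ c, wordPerm ω ((wordPerm ω)⁻¹ c) = c := (wordPerm ω).apply_symm_apply
      rw [hw, hw]
      exact fun h => h.2.not_gt x.lt

theorem exists_poly_tw (ω : List (Letter κ.degree)) {f : KLR D κ} (hf : f ∈ polySub D κ) :
    ∃ f' ∈ polySub D κ, f * tw D ω - tw D ω * f' ∈ low D (fun _ => (0 : Fin 1)) ω.length := by
  have hb : IsBlockWord (fun _ => (0 : Fin 1)) ω := fun _ _ => rfl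
  induction hf using Algebra.adjoin_induction with
  | mem x hx =>
    rcases hx with ⟨p, rfl⟩ | ⟨i, rfl⟩
    · refine ⟨_, y_mem_polySub ((wordPerm ω)⁻¹ p), ?_⟩
      have := y_tw_sub_mem (D := D) hb ((wordPerm ω)⁻¹ p)
      rwa [show (wordPerm ω) ((wordPerm ω)⁻¹ p) = p from (wordPerm ω).apply_symm_apply p] at this
    · refine ⟨_, e_mem_polySub (i.act (wordPerm ω)⁻¹), ?_⟩
      rw [tw_e, Seq.act_act, mul_inv_cancel, Seq.act_one, sub_self]
      exact zero_mem _
  | algebraMap c =>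
    refine ⟨_, Subalgebra.algebraMap_mem _ c, ?_⟩
    rw [Algebra.commutes, sub_self]
    exact zero_mem _
  | add x y _ _ hx hy =>
    obtain ⟨x', hx', h1⟩ := hx
    obtain ⟨y', hy', h2⟩ := hy
    refine ⟨_, add_mem hx' hy', ?_⟩
    have := add_mem h1 h2
    rwa [show (x + y) * tw D ω - tw D ω * (x' + y') =
      x * tw D ω - tw D ω * x' + (y * tw D ω - tw D ω * y') by noncomm_ring]
  | mul x y hxm _ hx hy =>
    obtain ⟨x', hx', h1⟩ := hx
    obtain ⟨y', hy', h2⟩ := hy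
    refine ⟨_, mul_mem hx' hy', ?_⟩
    have := add_mem (poly_mul_low hxm h2) (low_mul_poly h1 hy')
    rwa [show x * y * tw D ω - tw D ω * (x' * y') =
      x * (y * tw D ω - tw D ω * y') + (x * tw D ω - tw D ω * x') * y' by noncomm_ring]

theorem tl_tw_sub_mem {ω : List (Letter κ.degree)} (hω : IsRed ω) {x y : Letter κ.degree}
    (h1 : wordPerm ω y.1.1 = x.1.1) (h2 : wordPerm ω y.1.2 = x.1.2) :
    tl D x * tw D ω - tw D ω * tl D y ∈ low D (fun _ => (0 : Fin 1)) ω.length := by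
  have h3 : wordPerm (ω ++ [y]) = wordPerm (x :: ω) := by
    rw [wordPerm_append, wordPerm_cons, wordPerm_cons, wordPerm_nil, mul_one, mul_sw_eq h1 h2]
  have h4 : IsRed (x :: ω) := isRed_cons hω (by
    rw [← h1, ← h2]
    simpa using y.lt)
  have := tw_sub_mem (D := D) (β := fun _ => (0 : Fin 1)) monotone_const (ω.length + 1) (x :: ω)
    (ω ++ [y]) (fun _ _ => rfl) (fun _ _ => rfl) h4 (by
      rw [IsRed, h3, ← h4, List.length_append, List.length_cons, List.length_cons, List.length_nil])
      h3.symm (by rw [List.length_cons])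
  simpa using this

end KLR

namespace FoldingDatum

open KLR

variable {k : Type u} [Field k] [Infinite k] {I : Type u} {D : FoldingDatum k I} {r s : ℕ}
  {lam : Fin r → D.NJ} {mu : Fin s → D.NJ} {κ : D.NJ} (hlam : ∑ c, lam c = κ)
  (hmu : ∑ d, mu d = κ)

/-- An element of the image of the tensor product is a combination of words. -/
theorem exists_cmap_mem_low (F : Factorization D) (b : (FoldedAlg.pi fun j => D.R (mu j)).carrier) :
    ∃ m : ℕ, cmap hmu b ∈ low D (blk (sum_coe hmu)) m := by
  have hb : b ∈ Submodule.span k (Set.range (catBasis F mu)) := by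
    rw [(catBasis F mu).span_eq]; trivial
  induction hb using Submodule.span_induction with
  | mem x hx =>
    obtain ⟨t, rfl⟩ := hx
    refine ⟨(catW hmu fun j => (t j).1).length + 1, ?_⟩
    rw [concat_catBasis]
    exact low_mul_poly (tw_mul_mem_low (catW_block hmu _) (by push_cast; omega) (ev_mem _))
      (e_mem_polySub _)
  | zero => exact ⟨0, by rw [map_zero]; exact zero_mem _⟩
  | add x y _ _ hx hy =>
    obtain ⟨m, hm⟩ := hx
    obtain ⟨m', hm'⟩ := hy
    refine ⟨max m m', ?_⟩
    rw [map_add]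
    exact add_mem (low_mono (by push_cast; exact le_max_left _ _) hm)
      (low_mono (by push_cast; exact le_max_right _ _) hm')
  | smul a x _ hx =>
    obtain ⟨m, hm⟩ := hx
    exact ⟨m, by rw [map_smul]; exact Submodule.smul_mem _ _ hm⟩

/-- The matrices that index the double cosets. -/
abbrev CMat (lam : Fin r → D.NJ) (mu : Fin s → D.NJ) : Type u :=
  Mat (fun c => (lam c : I →₀ ℕ)) fun d => (mu d : I →₀ ℕ)

/-- The permutation attached to a matrix. -/
def mw (ν : CMat lam mu) : Equiv.Perm (Fin (κ : I →₀ ℕ).degree) := ν.w (sum_coe hlam) (sum_coe hmu)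

/-- The element of the KLR algebra attached to a matrix. -/
def mt (ν : CMat lam mu) : KLR D (κ : I →₀ ℕ) :=
  tw D (rw1 (mw hlam hmu ν)) * eSum D (ν.Fits (sum_coe hlam))

theorem mw_short (ν : CMat lam mu) :
    IsShort (blk (sum_coe hlam)) (blk (sum_coe hmu)) (mw hlam hmu ν) := ν.isShort_w _ _

/-- The rank of a matrix. -/
def rk (ν : CMat lam mu) : ℕ := inv (mw hlam hmu ν)

/-- The index set of the coset representatives. -/
def Coset : Type u := {x : CMat lam mu × Equiv.Perm (Fin (κ : I →₀ ℕ).degree) //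
  (∀ a, blk (sum_coe hmu) (x.2 a) = blk (sum_coe hmu) a) ∧
    MonoOnBlocks (tgt (blk (sum_coe hlam)) (blk (sum_coe hmu)) (mw hlam hmu x.1)) x.2}

instance : Finite (Coset hlam hmu) := inferInstanceAs (Finite (Subtype _))

instance : Fintype (Coset hlam hmu) := Fintype.ofFinite _

variable {hlam hmu}

/-- The word of a coset representative. -/
def Coset.word (q : Coset hlam hmu) : List (Letter (κ : I →₀ ℕ).degree) :=
  redWord (monotone_blk (sum_coe hmu)) q.1.2 q.2.1

theorem Coset.word_block (q : Coset hlam hmu) : IsBlockWord (blk (sum_coe hmu)) q.word :=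
  redWord_block _ _ _

/-- The element of the tensor product attached to a coset representative. -/
def Coset.b (q : Coset hlam hmu) : (FoldedAlg.pi fun d => D.R (mu d)).carrier :=
  (exists_concat hmu q.word_block (one_mem _)).choose

theorem Coset.cmap_b (q : Coset hlam hmu) :
    cmap hmu q.b = (tw D q.word * eSum D (IsConcat (sum_coe hmu)) : KLR D (κ : I →₀ ℕ)) := by
  refine (exists_concat hmu q.word_block (one_mem (polySub D (κ : I →₀ ℕ)))).choose_spec.trans ?_
  rw [mul_one]

variable (hlam hmu)

/-- The span of the strata of the given matrices. -/
def strata (S : Set (CMat lam mu)) : Submodule k (KLR D (κ : I →₀ ℕ)) :=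
  Submodule.span k {z | ∃ (q : Coset hlam hmu) (x : (FoldedAlg.pi fun c => D.R (lam c)).carrier),
    q.1.1 ∈ S ∧ z = cmap hmu q.b * mt hlam hmu q.1.1 * cmap hlam x}

variable {hlam hmu}

theorem mem_strata {S : Set (CMat lam mu)} (q : Coset hlam hmu) (hq : q.1.1 ∈ S)
    (x : (FoldedAlg.pi fun c => D.R (lam c)).carrier) :
    (cmap hmu q.b * mt hlam hmu q.1.1 * cmap hlam x : KLR D (κ : I →₀ ℕ)) ∈ strata hlam hmu S :=
  Submodule.subset_span ⟨q, x, hq, rfl⟩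

theorem strata_mono {S S' : Set (CMat lam mu)} (h : S ⊆ S') :
    strata hlam hmu S ≤ strata hlam hmu S' :=
  Submodule.span_mono fun _ ⟨q, x, hq, hz⟩ => ⟨q, x, h hq, hz⟩

theorem strata_mul {S : Set (CMat lam mu)} {z : KLR D (κ : I →₀ ℕ)} (hz : z ∈ strata hlam hmu S)
    (a : (FoldedAlg.pi fun c => D.R (lam c)).carrier) : z * cmap hlam a ∈ strata hlam hmu S := by
  induction hz using Submodule.span_induction with
  | mem z hz =>
    obtain ⟨q, x, hq, rfl⟩ := hz
    rw [mul_assoc, ← cmap_mul]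
    exact mem_strata q hq _
  | zero => rw [zero_mul]; exact zero_mem _
  | add x y _ _ hx hy => rw [add_mul]; exact add_mem hx hy
  | smul c x _ hx => rw [smul_mul_assoc]; exact Submodule.smul_mem _ _ hx

theorem exists_of_mem_strata {S : Set (CMat lam mu)} {z : KLR D (κ : I →₀ ℕ)}
    (hz : z ∈ strata hlam hmu S) :
    ∃ x : Coset hlam hmu → (FoldedAlg.pi fun c => D.R (lam c)).carrier,
      z = ∑ q : Coset hlam hmu, cmap hmu q.b * mt hlam hmu q.1.1 * cmap hlam (x q) ∧ ∀ q, x q ≠ 0 → q.1.1 ∈ S := by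
  classical
  induction hz using Submodule.span_induction with
  | mem z hz =>
    obtain ⟨q, x, hq, rfl⟩ := hz
    refine ⟨Pi.single q x, ?_, fun q' hq' => ?_⟩
    · rw [Finset.sum_eq_single q, Pi.single_eq_same]
      · intro q' _ h
        rw [Pi.single_eq_of_ne h, map_zero, mul_zero]
      · exact fun h => absurd (Finset.mem_univ _) h
    · by_cases h : q' = q
      · rwa [h]
      · exact absurd (Pi.single_eq_of_ne h _) hq'
  | zero => exact ⟨0, by simp, fun q h => absurd rfl h⟩
  | add x y _ _ hx hy =>
    obtain ⟨a, ha, ha'⟩ := hx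
    obtain ⟨b, hb, hb'⟩ := hy
    refine ⟨a + b, ?_, fun q hq => ?_⟩
    · rw [ha, hb, ← Finset.sum_add_distrib]
      exact Finset.sum_congr rfl fun q _ => by rw [Pi.add_apply, map_add, mul_add]
    · by_contra h
      refine hq ?_
      rw [Pi.add_apply, not_not.1 fun h' => h (ha' q h'), not_not.1 fun h' => h (hb' q h'),
        add_zero]
  | smul c x _ hx =>
    obtain ⟨a, ha, ha'⟩ := hx
    refine ⟨c • a, ?_, fun q hq => ha' q fun h => hq ?_⟩
    · rw [ha, Finset.smul_sum]
      exact Finset.sum_congr rfl fun q _ => by rw [Pi.smul_apply, map_smul, mul_smul_comm]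
    · rw [Pi.smul_apply, h, smul_zero]

theorem concat_mul_mt (ν : CMat lam mu) :
    (eSum D (IsConcat (sum_coe hmu)) * mt hlam hmu ν : KLR D (κ : I →₀ ℕ)) = mt hlam hmu ν := by
  have h : ∀ i : Seq (κ : I →₀ ℕ), ν.Fits (sum_coe hlam) i ↔
      ν.Fits (sum_coe hlam) ((i.act (wordPerm (rw1 (mw hlam hmu ν)))).act (mw hlam hmu ν)⁻¹) :=
    fun i => by rw [wordPerm_rw1, Seq.act_act, inv_mul_cancel, Seq.act_one]
  rw [mt, tw_mul_eSum (P' := fun i => ν.Fits (sum_coe hlam) (i.act (mw hlam hmu ν)⁻¹)) _ h,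
    ← mul_assoc, eSum_mul_of_imp']
  intro i hi
  have := Mat.Fits.isConcat_act (sum_coe hlam) (sum_coe hmu) ν hi
  change IsConcat (sum_coe hmu) ((i.act (mw hlam hmu ν)⁻¹).act (mw hlam hmu ν)) at this
  rwa [Seq.act_act, mul_inv_cancel, Seq.act_one] at this

theorem mt_mul_concat (ν : CMat lam mu) :
    (mt hlam hmu ν * eSum D (IsConcat (sum_coe hlam)) : KLR D (κ : I →₀ ℕ)) = mt hlam hmu ν := by
  rw [mt, mul_assoc, eSum_mul_of_imp]
  exact fun i hi => Mat.Fits.isConcat (sum_coe hlam) ν hi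

theorem concat_mul_cmap {l : ℕ} {mu : Fin l → D.NJ} (hmu : ∑ d, mu d = κ)
    (b : (FoldedAlg.pi fun d => D.R (mu d)).carrier) :
    (eSum D (IsConcat (sum_coe hmu)) * cmap hmu b : KLR D (κ : I →₀ ℕ)) = cmap hmu b := by
  rw [← cmap_one hmu, ← cmap_mul, one_mul]

variable (hlam hmu) in
/-- Multiplication by the idempotents on both sides. -/
def sandwich : KLR D (κ : I →₀ ℕ) →ₗ[k] KLR D (κ : I →₀ ℕ) :=
  LinearMap.mulLeft k (eSum D (IsConcat (sum_coe hmu))) ∘ₗ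
    LinearMap.mulRight k (eSum D (IsConcat (sum_coe hlam)))

variable (hlam hmu) in
theorem sandwich_apply (y : KLR D (κ : I →₀ ℕ)) : sandwich hlam hmu y =
    eSum D (IsConcat (sum_coe hmu)) * (y * eSum D (IsConcat (sum_coe hlam))) := rfl

theorem sandwich_mem {m : ℕ} {y : KLR D (κ : I →₀ ℕ)} (hy : y ∈ low D (fun _ => (0 : Fin 1)) m) :
    sandwich hlam hmu y ∈ strata hlam hmu {ν | rk hlam hmu ν < m} := by
  classical
  refine low_le (β := fun _ => (0 : Fin 1)) monotone_const
    ((strata hlam hmu {ν | rk hlam hmu ν < m}).comap (sandwich hlam hmu)) m m le_rfl ?_ hy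
  intro w _ hw i
  have hβ := monotone_blk (sum_coe hlam)
  have hβ' := monotone_blk (sum_coe hmu)
  obtain ⟨u, z, v, rfl, hu, hz, hv, hm⟩ := exists_double_coset hβ hβ' w
  have hinv : inv (u * z * v) = inv u + inv z + inv v := by
    rw [inv_mul_of_mono hβ hm hv, hz.inv_mul hβ' hu]
  refine ⟨redWord hβ' u hu ++ rw1 z ++ redWord hβ v hv, fun _ _ => rfl, ?_, ?_, ?_⟩
  · rw [IsRed, List.length_append, List.length_append, wordPerm_append, wordPerm_append,
      redWord_red, redWord_red, rw1_red, wordPerm_redWord, wordPerm_redWord, wordPerm_rw1, hinv]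
  · rw [wordPerm_append, wordPerm_append, wordPerm_redWord, wordPerm_redWord, wordPerm_rw1]
  intro f hf
  rw [Submodule.mem_comap, sandwich_apply, mul_assoc _ (e D i), (commute_e_of_mem (eSum_mem_polySub _) i).symm.eq,
    eSum_mul_e]
  by_cases hi : IsConcat (sum_coe hlam) i
  swap
  · rw [if_neg hi, mul_zero, mul_zero]; exact zero_mem _
  have hi2 : IsConcat (sum_coe hlam) (i.act v) := isConcat_act (sum_coe hlam) hv hi
  have h1 : (eSum D (IsConcat (sum_coe hmu)) * (tw D (redWord hβ' u hu ++ rw1 z ++ redWord hβ v hv) *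
      f * e D i) : KLR D (κ : I →₀ ℕ)) = tw D (redWord hβ' u hu) * (eSum D (IsConcat (sum_coe hmu)) *
        e D ((i.act v).act z)) * tw D (rw1 z) * tw D (redWord hβ v hv) * f := by
    rw [tw_append, tw_append, mul_assoc _ f, (commute_e_of_mem hf i).eq]
    have c1 := (eSum_concat_commute_tw (D := D) (sum_coe hmu) (redWord_block hβ' u hu)).eq
    have c2 := tw_e (D := D) (redWord hβ v hv) i
    have c3 := tw_e (D := D) (rw1 z) (i.act v)
    rw [wordPerm_redWord] at c2
    rw [wordPerm_rw1] at c3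
    calc _ = (eSum D (IsConcat (sum_coe hmu)) * tw D (redWord hβ' u hu)) * tw D (rw1 z) *
          (tw D (redWord hβ v hv) * e D i) * f := by simp only [mul_assoc]
      _ = tw D (redWord hβ' u hu) * eSum D (IsConcat (sum_coe hmu)) * (tw D (rw1 z) *
          e D (i.act v)) * tw D (redWord hβ v hv) * f := by rw [c1, c2]; simp only [mul_assoc]
      _ = _ := by rw [c3]; simp only [mul_assoc]
  by_cases hi3 : IsConcat (sum_coe hmu) ((i.act v).act z)
  swap
  · rw [if_pos hi, h1, eSum_mul_e, if_neg hi3]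
    simp
  obtain ⟨ν, hν, hfit⟩ := Mat.exists_fits (sum_coe hlam) (sum_coe hmu) hi2 hz hi3
  have hν' : mw hlam hmu ν = z := hν
  obtain ⟨x, hx⟩ := exists_concat hlam (redWord_block hβ v hv) (mul_mem hf (e_mem_polySub i))
  let q : Coset hlam hmu := ⟨(ν, u), hu, by
    rw [hν']
    exact (hz.mono_mul_iff hβ' hu).1 hm⟩
  have key := mem_strata (S := {ν | rk hlam hmu ν < m}) q (by
    change inv (mw hlam hmu ν) < m
    rw [hν']
    have : inv (u * z * v) < m := by exact_mod_cast hw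
    omega) x
  convert key using 1
  rw [if_pos hi, h1, eSum_mul_e, if_pos hi3, Coset.cmap_b, mul_assoc _ _ (mt hlam hmu _), concat_mul_mt, hx]
  have h2 : q.word = redWord hβ' u hu := rfl
  have h3 : mt hlam hmu q.1.1 = tw D (rw1 z) * eSum D (ν.Fits (sum_coe hlam)) := by
    change tw D (rw1 (mw hlam hmu ν)) * _ = _
    rw [hν']
  have c2 := tw_e (D := D) (redWord hβ v hv) i
  have c3 := tw_e (D := D) (rw1 z) (i.act v)
  have c4 := eSum_mul_e (D := D) (ν.Fits (sum_coe hlam)) (i.act v)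
  rw [wordPerm_redWord] at c2
  rw [wordPerm_rw1] at c3
  rw [if_pos hfit] at c4
  have c5 := eSum_mul_e (D := D) (IsConcat (sum_coe hlam)) i
  rw [if_pos hi] at c5
  rw [h2, h3, mul_assoc _ (f * e D i), mul_assoc f, (commute_e_of_mem (eSum_mem_polySub _) i).symm.eq, c5,
    (commute_e_of_mem hf i).eq]
  calc _ = tw D (redWord hβ' u hu) * (e D ((i.act v).act z) * tw D (rw1 z)) *
        tw D (redWord hβ v hv) * f := by simp only [mul_assoc]
    _ = tw D (redWord hβ' u hu) * tw D (rw1 z) * e D (i.act v) * tw D (redWord hβ v hv) * f := by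
        rw [← c3]; simp only [mul_assoc]
    _ = tw D (redWord hβ' u hu) * tw D (rw1 z) * (eSum D (ν.Fits (sum_coe hlam)) *
      (e D (i.act v) * tw D (redWord hβ v hv))) * f := by
        rw [← mul_assoc (eSum D _), c4]; simp only [mul_assoc]
    _ = _ := by rw [← c2]; simp only [mul_assoc]

end FoldingDatum

namespace FoldingDatum

open KLR

variable {k : Type u} [Field k] [Infinite k] {I : Type u} {D : FoldingDatum k I} {r s : ℕ}
  {lam : Fin r → D.NJ} {mu : Fin s → D.NJ} {κ : D.NJ} {hlam : ∑ c, lam c = κ}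
  {hmu : ∑ d, mu d = κ}

/-- Left multiplication by one element and right multiplication by another one agree on the
generator of a stratum, modulo lower strata. -/
def Agree (ν : CMat lam mu) (y y' : KLR D (κ : I →₀ ℕ)) : Prop :=
  y * mt hlam hmu ν - mt hlam hmu ν * y' ∈ strata hlam hmu {ν' | rk hlam hmu ν' < rk hlam hmu ν}

theorem agree_of_sub_mem {ν : CMat lam mu} {y y' : KLR D (κ : I →₀ ℕ)}
    (hy' : Commute (eSum D (ν.Fits (sum_coe hlam))) y')
    (h : y * tw D (rw1 (mw hlam hmu ν)) - tw D (rw1 (mw hlam hmu ν)) * y' ∈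
      low D (fun _ => (0 : Fin 1)) (rk hlam hmu ν)) :
    Agree (hlam := hlam) (hmu := hmu) ν (eSum D (IsConcat (sum_coe hmu)) * y)
      (y' * eSum D (IsConcat (sum_coe hlam))) := by
  have h1 := sandwich_mem (hlam := hlam) (hmu := hmu)
    (low_mul_poly h (eSum_mem_polySub (ν.Fits (sum_coe hlam))))
  rw [sandwich_apply] at h1
  rw [Agree]
  convert h1 using 1
  rw [sub_mul, mul_assoc _ y', ← hy'.eq, mul_assoc y, ← mul_assoc _ _ y']
  change _ = _ * ((y * mt hlam hmu ν - mt hlam hmu ν * y') * _)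
  rw [sub_mul, mul_assoc y, mt_mul_concat, mul_sub, ← mul_assoc, mul_assoc (mt hlam hmu ν) y',
    ← mul_assoc _ (mt hlam hmu ν), concat_mul_mt, mul_assoc]

variable (hlam hmu) in
/-- The lower strata are stable under left multiplication. -/
def IsLeftStable (m : ℕ) : Prop :=
  ∀ (b : (FoldedAlg.pi fun d => D.R (mu d)).carrier) (z : KLR D (κ : I →₀ ℕ)),
    z ∈ strata hlam hmu {ν | rk hlam hmu ν < m} →
      cmap hmu b * z ∈ strata hlam hmu {ν | rk hlam hmu ν < m}

theorem Agree.mul {ν : CMat lam mu} (hs : IsLeftStable hlam hmu (rk hlam hmu ν))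
    {y : KLR D (κ : I →₀ ℕ)} {b : (FoldedAlg.pi fun d => D.R (mu d)).carrier}
    {a a' : (FoldedAlg.pi fun c => D.R (lam c)).carrier}
    (h1 : Agree (hlam := hlam) (hmu := hmu) ν (cmap hmu b) (cmap hlam a))
    (h2 : Agree (hlam := hlam) (hmu := hmu) ν y (cmap hlam a')) :
    Agree (hlam := hlam) (hmu := hmu) ν (cmap hmu b * y) (cmap hlam a * cmap hlam a') := by
  have h3 := add_mem (hs b _ h2) (strata_mul h1 a')
  rw [Agree]
  convert h3 using 1
  noncomm_ring

/-- A word in the letters of the target blocks, times a polynomial, can be moved past the generator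
of a stratum. -/
theorem exists_agree {ν : CMat lam mu} (hs : IsLeftStable hlam hmu (rk hlam hmu ν))
    {ω : List (Letter (κ : I →₀ ℕ).degree)}
    (hω : IsBlockWord (tgt (blk (sum_coe hlam)) (blk (sum_coe hmu)) (mw hlam hmu ν)) ω)
    {f : KLR D (κ : I →₀ ℕ)} (hf : f ∈ polySub D (κ : I →₀ ℕ)) :
    ∃ a, Agree (hlam := hlam) (hmu := hmu) ν (eSum D (IsConcat (sum_coe hmu)) * (tw D ω * f))
      (cmap hlam a) := by
  have hrk : ((rw1 (mw hlam hmu ν)).length : ℤ) = rk hlam hmu ν := by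
    rw [rw1_red, wordPerm_rw1]
    rfl
  induction ω with
  | nil =>
    obtain ⟨f', hf', h⟩ := exists_poly_tw (rw1 (mw hlam hmu ν)) hf
    obtain ⟨a, ha⟩ := exists_concat_poly hlam hf'
    refine ⟨a, ?_⟩
    rw [ha, tw_nil, one_mul]
    rw [hrk] at h
    exact agree_of_sub_mem (eSum_commute_poly _ hf') h
  | cons x ω ih =>
    rw [isBlockWord_cons] at hω
    obtain ⟨a', ha'⟩ := ih hω.2
    obtain ⟨y, hy1, hy2⟩ := (mw_short hlam hmu ν).exists_letter (monotone_blk _) x hω.1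
    have hx := tgt_eq_iff.1 hω.1
    have hx1 : IsBlockWord (blk (sum_coe hmu)) [x] := isBlockWord_cons.2 ⟨hx.1, isBlockWord_nil⟩
    have hy : IsBlockWord (blk (sum_coe hlam)) [y] := by
      refine isBlockWord_cons.2 ⟨?_, isBlockWord_nil⟩
      have := hx.2
      rw [← hy1, ← hy2] at this
      simpa using this
    obtain ⟨a, ha⟩ := exists_concat hlam hy (one_mem (polySub D (κ : I →₀ ℕ)))
    obtain ⟨b, hb⟩ := exists_concat hmu hx1 (one_mem (polySub D (κ : I →₀ ℕ)))
    rw [mul_one, tw_cons, tw_nil, mul_one] at ha hb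
    have hc := (eSum_concat_commute_tw (D := D) (sum_coe hmu) hx1).eq
    rw [tw_cons, tw_nil, mul_one] at hc
    have h1 : Agree (hlam := hlam) (hmu := hmu) ν (cmap hmu b) (cmap hlam a) := by
      rw [ha, hb, ← hc]
      refine agree_of_sub_mem ?_ ?_
      · have h2 := tw_mul_eSum (D := D) (κ := (κ : I →₀ ℕ)) [y] (P := ν.Fits (sum_coe hlam))
          (P' := ν.Fits (sum_coe hlam)) fun i => by
            rw [wordPerm_cons, wordPerm_nil, mul_one, Mat.fits_iff _ (sum_coe hmu),
              Mat.fits_iff _ (sum_coe hmu)]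
            refine forall_congr' fun c => forall_congr' fun d => ?_
            have h3 : ∑ a with blk (sum_coe hlam) a = c ∧ blk (sum_coe hmu)
                (ν.w (sum_coe hlam) (sum_coe hmu) a) = d, Finsupp.single (i.act (sw y) a) 1 =
                ∑ a with blk (sum_coe hlam) a = c ∧ blk (sum_coe hmu)
                (ν.w (sum_coe hlam) (sum_coe hmu) a) = d, Finsupp.single (i a) 1 := by
              refine Finset.sum_equiv (sw y) (fun a => ?_) fun a _ => ?_
              · have h4 : blk (sum_coe hlam) (sw y a) = blk (sum_coe hlam) a := by
                  have := hy.apply a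
                  rwa [wordPerm_cons, wordPerm_nil, mul_one] at this
                have h5 : blk (sum_coe hmu) (mw hlam hmu ν (sw y a)) =
                    blk (sum_coe hmu) (mw hlam hmu ν a) := by
                  rw [← Equiv.Perm.mul_apply, mul_sw_eq hy1 hy2, Equiv.Perm.mul_apply,
                    apply_sw hx.1]
                simp only [Finset.mem_filter, Finset.mem_univ, true_and, h4]
                change _ ↔ _ ∧ blk (sum_coe hmu) (mw hlam hmu ν (sw y a)) = d
                rw [h5]
                rfl
              · simp
            rw [h3]
        rw [tw_cons, tw_nil, mul_one] at h2
        exact h2.symm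
      · have h2 := tl_tw_sub_mem (D := D) (rw1_red (mw hlam hmu ν)) (x := x) (y := y)
          (by rwa [wordPerm_rw1]) (by rwa [wordPerm_rw1])
        rwa [hrk] at h2
    refine ⟨a * a', ?_⟩
    have h3 := h1.mul hs ha'
    rw [← cmap_mul, hb] at h3
    convert h3 using 1
    rw [tw_cons, ← hc]
    have h4 := eSum_mul_self (D := D) (IsConcat (sum_coe hmu))
    calc _ = (eSum D (IsConcat (sum_coe hmu)) * tl D x) * (tw D ω * f) := by simp only [mul_assoc]
      _ = tl D x * (eSum D (IsConcat (sum_coe hmu)) * eSum D (IsConcat (sum_coe hmu))) *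
          (tw D ω * f) := by rw [h4, hc]
      _ = (tl D x * eSum D (IsConcat (sum_coe hmu))) *
          (eSum D (IsConcat (sum_coe hmu)) * (tw D ω * f)) := by simp only [mul_assoc]
      _ = _ := by rw [← hc]

theorem cmap_mul_mt_mem_of (F : Factorization D) {ν : CMat lam mu}
    (hs : IsLeftStable hlam hmu (rk hlam hmu ν))
    (b : (FoldedAlg.pi fun d => D.R (mu d)).carrier) :
    (cmap hmu b * mt hlam hmu ν : KLR D (κ : I →₀ ℕ)) ∈
      strata hlam hmu {ν' | ν' = ν ∨ rk hlam hmu ν' < rk hlam hmu ν} := by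
  obtain ⟨m, hm⟩ := exists_cmap_mem_low hmu F b
  have hβ' := monotone_blk (sum_coe hmu)
  have hβ := monotone_blk (sum_coe hlam)
  have hz := mw_short hlam hmu ν
  have hτ := monotone_tgt hβ hβ' hz.right
  let S : Set (CMat lam mu) := {ν' | ν' = ν ∨ rk hlam hmu ν' < rk hlam hmu ν}
  let T : KLR D (κ : I →₀ ℕ) →ₗ[k] KLR D (κ : I →₀ ℕ) :=
    LinearMap.mulLeft k (eSum D (IsConcat (sum_coe hmu))) ∘ₗ
      LinearMap.mulRight k (mt hlam hmu ν)
  have key : low D (blk (sum_coe hmu)) m ≤ (strata hlam hmu S).comap T := by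
    refine low_le hβ' _ m m le_rfl fun w hw _ i => ?_
    obtain ⟨u, v, rfl, hv, hu⟩ := exists_mono_mul hτ w
    have hv2 : ∀ a, blk (sum_coe hmu) (v a) = blk (sum_coe hmu) a :=
      fun a => (tgt_eq_iff.1 (hv a)).1
    have hu2 : ∀ a, blk (sum_coe hmu) (u a) = blk (sum_coe hmu) a := fun a => by
      have h1 := hw (v⁻¹ a)
      rw [Equiv.Perm.mul_apply, apply_inv hv2, show v (v⁻¹ a) = a from v.apply_symm_apply a] at h1
      exact h1
    have hb1 := redWord_block hβ' u hu2
    have hb2 := redWord_block hτ v hv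
    refine ⟨redWord hβ' u hu2 ++ redWord hτ v hv, isBlockWord_append.2 ⟨hb1, fun x hx =>
      (tgt_eq_iff.1 (hb2 x hx)).1⟩, ?_, ?_, fun f hf => ?_⟩
    · rw [IsRed, List.length_append, wordPerm_append, redWord_red, redWord_red, wordPerm_redWord,
        wordPerm_redWord, inv_mul_of_mono hτ hu hv]
    · rw [wordPerm_append, wordPerm_redWord, wordPerm_redWord]
    obtain ⟨a, ha⟩ := exists_agree hs hb2 (mul_mem hf (e_mem_polySub i))
    let q : Coset hlam hmu := ⟨(ν, u), hu2, hu⟩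
    have h2 : (cmap hmu q.b : KLR D (κ : I →₀ ℕ)) = tw D (redWord hβ' u hu2) *
      eSum D (IsConcat (sum_coe hmu)) := q.cmap_b
    have h1 := add_mem (mem_strata (S := S) q (Or.inl rfl) a)
      (strata_mono (fun _ h => Or.inr h) (hs q.b _ ha))
    have hT : ∀ y, T y = eSum D (IsConcat (sum_coe hmu)) * (y * mt hlam hmu ν) := fun _ => rfl
    rw [Submodule.mem_comap, hT]
    convert h1 using 1
    have hq : q.1.1 = ν := rfl
    rw [hq, mul_assoc _ _ (cmap hlam a), ← mul_add, add_sub_cancel, h2]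
    have c1 := (eSum_concat_commute_tw (D := D) (sum_coe hmu) hb1).eq
    have c4 := eSum_mul_self (D := D) (IsConcat (sum_coe hmu))
    rw [tw_append]
    calc _ = (eSum D (IsConcat (sum_coe hmu)) * tw D (redWord hβ' u hu2)) *
          (tw D (redWord hτ v hv) * (f * e D i)) * mt hlam hmu ν := by simp only [mul_assoc]
      _ = tw D (redWord hβ' u hu2) * (eSum D (IsConcat (sum_coe hmu)) *
          eSum D (IsConcat (sum_coe hmu))) *
          (tw D (redWord hτ v hv) * (f * e D i)) * mt hlam hmu ν := by rw [c1, c4]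
      _ = _ := by simp only [mul_assoc]
  have h1 : eSum D (IsConcat (sum_coe hmu)) * (cmap hmu b * mt hlam hmu ν) ∈ strata hlam hmu S :=
    key hm
  rwa [← mul_assoc, concat_mul_cmap] at h1

theorem isLeftStable (F : Factorization D) (m : ℕ) : IsLeftStable hlam hmu m := by
  induction m using Nat.strong_induction_on with
  | _ m ih =>
    intro b z hz
    induction hz using Submodule.span_induction with
    | mem z hz =>
      obtain ⟨q, x, hq, rfl⟩ := hz
      rw [← mul_assoc, ← mul_assoc, ← cmap_mul]
      refine strata_mul (strata_mono ?_ (cmap_mul_mt_mem_of F (ih _ hq) _)) x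
      rintro ν' (rfl | h)
      · exact hq
      · exact lt_trans h hq
    | zero => rw [mul_zero]; exact zero_mem _
    | add x y _ _ hx hy => rw [mul_add]; exact add_mem hx hy
    | smul c x _ hx => rw [mul_smul_comm]; exact Submodule.smul_mem _ _ hx

variable (hlam hmu) in
/-- The idempotent attached to a matrix. -/
def mε (ν : CMat lam mu) : (FoldedAlg.pi fun c => D.R (lam c)).carrier :=
  (exists_concat_poly hlam (eSum_mem_polySub (ν.Fits (sum_coe hlam)))).choose

theorem cmap_mε (ν : CMat lam mu) :
    cmap hlam (mε hlam ν) = (eSum D (ν.Fits (sum_coe hlam)) : KLR D (κ : I →₀ ℕ)) := by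
  refine (exists_concat_poly hlam (eSum_mem_polySub (ν.Fits (sum_coe hlam)))).choose_spec.trans ?_
  rw [eSum_mul_of_imp]
  exact fun i hi => Mat.Fits.isConcat (sum_coe hlam) ν hi

theorem mt_mul_mε (ν : CMat lam mu) :
    mt hlam hmu ν * cmap hlam (mε hlam ν) = mt hlam hmu ν := by
  rw [cmap_mε, mt, mul_assoc, eSum_mul_self]

theorem mt_mem (ν : CMat lam mu) : mt hlam hmu ν ∈ gr D (κ : I →₀ ℕ) (ν.deg D) := by
  classical
  rw [mt, eSum, Finset.mul_sum]
  refine sum_mem fun i hi => ?_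
  have h := tw_e_mem_gr (D := D) (rw1_red (mw hlam hmu ν)) i
  rw [wordPerm_rw1] at h
  have h2 := Mat.Fits.sum_invSet (sum_coe hlam) (sum_coe hmu) ν D (Finset.mem_filter.1 hi).2
  rw [← h2]
  exact h

theorem exists_strata (r : KLR D (κ : I →₀ ℕ)) :
    sandwich hlam hmu r ∈ strata hlam hmu Set.univ := by
  obtain ⟨m, hm⟩ := exists_mem_low r
  exact strata_mono (Set.subset_univ _) (sandwich_mem hm)

theorem strata_inj (F : Factorization D)
    (x : Coset hlam hmu → (FoldedAlg.pi fun c => D.R (lam c)).carrier)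
    (hx : ∀ q, mε hlam q.1.1 * x q = x q)
    (h : ∑ q : Coset hlam hmu, (cmap hmu q.b * mt hlam hmu q.1.1 * cmap hlam (x q) :
      KLR D (κ : I →₀ ℕ)) = 0) (q : Coset hlam hmu) : x q = 0 := by
  have hβ := monotone_blk (sum_coe hlam)
  have hβ' := monotone_blk (sum_coe hmu)
  have hwp : ∀ q : Coset hlam hmu, wordPerm (q.word ++ rw1 (mw hlam hmu q.1.1)) =
      q.1.2 * mw hlam hmu q.1.1 := fun q => by
    rw [wordPerm_append, Coset.word, wordPerm_redWord, wordPerm_rw1]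
  have hm : ∀ q : Coset hlam hmu, MonoOnBlocks (blk (sum_coe hlam)) (q.1.2 * mw hlam hmu q.1.1) :=
    fun q => ((mw_short hlam hmu q.1.1).mono_mul_iff hβ' q.2.1).2 q.2.2
  have hfit : ∀ q, (eSum D (q.1.1.Fits (sum_coe hlam)) * cmap hlam (x q) : KLR D (κ : I →₀ ℕ)) =
      cmap hlam (x q) := fun q => by
    rw [← cmap_mε, ← cmap_mul, hx]
  refine eq_zero_of_sum_mul_concat hlam F
    (fun q : Coset hlam hmu => q.word ++ rw1 (mw hlam hmu q.1.1))
    (fun q => q.1.1.Fits (sum_coe hlam)) ?_ ?_ x hfit ?_ q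
  · intro q v hv
    rw [hwp, inv_mul_of_mono hβ (hm q) hv, (mw_short hlam hmu q.1.1).inv_mul hβ' q.2.1,
      List.length_append, Coset.word, redWord_red, rw1_red, wordPerm_redWord, wordPerm_rw1]
  · intro q q' i v v' hP hP' hv hv' he
    rw [hwp, hwp] at he
    obtain ⟨h1, h2, h3⟩ := IsShort.unique hβ hβ' (mw_short hlam hmu q.1.1)
      (mw_short hlam hmu q'.1.1) q.2.1 q'.2.1 hv hv' (hm q) (hm q') he
    subst h3
    refine ⟨Subtype.ext (Prod.ext ?_ h1), rfl⟩
    exact Mat.eq_of_fits (sum_coe hlam) (sum_coe hmu) hP hP' h2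
  · rw [← h]
    refine Finset.sum_congr rfl fun q _ => ?_
    rw [Coset.cmap_b, mul_assoc (tw D q.word), concat_mul_mt, tw_append, mt]
    simp only [mul_assoc, hfit]

end FoldingDatum

/-- A numbering of the orbits of a permutation that refines an invariant rank. -/
theorem exists_orbit_numbering {T : Type u} [Finite T] (α : Equiv.Perm T) (rk : T → ℕ)
    (hrk : ∀ ν, rk (α ν) = rk ν) : ∃ (m : ℕ) (g : T → ℕ), (∀ ν, g (α ν) = g ν) ∧
      (∀ ν ν', g ν = g ν' → ∃ j : ℕ, α^[j] ν' = ν) ∧ (∀ ν ν', rk ν < rk ν' → g ν < g ν') ∧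
      (∀ ν, g ν < m) ∧ ∀ p < m, ∃ ν, g ν = p := by
  classical
  let Q := Quotient (Equiv.Perm.SameCycle.setoid α)
  have : Finite Q := Quotient.finite _
  obtain ⟨K, ⟨o⟩⟩ := Finite.exists_equiv_fin Q
  let f : T → ℕ := fun ν => rk ν * K + o (Quotient.mk _ ν)
  have hf1 : ∀ ν, f (α ν) = f ν := fun ν => by
    have : (Quotient.mk (Equiv.Perm.SameCycle.setoid α) (α ν)) =
        Quotient.mk (Equiv.Perm.SameCycle.setoid α) ν :=
      Quotient.sound ((Equiv.Perm.SameCycle.refl α ν).apply_left)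
    simp only [f, hrk, this]
  have hf2 : ∀ ν ν', rk ν < rk ν' → f ν < f ν' := fun ν ν' h => by
    have h1 : rk ν * K + K ≤ rk ν' * K := by
      rw [← Nat.succ_mul]
      exact Nat.mul_le_mul_right K h
    have h2 := (o (Quotient.mk (Equiv.Perm.SameCycle.setoid α) ν)).2
    simp only [f]
    omega
  have hf3 : ∀ ν ν', f ν = f ν' → ∃ j : ℕ, α^[j] ν' = ν := fun ν ν' h => by
    have h0 : rk ν = rk ν' := by
      rcases lt_trichotomy (rk ν) (rk ν') with h1 | h1 | h1
      · exact absurd h (hf2 _ _ h1).ne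
      · exact h1
      · exact absurd h (hf2 _ _ h1).ne'
    have h1 : Quotient.mk (Equiv.Perm.SameCycle.setoid α) ν = Quotient.mk _ ν' := by
      refine o.injective (Fin.ext ?_)
      simp only [f, h0] at h
      omega
    obtain ⟨j, hj⟩ := (Quotient.exact h1 : Equiv.Perm.SameCycle α ν ν').symm.exists_nat_pow_eq
    exact ⟨j, by rw [← hj, Equiv.Perm.iterate_eq_pow]⟩
  have hfin : (Set.range f).Finite := Set.finite_range f
  let S : Finset ℕ := hfin.toFinset
  let e := S.orderIsoOfFin rfl
  have hS : ∀ ν, f ν ∈ S := fun ν => by simp [S]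
  refine ⟨S.card, fun ν => e.symm ⟨f ν, hS ν⟩, ?_, ?_, ?_, fun ν => Fin.is_lt _, ?_⟩
  · intro ν
    simp only [hf1]
  · intro ν ν' h
    have := e.symm.injective (Fin.ext h)
    exact hf3 ν ν' (congrArg Subtype.val this)
  · intro ν ν' h
    exact (OrderIso.lt_iff_lt e.symm).2 (Subtype.mk_lt_mk.2 (hf2 ν ν' h))
  · intro p hp
    have h1 := (e ⟨p, hp⟩).2
    obtain ⟨ν, hν⟩ : ∃ ν, f ν = e ⟨p, hp⟩ := hfin.mem_toFinset.1 h1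
    refine ⟨ν, ?_⟩
    have : (⟨f ν, hS ν⟩ : S) = e ⟨p, hp⟩ := Subtype.ext hν
    simp only [this, OrderIso.symm_apply_apply]

namespace FoldingDatum

open KLR

variable {k : Type u} [Field k] {I : Type u} {D : FoldingDatum k I} {r s : ℕ}
  {lam : Fin r → D.NJ} {mu : Fin s → D.NJ}

/-- The action of the automorphism on the matrices. -/
def αMat (lam : Fin r → D.NJ) (mu : Fin s → D.NJ) : Equiv.Perm (CMat lam mu) where
  toFun ν := ⟨fun c d => (ν.1 c d).mapDomain D.a, fun c => by
    rw [← Finsupp.mapDomain_finsetSum, ν.2.1]; exact mapDomain_a (lam c).2, fun d => by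
    rw [← Finsupp.mapDomain_finsetSum, ν.2.2]; exact mapDomain_a (mu d).2⟩
  invFun ν := ⟨fun c d => (ν.1 c d).mapDomain D.a.symm, fun c => by
    rw [← Finsupp.mapDomain_finsetSum, ν.2.1]; exact mapDomain_symm (lam c).2, fun d => by
    rw [← Finsupp.mapDomain_finsetSum, ν.2.2]; exact mapDomain_symm (mu d).2⟩
  left_inv ν := Subtype.ext (by
    funext c d
    change ((ν.1 c d).mapDomain D.a).mapDomain D.a.symm = _
    rw [← Finsupp.mapDomain_comp]
    simp)
  right_inv ν := Subtype.ext (by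
    funext c d
    change ((ν.1 c d).mapDomain D.a.symm).mapDomain D.a = _
    rw [← Finsupp.mapDomain_comp]
    simp)

theorem αMat_apply (ν : CMat lam mu) (c : Fin r) (d : Fin s) :
    (αMat lam mu ν).1 c d = (ν.1 c d).mapDomain D.a := rfl

theorem αMat_pow_apply (t : ℕ) (ν : CMat lam mu) (c : Fin r) (d : Fin s) :
    ((αMat lam mu ^ t) ν).1 c d = (ν.1 c d).mapDomain (D.a ^ t : Equiv.Perm I) := by
  induction t with
  | zero => exact Finsupp.mapDomain_id.symm
  | succ t ih =>
    rw [pow_succ', Equiv.Perm.mul_apply, αMat_apply, ih, ← Finsupp.mapDomain_comp, pow_succ']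
    rfl

theorem αMat_pow : (αMat lam mu).symm ^ D.n = 1 := by
  have h : αMat lam mu ^ D.n = 1 := by
    ext1 ν
    refine Subtype.ext ?_
    funext c d
    rw [αMat_pow_apply, FoldingDatum.n, pow_orderOf_eq_one]
    exact Finsupp.mapDomain_id
  change (αMat lam mu)⁻¹ ^ D.n = 1
  rw [inv_pow, h, _root_.inv_one]

theorem αMat_symm_eq_iff {ν : CMat lam mu} :
    (αMat lam mu).symm ν = ν ↔ ∀ c d, ν.1 c d ∈ D.NJ := by
  rw [Equiv.symm_apply_eq]
  exact ⟨fun h c d => show (ν.1 c d).mapDomain D.a = ν.1 c d from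
      congrFun (congrFun (congrArg (fun ν : CMat lam mu => ν.1) h.symm) c) d,
    fun h => Subtype.ext (funext fun c => funext fun d => (h c d).symm)⟩

variable {κ : D.NJ} {hlam : ∑ c, lam c = κ} {hmu : ∑ d, mu d = κ}

variable [Infinite k]

theorem mw_α (ν : CMat lam mu) : mw hlam hmu (αMat lam mu ν) = mw hlam hmu ν := by
  refine IsShort.eq_of_card (monotone_blk _) (monotone_blk _) (mw_short hlam hmu _)
    (mw_short hlam hmu _) fun c d => ?_
  have h : ∀ ν : CMat lam mu, (Finset.univ.filter fun a => blk (sum_coe hlam) a = c ∧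
      blk (sum_coe hmu) (mw hlam hmu ν a) = d).card = (ν.1 c d).degree := fun ν => by
    have h2 := ν.sum_spos (sum_coe hlam) (sum_coe hmu) (fun _ => 1) c d
    rw [Finset.sum_const, smul_eq_mul, mul_one] at h2
    refine h2.trans ?_
    simp only [Finset.sum_const, smul_eq_mul, mul_one, Finset.card_univ, Fintype.card_fin]
  rw [h, h, αMat_apply, Finsupp.degree_mapDomain]

theorem fits_α {ν : CMat lam mu} {i : Seq (κ : I →₀ ℕ)} : ν.Fits (sum_coe hlam) i ↔
    (αMat lam mu ν).Fits (sum_coe hlam) (i.map D.a (mapDomain_a κ.2)) := by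
  have hmu : ∑ d, mu d = κ := by
    refine Subtype.ext ?_
    rw [← hlam, AddSubmonoid.coe_finsetSum, AddSubmonoid.coe_finsetSum]
    rw [← Finset.sum_congr rfl fun d _ => ν.2.2 d, Finset.sum_comm]
    exact Finset.sum_congr rfl fun c _ => ν.2.1 c
  rw [Mat.fits_iff (sum_coe hlam) (sum_coe hmu), Mat.fits_iff (sum_coe hlam) (sum_coe hmu)]
  refine forall_congr' fun c => forall_congr' fun d => ?_
  have h1 : (αMat lam mu ν).w (sum_coe hlam) (sum_coe hmu) = ν.w (sum_coe hlam) (sum_coe hmu) :=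
    mw_α (hlam := hlam) (hmu := hmu) ν
  rw [h1, αMat_apply]
  have h2 : ∀ S : Finset (Fin (κ : I →₀ ℕ).degree),
      ∑ a ∈ S, Finsupp.single (i.map D.a (mapDomain_a κ.2) a) 1 =
      (∑ a ∈ S, Finsupp.single (i a) 1 : I →₀ ℕ).mapDomain D.a := fun S => by
    rw [Finsupp.mapDomain_finsetSum]
    simp
  rw [h2]
  exact ⟨fun h => by rw [h], fun h => Finsupp.mapDomain_injective D.a.injective h⟩

theorem aut_tw (hκ : (κ : I →₀ ℕ) ∈ D.NJ) (ω : List (Letter (κ : I →₀ ℕ).degree)) :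
    aut hκ (tw D ω) = tw D ω := by
  induction ω with
  | nil => simp
  | cons x ω ih => rw [tw_cons, map_mul, ih, aut_tau]

theorem aut_mt (ν : CMat lam mu) : aut κ.2 (mt hlam hmu ν) = mt hlam hmu (αMat lam mu ν) := by
  rw [mt, mt, map_mul, aut_tw, aut_eSum κ.2 (fun _ => fits_α (hlam := hlam)), mw_α]

/-- The Mackey stratification. -/
def mackeyStrat (F : Factorization D) (hlam : ∑ c, lam c = κ) (hmu : ∑ d, mu d = κ)
    (g : CMat lam mu → ℕ) (g_α : ∀ ν, g ((αMat lam mu).symm ν) = g ν)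
    (g_eq : ∀ ν ν', g ν = g ν' → ∃ j : ℕ, (αMat lam mu).symm^[j] ν' = ν)
    (g_rk : ∀ ν ν', rk hlam hmu ν < rk hlam hmu ν' → g ν < g ν') :
    RingStrat (concat lam κ hlam) (concat mu κ hmu) (CMat lam mu) (Coset hlam hmu) where
  α := αMat lam mu
  α_pow := αMat_pow
  g := g
  g_α := g_α
  g_eq := g_eq
  pr q := q.1.1
  ε := mε hlam
  ε_idem ν := concat_injective hlam F (by
    rw [cmap_mul, cmap_mε, eSum_mul_self])
  b q := q.b
  c ν := ν.deg D
  t ν := mt hlam hmu ν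
  t_mem ν := mt_mem ν
  t_aut ν := by
    refine (AlgEquiv.symm_apply_eq (aut κ.2)).2 (Eq.trans ?_ (aut_mt _).symm)
    rw [Equiv.apply_symm_apply]
  e_t ν := (congrArg (· * mt hlam hmu ν) (cmap_one hmu)).trans (concat_mul_mt ν)
  t_ε ν := mt_mul_mε ν
  surj x := by
    obtain ⟨y, hy, -⟩ := exists_of_mem_strata (exists_strata (hlam := hlam) (hmu := hmu) x)
    refine ⟨y, Eq.trans ?_ hy⟩
    have h : ∀ x : KLR D (κ : I →₀ ℕ), cmap hmu 1 * x * cmap hlam 1 = sandwich hlam hmu x :=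
      fun x => by rw [sandwich_apply, ← cmap_one hmu, ← cmap_one hlam, mul_assoc]
    exact h x
  inj x hx h q := strata_inj F x hx h q
  stab b ν := by
    obtain ⟨y, hy, hy'⟩ := exists_of_mem_strata
      (cmap_mul_mt_mem_of F (isLeftStable F (rk hlam hmu ν)) b)
    exact ⟨y, hy, fun q hq => (hy' q hq).imp id fun h => g_rk _ _ h⟩

end FoldingDatum

namespace FoldingDatum

open KLR

variable {k : Type u} [Field k] [Infinite k] {I : Type u} {D : FoldingDatum k I} {l m : ℕ}
  {M : Fin l → D.NJ} {κ : D.NJ} (h : ∑ j, M j = κ) {N : Fin l → Fin m → D.NJ}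
  (h' : ∀ j, ∑ i, N j i = M j)

/-- The iterated concatenation of positions. -/
def npos (j : Fin l) (i : Fin m) (p : Fin (N j i : I →₀ ℕ).degree) : Fin (κ : I →₀ ℕ).degree :=
  pos (ν := fun j => (M j : I →₀ ℕ)) (sum_coe h) j
    (pos (ν := fun i => (N j i : I →₀ ℕ)) (sum_coe (h' j)) i p)

/-- The iterated concatenation of letters. -/
def nletter (j : Fin l) (i : Fin m) (x : Letter (N j i : I →₀ ℕ).degree) :
    Letter (κ : I →₀ ℕ).degree :=
  posLetter (ν := fun j => (M j : I →₀ ℕ)) (sum_coe h) j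
    (posLetter (ν := fun i => (N j i : I →₀ ℕ)) (sum_coe (h' j)) i x)

/-- The sequence is an iterated concatenation. -/
def Nested (f : Seq (κ : I →₀ ℕ)) : Prop :=
  ∀ j i, ∑ p, Finsupp.single (f (npos h h' j i p)) 1 = (N j i : I →₀ ℕ)

theorem Nested.isConcat {f : Seq (κ : I →₀ ℕ)} (hf : Nested h h' f) : IsConcat (sum_coe h) f := by
  intro j
  rw [← (posEquiv (sum_coe (h' j))).sum_comp, Fintype.sum_sigma]
  exact (Finset.sum_congr rfl fun i _ => hf j i).trans (sum_coe (h' j))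

theorem nested_swap (j : Fin l) (i : Fin m) (x : Letter (N j i : I →₀ ℕ).degree)
    {f : Seq (κ : I →₀ ℕ)} (hf : Nested h h' f) :
    Nested h h' (f.act (sw (nletter h h' j i x))) := by
  intro j' i'
  simp only [Seq.act_apply, sw_inv]
  by_cases hj : j' = j
  · subst hj
    by_cases hi : i' = i
    · subst hi
      refine Eq.trans ?_ (hf j' i')
      rw [← Equiv.sum_comp (sw x) fun p => (Finsupp.single (f (npos h h' j' i' p)) 1 : I →₀ ℕ)]
      refine Finset.sum_congr rfl fun p _ => ?_
      rw [nletter, npos, npos, sw_posLetter, sw_posLetter]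
    · refine Eq.trans ?_ (hf j' i')
      refine Finset.sum_congr rfl fun p _ => ?_
      rw [nletter, npos, sw_posLetter, sw_posLetter_of_ne _ hi]
  · refine Eq.trans ?_ (hf j' i')
    refine Finset.sum_congr rfl fun p _ => ?_
    rw [nletter, npos, sw_posLetter_of_ne _ hj]

theorem nested_swap_iff (j : Fin l) (i : Fin m) (x : Letter (N j i : I →₀ ℕ).degree)
    {f : Seq (κ : I →₀ ℕ)} :
    Nested h h' f ↔ Nested h h' (f.act (sw (nletter h h' j i x))) :=
  ⟨nested_swap h h' j i x, fun hf => by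
    have := nested_swap h h' j i x hf
    rwa [Seq.act_act, sw_mul_self, Seq.act_one] at this⟩

theorem tl_commute_nested (j : Fin l) (i : Fin m) (x : Letter (N j i : I →₀ ℕ).degree) :
    Commute (eSum D (Nested h h')) (tl D (nletter h h' j i x)) := by
  have := tw_mul_eSum (D := D) [nletter h h' j i x] (P := Nested h h') (P' := Nested h h') fun f => by
    rw [wordPerm_cons, wordPerm_nil, mul_one]
    exact nested_swap_iff h h' j i x
  rw [tw_cons, tw_nil, mul_one] at this
  exact this.symm

/-- The iterated tensor product of the concatenation homomorphisms, in the KLR algebra. -/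
def nmap : (FoldedAlg.pi fun j => FoldedAlg.pi fun i => D.R (N j i)).carrier →ₗ[k]
    KLR D (κ : I →₀ ℕ) :=
  cmap h ∘ₗ (FoldedHom.pi fun j => concat (N j) (M j) (h' j)).toLin

theorem nmap_mul (x y : (FoldedAlg.pi fun j => FoldedAlg.pi fun i => D.R (N j i)).carrier) :
    nmap h h' (x * y) = nmap h h' x * nmap h h' y := by
  rw [nmap, LinearMap.comp_apply, FoldedHom.map_mul, cmap_mul]
  rfl

/-- An element of a tensor factor of an iterated tensor product. -/
def nsingle (N : Fin l → Fin m → D.NJ) (j : Fin l) (i : Fin m) (x : KLR D (N j i : I →₀ ℕ)) :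
    (FoldedAlg.pi fun j => FoldedAlg.pi fun i => D.R (N j i)).carrier :=
  (FoldedHom.single (fun j => FoldedAlg.pi fun i => D.R (N j i)) j).toLin
    ((FoldedHom.single (fun i => D.R (N j i)) i).toLin x)

theorem pi_single {n : ℕ} {S R : Fin l → FoldedAlg k n} (φ : ∀ j, FoldedHom (S j) (R j))
    (j : Fin l) (x : (S j).carrier) : (FoldedHom.pi φ).toLin ((FoldedHom.single S j).toLin x) =
      (FoldedHom.pi φ).toLin 1 * (FoldedHom.single R j).toLin ((φ j).toLin x) := by
  rw [FoldedHom.single_apply, FoldedHom.single_apply, FoldedHom.pi_tprod,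
    PiTensorProduct.one_def, FoldedHom.pi_tprod]
  refine Eq.trans ?_ (PiTensorProduct.tprod_mul_tprod _ _).symm
  congr 1
  funext j'
  rw [Pi.mul_apply]
  by_cases hj : j' = j
  · subst hj
    rw [Pi.mulSingle_eq_same, Pi.mulSingle_eq_same, Pi.one_apply]
    exact ((φ j').e_mul_map x).symm
  · rw [Pi.mulSingle_eq_of_ne hj, Pi.mulSingle_eq_of_ne hj, mul_one, Pi.one_apply]

theorem block_eSum {κ : I →₀ ℕ} {ν : Fin l → I →₀ ℕ} (h : ∑ j, ν j = κ) (j : Fin l)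
    (P : Seq (ν j) → Prop) : block D h j (eSum D P) =
      eSum D fun f => ∃ hf : IsConcat h f, P ⟨fun p => f (pos h j p), hf j⟩ := by
  classical
  rw [eSum, map_sum]
  simp only [block_e]
  refine eq_of_mul_e D fun f => ?_
  rw [eSum_mul_e, Finset.sum_mul]
  simp only [eSum_mul_e]
  by_cases hf : IsConcat h f
  · let g : Seq (ν j) := ⟨fun p => f (pos h j p), hf j⟩
    have h1 : ∀ g' : Seq (ν j), HasBlock h j g' f ↔ g' = g := fun g' =>
      ⟨fun hg => Seq.ext fun p => (hg.2 p).symm, fun hg => ⟨hf, fun p => by rw [hg]⟩⟩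
    simp only [h1, Finset.sum_ite_eq', Finset.mem_filter, Finset.mem_univ, true_and]
    exact if_congr ⟨fun hg => ⟨hf, hg⟩, fun hg => hg.2⟩ rfl rfl
  · rw [if_neg fun hg => hf hg.1]
    exact Finset.sum_eq_zero fun g _ => if_neg fun hg => hf hg.1

theorem nmap_one : nmap h h' 1 = eSum D (Nested h h') := by
  classical
  rw [nmap, LinearMap.comp_apply, PiTensorProduct.one_def, FoldedHom.pi_tprod]
  refine (concat_tprod h _).trans ?_
  have h1 : ∀ j, block D (ν := fun j => (M j : I →₀ ℕ)) (sum_coe h) j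
      ((concat (N j) (M j) (h' j)).toLin 1) =
      eSum D fun f => ∃ hf : IsConcat (sum_coe h) f,
        IsConcat (sum_coe (h' j)) ⟨fun p => f (pos (sum_coe h) j p), hf j⟩ := fun j => by
    rw [← block_eSum]
    exact congrArg _ (concat_one (h' j))
  refine (congrArg (fun z => eSum D (IsConcat (sum_coe h)) * (List.ofFn z).prod)
    (funext h1)).trans ?_
  refine eq_of_mul_e D fun f => ?_
  rw [mul_assoc, list_prod_eSum_mul_e, eSum_mul_e]
  by_cases hf : Nested h h' f
  · have hc := Nested.isConcat h h' hf
    rw [if_pos hf, if_pos fun j => ⟨hc, fun i => hf j i⟩, eSum_mul_e, if_pos hc]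
  · rw [if_neg hf]
    split_ifs with hg
    · exact absurd (fun j i => (hg j).2 i) hf
    · rw [mul_zero]

theorem nmap_nsingle (j : Fin l) (i : Fin m) (x : KLR D (N j i : I →₀ ℕ)) :
    nmap h h' (nsingle N j i x) = eSum D (Nested h h') *
      block D (ν := fun j => (M j : I →₀ ℕ)) (sum_coe h) j
        (block D (ν := fun i => (N j i : I →₀ ℕ)) (sum_coe (h' j)) i x) := by
  rw [nmap, LinearMap.comp_apply, nsingle, pi_single, cmap_mul, concat_single]
  refine congrArg₂ (· * ·) (nmap_one h h') ?_
  exact congrArg (block D (ν := fun j => (M j : I →₀ ℕ)) (sum_coe h) j) (concat_single (h' j) i x)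

theorem nested_mul_block (j : Fin l) :
    (eSum D (Nested h h') * block D (ν := fun j => (M j : I →₀ ℕ)) (sum_coe h) j
      (eSum D (IsConcat (sum_coe (h' j)))) : KLR D (κ : I →₀ ℕ)) = eSum D (Nested h h') := by
  rw [block_eSum, eSum_mul_of_imp]
  exact fun f hf => ⟨Nested.isConcat h h' hf, fun i => hf j i⟩

theorem nested_mul_concat :
    (eSum D (Nested h h') * eSum D (IsConcat (sum_coe h)) : KLR D (κ : I →₀ ℕ)) =
      eSum D (Nested h h') := eSum_mul_of_imp fun _ hf => Nested.isConcat h h' hf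

theorem nmap_tl (j : Fin l) (i : Fin m) (x : Letter (N j i : I →₀ ℕ).degree) :
    nmap h h' (nsingle N j i (tl D x)) =
      eSum D (Nested h h') * tl D (nletter h h' j i x) := by
  rw [nmap_nsingle]
  have h1 : block D (ν := fun i => (N j i : I →₀ ℕ)) (sum_coe (h' j)) i (tl D x) =
      eSum D (IsConcat (sum_coe (h' j))) * tl D (posLetter (sum_coe (h' j)) i x) :=
    block_tau _ _ _ _ _
  have h2 : block D (ν := fun j => (M j : I →₀ ℕ)) (sum_coe h) j
      (tl D (posLetter (ν := fun i => (N j i : I →₀ ℕ)) (sum_coe (h' j)) i x)) =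
      eSum D (IsConcat (sum_coe h)) * tl D (nletter h h' j i x) :=
    block_tau _ _ _ _ _
  rw [h1, block_mul, ← mul_assoc, nested_mul_block, h2, ← mul_assoc, nested_mul_concat]

theorem nmap_y (j : Fin l) (i : Fin m) (p : Fin (N j i : I →₀ ℕ).degree) :
    nmap h h' (nsingle N j i (y D p)) = eSum D (Nested h h') * y D (npos h h' j i p) := by
  rw [nmap_nsingle, block_y, block_mul, ← mul_assoc, nested_mul_block, block_y, ← mul_assoc,
    nested_mul_concat]
  rfl

theorem nmap_e (j : Fin l) (i : Fin m) (g : Seq (N j i : I →₀ ℕ)) :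
    nmap h h' (nsingle N j i (e D g)) =
      eSum D (Nested h h') * eSum D fun f => ∀ p, f (npos h h' j i p) = g p := by
  classical
  rw [nmap_nsingle, block_e, block_eSum]
  refine eq_of_mul_e D fun f => ?_
  rw [mul_assoc, mul_assoc, eSum_mul_e, eSum_mul_e]
  by_cases hf : Nested h h' f
  · have hc := Nested.isConcat h h' hf
    exact congrArg _ (if_congr ⟨fun hg => hg.2.2, fun hg => ⟨hc, fun i => hf j i, hg⟩⟩ rfl rfl)
  · have h0 : eSum D (Nested h h') * e D f = 0 := by rw [eSum_mul_e, if_neg hf]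
    split_ifs <;> simp [h0]

theorem nested_induction {p : (FoldedAlg.pi fun j => FoldedAlg.pi fun i => D.R (N j i)).carrier → Prop}
    (hk : ∀ c : k, p (c • 1)) (hadd : ∀ x y, p x → p y → p (x + y))
    (hmul : ∀ x y, p x → p y → p (x * y))
    (he : ∀ j i f, p (nsingle N j i (e D f))) (hy : ∀ j i q, p (nsingle N j i (y D q)))
    (ht : ∀ j i x, p (nsingle N j i (tl D x))) (x) : p x := by
  have key : ∀ j i (x : KLR D (N j i : I →₀ ℕ)), p (nsingle N j i x) := by
    intro j i x
    induction x using KLR.induction with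
    | he f => exact he j i f
    | hy q => exact hy j i q
    | htau a b hab => exact ht j i ⟨(a, b), hab⟩
    | hadd x y hx hy =>
      have : nsingle N j i (x + y) = nsingle N j i x + nsingle N j i y := by
        rw [nsingle]
        exact (congrArg _ (map_add _ x y)).trans (map_add _ _ _)
      rw [this]
      exact hadd _ _ hx hy
    | hmul x y hx hy =>
      have : nsingle N j i (x * y) = nsingle N j i x * nsingle N j i y := by
        rw [nsingle]
        exact (congrArg _ (FoldedHom.map_mul (FoldedHom.single (fun i => D.R (N j i)) i) x y)).trans
          (FoldedHom.map_mul _ _ _)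
      rw [this]
      exact hmul _ _ hx hy
    | hk c =>
      have : nsingle N j i (algebraMap k (KLR D (N j i : I →₀ ℕ)) c) = c • 1 := by
        rw [Algebra.algebraMap_eq_smul_one, nsingle]
        have h1 : (FoldedHom.single (fun i => D.R (N j i)) i).toLin (c • 1 : (D.R (N j i)).carrier)
            = c • 1 := by
          rw [map_smul]
          exact congrArg (c • ·) (map_one (PiTensorProduct.singleAlgHom (R := k)
            (A := fun i => (D.R (N j i)).carrier) i))
        refine (congrArg _ h1).trans ?_
        rw [map_smul]
        exact congrArg (c • ·) (map_one (PiTensorProduct.singleAlgHom (R := k)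
          (A := fun j => (FoldedAlg.pi fun i => D.R (N j i)).carrier) j))
      rw [this]
      exact hk c
  have hone : p 1 := by simpa using hk 1
  have hlist : ∀ L : List (FoldedAlg.pi fun j => FoldedAlg.pi fun i => D.R (N j i)).carrier,
      (∀ z ∈ L, p z) → p L.prod := by
    intro L hL
    induction L with
    | nil => exact hone
    | cons z L ih =>
      rw [List.prod_cons]
      exact hmul _ _ (hL z List.mem_cons_self) (ih fun w hw => hL w (List.mem_cons_of_mem _ hw))
  have hzero : p 0 := by simpa using hk 0
  have hsmul : ∀ (c : k) x, p x → p (c • x) := fun c x hx => by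
    have := hmul _ _ (hk c) hx
    rwa [smul_mul_assoc, one_mul] at this
  have hsingle : ∀ j (x : (FoldedAlg.pi fun i => D.R (N j i)).carrier),
      p ((FoldedHom.single (fun j => FoldedAlg.pi fun i => D.R (N j i)) j).toLin x) := by
    intro j x
    induction x using PiTensorProduct.induction_on with
    | smul_tprod c x =>
      rw [map_smul]
      refine hsmul _ _ ?_
      rw [← list_prod_single]
      have h1 := map_list_prod (PiTensorProduct.singleAlgHom (R := k)
        (A := fun j => (FoldedAlg.pi fun i => D.R (N j i)).carrier) j)
        (List.ofFn fun i => (FoldedHom.single (fun i => D.R (N j i)) i).toLin (x i))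
      refine h1.symm ▸ hlist _ ?_
      intro z hz
      rw [List.map_ofFn, List.mem_ofFn'] at hz
      obtain ⟨i, rfl⟩ := hz
      exact key j i (x i)
    | add x y hx hy => rw [map_add]; exact hadd _ _ hx hy
  induction x using PiTensorProduct.induction_on with
  | smul_tprod c x =>
    refine hsmul _ _ ?_
    rw [← list_prod_single]
    refine hlist _ ?_
    intro z hz
    rw [List.mem_ofFn'] at hz
    obtain ⟨j, rfl⟩ := hz
    exact hsingle j (x j)
  | add x y hx hy => exact hadd _ _ hx hy

theorem swap_one {r l n : ℕ} (B : Fin r → Fin l → FoldedAlg k n) :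
    (FoldedHom.swap B).toLin 1 = 1 := by
  have := FoldedHom.swap_tprod B fun _ _ => 1
  exact this

theorem swap_nsingle {r l : ℕ} (N : Fin r → Fin l → D.NJ) (j : Fin l) (i : Fin r)
    (x : KLR D (N i j : I →₀ ℕ)) :
    (FoldedHom.swap fun i j => D.R (N i j)).toLin (nsingle (fun j i => N i j) j i x) =
      nsingle N i j x := by
  let X : ∀ i' j', (D.R (N i' j')).carrier := fun i' j' =>
    (Pi.mulSingle j (Pi.mulSingle i x : ∀ i', (D.R (N i' j)).carrier) :
      ∀ j' i', (D.R (N i' j')).carrier) j' i'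
  have h1 : (nsingle (fun j i => N i j) j i x) = PiTensorProduct.tprod k fun j' =>
      (PiTensorProduct.tprod k fun i' => X i' j' : (FoldedAlg.pi fun i' => D.R (N i' j')).carrier) := by
    rw [nsingle, FoldedHom.single_apply]
    congr 1
    funext j'
    by_cases hj : j' = j
    · subst hj
      rw [Pi.mulSingle_eq_same]
      refine (FoldedHom.single_apply (fun i => D.R (N i j')) i x).trans ?_
      congr 1
      funext i'
      simp only [X, Pi.mulSingle_eq_same]
    · rw [Pi.mulSingle_eq_of_ne hj, PiTensorProduct.one_def]
      congr 1
      funext i'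
      simp only [X, Pi.mulSingle_eq_of_ne hj]
  have h2 : (nsingle N i j x) = PiTensorProduct.tprod k fun i' =>
      (PiTensorProduct.tprod k fun j' => X i' j' : (FoldedAlg.pi fun j' => D.R (N i' j')).carrier) := by
    rw [nsingle, FoldedHom.single_apply]
    congr 1
    funext i'
    by_cases hi : i' = i
    · subst hi
      rw [Pi.mulSingle_eq_same]
      refine (FoldedHom.single_apply (fun j => D.R (N i' j)) j x).trans ?_
      congr 1
      funext j'
      by_cases hj : j' = j
      · subst hj
        simp only [X, Pi.mulSingle_eq_same]
        exact (Pi.mulSingle_eq_same (M := fun j => (D.R (N i' j)).carrier) j' x).trans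
          (Pi.mulSingle_eq_same (M := fun i => (D.R (N i j')).carrier) i' x).symm
      · simp only [X, Pi.mulSingle_eq_of_ne hj, Pi.one_apply]
        exact Pi.mulSingle_eq_of_ne (M := fun j => (D.R (N i' j)).carrier) hj x
    · rw [Pi.mulSingle_eq_of_ne hi, PiTensorProduct.one_def]
      congr 1
      funext j'
      by_cases hj : j' = j
      · subst hj
        simp only [X, Pi.mulSingle_eq_same]
        exact (Pi.mulSingle_eq_of_ne (M := fun i' => (D.R (N i' j')).carrier) hi x).symm
      · simp only [X, Pi.mulSingle_eq_of_ne hj, Pi.one_apply]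
  rw [h1, h2]
  exact FoldedHom.swap_tprod (fun i j => D.R (N i j)) X

/-- Words inside the iterated blocks lie in the image of the iterated tensor product. -/
theorem exists_nmap {ω : List (Letter (κ : I →₀ ℕ).degree)}
    (hω : ∀ x ∈ ω, ∃ j i x', nletter h h' j i x' = x) {f : KLR D (κ : I →₀ ℕ)}
    (hf : f ∈ polySub D (κ : I →₀ ℕ)) : ∃ z, nmap h h' z = tw D ω * f * eSum D (Nested h h') := by
  classical
  have hG := eSum_mul_self (D := D) (Nested h h')
  induction ω with
  | nil =>
    rw [tw_nil, one_mul]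
    induction hf using Algebra.adjoin_induction with
    | mem x hx =>
      rcases hx with ⟨q, rfl⟩ | ⟨f, rfl⟩
      · obtain ⟨q', hq⟩ := exists_pos (ν := fun j => (M j : I →₀ ℕ)) (sum_coe h) q
        obtain ⟨p, hp⟩ := exists_pos (ν := fun i => (N (blk (sum_coe h) q) i : I →₀ ℕ))
          (sum_coe (h' (blk (sum_coe h) q))) q'
        refine ⟨nsingle N _ _ (y D p), ?_⟩
        rw [nmap_y, (y_commute_eSum _ _).eq, npos, hp, hq]
      · rw [(commute_e_of_mem (eSum_mem_polySub _) f).symm.eq, eSum_mul_e]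
        by_cases hg : Nested h h' f
        · rw [if_pos hg]
          have hc := Nested.isConcat h h' hg
          let g : ∀ j, Seq (M j : I →₀ ℕ) := fun j => ⟨fun p => f (pos (sum_coe h) j p), hc j⟩
          have hgc : ∀ j, IsConcat (sum_coe (h' j)) (g j) := fun j i => hg j i
          let g' : ∀ j i, Seq (N j i : I →₀ ℕ) := fun j i =>
            ⟨fun p => g j (pos (sum_coe (h' j)) i p), hgc j i⟩
          refine ⟨PiTensorProduct.tprod k fun j => (PiTensorProduct.tprod k fun i =>
            (e D (g' j i) : KLR D (N j i : I →₀ ℕ)) :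
              (FoldedAlg.pi fun i => D.R (N j i)).carrier), ?_⟩
          rw [nmap, LinearMap.comp_apply, FoldedHom.pi_tprod]
          have h1 : ∀ j, (concat (N j) (M j) (h' j)).toLin (PiTensorProduct.tprod k fun i =>
              (e D (g' j i) : KLR D (N j i : I →₀ ℕ))) = (e D (g j) : KLR D (M j : I →₀ ℕ)) := by
            intro j
            refine (concat_tprod_e (h' j) (g' j)).trans ?_
            rw [← eq_catSeq (sum_coe (h' j)) (hgc j)]
          refine (congrArg (fun z => cmap h (PiTensorProduct.tprod k z)) (funext h1)).trans ?_
          refine (concat_tprod_e h g).trans ?_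
          rw [← eq_catSeq (sum_coe h) hc]
        · exact ⟨0, by rw [if_neg hg, map_zero]⟩
    | algebraMap c =>
      refine ⟨c • 1, ?_⟩
      rw [map_smul, nmap_one, Algebra.algebraMap_eq_smul_one, smul_mul_assoc, one_mul]
    | add x y _ _ hx hy =>
      obtain ⟨z, hz⟩ := hx
      obtain ⟨z', hz'⟩ := hy
      exact ⟨z + z', by rw [map_add, hz, hz', add_mul]⟩
    | mul x y _ hym hx hy =>
      obtain ⟨z, hz⟩ := hx
      obtain ⟨z', hz'⟩ := hy
      refine ⟨z * z', ?_⟩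
      have hc := (eSum_commute_poly (Nested h h') hym).eq
      rw [nmap_mul, hz, hz', mul_assoc, ← mul_assoc _ y, hc, mul_assoc y, hG, mul_assoc]
  | cons x ω ih =>
    obtain ⟨z, hz⟩ := ih fun y hy => hω y (List.mem_cons_of_mem _ hy)
    obtain ⟨j, i, x', hx⟩ := hω x List.mem_cons_self
    refine ⟨nsingle N j i (tl D x') * z, ?_⟩
    have hcomm : ∀ ω : List (Letter (κ : I →₀ ℕ).degree),
        (∀ x ∈ ω, ∃ j i x', nletter h h' j i x' = x) →
        Commute (eSum D (Nested h h')) (tw D ω) := by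
      intro ω hω
      induction ω with
      | nil => exact Commute.one_right _
      | cons x ω ih =>
        rw [tw_cons]
        obtain ⟨j, i, x', rfl⟩ := hω x List.mem_cons_self
        exact (tl_commute_nested h h' j i x').mul_right
          (ih fun y hy => hω y (List.mem_cons_of_mem _ hy))
    have c1 := (hcomm _ hω).eq
    have c2 := (eSum_commute_poly (Nested h h') hf).eq
    rw [nmap_mul, hz, nmap_tl, hx]
    rw [tw_cons] at c1 ⊢
    calc _ = eSum D (Nested h h') * (tl D x * tw D ω) * f * eSum D (Nested h h') := by
          simp only [mul_assoc]
      _ = tl D x * tw D ω * (eSum D (Nested h h') * f) * eSum D (Nested h h') := by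
          rw [c1]; simp only [mul_assoc]
      _ = tl D x * tw D ω * f * (eSum D (Nested h h') * eSum D (Nested h h')) := by
          rw [c2]; simp only [mul_assoc]
      _ = _ := by rw [hG]

end FoldingDatum

namespace FoldingDatum

open KLR

variable {k : Type u} [Field k] [Infinite k] {I : Type u} {D : FoldingDatum k I} {r s : ℕ}
  {lam : Fin r → D.NJ} {mu : Fin s → D.NJ} {κ : D.NJ} (hlam : ∑ c, lam c = κ)
  (hmu : ∑ d, mu d = κ) {ν : Fin r → Fin s → D.NJ} (hr : ∀ c, ∑ d, ν c d = lam c)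
  (hc : ∀ d, ∑ c, ν c d = mu d)

/-- The matrix of weights of a matrix of fixed weights. -/
def toMat : CMat lam mu :=
  ⟨fun c d => (ν c d : I →₀ ℕ), fun c => sum_coe (hr c), fun d => sum_coe (hc d)⟩

theorem nested_iff_act {i : Seq (κ : I →₀ ℕ)} : (toMat hr hc).Fits (sum_coe hlam) i ↔
    Nested hmu (N := fun d c => ν c d) hc (i.act (mw hlam hmu (toMat hr hc))) := by
  rw [Mat.fits_iff_act (sum_coe hlam) (sum_coe hmu)]
  exact forall_comm

theorem tw_mul_eSum_fits : tw D (rw1 (mw hlam hmu (toMat hr hc))) *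
    eSum D ((toMat hr hc).Fits (sum_coe hlam)) =
      eSum D (Nested hmu (N := fun d c => ν c d) hc) * tw D (rw1 (mw hlam hmu (toMat hr hc))) :=
  tw_mul_eSum _ fun i => by
    rw [wordPerm_rw1]
    exact nested_iff_act hlam hmu hr hc

theorem nested_mul_mt : eSum D (Nested hmu (N := fun d c => ν c d) hc) *
    mt hlam hmu (toMat hr hc) = mt hlam hmu (toMat hr hc) := by
  rw [mt, tw_mul_eSum_fits, ← mul_assoc, eSum_mul_self]

theorem agree_nested {y y' : KLR D (κ : I →₀ ℕ)}
    (hy : Commute (eSum D (Nested hmu (N := fun d c => ν c d) hc)) y)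
    (hy' : Commute (eSum D ((toMat hr hc).Fits (sum_coe hlam))) y')
    (h : y * tw D (rw1 (mw hlam hmu (toMat hr hc))) - tw D (rw1 (mw hlam hmu (toMat hr hc))) * y' ∈
      low D (fun _ => (0 : Fin 1)) (rk hlam hmu (toMat hr hc))) :
    Agree (hlam := hlam) (hmu := hmu) (toMat hr hc)
      (eSum D (Nested hmu (N := fun d c => ν c d) hc) * y)
      (eSum D ((toMat hr hc).Fits (sum_coe hlam)) * y') := by
  have e1 := eSum_mul_self (D := D) (Nested hmu (N := fun d c => ν c d) hc)
  have e2 := eSum_mul_self (D := D) ((toMat hr hc).Fits (sum_coe hlam))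
  have c1 : (eSum D (IsConcat (sum_coe hmu)) * eSum D (Nested hmu (N := fun d c => ν c d) hc) :
      KLR D (κ : I →₀ ℕ)) = _ :=
    eSum_mul_of_imp' fun i hi => Nested.isConcat hmu hc hi
  have c2 : (eSum D ((toMat hr hc).Fits (sum_coe hlam)) * eSum D (IsConcat (sum_coe hlam)) :
      KLR D (κ : I →₀ ℕ)) = _ :=
    eSum_mul_of_imp fun i hi => Nested.isConcat hlam hr hi
  have h1 := agree_of_sub_mem (hlam := hlam) (hmu := hmu) (ν := toMat hr hc)
    (y := eSum D (Nested hmu (N := fun d c => ν c d) hc) * y)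
    (y' := y' * eSum D ((toMat hr hc).Fits (sum_coe hlam))) (hy'.mul_right (Commute.refl _)) (by
      have h2 := low_mul_poly h (eSum_mem_polySub ((toMat hr hc).Fits (sum_coe hlam)))
      convert h2 using 1
      rw [sub_mul, hy.eq, mul_assoc y, ← tw_mul_eSum_fits, mul_assoc, mul_assoc])
  rwa [← mul_assoc, c1, mul_assoc, c2, ← hy'.eq] at h1

theorem Agree.add {ν : CMat lam mu} {x x' y y' : KLR D (κ : I →₀ ℕ)}
    (h1 : Agree (hlam := hlam) (hmu := hmu) ν x x')
    (h2 : Agree (hlam := hlam) (hmu := hmu) ν y y') :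
    Agree (hlam := hlam) (hmu := hmu) ν (x + y) (x' + y') := by
  have h3 := add_mem h1 h2
  rw [Agree]
  convert h3 using 1
  noncomm_ring

theorem agree_nmap (F : Factorization D)
    (z : (FoldedAlg.pi fun d => FoldedAlg.pi fun c => D.R (ν c d)).carrier) :
    Agree (hlam := hlam) (hmu := hmu) (toMat hr hc) (nmap hmu hc z)
      (nmap hlam hr ((FoldedHom.swap fun c d => D.R (ν c d)).toLin z)) := by
  have hlen : ((rw1 (mw hlam hmu (toMat hr hc))).length : ℤ) = rk hlam hmu (toMat hr hc) := by
    rw [rw1_red, wordPerm_rw1]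
    rfl
  have hN : eSum D (Nested hlam hr) = eSum D ((toMat hr hc).Fits (sum_coe hlam)) := rfl
  have hpos : ∀ d c p, wordPerm (rw1 (mw hlam hmu (toMat hr hc))) (npos hlam hr c d p) =
      npos hmu (N := fun d c => ν c d) hc d c p := fun d c p => by
    rw [wordPerm_rw1]
    exact (toMat hr hc).w_spos (sum_coe hlam) (sum_coe hmu) c d p
  induction z using nested_induction with
  | hk a =>
    rw [map_smul, map_smul, map_smul, swap_one, nmap_one, nmap_one, hN, Agree, smul_mul_assoc,
      mul_smul_comm, nested_mul_mt, mt, mul_assoc, eSum_mul_self, sub_self]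
    exact zero_mem _
  | hadd x y hx hy =>
    rw [map_add, map_add, map_add]
    exact Agree.add hlam hmu hx hy
  | hmul x y hx hy =>
    rw [nmap_mul, FoldedHom.map_mul, nmap_mul]
    exact Agree.mul (isLeftStable F _) hx hy
  | he d c f =>
    rw [swap_nsingle, nmap_e, nmap_e, hN]
    refine agree_nested hlam hmu hr hc (eSum_commute _ _) (eSum_commute _ _) ?_
    rw [tw_mul_eSum (D := D) (rw1 (mw hlam hmu (toMat hr hc)))
      (P' := fun g => ∀ p, g (npos hmu (N := fun d c => ν c d) hc d c p) = f p) fun g => by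
        refine forall_congr' fun p => ?_
        rw [Seq.act_apply, ← hpos]
        simp, sub_self]
    exact zero_mem _
  | hy d c p =>
    rw [swap_nsingle, nmap_y, nmap_y, hN]
    refine agree_nested hlam hmu hr hc (y_commute_eSum _ _).symm (y_commute_eSum _ _).symm ?_
    have h1 := y_tw_sub_mem (D := D) (β := fun _ => (0 : Fin 1)) (ω := rw1 (mw hlam hmu (toMat hr hc)))
      (fun _ _ => rfl) (npos hlam hr c d p)
    rwa [hpos, hlen] at h1
  | ht d c x =>
    rw [swap_nsingle, nmap_tl, nmap_tl, hN]
    refine agree_nested hlam hmu hr hc (tl_commute_nested hmu hc d c x)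
      (tl_commute_nested hlam hr c d x) ?_
    have h1 := tl_tw_sub_mem (D := D) (rw1_red (mw hlam hmu (toMat hr hc)))
      (x := nletter hmu (N := fun d c => ν c d) hc d c x) (y := nletter hlam hr c d x)
      (hpos d c x.1.1) (hpos d c x.1.2)
    rwa [hlen] at h1

theorem exists_nletter {x : Letter (κ : I →₀ ℕ).degree}
    (hx : tgt (blk (sum_coe hlam)) (blk (sum_coe hmu)) (mw hlam hmu (toMat hr hc)) x.1.1 =
      tgt (blk (sum_coe hlam)) (blk (sum_coe hmu)) (mw hlam hmu (toMat hr hc)) x.1.2) :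
    ∃ d c x', nletter hmu (N := fun d c => ν c d) hc d c x' = x := by
  obtain ⟨h1, h2⟩ := tgt_eq_iff.1 hx
  obtain ⟨d, x', rfl⟩ := exists_posLetter (sum_coe hmu) h1
  have h3 : ∀ p, blk (sum_coe hlam) ((mw hlam hmu (toMat hr hc))⁻¹ (pos (sum_coe hmu) d p)) =
      blk (ν := fun c => (ν c d : I →₀ ℕ)) (sum_coe (hc d)) p := fun p => by
    obtain ⟨q, hq⟩ := exists_pos (ν := fun c => (ν c d : I →₀ ℕ)) (sum_coe (hc d)) p
    have h4 := (toMat hr hc).w_inv_tpos (sum_coe hlam) (sum_coe hmu) _ d q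
    have h5 : (toMat hr hc).tpos (sum_coe hmu) _ d q = pos (sum_coe hmu) d p :=
      congrArg (pos (sum_coe hmu) d) hq
    rw [h5] at h4
    refine (congrArg (blk (sum_coe hlam)) h4).trans ?_
    exact Mat.blk_spos _ _ _ _ _
  have h6 : blk (ν := fun c => (ν c d : I →₀ ℕ)) (sum_coe (hc d)) x'.1.1 =
      blk (ν := fun c => (ν c d : I →₀ ℕ)) (sum_coe (hc d)) x'.1.2 := by
    rw [← h3, ← h3]
    exact h2
  obtain ⟨c, x'', rfl⟩ := exists_posLetter (ν := fun c => (ν c d : I →₀ ℕ)) (sum_coe (hc d)) h6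
  exact ⟨d, c, x'', rfl⟩

theorem exists_sum_nmap (F : Factorization D) (b : (FoldedAlg.pi fun d => D.R (mu d)).carrier) :
    ∃ z : Coset hlam hmu → (FoldedAlg.pi fun d => FoldedAlg.pi fun c => D.R (ν c d)).carrier,
      cmap hmu b * eSum D (Nested hmu (N := fun d c => ν c d) hc) =
        ∑ q : Coset hlam hmu, cmap hmu q.b * nmap hmu hc (z q) ∧
      ∀ q, z q ≠ 0 → q.1.1 = toMat hr hc := by
  classical
  let W : Submodule k (KLR D (κ : I →₀ ℕ)) :=
    { carrier := {y | ∃ z : Coset hlam hmu →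
          (FoldedAlg.pi fun d => FoldedAlg.pi fun c => D.R (ν c d)).carrier,
        y = ∑ q : Coset hlam hmu, cmap hmu q.b * nmap hmu hc (z q) ∧
        ∀ q, z q ≠ 0 → q.1.1 = toMat hr hc}
      zero_mem' := ⟨0, by simp, fun q h => absurd rfl h⟩
      add_mem' := by
        rintro _ _ ⟨x, rfl, hx⟩ ⟨y, rfl, hy⟩
        refine ⟨x + y, ?_, fun q hq => ?_⟩
        · rw [← Finset.sum_add_distrib]
          exact Finset.sum_congr rfl fun q _ => by rw [Pi.add_apply, map_add, mul_add]
        · by_contra h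
          refine hq ?_
          rw [Pi.add_apply, not_not.1 fun h' => h (hx q h'), not_not.1 fun h' => h (hy q h'),
            add_zero]
      smul_mem' := by
        rintro a _ ⟨x, rfl, hx⟩
        refine ⟨a • x, ?_, fun q hq => hx q fun h => hq (by rw [Pi.smul_apply, h, smul_zero])⟩
        rw [Finset.smul_sum]
        exact Finset.sum_congr rfl fun q _ => by rw [Pi.smul_apply, map_smul, mul_smul_comm] }
  obtain ⟨m, hm⟩ := exists_cmap_mem_low hmu F b
  have hβ' := monotone_blk (sum_coe hmu)
  have hβ := monotone_blk (sum_coe hlam)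
  have hz := mw_short hlam hmu (toMat hr hc)
  have hτ := monotone_tgt hβ hβ' hz.right
  let T : KLR D (κ : I →₀ ℕ) →ₗ[k] KLR D (κ : I →₀ ℕ) :=
    LinearMap.mulLeft k (eSum D (IsConcat (sum_coe hmu))) ∘ₗ
      LinearMap.mulRight k (eSum D (Nested hmu (N := fun d c => ν c d) hc))
  have key : low D (blk (sum_coe hmu)) m ≤ W.comap T := by
    refine low_le hβ' _ m m le_rfl fun w hw _ i => ?_
    obtain ⟨u, v, rfl, hv, hu⟩ := exists_mono_mul hτ w
    have hv2 : ∀ a, blk (sum_coe hmu) (v a) = blk (sum_coe hmu) a :=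
      fun a => (tgt_eq_iff.1 (hv a)).1
    have hu2 : ∀ a, blk (sum_coe hmu) (u a) = blk (sum_coe hmu) a := fun a => by
      have h1 := hw (v⁻¹ a)
      rw [Equiv.Perm.mul_apply, apply_inv hv2, show v (v⁻¹ a) = a from v.apply_symm_apply a] at h1
      exact h1
    have hb1 := redWord_block hβ' u hu2
    have hb2 := redWord_block hτ v hv
    refine ⟨redWord hβ' u hu2 ++ redWord hτ v hv, isBlockWord_append.2 ⟨hb1, fun x hx =>
      (tgt_eq_iff.1 (hb2 x hx)).1⟩, ?_, ?_, fun f hf => ?_⟩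
    · rw [IsRed, List.length_append, wordPerm_append, redWord_red, redWord_red, wordPerm_redWord,
        wordPerm_redWord, inv_mul_of_mono hτ hu hv]
    · rw [wordPerm_append, wordPerm_redWord, wordPerm_redWord]
    obtain ⟨z, hz⟩ := exists_nmap hmu hc (fun x hx => exists_nletter hlam hmu hr hc (hb2 x hx))
      (mul_mem hf (e_mem_polySub i))
    let q : Coset hlam hmu := ⟨(toMat hr hc, u), hu2, hu⟩
    have h2 : (cmap hmu q.b : KLR D (κ : I →₀ ℕ)) = tw D (redWord hβ' u hu2) *
      eSum D (IsConcat (sum_coe hmu)) := q.cmap_b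
    refine ⟨Pi.single q z, ?_, fun q' hq' => ?_⟩
    · rw [Finset.sum_eq_single q, Pi.single_eq_same]
      · rw [h2, hz]
        have c1 := (eSum_concat_commute_tw (D := D) (sum_coe hmu) hb1).eq
        change eSum D _ * (tw D (_ ++ _) * f * e D i * eSum D _) = _
        rw [tw_append]
        calc _ = (eSum D (IsConcat (sum_coe hmu)) * tw D (redWord hβ' u hu2)) *
              (tw D (redWord hτ v hv) * (f * e D i) *
                eSum D (Nested hmu (N := fun d c => ν c d) hc)) := by simp only [mul_assoc]
          _ = _ := by rw [c1]
      · intro q' _ h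
        rw [Pi.single_eq_of_ne h, map_zero, mul_zero]
      · exact fun h => absurd (Finset.mem_univ _) h
    · by_cases h : q' = q
      · rw [h]
      · exact absurd (Pi.single_eq_of_ne h _) hq'
  have h1 : eSum D (IsConcat (sum_coe hmu)) * (cmap hmu b *
    eSum D (Nested hmu (N := fun d c => ν c d) hc)) ∈ W := key hm
  rwa [← mul_assoc, concat_mul_cmap] at h1

/-- The subquotient attached to a fixed matrix. -/
theorem mackeyStrat_gra_iso (F : Factorization D) (g : CMat lam mu → ℕ)
    (g_α : ∀ ν, g ((αMat lam mu).symm ν) = g ν)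
    (g_eq : ∀ ν ν', g ν = g ν' → ∃ j : ℕ, (αMat lam mu).symm^[j] ν' = ν)
    (g_rk : ∀ ν ν', rk hlam hmu ν < rk hlam hmu ν' → g ν < g ν') :
    Nonempty ((mackeyStrat F hlam hmu g g_α g_eq g_rk).toStrat.gra (g (toMat hr hc)) ≅
      mackeyFunctor ν hr hc ⋙ FMod.shift _ ((toMat hr hc).deg D)) := by
  refine Strat.gra_iso (mackeyStrat F hlam hmu g g_α g_eq g_rk).toStrat
    (FoldedHom.pi fun c => concat (ν c) (lam c) (hr c)) (FoldedHom.swap fun c d => D.R (ν c d))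
    (FoldedHom.pi fun d => concat (fun c => ν c d) (mu d) (hc d)) (ν := toMat hr hc) ?_ ?_ ?_ ?_
  · exact αMat_symm_eq_iff.2 fun c d => (ν c d).2
  · refine concat_injective hlam F ?_
    refine Eq.trans ?_ (cmap_mε (hlam := hlam) (toMat hr hc)).symm
    rw [FoldedHom.e, swap_one]
    exact nmap_one hlam hr
  · intro x M m
    refine RingStrat.sub_mem_fil _ ?_ m
    obtain ⟨y, hy, hy'⟩ := exists_of_mem_strata (agree_nmap hlam hmu hr hc F x)
    exact ⟨y, hy, fun q hq => g_rk _ _ (hy' q hq)⟩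
  · intro b
    obtain ⟨z, hz, hz'⟩ := exists_sum_nmap hlam hmu hr hc F b
    refine ⟨z, concat_injective hmu F ?_, hz'⟩
    rw [cmap_mul]
    refine Eq.trans (congrArg (cmap hmu b * ·) (nmap_one hmu hc)) (hz.trans ?_)
    rw [map_sum]
    refine Finset.sum_congr rfl fun q _ => ?_
    rw [cmap_mul]
    rfl

end FoldingDatum

section Scaling

variable {k : Type u} [Field k] {n : ℕ}

/-- The automorphism that rescales the variables of a polynomial ring. -/
def scPoly (c : Fin n → kˣ) : MvPolynomial (Fin n) k ≃ₐ[k] MvPolynomial (Fin n) k :=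
  AlgEquiv.ofAlgHom (MvPolynomial.aeval fun l => (c l : k) • MvPolynomial.X l)
    (MvPolynomial.aeval fun l => ((c l)⁻¹ : kˣ).1 • MvPolynomial.X l)
    (by ext1 l; simp [smul_smul]) (by ext1 l; simp [smul_smul])

theorem scPoly_X (c : Fin n → kˣ) (l : Fin n) :
    scPoly c (MvPolynomial.X l) = (c l : k) • MvPolynomial.X l := by
  simp [scPoly]

theorem coeff_scPoly (c : Fin n → kˣ) (f : MvPolynomial (Fin n) k) (m : Fin n →₀ ℕ) :
    (scPoly c f).coeff m = (∏ l, (c l : k) ^ m l) * f.coeff m := by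
  classical
  induction f using MvPolynomial.induction_on' with
  | monomial m' a =>
    have : scPoly c (MvPolynomial.monomial m' a) =
        MvPolynomial.monomial m' ((∏ l, (c l : k) ^ m' l) * a) := by
      rw [MvPolynomial.monomial_eq, Finsupp.prod_fintype _ _ (by simp), map_mul, map_prod]
      simp only [map_pow, scPoly_X, smul_pow]
      rw [← MvPolynomial.algebraMap_eq, AlgEquiv.commutes, Finset.prod_smul,
        MvPolynomial.monomial_eq, Finsupp.prod_fintype _ _ (by simp), MvPolynomial.algebraMap_eq,
        map_mul, MvPolynomial.smul_eq_C_mul]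
      ring
    rw [this, MvPolynomial.coeff_monomial, MvPolynomial.coeff_monomial]
    split_ifs with h
    · rw [h]
    · rw [mul_zero]
  | add f g hf hg => rw [map_add, MvPolynomial.coeff_add, hf, hg, MvPolynomial.coeff_add, mul_add]

/-- The automorphism that rescales the variables of a field of rational functions. -/
def sc (c : Fin n → kˣ) : Rat' k n ≃ₐ[k] Rat' k n :=
  IsFractionRing.algEquivOfAlgEquiv (scPoly c)

theorem sc_algebraMap (c : Fin n → kˣ) (f : MvPolynomial (Fin n) k) :
    sc c (algebraMap _ (Rat' k n) f) = algebraMap _ _ (scPoly c f) := by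
  simp [sc]

theorem smul_algebraMap (a : k) (f : MvPolynomial (Fin n) k) :
    algebraMap _ (Rat' k n) (a • f) = a • algebraMap _ (Rat' k n) f := by
  rw [Algebra.algebraMap_eq_smul_one, smul_assoc, ← Algebra.algebraMap_eq_smul_one]

theorem sc_xv (c : Fin n → kˣ) (l : Fin n) : sc c (xv (k := k) l) = (c l : k) • xv l := by
  rw [xv, sc_algebraMap, scPoly_X, smul_algebraMap]

theorem sc_pact (c : Fin n → kˣ) (w : Equiv.Perm (Fin n)) (f : Rat' k n) :
    sc c (pact w f) = pact w (sc (c ∘ w) f) := by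
  have h : ∀ f : MvPolynomial (Fin n) k,
      scPoly c (MvPolynomial.rename w f) = MvPolynomial.rename w (scPoly (c ∘ w) f) := by
    intro f
    have : (scPoly c).toAlgHom.comp (MvPolynomial.rename w) =
        (MvPolynomial.rename w).comp (scPoly (c ∘ w)).toAlgHom := by
      ext1 l
      simp [scPoly_X]
    exact congrArg (fun g => g f) this
  obtain ⟨x, y, -, rfl⟩ := IsFractionRing.div_surjective (MvPolynomial (Fin n) k) f
  simp only [map_div₀, pact_algebraMap, sc_algebraMap, h]

theorem sc_pv (c : Fin n → kˣ) (P : MvPolynomial (Fin 2) k) (a b : Rat' k n) :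
    sc c (pv P a b) = pv P (sc c a) (sc c b) := by
  have : sc c (pv P a b) = (sc c).toAlgHom (pv P a b) := rfl
  rw [this, pv, pv, MvPolynomial.aeval_def, ← AlgHom.coe_toRingHom, MvPolynomial.hom_eval₂]
  simp only [MvPolynomial.aeval_def]
  congr 1
  · ext; simp
  · funext i
    fin_cases i <;> rfl

theorem pv_smul {P : MvPolynomial (Fin 2) k} {w₀ w₁ m : ℤ}
    (hP : P.IsWeightedHomogeneous ![w₀, w₁] m) (z : kˣ) (a b : Rat' k n) :
    pv P (((z ^ w₀ : kˣ) : k) • a) (((z ^ w₁ : kˣ) : k) • b) = ((z ^ m : kˣ) : k) • pv P a b := by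
  simp only [pv, MvPolynomial.aeval_def, MvPolynomial.eval₂_eq', Finset.smul_sum]
  refine Finset.sum_congr rfl fun c hc => ?_
  have h := hP (MvPolynomial.mem_support_iff.1 hc)
  rw [Finsupp.weight_apply, Finsupp.sum_fintype _ _ (by simp)] at h
  simp only [Fin.sum_univ_two, Fin.prod_univ_two, Matrix.cons_val_zero, Matrix.cons_val_one,
    nsmul_eq_mul] at h ⊢
  have h2 : ((z ^ m : kˣ) : k) = ((z ^ w₀ : kˣ) : k) ^ c 0 * ((z ^ w₁ : kˣ) : k) ^ c 1 := by
    rw [← h, zpow_add, mul_comm _ w₀, mul_comm _ w₁, zpow_mul, zpow_mul]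
    simp
  rw [h2, smul_pow, smul_pow]
  simp only [Algebra.smul_def, map_mul, map_pow]
  ring

/-- Divided differences of polynomials are polynomials. -/
theorem exists_divided (x : Letter n) (f : MvPolynomial (Fin n) k) :
    ∃ g, MvPolynomial.rename (sw x) f - f = (MvPolynomial.X x.1.1 - MvPolynomial.X x.1.2) * g := by
  induction f using MvPolynomial.induction_on with
  | C a => exact ⟨0, by simp⟩
  | add f f' hf hf' =>
    obtain ⟨g, hg⟩ := hf
    obtain ⟨g', hg'⟩ := hf'
    exact ⟨g + g', by rw [map_add, mul_add, ← hg, ← hg']; ring⟩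
  | mul_X f l hf =>
    obtain ⟨g, hg⟩ := hf
    have : ∃ h : MvPolynomial (Fin n) k, (MvPolynomial.X (sw x l) - MvPolynomial.X l :
        MvPolynomial (Fin n) k) = (MvPolynomial.X x.1.1 - MvPolynomial.X x.1.2) * h := by
      by_cases h1 : l = x.1.1
      · subst h1
        exact ⟨-1, by rw [sw_left]; ring⟩
      · by_cases h2 : l = x.1.2
        · subst h2
          exact ⟨1, by rw [sw_right]; ring⟩
        · exact ⟨0, by rw [sw_of_ne x h1 h2]; ring⟩
    obtain ⟨h, hh⟩ := this
    refine ⟨g * MvPolynomial.X (sw x l) + f * h, ?_⟩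
    rw [map_mul, MvPolynomial.rename_X]
    linear_combination hg * MvPolynomial.X (sw x l) + f * hh

end Scaling

namespace FoldingDatum

variable {k : Type u} [Field k] {I : Type u} (D : FoldingDatum k I)

/-- The orbit of a colour, encoded by an element of a linearly ordered type. -/
def orb (i : I) : Cardinal.{u} :=
  embeddingToCardinal (Quotient.mk (Equiv.Perm.SameCycle.setoid D.a) i)

variable {D}

theorem orb_eq_iff {i j : I} : D.orb i = D.orb j ↔ D.a.SameCycle i j := by
  rw [orb, orb, embeddingToCardinal.injective.eq_iff, Quotient.eq]
  rfl

@[simp] theorem orb_a (i : I) : D.orb (D.a i) = D.orb i :=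
  orb_eq_iff.2 (Equiv.Perm.sameCycle_apply_left.2 (Equiv.Perm.SameCycle.refl _ _))

theorem form_eq_zero {i j : I} (h : D.orb i = D.orb j) (hij : i ≠ j) : D.form i j = 0 := by
  obtain ⟨t, rfl⟩ := orb_eq_iff.1 h
  obtain ⟨m, hm⟩ := D.finite_order.mem_powers_iff_mem_zpowers.2 ⟨t, rfl⟩
  have hm' : D.a ^ m = D.a ^ t := hm
  rw [← hm'] at hij ⊢
  exact D.orthogonal i m (Ne.symm hij)

theorem Q_eq_C {i j : I} (hij : i ≠ j) (h : D.form i j = 0) :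
    D.Q i j = MvPolynomial.C ((D.Q i j).coeff 0) ∧ (D.Q i j).coeff 0 ≠ 0 := by
  have hd : ∀ i, 0 < D.d i := fun i => by
    have := D.two_mul_d i
    have := D.pos i
    omega
  have hc : D.c i j = 0 := by
    have := D.d_mul_c hij
    rw [h] at this
    exact (mul_eq_zero.1 this).resolve_left (hd i).ne'
  constructor
  · refine MvPolynomial.ext _ _ fun m => ?_
    rw [MvPolynomial.coeff_C]
    split_ifs with hm
    · rw [hm]
    · by_contra hne
      have h1 := D.Q_homogeneous i j hij hne
      rw [hc, mul_zero, neg_zero, Finsupp.weight_apply, Finsupp.sum_fintype _ _ (by simp)] at h1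
      simp only [Fin.sum_univ_two, Matrix.cons_val_zero, Matrix.cons_val_one, nsmul_eq_mul] at h1
      have h2 := hd i
      have h3 := hd j
      have h4 : (0 : ℤ) ≤ m 0 := Int.natCast_nonneg _
      have h5 : (0 : ℤ) ≤ m 1 := Int.natCast_nonneg _
      have h6 : (m 0 : ℤ) = 0 := by nlinarith
      have h7 : (m 1 : ℤ) = 0 := by nlinarith
      refine hm (Finsupp.ext fun l => ?_)
      fin_cases l
      · exact (by exact_mod_cast h6.symm)
      · exact (by exact_mod_cast h7.symm)
  · have := D.Q_coeff_u i j hij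
    rwa [hc, neg_zero, Int.toNat_zero, Finsupp.single_zero] at this

/-- A square root. -/
def root [IsAlgClosed k] (c : k) : k := (IsAlgClosed.exists_pow_nat_eq c two_pos).choose

theorem root_mul_root [IsAlgClosed k] (c : k) : root c * root c = c := by
  rw [← sq]; exact (IsAlgClosed.exists_pow_nat_eq c two_pos).choose_spec

variable (D) in
/-- The factorization that takes the square roots of the constants inside the orbits, and is
otherwise determined by the order of the orbits. -/
def orbitFactorization [IsAlgClosed k] : Factorization D where
  P i j := if D.orb i < D.orb j then D.Q i j else if D.orb j < D.orb i then 1 else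
    MvPolynomial.C (root ((D.Q i j).coeff 0))
  spec i j hij := by
    rcases lt_trichotomy (D.orb i) (D.orb j) with h | h | h
    · rw [if_pos h, if_neg h.not_gt, if_pos h, map_one, mul_one]
    · rw [if_neg h.not_lt, if_neg h.not_gt, if_neg h.not_gt, if_neg h.not_lt]
      obtain ⟨h1, -⟩ := Q_eq_C hij (form_eq_zero h hij)
      obtain ⟨h2, -⟩ := Q_eq_C hij.symm (form_eq_zero h.symm hij.symm)
      have h3 : (D.Q j i).coeff 0 = (D.Q i j).coeff 0 := by
        have := D.Q_symm i j
        rw [h2, MvPolynomial.rename_C] at this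
        rw [this, MvPolynomial.coeff_zero_C]
      rw [h3, MvPolynomial.rename_C, ← map_mul, root_mul_root]
      exact h1.symm
    · rw [if_neg h.not_gt, if_pos h, if_pos h, one_mul]
      exact (D.Q_symm i j).symm

variable (D) in
/-- The degree of a factor. -/
def facDeg (i j : I) : ℤ := if D.orb i < D.orb j then -(2 * D.form i j) else 0

theorem pv_P_smul [IsAlgClosed k] {n : ℕ} {i j : I} (hij : i ≠ j) (z : kˣ) (a b : Rat' k n) :
    pv (D.orbitFactorization.P i j) (((z ^ D.form i i : kˣ) : k) • a)
      (((z ^ D.form j j : kˣ) : k) • b) =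
      ((z ^ D.facDeg i j : kˣ) : k) • pv (D.orbitFactorization.P i j) a b := by
  simp only [orbitFactorization, facDeg]
  split_ifs
  · have h := pv_smul (n := n) (D.Q_homogeneous i j hij) (z ^ 2) a b
    have h2 : ∀ m : ℤ, (z ^ 2) ^ m = z ^ (2 * m) := fun m => by
      rw [zpow_mul]; rfl
    rwa [h2, h2, h2, D.two_mul_d, D.two_mul_d, D.d_mul_c hij, mul_neg] at h
  · simp [pv]
  · simp [pv]

theorem P_a [IsAlgClosed k] (i j : I) :
    D.orbitFactorization.P (D.a i) (D.a j) = D.orbitFactorization.P i j := by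
  simp only [orbitFactorization, orb_a, D.Q_a]

/-- The degree of a lowest vector of the polynomial representation. -/
def lowDeg {ν : I →₀ ℕ} (i : Seq ν) : ℤ :=
  ∑ ab : Fin ν.degree × Fin ν.degree with ab.1 < ab.2,
    if D.orb (i ab.2) < D.orb (i ab.1) then D.form (i ab.1) (i ab.2) else 0

theorem lowDeg_act {ν : I →₀ ℕ} (i : Seq ν) (x : Letter ν.degree) (hi : i x.1.1 ≠ i x.1.2) :
    lowDeg (D := D) (i.act (sw x)) + D.facDeg (i x.1.1) (i x.1.2) =
      lowDeg (D := D) i - D.form (i x.1.1) (i x.1.2) := by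
  classical
  let φ : Seq ν → Fin ν.degree × Fin ν.degree → ℤ := fun i ab =>
    if D.orb (i ab.2) < D.orb (i ab.1) then D.form (i ab.1) (i ab.2) else 0
  let T : Finset (Fin ν.degree × Fin ν.degree) :=
    (Finset.univ.filter fun ab : Fin ν.degree × Fin ν.degree => ab.1 < ab.2).erase x.1
  have hsplit : ∀ i : Seq ν, lowDeg (D := D) i = φ i x.1 + ∑ ab ∈ T, φ i ab := fun i =>
    (Finset.add_sum_erase (Finset.univ.filter fun ab : Fin ν.degree × Fin ν.degree =>
      ab.1 < ab.2) (φ i) (a := x.1) (Finset.mem_filter.2 ⟨Finset.mem_univ _, x.lt⟩)).symm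
  have hT : ∑ ab ∈ T, φ (i.act (sw x)) ab = ∑ ab ∈ T, φ i ab := by
    have hmem : ∀ ab ∈ T, ((sw x ab.1, sw x ab.2) : Fin ν.degree × Fin ν.degree) ∈ T := by
      intro ab hab
      simp only [T, Finset.mem_erase, Finset.mem_filter, Finset.mem_univ, true_and] at hab ⊢
      refine ⟨fun h => ?_, sw_lt x hab.2 hab.1⟩
      have h1 := congrArg (sw x) (congrArg Prod.fst h)
      have h2 := congrArg (sw x) (congrArg Prod.snd h)
      simp only [sw_sw, sw_left, sw_right] at h1 h2
      have := hab.2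
      rw [h1, h2] at this
      exact this.not_gt x.lt
    refine Finset.sum_nbij' (fun ab => (sw x ab.1, sw x ab.2)) (fun ab => (sw x ab.1, sw x ab.2))
      hmem hmem (fun ab _ => by simp) (fun ab _ => by simp) fun ab _ => ?_
    simp [φ]
  rw [hsplit, hsplit, hT]
  have e1 : φ (i.act (sw x)) x.1 = if D.orb (i x.1.1) < D.orb (i x.1.2) then
      D.form (i x.1.2) (i x.1.1) else 0 := by
    simp [φ]
  have e2 : φ i x.1 = if D.orb (i x.1.2) < D.orb (i x.1.1) then
      D.form (i x.1.1) (i x.1.2) else 0 := rfl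
  rw [e1, e2, facDeg, D.symm (i x.1.2)]
  rcases lt_trichotomy (D.orb (i x.1.1)) (D.orb (i x.1.2)) with h | h | h
  · rw [if_pos h, if_pos h, if_neg h.not_gt]; ring
  · rw [if_neg h.not_lt, if_neg h.not_lt, if_neg h.not_gt, form_eq_zero h hi]; ring
  · rw [if_neg h.not_gt, if_neg h.not_gt, if_pos h]; ring

end FoldingDatum

namespace FoldingDatum

open KLR

variable {k : Type u} [Field k] {I : Type u} {D : FoldingDatum k I} {κ : I →₀ ℕ}

/-- The units by which the variables are rescaled on a component. -/
def weightUnit (D : FoldingDatum k I) (z : kˣ) (j : Seq κ) (l : Fin κ.degree) : kˣ :=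
  z ^ D.form (j l) (j l)

theorem weightUnit_comp (z : kˣ) (j : Seq κ) (x : Letter κ.degree) :
    D.weightUnit z j ∘ sw x = D.weightUnit z (j.act (sw x)) := by
  funext l
  simp [weightUnit]

/-- The operators that act on the components of a grading as the powers of a unit. -/
def scOp (D : FoldingDatum k I) (z : kˣ) : RepSpace k κ →ₗ[k] RepSpace k κ where
  toFun f j := ((z ^ lowDeg (D := D) j : kˣ) : k) • sc (D.weightUnit z j) (f j)
  map_add' f g := funext fun j => by simp
  map_smul' a f := funext fun j => by
    simp only [Pi.smul_apply, map_smul, RingHom.id_apply]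
    rw [smul_comm]

theorem weightUnit_sum (z : kˣ) (j : Seq κ) (m : Fin κ.degree →₀ ℕ) :
    ((z ^ ∑ l, (m l : ℤ) * D.form (j l) (j l) : kˣ) : k) =
      ∏ l, (D.weightUnit z j l : k) ^ m l := by
  classical
  have h : ∀ s : Finset (Fin κ.degree), (z ^ ∑ l ∈ s, (m l : ℤ) * D.form (j l) (j l) : kˣ) =
      ∏ l ∈ s, D.weightUnit z j l ^ m l := by
    intro s
    induction s using Finset.induction_on with
    | empty => simp
    | insert l s hl ih =>
      rw [Finset.sum_insert hl, Finset.prod_insert hl, zpow_add, ih, mul_comm (m l : ℤ), zpow_mul,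
        zpow_natCast, weightUnit]
  rw [h]
  simp

theorem scOp_apply (z : kˣ) (f : RepSpace k κ) (j : Seq κ) :
    scOp D z f j = ((z ^ lowDeg (D := D) j : kˣ) : k) • sc (D.weightUnit z j) (f j) := rfl

variable (D κ) in
/-- The vectors of a given degree. -/
def homog (d : ℤ) : Submodule k (RepSpace k κ) where
  carrier := {f | ∀ z : kˣ, scOp D z f = ((z ^ d : kˣ) : k) • f}
  add_mem' {f g} hf hg z := by rw [map_add, hf z, hg z, smul_add]
  zero_mem' z := by rw [map_zero, smul_zero]
  smul_mem' a f hf z := by rw [map_smul, hf z, smul_comm]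

theorem sc_of_mem_homog {d : ℤ} {f : RepSpace k κ} (hf : f ∈ homog D κ d) (z : kˣ) (j : Seq κ) :
    sc (D.weightUnit z j) (f j) = ((z ^ (d - lowDeg (D := D) j) : kˣ) : k) • f j := by
  have h := congrFun (hf z) j
  rw [scOp_apply, Pi.smul_apply] at h
  have h2 : ((z ^ (d - lowDeg (D := D) j) : kˣ) : k) =
      ((z ^ (-lowDeg (D := D) j) : kˣ) : k) * ((z ^ d : kˣ) : k) := by
    rw [← Units.val_mul, ← zpow_add]
    congr 2
    ring
  rw [h2, mul_smul, ← h, smul_smul, ← Units.val_mul, ← zpow_add]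
  simp

variable [IsAlgClosed k]

theorem projOp_mem_homog (i : Seq κ) {d : ℤ} {f : RepSpace k κ} (hf : f ∈ homog D κ d) :
    projOp k i f ∈ homog D κ d := by
  classical
  intro z
  funext j
  rw [scOp_apply, projOp_apply, Pi.smul_apply, projOp_apply]
  split_ifs
  · exact congrFun (hf z) j
  · simp

theorem varOp_projOp_mem_homog (p : Fin κ.degree) (i : Seq κ) {d : ℤ} {f : RepSpace k κ}
    (hf : f ∈ homog D κ d) :
    varOp k p (projOp k i f) ∈ homog D κ (D.form (i p) (i p) + d) := by
  classical
  intro z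
  funext j
  rw [scOp_apply, varOp_apply, projOp_apply, Pi.smul_apply, varOp_apply, projOp_apply]
  split_ifs with h
  · subst h
    rw [map_mul, sc_xv, sc_of_mem_homog hf, smul_mul_smul_comm, smul_smul, weightUnit,
      ← Units.val_mul, ← Units.val_mul, ← zpow_add, ← zpow_add]
    congr 3
    ring
  · simp

theorem tauOp_projOp_mem_homog (x : Letter κ.degree) (i : Seq κ) {d : ℤ} {f : RepSpace k κ}
    (hf : f ∈ homog D κ d) :
    tauOp D.orbitFactorization x (projOp k i f) ∈
      homog D κ (-D.form (i x.1.1) (i x.1.2) + d) := by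
  classical
  intro z
  funext j
  rw [scOp_apply, Pi.smul_apply]
  by_cases hj : j x.1.1 = j x.1.2
  · rw [tauOp_eq _ x _ hj, projOp_apply]
    split_ifs with h
    · subst h
      have h1 : D.weightUnit z j ∘ sw x = D.weightUnit z j := by
        rw [weightUnit_comp, act_eq_self x hj]
      rw [map_div₀, map_sub, map_sub, sc_pact, h1, sc_of_mem_homog hf, sc_xv, sc_xv, map_smul]
      have h2 : D.weightUnit z j x.1.2 = D.weightUnit z j x.1.1 := by
        rw [weightUnit, weightUnit, hj]
      rw [h2, ← smul_sub, ← smul_sub, ← hj]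
      have h3 : ((z ^ (-D.form (j x.1.1) (j x.1.1) + d) : kˣ) : k) =
          ((z ^ lowDeg (D := D) j : kˣ) : k) * (((z ^ (d - lowDeg (D := D) j) : kˣ) : k) *
            (D.weightUnit z j x.1.1 : k)⁻¹) := by
        rw [weightUnit, ← Units.val_inv_eq_inv_val, ← Units.val_mul, ← Units.val_mul, ← zpow_neg,
          ← zpow_add, ← zpow_add]
        congr 2
        ring
      rw [h3, mul_smul]
      congr 1
      have hne : algebraMap k (Rat' k κ.degree) (D.weightUnit z j x.1.1 : k) ≠ 0 := by simp
      have hx := xv_sub_ne (k := k) x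
      simp only [Algebra.smul_def, map_mul, map_inv₀]
      field_simp
    · simp
  · rw [tauOp_ne _ x _ hj, projOp_apply]
    split_ifs with h
    · subst h
      have hj' : (j.act (sw x)) x.1.1 ≠ (j.act (sw x)) x.1.2 := by simpa using Ne.symm hj
      rw [map_mul, sc_pv, sc_xv, sc_xv, sc_pact, weightUnit_comp, sc_of_mem_homog hf, map_smul]
      have h1 := pv_P_smul (D := D) (Ne.symm hj) z (xv (k := k) x.1.2) (xv x.1.1)
      have h2 := lowDeg_act (D := D) (j.act (sw x)) x hj'
      simp only [Seq.act_act, sw_mul_self, Seq.act_one, Seq.act_apply, sw_inv, sw_left,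
        sw_right] at h2 ⊢
      refine (congrArg (fun y => ((z ^ lowDeg (D := D) j : kˣ) : k) • (y * _)) h1).trans ?_
      rw [smul_mul_smul_comm, smul_smul, ← Units.val_mul, ← Units.val_mul, ← zpow_add, ← zpow_add]
      congr 3
      linarith
    · simp

theorem rep_mem_homog {c d : ℤ} {r : KLR D κ} (hr : r ∈ gr D κ c) {f : RepSpace k κ}
    (hf : f ∈ homog D κ d) : rep D.orbitFactorization r f ∈ homog D κ (c + d) := by
  induction hr using Submodule.span_induction with
  | mem x hx =>
    change IsWord D c x at hx
    induction hx generalizing d f with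
    | e i => rw [rep_e, zero_add]; exact projOp_mem_homog i hf
    | y p i =>
      rw [map_mul, rep_y, rep_e]
      exact varOp_projOp_mem_homog p i hf
    | tau p q h i =>
      rw [map_mul, rep_e]
      have := tauOp_projOp_mem_homog (⟨(p, q), h⟩ : Letter κ.degree) i hf
      rw [← rep_tl] at this
      exact this
    | mul _ _ hx hy =>
      rw [map_mul, add_assoc]
      exact hx (hy hf)
  | zero => rw [map_zero]; exact zero_mem _
  | add x y _ _ hx hy => rw [map_add]; exact add_mem hx hy
  | smul a x _ hx => rw [map_smul]; exact Submodule.smul_mem _ _ hx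

variable (k κ) in
/-- The vectors of polynomials. -/
def polyVec : Submodule k (RepSpace k κ) where
  carrier := {f | ∀ j, ∃ P : MvPolynomial (Fin κ.degree) k, f j = algebraMap _ _ P}
  add_mem' {f g} hf hg j := by
    obtain ⟨P, hP⟩ := hf j
    obtain ⟨P', hP'⟩ := hg j
    exact ⟨P + P', by rw [map_add, Pi.add_apply, hP, hP']⟩
  zero_mem' j := ⟨0, by rw [map_zero]; rfl⟩
  smul_mem' a f hf j := by
    obtain ⟨P, hP⟩ := hf j
    exact ⟨a • P, by rw [smul_algebraMap, Pi.smul_apply, hP]⟩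

theorem pv_xv_mem {n : ℕ} (P : MvPolynomial (Fin 2) k) (p q : Fin n) :
    ∃ R, pv P (xv (k := k) p) (xv q) = algebraMap (MvPolynomial (Fin n) k) _ R := by
  refine ⟨MvPolynomial.rename ![p, q] P, ?_⟩
  rw [← MvPolynomial.aeval_X_left_apply (MvPolynomial.rename ![p, q] P),
    MvPolynomial.aeval_rename, pv, ← MvPolynomial.aeval_algebraMap_apply]
  congr 2
  funext i
  fin_cases i <;> rfl

theorem rep_mem_polyVec (r : KLR D κ) {f : RepSpace k κ} (hf : f ∈ polyVec k κ) :
    rep D.orbitFactorization r f ∈ polyVec k κ := by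
  classical
  induction r using KLR.induction generalizing f with
  | he i =>
    intro j
    rw [rep_e, projOp_apply]
    split_ifs
    · exact hf j
    · exact ⟨0, by rw [map_zero]⟩
  | hy p =>
    intro j
    obtain ⟨P, hP⟩ := hf j
    exact ⟨MvPolynomial.X p * P, by rw [rep_y, varOp_apply, hP, map_mul, xv]⟩
  | htau p q h =>
    have h1 := rep_tl D.orbitFactorization (⟨(p, q), h⟩ : Letter κ.degree)
    have h2 : tau D p q h = tl D (⟨(p, q), h⟩ : Letter κ.degree) := rfl
    rw [h2, h1]
    generalize (⟨(p, q), h⟩ : Letter κ.degree) = x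
    intro j
    by_cases hj : j x.1.1 = j x.1.2
    · obtain ⟨P, hP⟩ := hf j
      obtain ⟨R, hR⟩ := exists_divided x P
      refine ⟨R, ?_⟩
      have hx := xv_sub_ne (k := k) x
      rw [tauOp_eq _ x _ hj, hP, pact_algebraMap, ← map_sub, hR, map_mul, map_sub]
      exact mul_div_cancel_left₀ _ hx
    · obtain ⟨P, hP⟩ := hf (j.act (sw x))
      obtain ⟨R, hR⟩ := pv_xv_mem (D.orbitFactorization.P (j x.1.2) (j x.1.1)) x.1.2 x.1.1
      exact ⟨R * MvPolynomial.rename (sw x) P, by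
        rw [tauOp_ne _ x _ hj, hP, hR, pact_algebraMap, map_mul]⟩
  | hadd x y hx hy => rw [map_add]; exact add_mem (hx hf) (hy hf)
  | hmul x y hx hy => rw [map_mul]; exact hx (hy hf)
  | hk c =>
    rw [AlgHom.commutes]
    exact Submodule.smul_mem _ c hf

variable (hκ : κ ∈ D.NJ)

/-- The relabelling of the components by the automorphism. -/
def sigmaOp : RepSpace k κ →ₗ[k] RepSpace k κ where
  toFun f j := f (j.map D.a (mapDomain_a hκ))
  map_add' _ _ := rfl
  map_smul' _ _ := rfl

theorem sigmaOp_apply (f : RepSpace k κ) (j : Seq κ) :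
    sigmaOp hκ f j = f (j.map D.a (mapDomain_a hκ)) := rfl

theorem sigmaOp_rep (r : KLR D κ) (f : RepSpace k κ) :
    sigmaOp hκ (rep D.orbitFactorization (aut hκ r) f) =
      rep D.orbitFactorization r (sigmaOp hκ f) := by
  classical
  have hinj : Function.Injective (Seq.map (ν := κ) D.a (mapDomain_a hκ)) :=
    fun i j h => Seq.ext fun p => by
      have := congrArg (fun i : Seq κ => i p) h
      simpa using this
  induction r using KLR.induction generalizing f with
  | he i =>
    funext j
    rw [aut_e, rep_e, rep_e, sigmaOp_apply, projOp_apply, projOp_apply, sigmaOp_apply]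
    exact if_congr hinj.eq_iff rfl rfl
  | hy p =>
    rw [aut_y, rep_y]
    rfl
  | htau p q h =>
    have h1 := rep_tl D.orbitFactorization (⟨(p, q), h⟩ : Letter κ.degree)
    have h2 : tau D p q h = tl D (⟨(p, q), h⟩ : Letter κ.degree) := rfl
    rw [aut_tau, h2, h1]
    generalize (⟨(p, q), h⟩ : Letter κ.degree) = x
    funext j
    rw [sigmaOp_apply]
    by_cases hj : j x.1.1 = j x.1.2
    · rw [tauOp_eq _ x _ hj, tauOp_eq _ x _ (by simp [hj])]
      rfl
    · rw [tauOp_ne _ x _ hj, tauOp_ne _ x _ (by simpa using hj)]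
      simp only [Seq.map_apply, P_a]
      rfl
  | hadd x y hx hy => simp only [map_add, LinearMap.add_apply, hx, hy]
  | hmul x y hx hy => simp only [map_mul, Module.End.mul_apply, hx, hy]
  | hk c => simp only [AlgEquiv.commutes, AlgHom.commutes, Module.algebraMap_end_apply, map_smul]

theorem sigmaOp_mem_polyVec {f : RepSpace k κ} (hf : f ∈ polyVec k κ) :
    sigmaOp hκ f ∈ polyVec k κ := fun j => hf _

theorem lowDeg_map (j : Seq κ) :
    lowDeg (D := D) (j.map D.a (mapDomain_a hκ)) = lowDeg (D := D) j := by
  simp only [lowDeg, Seq.map_apply, orb_a, D.form_a]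

theorem sigmaOp_mem_homog {d : ℤ} {f : RepSpace k κ} (hf : f ∈ homog D κ d) :
    sigmaOp hκ f ∈ homog D κ d := by
  intro z
  funext j
  have h := congrFun (hf z) (j.map D.a (mapDomain_a hκ))
  rw [scOp_apply, lowDeg_map hκ] at h
  have h2 : D.weightUnit z (j.map D.a (mapDomain_a hκ)) = D.weightUnit z j := by
    funext l
    simp [weightUnit, D.form_a]
  rw [h2] at h
  exact h

theorem sigmaOp_pow (f : RepSpace k κ) : (sigmaOp hκ ^ D.n) f = f := by
  have h : ∀ (t : ℕ) (f : RepSpace k κ) (j j' : Seq κ), (∀ l, j' l = (D.a ^ t) (j l)) →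
      (sigmaOp hκ ^ t) f j = f j' := by
    intro t
    induction t with
    | zero =>
      intro f j j' h
      rw [Seq.ext h]
      rfl
    | succ t ih =>
      intro f j j' h
      rw [pow_succ', Module.End.mul_apply, sigmaOp_apply]
      exact ih _ _ _ fun l => by
        rw [h, Seq.map_apply, pow_succ, Equiv.Perm.mul_apply]
  funext j
  exact h D.n f j j fun l => by rw [FoldingDatum.n, pow_orderOf_eq_one]; rfl

theorem single_mem_polyVec [DecidableEq (Seq κ)] (j : Seq κ) (P : MvPolynomial (Fin κ.degree) k) :
    (Pi.single j (algebraMap _ _ P) : RepSpace k κ) ∈ polyVec k κ := by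
  intro j'
  by_cases h : j' = j
  · subst h; exact ⟨P, by rw [Pi.single_eq_same]⟩
  · exact ⟨0, by rw [Pi.single_eq_of_ne h, map_zero]⟩

theorem single_monomial_mem_homog [DecidableEq (Seq κ)] (j : Seq κ) (m : Fin κ.degree →₀ ℕ)
    (a : k) : (Pi.single j (algebraMap _ _ (MvPolynomial.monomial m a)) : RepSpace k κ) ∈
      homog D κ (lowDeg (D := D) j + ∑ l, m l * D.form (j l) (j l)) := by
  intro z
  funext j'
  rw [scOp_apply, Pi.smul_apply]
  by_cases h : j' = j
  · subst h
    rw [Pi.single_eq_same, sc_algebraMap, ← smul_algebraMap, ← smul_algebraMap]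
    congr 1
    refine MvPolynomial.ext _ _ fun m' => ?_
    rw [MvPolynomial.coeff_smul, MvPolynomial.coeff_smul, coeff_scPoly,
      MvPolynomial.coeff_monomial]
    split_ifs with hm
    · subst hm
      rw [smul_eq_mul, smul_eq_mul, ← mul_assoc]
      rw [zpow_add, Units.val_mul, weightUnit_sum]
    · simp
  · rw [Pi.single_eq_of_ne h]
    simp

theorem scOp_mem_polyVec (z : kˣ) {f : RepSpace k κ} (hf : f ∈ polyVec k κ) :
    scOp D z f ∈ polyVec k κ := by
  intro j
  obtain ⟨P, hP⟩ := hf j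
  exact ⟨_, by rw [scOp_apply, hP, sc_algebraMap, ← smul_algebraMap]⟩

theorem polyVec_internal :
    DirectSum.IsInternal fun d => (homog D κ d).comap (polyVec k κ).subtype := by
  classical
  have : Infinite k := IsAlgClosed.instInfinite
  refine isInternal_of_scaling _ ?_
    (fun z => (scOp D z).restrict (p := polyVec k κ) (q := polyVec k κ)
      fun f hf => scOp_mem_polyVec z hf) fun z d x hx => Subtype.ext (hx z)
  rw [eq_top_iff]
  rintro ⟨f, hf⟩ -
  have hf' := hf
  choose P hP using hf'
  have h1 : (⟨f, hf⟩ : polyVec k κ) = ∑ j, ∑ m ∈ (P j).support,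
      ⟨Pi.single j (algebraMap _ _ (MvPolynomial.monomial m ((P j).coeff m))),
        single_mem_polyVec j _⟩ := by
    refine Subtype.ext ?_
    rw [Submodule.coe_sum]
    simp only [Submodule.coe_sum]
    have h2 : ∀ j, ∑ m ∈ (P j).support, (Pi.single j (algebraMap _ _
        (MvPolynomial.monomial m ((P j).coeff m))) : RepSpace k κ) = Pi.single j (f j) := by
      intro j
      have h3 : ∀ s : Finset (Fin κ.degree →₀ ℕ), ∑ m ∈ s, (Pi.single j (algebraMap _ _
        (MvPolynomial.monomial m ((P j).coeff m))) : RepSpace k κ) =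
          Pi.single j (algebraMap _ _ (∑ m ∈ s, MvPolynomial.monomial m ((P j).coeff m))) := by
        intro s
        induction s using Finset.induction_on with
        | empty => simp
        | insert m s hm ih => rw [Finset.sum_insert hm, Finset.sum_insert hm, ih, map_add,
            Pi.single_add]
      rw [h3, ← MvPolynomial.as_sum, hP]
    simp only [h2]
    exact (Finset.univ_sum_single f).symm
  rw [h1]
  refine sum_mem fun j _ => sum_mem fun m _ => ?_
  exact Submodule.mem_iSup_of_mem _ (single_monomial_mem_homog j m _)

/-- A polynomial vector of low degree is a multiple of a lowest vector. -/
theorem exists_of_mem_homog {d : ℤ} {f : RepSpace k κ} (hf : f ∈ polyVec k κ)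
    (hd : f ∈ homog D κ d) (j : Seq κ) (h : f j ≠ 0) : lowDeg (D := D) j ≤ d ∧
      (d = lowDeg (D := D) j → ∃ c : k, f j = algebraMap k _ c) := by
  have : Infinite k := IsAlgClosed.instInfinite
  obtain ⟨P, hP⟩ := hf j
  have key : ∀ m, P.coeff m ≠ 0 → ∑ l, (m l : ℤ) * D.form (j l) (j l) = d - lowDeg (D := D) j := by
    intro m hm
    by_contra hne
    obtain ⟨z, hz⟩ := exists_unit_injOn (k := k)
      {∑ l, (m l : ℤ) * D.form (j l) (j l), d - lowDeg (D := D) j}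
    have h1 := sc_of_mem_homog hd z j
    rw [hP, sc_algebraMap, ← smul_algebraMap, (IsFractionRing.injective _ _).eq_iff] at h1
    have h2 := congrArg (MvPolynomial.coeff m) h1
    rw [coeff_scPoly, MvPolynomial.coeff_smul, smul_eq_mul] at h2
    have h3 := mul_right_cancel₀ hm h2
    refine hne (hz (by simp) (by simp) ?_)
    simp only
    rw [← h3, weightUnit_sum]
  have hP0 : P ≠ 0 := by
    rintro rfl
    rw [map_zero] at hP
    exact h hP
  have hnn : ∀ m : Fin κ.degree →₀ ℕ, ∀ l ∈ Finset.univ, (0 : ℤ) ≤ m l * D.form (j l) (j l) :=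
    fun m l _ => mul_nonneg (Int.natCast_nonneg _) (D.pos _).le
  constructor
  · obtain ⟨m, hm⟩ := MvPolynomial.ne_zero_iff.1 hP0
    have h1 := key m hm
    have h2 := Finset.sum_nonneg (hnn m)
    omega
  · intro hd'
    refine ⟨P.coeff 0, ?_⟩
    have h1 : P = MvPolynomial.C (P.coeff 0) := by
      refine MvPolynomial.ext _ _ fun m => ?_
      rw [MvPolynomial.coeff_C]
      split_ifs with hm
      · rw [hm]
      · by_contra hne
        have h1 := key m hne
        rw [hd', sub_self, Finset.sum_eq_zero_iff_of_nonneg (hnn m)] at h1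
        refine hm (Finsupp.ext fun l => ?_)
        have h2 := (mul_eq_zero.1 (h1 l (Finset.mem_univ l))).resolve_right (D.pos _).ne'
        exact (by exact_mod_cast h2.symm)
    rw [hP, h1, MvPolynomial.coeff_C, if_pos rfl, ← MvPolynomial.algebraMap_eq,
      ← IsScalarTower.algebraMap_apply]

end FoldingDatum

/-- Positions can be sorted inside the blocks by a given key. -/
theorem exists_sort {n : ℕ} {o L : Type*} [LinearOrder o] [LinearOrder L] {β : Fin n → o}
    (hβ : Monotone β) (K : Fin n → L) : ∃ v : Equiv.Perm (Fin n), (∀ a, β (v a) = β a) ∧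
      ∀ a b, β a = β b → (v a < v b ↔ K a < K b ∨ K a = K b ∧ a < b) := by
  let key : Fin n → o ×ₗ (L ×ₗ Fin n) := fun a => toLex (β a, toLex (K a, a))
  have hinj : Function.Injective key := fun a b h => by
    have h1 := congrArg (fun x : o ×ₗ (L ×ₗ Fin n) => (ofLex (ofLex x).2).2) h
    exact h1
  let σ := Tuple.sort key
  have hmono : Monotone (key ∘ σ) := Tuple.monotone_sort key
  have hstrict : StrictMono (key ∘ σ) := hmono.strictMono_of_injective (hinj.comp σ.injective)
  have hβσ : β ∘ σ = β := by
    refine eq_of_monotone_of_card (fun a b hab => ?_) hβ fun x => ?_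
    · have h1 := hmono hab
      rcases Prod.Lex.le_iff.1 h1 with h2 | h2
      · exact h2.le
      · exact h2.1.le
    · refine Finset.card_equiv σ fun a => ?_
      simp
  have hv : ∀ a, key a = (key ∘ σ) (σ⁻¹ a) := fun a =>
    congrArg key (σ.apply_symm_apply a).symm
  refine ⟨σ⁻¹, fun a => ?_, fun a b hab => ?_⟩
  · have := congrFun hβσ (σ⁻¹ a)
    rw [← this]
    exact congrArg β (σ.apply_symm_apply a)
  · rw [← hstrict.lt_iff_lt, ← hv, ← hv, Prod.Lex.lt_iff]
    simp only [key, ofLex_toLex, hab, lt_self_iff_false, true_and, false_or]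
    rw [Prod.Lex.lt_iff]
    rfl

theorem eq_of_sorted {n : ℕ} {I o L : Type*} [LinearOrder o] [LinearOrder L] {β : Fin n → o}
    (hβ : Monotone β) {q : I → L} (hq : Function.Injective q) {i i' : Fin n → I}
    (hi : ∀ a b, a < b → β a = β b → q (i a) ≤ q (i b))
    (hi' : ∀ a b, a < b → β a = β b → q (i' a) ≤ q (i' b))
    (h : ∀ c, ∑ a with β a = c, Finsupp.single (i a) 1 =
      (∑ a with β a = c, Finsupp.single (i' a) 1 : I →₀ ℕ)) : i = i' := by
  classical
  have hm : ∀ i : Fin n → I, (∀ a b, a < b → β a = β b → q (i a) ≤ q (i b)) →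
      Monotone fun a => (toLex (β a, q (i a)) : o ×ₗ L) := by
    intro i hi a b hab
    rcases hab.eq_or_lt with rfl | hab'
    · exact le_rfl
    · refine Prod.Lex.le_iff.2 ?_
      rcases (hβ hab).lt_or_eq with h1 | h1
      · exact Or.inl h1
      · exact Or.inr ⟨h1, hi a b hab' h1⟩
  have hcard : ∀ (i : Fin n → I) c t, (∑ a with β a = c, Finsupp.single (i a) 1 : I →₀ ℕ) t =
      (Finset.univ.filter fun a => (toLex (β a, q (i a)) : o ×ₗ L) = toLex (c, q t)).card := by
    intro i c t
    rw [Finsupp.finsetSum_apply, Finset.card_eq_sum_ones, Finset.sum_filter, Finset.sum_filter]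
    refine Finset.sum_congr rfl fun a _ => ?_
    simp only [EmbeddingLike.apply_eq_iff_eq, Prod.mk.injEq, hq.eq_iff, Finsupp.single_apply]
    by_cases h1 : β a = c <;> by_cases h2 : i a = t <;> simp [h1, h2]
  have key := eq_of_monotone_of_card (hm i hi) (hm i' hi') fun x => by
    by_cases hx : ∃ t, q t = (ofLex x).2
    · obtain ⟨t, ht⟩ := hx
      have hx' : x = toLex ((ofLex x).1, q t) := by rw [ht]; rfl
      rw [hx', ← hcard, ← hcard, h]
    · have : ∀ i : Fin n → I, (Finset.univ.filter fun a =>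
          (toLex (β a, q (i a)) : o ×ₗ L) = x).card = 0 := fun i => by
        rw [Finset.card_eq_zero, Finset.filter_eq_empty_iff]
        rintro a - h1
        exact hx ⟨i a, by rw [← h1]; rfl⟩
      rw [this, this]
  funext a
  have h1 := congrArg (fun x : o ×ₗ L => (ofLex x).2) (congrFun key a)
  exact hq h1

theorem evalQ_C {k : Type u} [Field k] {B : Type u} [Ring B] [Algebra k B] (c : k) (u v : B) :
    evalQ (MvPolynomial.C c) u v = c • 1 := by
  classical
  rw [evalQ, MvPolynomial.C_apply, MvPolynomial.support_monomial]
  split_ifs with h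
  · simp [h]
  · simp

namespace FoldingDatum

open KLR

variable {k : Type u} [Field k] {I : Type u} (D : FoldingDatum k I)

/-- The key by which colours are sorted: first the orbit, then the colour. -/
def colourKey (i : I) : Cardinal.{u} ×ₗ Cardinal.{u} := toLex (D.orb i, embeddingToCardinal i)

theorem colourKey_injective : Function.Injective D.colourKey := fun _ _ h =>
  embeddingToCardinal.injective (congrArg (fun x : Cardinal ×ₗ Cardinal => (ofLex x).2) h)

variable {D}

theorem orb_le_of_key_le {i j : I} (h : D.colourKey i ≤ D.colourKey j) : D.orb i ≤ D.orb j := by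
  rcases Prod.Lex.le_iff.1 h with h1 | h1
  · exact h1.le
  · exact h1.1.le

variable {κ : I →₀ ℕ}

/-- A word that interchanges only orthogonal colours can be inverted, up to a scalar. -/
theorem exists_reverse_mul {ω : List (Letter κ.degree)} (hω : IsRed ω) (i : Seq κ)
    (h : ∀ ab ∈ invSet (wordPerm ω), i ab.1 ≠ i ab.2 ∧ D.form (i ab.1) (i ab.2) = 0) :
    ∃ c : k, c ≠ 0 ∧ tw D ω.reverse * (tw D ω * e D i) = c • e D i := by
  induction ω with
  | nil => exact ⟨1, one_ne_zero, by simp⟩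
  | cons x ω ih =>
    have hinv := invSet_sw_mul (wordPerm ω) x hω.cons_lt
    rw [wordPerm_cons, hinv] at h
    obtain ⟨c, hc, hc'⟩ := ih hω.of_cons fun ab hab => h ab (Finset.mem_insert_of_mem hab)
    obtain ⟨h1, h2⟩ := h _ (Finset.mem_insert_self _ _)
    let j := i.act (wordPerm ω)
    have h1' : j x.1.1 ≠ j x.1.2 := h1
    have h2' : D.form (j x.1.1) (j x.1.2) = 0 := h2
    obtain ⟨hQ, hQ'⟩ := Q_eq_C h1' h2'
    refine ⟨(D.Q (j x.1.1) (j x.1.2)).coeff 0 * c, mul_ne_zero hQ' hc, ?_⟩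
    have hsq : tl D x * tl D x * e D j = (D.Q (j x.1.1) (j x.1.2)).coeff 0 • e D j := by
      refine ((isFamily D).tau_sq _ _ _ j).trans ?_
      conv_lhs => rw [hQ]
      rw [evalQ_C, Algebra.smul_mul_assoc, one_mul]
    rw [List.reverse_cons, tw_append, tw_cons, tw_cons, tw_nil, mul_one]
    calc _ = tw D ω.reverse * (tl D x * tl D x * (tw D ω * e D i)) := by simp only [mul_assoc]
      _ = tw D ω.reverse * (tl D x * tl D x * e D j * tw D ω) := by
          rw [tw_e]; simp only [mul_assoc]; rfl
      _ = (D.Q (j x.1.1) (j x.1.2)).coeff 0 • (tw D ω.reverse * (e D j * tw D ω)) := by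
          rw [hsq, smul_mul_assoc, mul_smul_comm]
      _ = (D.Q (j x.1.1) (j x.1.2)).coeff 0 • (tw D ω.reverse * (tw D ω * e D i)) := by
          rw [tw_e]
      _ = _ := by rw [hc', smul_smul]

end FoldingDatum

theorem exists_proj {k V : Type u} [Field k] [AddCommGroup V] [Module k V]
    (gr : ℤ → Submodule k V) (h : DirectSum.IsInternal gr) (d : ℤ) : ∃ π : V →ₗ[k] V,
      (∀ x ∈ gr d, π x = x) ∧ ∀ d', d' ≠ d → ∀ x ∈ gr d', π x = 0 := by
  classical
  let f : V →ₗ[k] V := (DirectSum.toModule k ℤ V fun d' => if d' = d then (gr d').subtype else 0) ∘ₗ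
    (LinearEquiv.ofBijective (DirectSum.coeLinearMap gr) h).symm.toLinearMap
  have hf : ∀ d', ∀ x ∈ gr d', f x = if d' = d then x else 0 := by
    intro d' x hx
    have : (LinearEquiv.ofBijective (DirectSum.coeLinearMap gr) h).symm x =
        DirectSum.lof k ℤ (fun d => gr d) d' ⟨x, hx⟩ :=
      (LinearEquiv.symm_apply_eq _).2 (DirectSum.coeLinearMap_lof gr d' ⟨x, hx⟩).symm
    simp only [f, LinearMap.comp_apply, LinearEquiv.coe_coe, this, DirectSum.toModule_lof]
    split_ifs <;> rfl
  exact ⟨f, fun x hx => by rw [hf d x hx, if_pos rfl],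
    fun d' hd x hx => by rw [hf d' x hx, if_neg hd]⟩

namespace FMod

variable {k : Type u} [Field k] {n : ℕ} {B : FoldedAlg k n}

/-- An object is not traceless if the automorphism, followed by the action of an element, takes a
vector spanning a line cut out by the grading and the action to a nonzero multiple of itself. -/
theorem not_isTraceless (M : FMod B) {d : ℤ} {v : M.carrier} (hv : v ∈ M.gr d) (hv0 : v ≠ 0)
    {e b : B.carrier} (he : e • v = v)
    (huniq : ∀ x ∈ M.gr d, e • x = x → ∃ c : k, x = c • v) {c : k} (hc : c ≠ 0)
    (hb : b • M.σ v = c • v) : ¬ M.IsTraceless := by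
  classical
  rintro ⟨t, ht, -, N, hgr, hint, hσ⟩
  have : NeZero t := ⟨by omega⟩
  have : Fact (1 < t) := ⟨ht⟩
  obtain ⟨π, hπ, hπ'⟩ := exists_proj M.gr M.internal d
  have hstab : ∀ s x, x ∈ N s → π x ∈ N s ∧ π x ∈ M.gr d := by
    intro s x hx
    have hx' : x ∈ ⨆ d : ℤ, ((N s).restrictScalars k) ⊓ M.gr d := hgr s ▸ hx
    clear hx
    induction hx' using Submodule.iSup_induction' with
    | mem d' x hx =>
      by_cases hd : d' = d
      · subst hd
        rw [hπ x hx.2]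
        exact hx
      · rw [hπ' d' hd x hx.2]
        exact ⟨zero_mem _, zero_mem _⟩
    | zero => rw [map_zero]; exact ⟨zero_mem _, zero_mem _⟩
    | add x y _ _ hx hy =>
      rw [map_add]
      exact ⟨add_mem hx.1 hy.1, add_mem hx.2 hy.2⟩
  have htop : v ∈ ⨆ s, N s := by rw [hint.submodule_iSup_eq_top]; trivial
  obtain ⟨w, hw, hsum⟩ := (Submodule.mem_iSup_iff_exists_finsupp _ _).1 htop
  rw [Finsupp.sum_fintype _ _ (fun _ => rfl)] at hsum
  have hind := hint.submodule_iSupIndep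
  have hind' := hind
  rw [iSupIndep_iff_finsetSum_eq_zero_imp_eq_zero] at hind
  have h1 : v = ∑ s, π (w s) := by rw [← map_sum, hsum, hπ v hv]
  have h2 : ∀ s, e • π (w s) = π (w s) := by
    intro s
    have h3 := hind Finset.univ (fun s => e • π (w s) - π (w s)) (fun s _ =>
      sub_mem ((N s).smul_mem e (hstab s _ (hw s)).1) (hstab s _ (hw s)).1) (by
        rw [Finset.sum_sub_distrib, ← Finset.smul_sum, ← h1, he, sub_self]) s (Finset.mem_univ s)
    exact sub_eq_zero.1 h3
  obtain ⟨s, hs⟩ : ∃ s, π (w s) ≠ 0 := by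
    by_contra! h
    exact hv0 (by rw [h1]; exact Finset.sum_eq_zero fun s _ => h s)
  obtain ⟨a, ha⟩ := huniq _ (hstab s _ (hw s)).2 (h2 s)
  have ha0 : a ≠ 0 := by
    rintro rfl
    exact hs (by rw [ha, zero_smul])
  have hvs : v ∈ N s := by
    have h3 : a⁻¹ • π (w s) ∈ (N s).restrictScalars k :=
      Submodule.smul_mem _ _ (hstab s _ (hw s)).1
    rwa [ha, smul_smul, inv_mul_cancel₀ ha0, one_smul] at h3
  have hσv : M.σ v ∈ N (s + 1) := by
    have h3 : M.σ v ∈ ((N s).restrictScalars k).map M.σ := ⟨v, hvs, rfl⟩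
    rwa [hσ] at h3
  have hvs' : v ∈ N (s + 1) := by
    have h3 : c⁻¹ • (b • M.σ v) ∈ (N (s + 1)).restrictScalars k :=
      Submodule.smul_mem _ _ ((N (s + 1)).smul_mem b hσv)
    rwa [hb, smul_smul, inv_mul_cancel₀ hc, one_smul] at h3
  have hne : s ≠ s + 1 := fun h => one_ne_zero (left_eq_add.1 h)
  exact hv0 (Submodule.disjoint_def.1 (hind'.pairwiseDisjoint hne) v hvs hvs')

theorem exists_smul_of_span (M : FMod B) {d : ℤ} {v : M.carrier} {e : B.carrier}
    {S : Set M.carrier} (hS : Submodule.span k S = ⊤)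
    (h : ∀ x ∈ S, e • x = 0 ∨ e • x = x ∧ ∃ d', x ∈ M.gr d' ∧ (d' = d → ∃ c : k, x = c • v)) :
    ∀ x ∈ M.gr d, e • x = x → ∃ c : k, x = c • v := by
  obtain ⟨π, hπ, hπ'⟩ := exists_proj M.gr M.internal d
  have key : ∀ y : M.carrier, ∃ c : k, π (e • y) = c • v := by
    intro y
    have hy : y ∈ Submodule.span k S := by rw [hS]; trivial
    induction hy using Submodule.span_induction with
    | mem x hx =>
      rcases h x hx with h1 | ⟨h1, d', h2, h3⟩
      · exact ⟨0, by rw [h1, map_zero, zero_smul]⟩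
      · rw [h1]
        by_cases hd : d' = d
        · obtain ⟨c, hc⟩ := h3 hd
          exact ⟨c, by rw [hπ x (hd ▸ h2), hc]⟩
        · exact ⟨0, by rw [hπ' d' hd x h2, zero_smul]⟩
    | zero => exact ⟨0, by rw [smul_zero, map_zero, zero_smul]⟩
    | add x y _ _ hx hy =>
      obtain ⟨c, hc⟩ := hx
      obtain ⟨c', hc'⟩ := hy
      exact ⟨c + c', by rw [smul_add, map_add, hc, hc', add_smul]⟩
    | smul a x _ hx =>
      obtain ⟨c, hc⟩ := hx
      exact ⟨a * c, by rw [smul_comm, map_smul, hc, smul_smul]⟩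
  intro x hx hex
  obtain ⟨c, hc⟩ := key x
  exact ⟨c, by rw [← hc, hex, hπ x hx]⟩

end FMod

namespace FoldingDatum

open KLR

variable {k : Type u} [Field k] {I : Type u} {D : FoldingDatum k I} [IsAlgClosed k]

instance polyModule (κ : D.NJ) : Module (D.R κ).carrier (polyVec k (κ : I →₀ ℕ)) where
  smul r f := ⟨rep D.orbitFactorization r f.1, rep_mem_polyVec (D := D) r f.2⟩
  one_smul f := Subtype.ext (congrArg (fun φ => φ f.1) (map_one (rep D.orbitFactorization)))
  mul_smul r s f := Subtype.ext
    (congrArg (fun φ => φ f.1) (map_mul (rep D.orbitFactorization) r s))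
  smul_zero r := Subtype.ext (map_zero (rep D.orbitFactorization r))
  smul_add r f g := Subtype.ext (map_add (rep D.orbitFactorization r) _ _)
  add_smul r s f := Subtype.ext
    (congrArg (fun φ => φ f.1) (map_add (rep D.orbitFactorization) r s))
  zero_smul f := Subtype.ext (congrArg (fun φ => φ f.1) (map_zero (rep D.orbitFactorization)))

variable (D) in
/-- The polynomial representation. -/
def polyMod (κ : D.NJ) : FMod (D.R κ) where
  carrier := polyVec k (κ : I →₀ ℕ)
  tower := ⟨fun c r f => Subtype.ext
    (congrArg (fun φ => φ f.1) (map_smul (rep D.orbitFactorization) c r))⟩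
  gr d := (homog D (κ : I →₀ ℕ) d).comap (polyVec k (κ : I →₀ ℕ)).subtype
  internal := polyVec_internal
  smul_mem hr hm := rep_mem_homog hr hm
  σ := (sigmaOp κ.2).restrict fun _ hf => sigmaOp_mem_polyVec κ.2 hf
  σ_mem h := sigmaOp_mem_homog κ.2 h
  σ_smul r f := Subtype.ext (sigmaOp_rep κ.2 r f.1)
  σ_pow := by
    ext f
    rw [Module.End.pow_restrict]
    exact congrFun (sigmaOp_pow κ.2 f.1) _

end FoldingDatum

namespace FoldingDatum

open KLR

variable {k : Type u} [Field k] {I : Type u} {D : FoldingDatum k I} {r s : ℕ}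
  {lam : Fin r → D.NJ} {mu : Fin s → D.NJ} {κ : D.NJ} (hlam : ∑ c, lam c = κ)
  (hmu : ∑ d, mu d = κ) [Infinite k]

theorem fits_iff_tgt {ν : CMat lam mu} {i : Seq (κ : I →₀ ℕ)} : ν.Fits (sum_coe hlam) i ↔
    ∀ x, ∑ b with tgt (blk (sum_coe hlam)) (blk (sum_coe hmu)) (mw hlam hmu ν) b = x,
      Finsupp.single (i.act (mw hlam hmu ν) b) 1 = ν.1 (ofLex x).2 (ofLex x).1 := by
  rw [Mat.fits_iff _ (sum_coe hmu)]
  have key : ∀ c d, ∑ b with tgt (blk (sum_coe hlam)) (blk (sum_coe hmu)) (mw hlam hmu ν) b =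
      toLex (d, c), Finsupp.single (i.act (mw hlam hmu ν) b) 1 =
      (∑ a with blk (sum_coe hlam) a = c ∧ blk (sum_coe hmu)
        (ν.w (sum_coe hlam) (sum_coe hmu) a) = d, Finsupp.single (i a) 1 : I →₀ ℕ) := by
    intro c d
    refine (Finset.sum_equiv (mw hlam hmu ν) (fun a => ?_) fun a _ => ?_).symm
    · simp only [Finset.mem_filter, Finset.mem_univ, true_and, tgt, EmbeddingLike.apply_eq_iff_eq,
        Prod.mk.injEq]
      rw [show (mw hlam hmu ν)⁻¹ (mw hlam hmu ν a) = a from (mw hlam hmu ν).symm_apply_apply a]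
      exact and_comm
    · simp
  exact ⟨fun h x => (key (ofLex x).2 (ofLex x).1).trans (h _ _),
    fun h c d => (key c d).symm.trans (h (toLex (d, c)))⟩

theorem exists_seq_fits (ν : CMat lam mu) : ∃ i : Seq (κ : I →₀ ℕ), ν.Fits (sum_coe hlam) i := by
  choose f hf using fun c d => Mat.exists_seq (ν.1 c d)
  let E := Equiv.ofBijective _ (ν.spos_bijective (sum_coe hlam))
  let g : Fin (κ : I →₀ ℕ).degree → I := fun a => f (E.symm a).1 (E.symm a).2.1 (E.symm a).2.2
  have hg : ∀ c d p, g (ν.spos (sum_coe hlam) c d p) = f c d p := fun c d p => by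
    have : E.symm (ν.spos (sum_coe hlam) c d p) = ⟨c, d, p⟩ := E.symm_apply_apply ⟨c, d, p⟩
    exact congrArg (fun x : Σ c, Σ d, Fin (ν.1 c d).degree => f x.1 x.2.1 x.2.2) this
  have hsum : ∀ c d, ∑ p, Finsupp.single (g (ν.spos (sum_coe hlam) c d p)) 1 = ν.1 c d :=
    fun c d => by
      simp only [hg]
      exact hf c d
  refine ⟨⟨g, ?_⟩, hsum⟩
  rw [← E.sum_comp, Fintype.sum_sigma]
  refine Eq.trans ?_ (sum_coe hlam)
  refine Finset.sum_congr rfl fun c _ => ?_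
  rw [Fintype.sum_sigma]
  exact (Finset.sum_congr rfl fun d _ => hsum c d).trans (ν.2.1 c)

/-- The colours are sorted in every block. -/
def IsSorted {o : Type} (β : Fin (κ : I →₀ ℕ).degree → o) (i : Seq (κ : I →₀ ℕ)) : Prop :=
  ∀ a b, a < b → β a = β b → D.colourKey (i a) ≤ D.colourKey (i b)

/-- There is a coset representative of lowest degree among those that lead to a sorted sequence, and
it is unique. -/
theorem exists_extremal (ν : CMat lam mu) : ∃ (j : Seq (κ : I →₀ ℕ))
    (u : Equiv.Perm (Fin (κ : I →₀ ℕ).degree)),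
    ν.Fits (sum_coe hlam) (j.act (mw hlam hmu ν)⁻¹) ∧
    (∀ a, blk (sum_coe hmu) (u a) = blk (sum_coe hmu) a) ∧
    MonoOnBlocks (tgt (blk (sum_coe hlam)) (blk (sum_coe hmu)) (mw hlam hmu ν)) u ∧
    IsSorted (blk (sum_coe hmu)) (j.act u) ∧
    ∀ (j' : Seq (κ : I →₀ ℕ)) (u' : Equiv.Perm (Fin (κ : I →₀ ℕ).degree)),
      ν.Fits (sum_coe hlam) (j'.act (mw hlam hmu ν)⁻¹) →
      (∀ a, blk (sum_coe hmu) (u' a) = blk (sum_coe hmu) a) →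
      MonoOnBlocks (tgt (blk (sum_coe hlam)) (blk (sum_coe hmu)) (mw hlam hmu ν)) u' →
      j'.act u' = j.act u → j' = j ∧
        ∑ ab ∈ invSet u', D.form (j ab.1) (j ab.2) ≤ ∑ ab ∈ invSet u, D.form (j ab.1) (j ab.2) ∧
        (∑ ab ∈ invSet u', D.form (j ab.1) (j ab.2) = ∑ ab ∈ invSet u, D.form (j ab.1) (j ab.2) →
          u' = u) := by
  have hβ := monotone_blk (sum_coe hlam)
  have hβ' := monotone_blk (sum_coe hmu)
  have hτ := monotone_tgt hβ hβ' (mw_short hlam hmu ν).right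
  have hF : ∀ j : Seq (κ : I →₀ ℕ), ν.Fits (sum_coe hlam) (j.act (mw hlam hmu ν)⁻¹) ↔
      ∀ x, ∑ b with tgt (blk (sum_coe hlam)) (blk (sum_coe hmu)) (mw hlam hmu ν) b = x,
        Finsupp.single (j b) 1 = ν.1 (ofLex x).2 (ofLex x).1 := fun j => by
    rw [fits_iff_tgt hlam hmu, Seq.act_act, mul_inv_cancel, Seq.act_one]
  obtain ⟨i, hi⟩ := exists_seq_fits hlam ν
  rw [fits_iff_tgt hlam hmu] at hi
  obtain ⟨v, hv1, hv2⟩ := exists_sort hτ fun a => D.colourKey (i.act (mw hlam hmu ν) a)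
  let j : Seq (κ : I →₀ ℕ) := (i.act (mw hlam hmu ν)).act v
  have hj : ∀ x, ∑ b with tgt (blk (sum_coe hlam)) (blk (sum_coe hmu)) (mw hlam hmu ν) b = x,
      Finsupp.single (j b) 1 = ν.1 (ofLex x).2 (ofLex x).1 := fun x => by
    rw [← hi x]
    refine (Finset.sum_equiv v (fun a => ?_) fun a _ => ?_).symm
    · simp only [Finset.mem_filter, Finset.mem_univ, true_and, hv1]
    · simp [j]
  have hjs : ∀ a b, a < b → tgt (blk (sum_coe hlam)) (blk (sum_coe hmu)) (mw hlam hmu ν) a =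
      tgt (blk (sum_coe hlam)) (blk (sum_coe hmu)) (mw hlam hmu ν) b →
      D.colourKey (j a) ≤ D.colourKey (j b) := by
    intro a b hab h
    obtain ⟨a, rfl⟩ := v.surjective a
    obtain ⟨b, rfl⟩ := v.surjective b
    rw [hv1, hv1] at h
    have h1 := (hv2 a b h).1 hab
    have h2 : ∀ a, j (v a) = i.act (mw hlam hmu ν) a := fun a => by simp [j]
    rw [h2, h2]
    rcases h1 with h1 | h1
    · exact h1.le
    · exact h1.1.le
  obtain ⟨u, hu1, hu2⟩ := exists_sort hβ' fun a => (toLex (D.colourKey (j a),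
    OrderDual.toDual (blk (sum_coe hlam) ((mw hlam hmu ν)⁻¹ a))) :
      (Cardinal.{u} ×ₗ Cardinal.{u}) ×ₗ (Fin r)ᵒᵈ)
  have hu3 : ∀ a b, blk (sum_coe hmu) a = blk (sum_coe hmu) b → u a < u b →
      D.colourKey (j a) ≤ D.colourKey (j b) := by
    intro a b h hab
    rcases (hu2 a b h).1 hab with h1 | h1
    · rcases Prod.Lex.lt_iff.1 h1 with h2 | h2
      · exact h2.le
      · exact h2.1.le
    · exact le_of_eq (congrArg (fun x : (Cardinal.{u} ×ₗ Cardinal.{u}) ×ₗ (Fin r)ᵒᵈ =>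
        (ofLex x).1) h1.1)
  have hact : ∀ (j : Seq (κ : I →₀ ℕ)) (u : Equiv.Perm (Fin (κ : I →₀ ℕ).degree)) a,
      j.act u (u a) = j a := fun j u a => by simp
  have hsorted : IsSorted (D := D) (blk (sum_coe hmu)) (j.act u) := by
    intro a b hab h
    obtain ⟨a, rfl⟩ := u.surjective a
    obtain ⟨b, rfl⟩ := u.surjective b
    rw [hu1, hu1] at h
    rw [hact, hact]
    exact hu3 a b h hab
  refine ⟨j, u, (hF j).2 hj, hu1, ?_, hsorted, ?_⟩
  · intro a b hab h
    obtain ⟨h1, h2⟩ := tgt_eq_iff.1 h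
    refine (hu2 a b h1).2 ?_
    rcases (hjs a b hab h).lt_or_eq with h3 | h3
    · exact Or.inl (Prod.Lex.lt_iff.2 (Or.inl h3))
    · exact Or.inr ⟨by rw [h3, h2], hab⟩
  · intro j' u' hj' hu'1 hu'2 he
    have hs' : ∀ a b, blk (sum_coe hmu) a = blk (sum_coe hmu) b → u' a < u' b →
        D.colourKey (j' a) ≤ D.colourKey (j' b) := by
      intro a b h hab
      rw [← hact j' u', ← hact j' u', he]
      exact hsorted _ _ hab (by rw [hu'1, hu'1, h])
    have hjj : j' = j := by
      refine Seq.ext fun l => congrFun (eq_of_sorted hτ D.colourKey_injective (i := fun l => j' l)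
        (i' := fun l => j l) ?_ hjs fun x => ?_) l
      · intro a b hab h
        exact hs' a b (tgt_eq_iff.1 h).1 (hu'2 a b hab h)
      · rw [hj x]
        exact (hF j').1 hj' x
    rw [hjj] at hs' he hj'
    have hblk : ∀ (u : Equiv.Perm (Fin (κ : I →₀ ℕ).degree)),
        (∀ a, blk (sum_coe hmu) (u a) = blk (sum_coe hmu) a) → ∀ a b, a < b → u b < u a →
        blk (sum_coe hmu) a = blk (sum_coe hmu) b := by
      intro u hu a b hab hub
      refine le_antisymm (hβ' hab.le) ?_
      rw [← hu a, ← hu b]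
      exact hβ' hub.le
    have hsub : invSet u' ⊆ invSet u := by
      rintro ⟨a, b⟩ hab
      rw [mem_invSet] at hab ⊢
      refine ⟨hab.1, ?_⟩
      have h1 := hblk u' hu'1 a b hab.1 hab.2
      refine (hu2 b a h1.symm).2 (Or.inl (Prod.Lex.lt_iff.2 ?_))
      rcases (hs' b a h1.symm hab.2).lt_or_eq with h2 | h2
      · exact Or.inl h2
      · refine Or.inr ⟨h2, OrderDual.toDual_lt_toDual.2 ?_⟩
        have h3 : tgt (blk (sum_coe hlam)) (blk (sum_coe hmu)) (mw hlam hmu ν) a <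
            tgt (blk (sum_coe hlam)) (blk (sum_coe hmu)) (mw hlam hmu ν) b := by
          refine lt_of_le_of_ne (hτ hab.1.le) fun h => ?_
          exact (hu'2 a b hab.1 h).not_gt hab.2
        rcases Prod.Lex.lt_iff.1 h3 with h4 | h4
        · exact absurd h1 h4.ne
        · exact h4.2
    have hpos : ∀ ab ∈ invSet u \ invSet u', 0 < D.form (j ab.1) (j ab.2) := by
      rintro ⟨a, b⟩ hab
      rw [Finset.mem_sdiff, mem_invSet, mem_invSet] at hab
      obtain ⟨⟨h1, h2⟩, h3⟩ := hab
      have h4 := hblk u hu1 a b h1 h2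
      have h5 : u' a < u' b := lt_of_le_of_ne (not_lt.1 fun h => h3 ⟨h1, h⟩)
        fun h => h1.ne (u'.injective h)
      have h6 := D.colourKey_injective (le_antisymm (hs' a b h4 h5) (hu3 b a h4.symm h2))
      simp only [h6]
      exact D.pos _
    have hsum := Finset.sum_sdiff (f := fun ab => D.form (j ab.1) (j ab.2)) hsub
    refine ⟨hjj, ?_, fun h => ?_⟩
    · have := Finset.sum_nonneg fun ab hab => (hpos ab hab).le
      linarith
    · have h0 : ∑ ab ∈ invSet u \ invSet u', D.form (j ab.1) (j ab.2) = 0 := by linarith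
      refine eq_of_invSet_eq _ _ (Finset.Subset.antisymm hsub fun ab hab => ?_)
      by_contra hab'
      have h1 := Finset.mem_sdiff.2 ⟨hab, hab'⟩
      have h2 := (Finset.sum_eq_zero_iff_of_nonneg fun ab hab => (hpos ab hab).le).1 h0 ab h1
      exact (hpos ab h1).ne' h2

end FoldingDatum

open FMod

section Abstract

variable {k : Type u} [Field k] {n : ℕ} {A B R : FoldedAlg k n}

theorem FoldedHom.mem_gr_of_injective (φ : FoldedHom A R) (hφ : Function.Injective φ.toLin) {d : ℤ}
    {x : A.carrier} (hx : φ.toLin x ∈ R.gr d) : x ∈ A.gr d := by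
  obtain ⟨π, h1, h2⟩ := exists_proj A.gr A.internal d
  obtain ⟨π', h1', h2'⟩ := exists_proj R.gr R.internal d
  have key : ∀ y : A.carrier, π y ∈ A.gr d ∧ φ.toLin (π y) = π' (φ.toLin y) := by
    intro y
    have hy : y ∈ ⨆ d, A.gr d := by rw [A.internal.submodule_iSup_eq_top]; trivial
    induction hy using Submodule.iSup_induction' with
    | mem d' y hy =>
      by_cases hd : d' = d
      · subst hd
        rw [h1 y hy, h1' _ (φ.map_mem hy)]
        exact ⟨hy, rfl⟩
      · rw [h2 d' hd y hy, h2' d' hd _ (φ.map_mem hy), map_zero]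
        exact ⟨zero_mem _, rfl⟩
    | zero => simp
    | add y z _ _ hy hz =>
      simp only [map_add, hy.2, hz.2, and_true]
      exact add_mem hy.1 hz.1
  have h3 : π x = x := hφ (by rw [(key x).2, h1' _ hx])
  rw [← h3]
  exact (key x).1

namespace RingStrat

variable [Infinite k] {φ : FoldedHom A R} {ψ : FoldedHom B R} {T X : Type u} [Fintype X]
  (Z : RingStrat φ ψ T X)

theorem coe_smul_gen {M : FMod A} {b : B.carrier} {ν : T} {a : A.carrier} {m : M.carrier}
    (ha : a • m = m) : coeInd φ ψ M (b • Z.gen ν M m) =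
      φ.indMk M (ψ.toLin b * Z.t ν * φ.toLin a) m := by
  rw [coeInd_smul, coe_gen, φ.smul_indMk, φ.indMk_map, ha]

theorem smul_vMk_congr {p : ℕ} {ν : T} (hν : Z.toStrat.g ν = p) {M : FMod A} {b b' : B.carrier}
    {a : A.carrier} {m : M.carrier} (ha : a • m = m)
    (h : ψ.toLin b * Z.t ν * φ.toLin a = ψ.toLin b' * Z.t ν * φ.toLin a) :
    b • Z.toStrat.vMk hν M m = b' • Z.toStrat.vMk hν M m := by
  have h1 : b • Z.toStrat.tMk ν M m = b' • Z.toStrat.tMk ν M m :=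
    coeInd_injective φ ψ M ((Z.coe_smul_gen ha).trans
      ((congrArg (φ.indMk M · m) h).trans (Z.coe_smul_gen ha).symm))
  rw [Strat.smul_vMk, Strat.smul_vMk]
  simp only [h1]

theorem smul_vMk_eq_zero {p : ℕ} {ν : T} (hν : Z.toStrat.g ν = p) {M : FMod A} {b : B.carrier}
    {a : A.carrier} {m : M.carrier} (ha : a • m = m)
    (h : ψ.toLin b * Z.t ν * φ.toLin a = 0) : b • Z.toStrat.vMk hν M m = 0 := by
  rw [Z.smul_vMk_congr hν ha (b' := 0) (by rw [h, map_zero, zero_mul, zero_mul]), zero_smul]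

theorem smul_vMk_mem {p : ℕ} {ν : T} (hν : Z.toStrat.g ν = p) {M : FMod A} {b : B.carrier}
    {a : A.carrier} {m : M.carrier} (ha : a • m = m) {c d : ℤ} (hm : m ∈ M.gr d)
    (h : ψ.toLin b * Z.t ν * φ.toLin a ∈ R.gr c) :
    b • Z.toStrat.vMk hν M m ∈ ((Z.toStrat.gra p).obj M).gr (c + d) := by
  have h1 : coeInd φ ψ M (b • Z.toStrat.tMk ν M m) ∈ φ.indGr M (c + d) := by
    have h2 := φ.indMk_mem M h hm
    rwa [← Z.coe_smul_gen ha] at h2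
  exact ⟨⟨b • Z.toStrat.tMk ν M m, Submodule.smul_mem _ _
    (Z.toStrat.tMk_mem_fil (by omega) m)⟩, h1, rfl⟩

end RingStrat

end Abstract

namespace FoldingDatum

open KLR

variable {k : Type u} [Field k] [Infinite k] {I : Type u} {D : FoldingDatum k I} {r : ℕ}
  {lam : Fin r → D.NJ} {κ : D.NJ} (hlam : ∑ c, lam c = κ)

/-- The element of the tensor product given by a sequence. -/
def wt (i : Seq (κ : I →₀ ℕ)) : (FoldedAlg.pi fun c => D.R (lam c)).carrier :=
  (exists_concat_poly hlam (e_mem_polySub i)).choose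

theorem cmap_wt (i : Seq (κ : I →₀ ℕ)) :
    cmap hlam (wt hlam i) = (e D i * eSum D (IsConcat (sum_coe hlam)) : KLR D (κ : I →₀ ℕ)) :=
  (exists_concat_poly hlam (e_mem_polySub i)).choose_spec

theorem cmap_wt_of {i : Seq (κ : I →₀ ℕ)} (hi : IsConcat (sum_coe hlam) i) :
    cmap hlam (wt hlam i) = (e D i : KLR D (κ : I →₀ ℕ)) := by
  classical
  rw [cmap_wt, e_mul_eSum, if_pos hi]

theorem mem_gr_of_cmap (F : Factorization D) {d : ℤ}
    {x : (FoldedAlg.pi fun c => D.R (lam c)).carrier}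
    (hx : cmap hlam x ∈ gr D (κ : I →₀ ℕ) d) : x ∈ (FoldedAlg.pi fun c => D.R (lam c)).gr d :=
  (concat lam κ hlam).mem_gr_of_injective (concat_injective hlam F) hx

theorem wt_mem (F : Factorization D) (i : Seq (κ : I →₀ ℕ)) :
    wt hlam i ∈ (FoldedAlg.pi fun c => D.R (lam c)).gr 0 := by
  refine mem_gr_of_cmap hlam F ?_
  rw [cmap_wt, ← add_zero (0 : ℤ)]
  exact mul_mem_gr (Submodule.subset_span (IsWord.e i)) (eSum_mem_gr _)

theorem wt_mul_self (F : Factorization D) (i : Seq (κ : I →₀ ℕ)) :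
    wt hlam i * wt hlam i = wt hlam i := by
  classical
  refine concat_injective hlam F ?_
  rw [cmap_mul, cmap_wt, e_mul_eSum]
  split_ifs
  · exact (isFamily D).e_mul_self i
  · exact zero_mul _

theorem sum_wt (F : Factorization D) : ∑ i, wt hlam (D := D) i = 1 := by
  refine concat_injective hlam F ?_
  rw [map_sum, cmap_one]
  refine (Finset.sum_congr rfl fun i _ => cmap_wt hlam i).trans ?_
  rw [← Finset.sum_mul]
  have h : ∑ i, e D i = (1 : KLR D (κ : I →₀ ℕ)) := sum_e D
  rw [h, one_mul]

theorem aut_wt (F : Factorization D) (i : Seq (κ : I →₀ ℕ)) :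
    (FoldedAlg.pi fun c => D.R (lam c)).aut (wt hlam i) =
      wt hlam (i.map D.a (mapDomain_a κ.2)) := by
  refine concat_injective hlam F ?_
  rw [cmap_wt]
  refine ((concat lam κ hlam).comm _).trans ?_
  refine (congrArg (aut κ.2) (cmap_wt hlam i)).trans ?_
  rw [map_mul, aut_e, aut_concat _ κ.2 fun j => (lam j).2]

variable {s : ℕ} {mu : Fin s → D.NJ} {hlam} {hmu : ∑ d, mu d = κ}

theorem mt_mul_wt_of_not {ν : CMat lam mu} {f : Seq (κ : I →₀ ℕ)}
    (hf : ¬ ν.Fits (sum_coe hlam) f) : mt hlam hmu ν * cmap hlam (wt hlam f) = 0 := by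
  classical
  rw [cmap_wt, mt, mul_assoc, ← mul_assoc (eSum D _) (e D f), eSum_mul_e, if_neg hf, zero_mul,
    mul_zero]

theorem b_mul_mt_mul_wt (q : Coset hlam hmu) {f : Seq (κ : I →₀ ℕ)}
    (hf : q.1.1.Fits (sum_coe hlam) f) :
    (cmap hmu q.b * mt hlam hmu q.1.1 * cmap hlam (wt hlam f) : KLR D (κ : I →₀ ℕ)) =
      tw D q.word * e D (f.act (mw hlam hmu q.1.1)) * (tw D (rw1 (mw hlam hmu q.1.1)) * e D f) := by
  classical
  have h1 : IsConcat (sum_coe hmu) (f.act (mw hlam hmu q.1.1)) :=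
    Mat.Fits.isConcat_act (sum_coe hlam) (sum_coe hmu) q.1.1 hf
  rw [cmap_wt_of hlam (Mat.Fits.isConcat (sum_coe hlam) q.1.1 hf), Coset.cmap_b, mul_assoc, mt,
    mul_assoc (tw D (rw1 _)), eSum_mul_e, if_pos hf, tw_e, wordPerm_rw1, ← mul_assoc, mul_assoc
    (tw D q.word), eSum_mul_e, if_pos h1, mul_assoc, mul_assoc, ← mul_assoc (e D _) (e D _),
    (isFamily D).e_mul_self]

theorem b_mul_mt_mul_wt_mem (q : Coset hlam hmu) {f : Seq (κ : I →₀ ℕ)}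
    (hf : q.1.1.Fits (sum_coe hlam) f) :
    (cmap hmu q.b * mt hlam hmu q.1.1 * cmap hlam (wt hlam f) : KLR D (κ : I →₀ ℕ)) ∈
      gr D (κ : I →₀ ℕ) (-∑ ab ∈ invSet q.1.2, D.form (f.act (mw hlam hmu q.1.1) ab.1)
        (f.act (mw hlam hmu q.1.1) ab.2) + q.1.1.deg D) := by
  rw [b_mul_mt_mul_wt q hf]
  refine mul_mem_gr ?_ ?_
  · have h := tw_e_mem_gr (D := D) (redWord_red (monotone_blk (sum_coe hmu)) q.1.2 q.2.1)
      (f.act (mw hlam hmu q.1.1))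
    rwa [wordPerm_redWord] at h
  · have h := tw_e_mem_gr (D := D) (rw1_red (mw hlam hmu q.1.1)) f
    rw [wordPerm_rw1] at h
    rwa [mw, Mat.Fits.sum_invSet (sum_coe hlam) (sum_coe hmu) q.1.1 D hf] at h

theorem wt_mul_b_mul_mt_mul_wt (q : Coset hlam hmu) {f : Seq (κ : I →₀ ℕ)}
    (hf : q.1.1.Fits (sum_coe hlam) f) {i : Seq (κ : I →₀ ℕ)}
    [Decidable ((f.act (mw hlam hmu q.1.1)).act q.1.2 = i)] :
    (cmap hmu (wt hmu i * q.b) * mt hlam hmu q.1.1 * cmap hlam (wt hlam f) :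
      KLR D (κ : I →₀ ℕ)) = if (f.act (mw hlam hmu q.1.1)).act q.1.2 = i then
        cmap hmu q.b * mt hlam hmu q.1.1 * cmap hlam (wt hlam f) else 0 := by
  classical
  have h1 : IsConcat (sum_coe hmu) (f.act (mw hlam hmu q.1.1)) :=
    Mat.Fits.isConcat_act (sum_coe hlam) (sum_coe hmu) q.1.1 hf
  have h2 := isConcat_act (sum_coe hmu) q.2.1 h1
  rw [cmap_mul, mul_assoc, mul_assoc, ← mul_assoc (cmap hmu q.b), b_mul_mt_mul_wt q hf, tw_e,
    Coset.word, wordPerm_redWord, cmap_wt, e_mul_eSum]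
  split_ifs with h3 h4 h4
  · subst h4
    simp only [mul_assoc]
    rw [← mul_assoc (e D _) (e D _), (isFamily D).e_mul_self]
  · simp only [mul_assoc]
    rw [← mul_assoc (e D _) (e D _), (isFamily D).e_mul_ne _ _ (Ne.symm h4), zero_mul]
  · subst h4
    exact absurd h2 h3
  · rw [zero_mul]

end FoldingDatum

open FMod

section Abstract

variable {k : Type u} [Field k] {n : ℕ} {A B R : FoldedAlg k n}

namespace FMod

/-- The action of an element. -/
abbrev act (M : FMod A) (a : A.carrier) (m : M.carrier) : M.carrier := a • m

/-- Homogeneous weight vectors span. -/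
theorem mem_span_weight (M : FMod A) {Ω : Type*} [Fintype Ω] {wt : Ω → A.carrier}
    (h1 : ∀ f, wt f * wt f = wt f) (h2 : ∀ f, wt f ∈ A.gr 0) (h3 : ∑ f, wt f = 1)
    (m : M.carrier) :
    m ∈ Submodule.span k {m : M.carrier | ∃ f d, wt f • m = m ∧ m ∈ M.gr d} := by
  induction M.mem_iSup_gr m using Submodule.iSup_induction' with
  | mem d m hm =>
    rw [← one_smul A.carrier m, ← h3, Finset.sum_smul]
    refine sum_mem fun f _ => Submodule.subset_span ⟨f, d, ?_, M.smul_mem_zero (h2 f) hm⟩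
    rw [smul_smul, h1]
  | zero => exact zero_mem _
  | add x y _ _ hx hy => exact add_mem hx hy

theorem σ_ne_zero (hn : 0 < n) (M : FMod A) {v : M.carrier} (hv : v ≠ 0) : M.σ v ≠ 0 := by
  intro h
  refine hv ?_
  have h1 : (M.σ ^ n) v = v := by rw [M.σ_pow]; rfl
  obtain ⟨l, hl⟩ := Nat.exists_eq_add_one.2 hn
  have h2 : ∀ l, (M.σ ^ (l + 1)) v = 0 := fun l => by
    rw [pow_succ, Module.End.mul_apply, h, map_zero]
  rw [← h1]
  exact (congrArg (fun l => (M.σ ^ l) v) hl).trans (h2 l)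

end FMod

/-- A criterion for a subquotient of a stratified functor not to be traceless: a vector of lowest
degree in a weight space is unique up to scalars, and the automorphism, followed by the action of
an invertible element, preserves this weight space. -/
theorem RingStrat.not_isTraceless [Infinite k] (hn : 0 < n) {φ : FoldedHom A R} {ψ : FoldedHom B R}
    {T X : Type u} [Fintype X] (Z : RingStrat φ ψ T X) (M : FMod A) {ν : T}
    (hν : ∀ ν', Z.g ν' = Z.g ν → ν' = ν) {Ω : Type*} [Fintype Ω] {wt : Ω → A.carrier}
    (h1 : ∀ f, wt f * wt f = wt f) (h2 : ∀ f, wt f ∈ A.gr 0) (h3 : ∑ f, wt f = 1)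
    {q₀ : X} (hq₀ : Z.pr q₀ = ν) {m₀ : M.carrier} {f₀ : Ω} {c₀ d₀ : ℤ} {e₀ : B.carrier}
    (hm₀ : m₀ ∈ M.gr d₀) (hm₀' : m₀ ≠ 0) (hf₀ : wt f₀ • m₀ = m₀) (hε : Z.ε ν * wt f₀ = wt f₀)
    (he₀ : ψ.toLin (e₀ * Z.b q₀) * Z.t ν * φ.toLin (wt f₀) =
      ψ.toLin (Z.b q₀) * Z.t ν * φ.toLin (wt f₀))
    (hc₀ : ψ.toLin (Z.b q₀) * Z.t ν * φ.toLin (wt f₀) ∈ R.gr c₀)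
    (H : ∀ q f m d, Z.pr q = ν → wt f • m = m → m ∈ M.gr d → m ≠ 0 →
      ψ.toLin (e₀ * Z.b q) * Z.t ν * φ.toLin (wt f) = 0 ∨
      ψ.toLin (e₀ * Z.b q) * Z.t ν * φ.toLin (wt f) =
        ψ.toLin (Z.b q) * Z.t ν * φ.toLin (wt f) ∧
        ∃ c, ψ.toLin (Z.b q) * Z.t ν * φ.toLin (wt f) ∈ R.gr c ∧
          (c + d = c₀ + d₀ → q = q₀ ∧ ∃ c : k, m = c • m₀))
    {e₁ x y : B.carrier} {c : k} (he₁ : B.aut e₁ = e₀) (hc : c ≠ 0) (hyx : y * x = c • e₁)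
    (hx : e₀ * x = x) (hx' : x ∈ B.gr 0) :
    ¬ ((Z.toStrat.gra (Z.g ν)).obj M).IsTraceless := by
  classical
  have hg : Z.toStrat.g ν = Z.g ν := rfl
  let G := (Z.toStrat.gra (Z.g ν)).obj M
  let v : M.carrier →ₗ[k] G.carrier := Z.toStrat.vMk hg M
  have hv_mem : Z.b q₀ • v m₀ ∈ G.gr (c₀ + d₀) := Z.smul_vMk_mem hg hf₀ hm₀ hc₀
  have hev : e₀ • Z.b q₀ • v m₀ = Z.b q₀ • v m₀ := by
    rw [smul_smul]
    exact Z.smul_vMk_congr hg hf₀ he₀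
  have hv0 : Z.b q₀ • v m₀ ≠ 0 := by
    intro h
    have h4 : Z.toStrat.gsum (Z.g ν) M (Pi.single ⟨q₀, congrArg Z.g hq₀⟩ m₀) = 0 := by
      rw [Strat.gsum_eq_sum, Finset.sum_eq_single ⟨q₀, congrArg Z.g hq₀⟩, Pi.single_eq_same]
      · subst hq₀
        exact h
      · intro q _ hq
        rw [Pi.single_eq_of_ne hq, map_zero, smul_zero]
      · exact fun h => absurd (Finset.mem_univ _) h
    rw [Strat.gsum_eq_zero_iff] at h4
    have h5 := h4 ⟨q₀, congrArg Z.g hq₀⟩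
    rw [Pi.single_eq_same] at h5
    have h6 : Z.ε ν • m₀ = m₀ := by rw [← hf₀, smul_smul, hε]
    refine hm₀' (h6.symm.trans ?_)
    rw [← hq₀]
    exact h5
  have huniq : ∀ z ∈ G.gr (c₀ + d₀), e₀ • z = z → ∃ c : k, z = c • (Z.b q₀ • v m₀) := by
    refine FMod.exists_smul_of_span G (S := {z | ∃ q f m d, Z.pr q = ν ∧ wt f • m = m ∧ m ∈ M.gr d ∧
      z = Z.b q • v m}) ?_ ?_
    · rw [eq_top_iff]
      rintro z -
      obtain ⟨w, rfl⟩ := Z.toStrat.exists_gsum _ M z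
      rw [Strat.gsum_eq_sum]
      refine sum_mem fun q _ => ?_
      have hq := hν _ q.2
      have key : ∀ m : M.carrier, Z.b q.1 • v m ∈ Submodule.span k
          {z | ∃ q f m d, Z.pr q = ν ∧ wt f • m = m ∧ m ∈ M.gr d ∧ z = Z.b q • v m} := by
        intro m
        induction M.mem_span_weight h1 h2 h3 m using Submodule.span_induction with
        | mem m hm =>
          obtain ⟨f, d, h4, h5⟩ := hm
          exact Submodule.subset_span ⟨q.1, f, m, d, hq, h4, h5, rfl⟩
        | zero => rw [map_zero, smul_zero]; exact zero_mem _
        | add x y _ _ hx hy => rw [map_add, smul_add]; exact add_mem hx hy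
        | smul a x _ hx => rw [map_smul, smul_comm]; exact Submodule.smul_mem _ _ hx
      have hv : ∀ ν' (h : Z.toStrat.g ν' = Z.g ν), ν = ν' → Z.toStrat.vMk h M = v := by
        intro ν' h h'
        subst h'
        rfl
      have h4 : Z.toStrat.vMk q.2 M (w q) = v (w q) :=
        LinearMap.congr_fun (hv _ q.2 hq.symm) (w q)
      rw [h4]
      exact key (w q)
    · rintro _ ⟨q, f, m, d, hq, h4, h5, rfl⟩
      by_cases h0 : m = 0
      · left
        rw [h0, map_zero, smul_zero, smul_zero]
      rw [smul_smul]
      rcases H q f m d hq h4 h5 h0 with h6 | ⟨h6, c, h7, h8⟩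
      · exact Or.inl (Z.smul_vMk_eq_zero hg h4 h6)
      · refine Or.inr ⟨Z.smul_vMk_congr hg h4 h6, c + d, Z.smul_vMk_mem hg h4 h5 h7, fun h => ?_⟩
        obtain ⟨rfl, c', rfl⟩ := h8 h
        exact ⟨c', by rw [map_smul, smul_comm]⟩
  have h4 : e₁ • G.σ (Z.b q₀ • v m₀) = G.σ (Z.b q₀ • v m₀) := by
    rw [← G.σ_smul, he₁, hev]
  obtain ⟨c', hc'⟩ := huniq (x • G.σ (Z.b q₀ • v m₀)) (G.smul_mem_zero hx' (G.σ_mem hv_mem))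
    (by rw [smul_smul, hx])
  refine FMod.not_isTraceless G hv_mem hv0 hev huniq (c := c') ?_ hc'
  rintro rfl
  rw [zero_smul] at hc'
  have h5 : (y * x) • G.σ (Z.b q₀ • v m₀) = 0 := by rw [mul_smul, hc', smul_zero]
  rw [hyx, smul_assoc, h4] at h5
  exact G.σ_ne_zero hn hv0 ((smul_eq_zero.1 h5).resolve_left hc)

end Abstract

namespace FoldingDatum

open KLR

variable {k : Type u} [Field k] [IsAlgClosed k] {I : Type u} {D : FoldingDatum k I} {r s : ℕ}
  {lam : Fin r → D.NJ} {mu : Fin s → D.NJ} {κ : D.NJ} (hlam : ∑ c, lam c = κ)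

/-- The restriction of the polynomial representation. -/
def polyRes : D.C lam := (concat lam κ hlam).res.obj (polyMod D κ)

/-- The vector of polynomials given by an element of the restriction. -/
def polyCoe : (polyRes hlam).carrier →ₗ[k] RepSpace k (κ : I →₀ ℕ) :=
  (polyVec k (κ : I →₀ ℕ)).subtype ∘ₗ ((concat lam κ hlam).resSpace (polyMod D κ)).subtype

theorem polyCoe_injective : Function.Injective (polyCoe hlam) :=
  Subtype.val_injective.comp Subtype.val_injective

theorem polyCoe_smul (a : (FoldedAlg.pi fun c => D.R (lam c)).carrier)
    (m : (polyRes hlam).carrier) :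
    polyCoe hlam ((polyRes hlam).act a m) = rep D.orbitFactorization (cmap hlam a) (polyCoe hlam m) := rfl

theorem exists_one {f : Seq (κ : I →₀ ℕ)} (hf : IsConcat (sum_coe hlam) f) :
    ∃ m : (polyRes hlam).carrier, m ∈ (polyRes hlam).gr (lowDeg (D := D) f) ∧ m ≠ 0 ∧
      (polyRes hlam).act (wt hlam f) m = m ∧ ∀ m' : (polyRes hlam).carrier, (polyRes hlam).act (wt hlam f) m' = m' → m' ≠ 0 →
        ∀ d, m' ∈ (polyRes hlam).gr d → lowDeg (D := D) f ≤ d ∧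
          (d = lowDeg (D := D) f → ∃ c : k, m' = c • m) := by
  classical
  let P : RepSpace k (κ : I →₀ ℕ) := Pi.single f 
    (algebraMap _ _ (1 : MvPolynomial (Fin (κ : I →₀ ℕ).degree) k))
  have hP : P ∈ polyVec k (κ : I →₀ ℕ) := single_mem_polyVec f 1
  have hef : rep D.orbitFactorization (e D f) P = P := by
    rw [rep_e]
    funext j
    rw [projOp_apply]
    split_ifs with h
    · rfl
    · simp [P, Pi.single_eq_of_ne h]
  have hP' : (concat lam κ hlam).e • (⟨P, hP⟩ : (polyMod D κ).carrier) = ⟨P, hP⟩ := by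
    refine Subtype.ext ?_
    change rep D.orbitFactorization (cmap hlam 1) P = P
    rw [cmap_one, ← hef]
    refine (LinearMap.congr_fun (map_mul (rep D.orbitFactorization) _ _).symm P).trans ?_
    rw [eSum_mul_e, if_pos hf]
  have hdeg : P ∈ homog D (κ : I →₀ ℕ) (lowDeg (D := D) f) := by
    have h := single_monomial_mem_homog (D := D) f 0 (1 : k)
    simpa [P] using h
  obtain ⟨m, hm⟩ : ∃ m : (polyRes hlam).carrier, polyCoe hlam m = P := ⟨⟨⟨P, hP⟩, hP'⟩, rfl⟩
  have hm' : m ∈ (polyRes hlam).gr (lowDeg (D := D) f) := by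
    change polyCoe hlam m ∈ homog D (κ : I →₀ ℕ) (lowDeg (D := D) f)
    rwa [hm]
  refine ⟨m, hm', ?_, ?_, fun m' h1 h2 d h3 => ?_⟩
  · rintro rfl
    have h1 : P f = 0 := by rw [← hm, map_zero]; rfl
    simp [P] at h1
  · refine polyCoe_injective hlam ?_
    rw [polyCoe_smul, cmap_wt_of hlam hf, hm]
    exact hef
  · have h4 : ∀ j, j ≠ f → polyCoe hlam m' j = 0 := by
      intro j hj
      rw [← h1, polyCoe_smul, cmap_wt_of hlam hf, rep_e, projOp_apply, if_neg hj]
    have h5 : polyCoe hlam m' f ≠ 0 := by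
      intro h5
      refine h2 (polyCoe_injective hlam ?_)
      rw [map_zero]
      funext j
      by_cases hj : j = f
      · rw [hj, h5]; rfl
      · exact h4 j hj
    obtain ⟨h6, h7⟩ := exists_of_mem_homog (D := D) (f := polyCoe hlam m') m'.1.2 h3 f h5
    refine ⟨h6, fun hd => ?_⟩
    obtain ⟨c, hc⟩ := h7 hd
    refine ⟨c, polyCoe_injective hlam ?_⟩
    rw [map_smul, hm]
    funext j
    rw [Pi.smul_apply]
    by_cases hj : j = f
    · subst hj
      rw [hc]
      simp [P, Algebra.smul_def]
    · rw [h4 j hj]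
      simp [P, Pi.single_eq_of_ne hj]

/-- An element that takes the image under the automorphism of vectors of a sorted weight back to
this weight, and has an inverse. -/
theorem exists_resort {mu : Fin s → D.NJ} (hmu : ∑ d, mu d = κ) {i0 : Seq (κ : I →₀ ℕ)}
    (hi0 : IsConcat (sum_coe hmu) i0) (hs : IsSorted (D := D) (blk (sum_coe hmu)) i0) :
    ∃ (i1 : Seq (κ : I →₀ ℕ)) (x y : (FoldedAlg.pi fun d => D.R (mu d)).carrier) (c : k),
      i1.map D.a (mapDomain_a κ.2) = i0 ∧ c ≠ 0 ∧ y * x = c • wt hmu i1 ∧ wt hmu i0 * x = x ∧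
      x ∈ (FoldedAlg.pi fun d => D.R (mu d)).gr 0 := by
  classical
  have hβ := monotone_blk (sum_coe hmu)
  have ha : (κ : I →₀ ℕ).mapDomain D.a.symm = κ := by
    conv_lhs => rw [← mapDomain_a κ.2, ← Finsupp.mapDomain_comp]
    simp
  let i1 := i0.map D.a.symm ha
  have h1 : i1.map D.a (mapDomain_a κ.2) = i0 := Seq.ext fun l => by simp [i1]
  have horb : ∀ l, D.orb (i1 l) = D.orb (i0 l) := fun l => by
    conv_rhs => rw [← h1, Seq.map_apply, orb_a]
  have hi1 : IsConcat (sum_coe hmu) i1 :=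
    (isConcat_map (sum_coe hmu) D.a (mapDomain_a κ.2) (fun d => mapDomain_a (mu d).2)).2
      (by rwa [h1])
  obtain ⟨v, hv1, hv2⟩ := exists_sort hβ fun a => D.colourKey (i1 a)
  have hact : ∀ a, i1.act v (v a) = i1 a := fun a => by simp
  have hv3 : i1.act v = i0 := by
    refine Seq.ext fun l => congrFun (eq_of_sorted hβ D.colourKey_injective
      (i := fun l => i1.act v l) (i' := fun l => i0 l) ?_ hs fun d => ?_) l
    · intro a b hab h
      obtain ⟨a, rfl⟩ := v.surjective a
      obtain ⟨b, rfl⟩ := v.surjective b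
      rw [hv1, hv1] at h
      rw [hact, hact]
      rcases (hv2 a b h).1 hab with h2 | h2
      · exact h2.le
      · exact h2.1.le
    · rw [(Mat.isConcat_iff _).1 hi0]
      exact (Mat.isConcat_iff _).1 (isConcat_act (sum_coe hmu) hv1 hi1) d
  have hinv : ∀ ab ∈ invSet v, i1 ab.1 ≠ i1 ab.2 ∧ D.form (i1 ab.1) (i1 ab.2) = 0 := by
    rintro ⟨a, b⟩ hab
    rw [mem_invSet] at hab
    have h2 : blk (sum_coe hmu) a = blk (sum_coe hmu) b := by
      refine le_antisymm (hβ hab.1.le) ?_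
      rw [← hv1 a, ← hv1 b]
      exact hβ hab.2.le
    rcases (hv2 b a h2.symm).1 hab.2 with h3 | h3
    · have hne : i1 a ≠ i1 b := fun h => h3.ne (by rw [h])
      refine ⟨hne, form_eq_zero (le_antisymm ?_ (orb_le_of_key_le h3.le)) hne⟩
      have h4 : D.orb (i0 a) ≤ D.orb (i0 b) := orb_le_of_key_le (hs a b hab.1 h2)
      rwa [← horb, ← horb] at h4
    · exact absurd h3.2 hab.1.not_gt
  let ω := redWord hβ v hv1
  have hω : IsBlockWord (blk (sum_coe hmu)) ω := redWord_block hβ v hv1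
  have hω' : IsBlockWord (blk (sum_coe hmu)) ω.reverse := fun x hx =>
    hω x (List.mem_reverse.1 hx)
  have hωv : wordPerm ω = v := wordPerm_redWord hβ v hv1
  obtain ⟨x, hx⟩ := exists_concat hmu hω (e_mem_polySub i1)
  obtain ⟨y, hy⟩ := exists_concat hmu hω' (one_mem (polySub D (κ : I →₀ ℕ)))
  have hx' : cmap hmu x = (tw D ω * e D i1 : KLR D (κ : I →₀ ℕ)) := by
    rw [hx, mul_assoc, e_mul_eSum, if_pos hi1]
  obtain ⟨c, hc, hc'⟩ := exists_reverse_mul (D := D) (redWord_red hβ v hv1) i1 (by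
    rw [wordPerm_redWord]; exact hinv)
  have hconc : (eSum D (IsConcat (sum_coe hmu)) * (tw D ω * e D i1) : KLR D (κ : I →₀ ℕ)) =
      tw D ω * e D i1 := by
    rw [← mul_assoc, (eSum_concat_commute_tw (D := D) (sum_coe hmu) hω).eq, mul_assoc, eSum_mul_e,
      if_pos hi1]
  refine ⟨i1, x, y, c, h1, hc, ?_, ?_, ?_⟩
  · refine concat_injective hmu D.orbitFactorization ?_
    rw [cmap_mul, map_smul, cmap_wt_of hmu hi1, hx', hy, mul_one, mul_assoc, hconc]
    exact hc'
  · refine concat_injective hmu D.orbitFactorization ?_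
    rw [cmap_mul, cmap_wt_of hmu hi0, hx', tw_e, hωv, hv3, ← mul_assoc, (isFamily D).e_mul_self]
  · refine mem_gr_of_cmap hmu D.orbitFactorization ?_
    rw [hx']
    have h := tw_e_mem_gr (D := D) (redWord_red hβ v hv1) i1
    rw [wordPerm_redWord, Finset.sum_eq_zero fun ab hab => (hinv ab hab).2, neg_zero] at h
    exact h

end FoldingDatum

open FMod

namespace FoldingDatum

open KLR

variable {k : Type u} [Field k] [IsAlgClosed k] {I : Type u} {D : FoldingDatum k I} {r s : ℕ}
  {lam : Fin r → D.NJ} {mu : Fin s → D.NJ} {κ : D.NJ} (hlam : ∑ c, lam c = κ)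
  (hmu : ∑ d, mu d = κ)

theorem n_pos (D : FoldingDatum k I) : 0 < D.n := by
  have := orderOf_pos_iff.2 D.finite_order
  exact this

theorem not_isTracelessFunctor_gra (g : CMat lam mu → ℕ)
    (g_α : ∀ ν, g ((αMat lam mu).symm ν) = g ν)
    (g_eq : ∀ ν ν', g ν = g ν' → ∃ j : ℕ, (αMat lam mu).symm^[j] ν' = ν)
    (g_rk : ∀ ν ν', rk hlam hmu ν < rk hlam hmu ν' → g ν < g ν') {ν : CMat lam mu}
    (hν : (αMat lam mu).symm ν = ν) : ¬ IsTracelessFunctor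
      ((mackeyStrat D.orbitFactorization hlam hmu g g_α g_eq g_rk).toStrat.gra (g ν)) := by
  classical
  intro htr
  obtain ⟨j, u, hj, hu1, hu2, hs, hju⟩ := exists_extremal hlam hmu ν
  let f := j.act (mw hlam hmu ν)⁻¹
  have hfj : f.act (mw hlam hmu ν) = j := by
    rw [Seq.act_act, mul_inv_cancel, Seq.act_one]
  let q₀ : Coset hlam hmu := ⟨(ν, u), hu1, hu2⟩
  have hf : IsConcat (sum_coe hlam) f := Mat.Fits.isConcat (sum_coe hlam) ν hj
  have hj0 : IsConcat (sum_coe hmu) j := by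
    rw [← hfj]
    exact Mat.Fits.isConcat_act (sum_coe hlam) (sum_coe hmu) ν hj
  have hi0 : IsConcat (sum_coe hmu) (j.act u) := isConcat_act (sum_coe hmu) hu1 hj0
  obtain ⟨m₀, hm1, hm2, hm3, hm4⟩ := exists_one (D := D) hlam hf
  obtain ⟨i1, x, y, c, hi1, hc, hyx, hx, hx'⟩ := exists_resort hmu hi0 hs
  have hw0 := b_mul_mt_mul_wt_mem q₀ hj
  have he0 : (cmap hmu (wt hmu (j.act u) * q₀.b) * mt hlam hmu ν * cmap hlam (wt hlam f) :
      KLR D (κ : I →₀ ℕ)) = cmap hmu q₀.b * mt hlam hmu ν * cmap hlam (wt hlam f) :=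
    (wt_mul_b_mul_mt_mul_wt q₀ hj (i := j.act u)).trans (if_pos (congrArg (Seq.act u) hfj))
  refine RingStrat.not_isTraceless D.n_pos
    (mackeyStrat D.orbitFactorization hlam hmu g g_α g_eq g_rk) (polyRes hlam) (ν := ν)
    (fun ν' h => Strat.pr_eq_of_fixed
      (mackeyStrat D.orbitFactorization hlam hmu g g_α g_eq g_rk).toStrat hν h)
    (wt := wt hlam) (wt_mul_self hlam D.orbitFactorization) (wt_mem hlam D.orbitFactorization)
    (sum_wt hlam D.orbitFactorization) (q₀ := q₀) rfl (f₀ := f) (e₀ := wt hmu (j.act u)) hm1 hm2 hm3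
    ?_ he0 hw0 ?_ (e₁ := wt hmu i1) ?_ hc hyx hx hx' (htr _)
  · refine concat_injective hlam D.orbitFactorization ?_
    rw [cmap_mul, cmap_wt_of hlam hf]
    refine (congrArg (· * e D f) (cmap_mε (hlam := hlam) ν)).trans ?_
    exact (eSum_mul_e _ _).trans (if_pos hj)
  · rintro ⟨⟨ν', u'⟩, hq1, hq2⟩ f' m d hq hm hmd hm0
    obtain rfl : ν' = ν := hq
    let q : Coset hlam hmu := ⟨(ν', u'), hq1, hq2⟩
    change (cmap hmu (wt hmu (j.act u) * q.b) * mt hlam hmu ν' * cmap hlam (wt hlam f') :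
      KLR D (κ : I →₀ ℕ)) = 0 ∨
      (cmap hmu (wt hmu (j.act u) * q.b) * mt hlam hmu ν' * cmap hlam (wt hlam f') :
        KLR D (κ : I →₀ ℕ)) = cmap hmu q.b * mt hlam hmu ν' * cmap hlam (wt hlam f') ∧
        ∃ c, (cmap hmu q.b * mt hlam hmu ν' * cmap hlam (wt hlam f') : KLR D (κ : I →₀ ℕ)) ∈
          gr D (κ : I →₀ ℕ) c ∧ _
    by_cases hf' : ν'.Fits (sum_coe hlam) f'
    · have h1 := wt_mul_b_mul_mt_mul_wt q hf' (i := j.act u)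
      have h2 := b_mul_mt_mul_wt_mem q hf'
      by_cases h3 : (f'.act (mw hlam hmu ν')).act u' = j.act u
      · refine Or.inr ⟨h1.trans (if_pos h3), _, h2, fun hd => ?_⟩
        obtain ⟨h4, h5, h6⟩ := hju (f'.act (mw hlam hmu ν')) u'
          (by rwa [Seq.act_act, inv_mul_cancel, Seq.act_one]) hq1 hq2 h3
        have hff : f' = f := by
          rw [← Seq.act_one f', ← inv_mul_cancel (mw hlam hmu ν'), ← Seq.act_act, h4]
        subst hff
        obtain ⟨h7, h8⟩ := hm4 m hm hm0 d hmd
        have hd' : -∑ ab ∈ invSet u', D.form (j ab.1) (j ab.2) + ν'.deg D + d =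
            -∑ ab ∈ invSet u, D.form (j ab.1) (j ab.2) + ν'.deg D + lowDeg (D := D) f := by
          have h9 : -∑ ab ∈ invSet u', D.form (f.act (mw hlam hmu ν') ab.1)
              (f.act (mw hlam hmu ν') ab.2) + ν'.deg D + d =
            -∑ ab ∈ invSet u, D.form (f.act (mw hlam hmu ν') ab.1)
              (f.act (mw hlam hmu ν') ab.2) + ν'.deg D + lowDeg (D := D) f := hd
          rwa [hfj] at h9
        have huu : u' = u := h6 (by linarith)
        subst huu
        exact ⟨rfl, h8 (by linarith)⟩
      · exact Or.inl (h1.trans (if_neg h3))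
    · left
      rw [mul_assoc, mt_mul_wt_of_not hf', mul_zero]
  · exact (aut_wt hmu D.orbitFactorization i1).trans (congrArg (wt hmu) hi1)

end FoldingDatum

namespace FoldingDatum

/-- The Mackey filtration. -/
theorem exists_mackey_filtration {k I : Type u} [Field k] [IsAlgClosed k]
    (D : FoldingDatum k I) {r s : ℕ}
    (lam : Fin r → D.NJ) (mu : Fin s → D.NJ) (kap : D.NJ)
    (hlam : ∑ i, lam i = kap) (hmu : ∑ j, mu j = kap) :
    ∃ (m : ℕ) (F : Fin (m + 1) → (D.C lam ⥤ D.C mu)) (S : Fin m → (D.C lam ⥤ D.C mu))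
      (inc : ∀ p, F p.castSucc ⟶ F p.succ) (pr : ∀ p, F p.succ ⟶ S p)
      (e : {ν : Fin r → Fin s → D.NJ // (∀ i, ∑ j, ν i j = lam i) ∧ ∀ j, ∑ i, ν i j = mu j} ≃
        {p : Fin m // ¬ IsTracelessFunctor (S p)}),
      (∀ X, Subsingleton ((F 0).obj X).carrier) ∧
      Nonempty (F (Fin.last m) ≅ Ind lam kap hlam ⋙
        Res mu kap hmu) ∧
      (∀ p, IsExactFunctor (F p)) ∧
      (∀ p, IsExactFunctor (S p)) ∧
      (∀ p X, FMod.IsShortExact ((inc p).app X) ((pr p).app X)) ∧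
      ∀ ν, ∃ c : ℤ, Nonempty (S (e ν) ≅
        mackeyFunctor ν.1 ν.2.1 ν.2.2 ⋙ FMod.shift _ c) := by
  classical

  obtain ⟨m, g, g_α, g_eq, g_rk, g_lt, g_surj⟩ := exists_orbit_numbering (αMat lam mu).symm
    (rk hlam hmu) fun ν => by
      rw [rk, rk, ← mw_α ((αMat lam mu).symm ν), Equiv.apply_symm_apply]
  let Z := (mackeyStrat D.orbitFactorization hlam hmu g g_α g_eq g_rk).toStrat
  let S : Fin m → (D.C lam ⥤ D.C mu) := fun p => Z.gra p
  let T := {ν : Fin r → Fin s → D.NJ // (∀ i, ∑ j, ν i j = lam i) ∧ ∀ j, ∑ i, ν i j = mu j}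
  let M : T → CMat lam mu := fun ν => toMat ν.2.1 ν.2.2
  have hM : ∀ ν, (αMat lam mu).symm (M ν) = M ν := fun ν =>
    αMat_symm_eq_iff.2 fun c d => (ν.1 c d).2
  let f : T → {p : Fin m // ¬ IsTracelessFunctor (S p)} := fun ν =>
    ⟨⟨g (M ν), g_lt _⟩, not_isTracelessFunctor_gra hlam hmu g g_α g_eq g_rk (hM ν)⟩
  have hf : Function.Bijective f := by
    constructor
    · intro ν ν' h
      have h1 : g (M ν) = g (M ν') := congrArg (fun p => (p.1 : ℕ)) h
      have h2 : M ν = M ν' := Strat.pr_eq_of_fixed Z (hM ν') h1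
      refine Subtype.ext (funext fun c => funext fun d => Subtype.ext ?_)
      exact congrFun (congrFun (congrArg Subtype.val h2) c) d
    · rintro ⟨⟨p, hp⟩, hp'⟩
      obtain ⟨ν, rfl⟩ := g_surj p hp
      have h1 : (αMat lam mu).symm ν = ν := by
        by_contra h
        exact hp' (Z.isTraceless D.n_pos rfl h)
      have h2 := αMat_symm_eq_iff.1 h1
      refine ⟨⟨fun c d => ⟨ν.1 c d, h2 c d⟩, fun c => Subtype.ext ?_, fun d => Subtype.ext ?_⟩,
        rfl⟩
      · rw [AddSubmonoid.coe_finsetSum]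
        exact ν.2.1 c
      · rw [AddSubmonoid.coe_finsetSum]
        exact ν.2.2 d
  refine ⟨m, fun p => (Z.fil p).sub, S, fun p => FMod.SubFamily.inc (Z.fil_le p),
    fun p => FMod.SubFamily.proj (Z.fil_le p), Equiv.ofBijective f hf, fun X => Z.fil_zero X,
    ⟨FMod.SubFamily.isoOfTop _ fun X => Z.fil_top g_lt X⟩, fun p => Z.fil_exact p,
    fun p => Z.gra_exact p, fun p X => FMod.SubFamily.isShortExact (Z.fil_le p) X, fun ν => ?_⟩
  exact ⟨_, mackeyStrat_gra_iso hlam hmu ν.2.1 ν.2.2 D.orbitFactorization g g_α g_eq g_rk⟩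

end FoldingDatum

end
end FoldedKLR

theorem theorem4 {k I : Type u} [Field k] [IsAlgClosed k]
    (D : FoldedKLR.FoldingDatum k I) (hn : (D.n : k) ≠ 0) {r s : ℕ}
    (lam : Fin r → D.NJ) (mu : Fin s → D.NJ) (kap : D.NJ)
    (hlam : ∑ i, lam i = kap) (hmu : ∑ j, mu j = kap) :
    ∃ (m : ℕ) (F : Fin (m + 1) → (D.C lam ⥤ D.C mu)) (S : Fin m → (D.C lam ⥤ D.C mu))
      (inc : ∀ p, F p.castSucc ⟶ F p.succ) (pr : ∀ p, F p.succ ⟶ S p)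
      (e : {ν : Fin r → Fin s → D.NJ // (∀ i, ∑ j, ν i j = lam i) ∧ ∀ j, ∑ i, ν i j = mu j} ≃
        {p : Fin m // ¬ FoldedKLR.IsTracelessFunctor (S p)}),
      (∀ X, Subsingleton ((F 0).obj X).carrier) ∧
      Nonempty (F (Fin.last m) ≅ FoldedKLR.FoldingDatum.Ind lam kap hlam ⋙
        FoldedKLR.FoldingDatum.Res mu kap hmu) ∧
      (∀ p, FoldedKLR.IsExactFunctor (F p)) ∧
      (∀ p, FoldedKLR.IsExactFunctor (S p)) ∧
      (∀ p X, FoldedKLR.FMod.IsShortExact ((inc p).app X) ((pr p).app X)) ∧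
      ∀ ν, ∃ c : ℤ, Nonempty (S (e ν) ≅
        FoldedKLR.FoldingDatum.mackeyFunctor ν.1 ν.2.1 ν.2.2 ⋙ FoldedKLR.FMod.shift _ c) :=
  FoldedKLR.FoldingDatum.exists_mackey_filtration D lam mu kap hlam hmu
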